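/- **Conventions.** Let $M\subset\mathbb C^4$ be a real analytic hypersurface with CR structure $\mathcal H$ ($(1,0)$-vectors tangent to $M$), Levi form $\frac1{2i}[X,\overline Y]\bmod \mathcal H\oplus\overline{\mathcal H}$ of constant rank $2$ and Levi kernel $\mathcal K\subset\mathcal H$. $M$ is *uniformly $2$-nondegenerate* if at no point there is a section $X$ of $\mathcal K$, nonzero at the point, with $[X,\overline Y]\in\mathcal K\oplus\overline{\mathcal H}$ there for all sections $Y$ of $\mathcal H$. An *adapted frame* near $p\in M$ is a local frame $\phi=(g,f_1,f_2,e,\overline{f_1},\overline{f_2},\overline e)$ of $\mathbb CTM$ with $g$ real, $f_1,f_2$ in $\mathcal H$ and $e$ spanning $\mathcal K$. It defines matrix functions by $\frac1{2i}[f_a,\overline{f_b}]\equiv H_{ab}\,g$ mod $\mathcal H\oplus\overline{\mathcal H}$, $[e,\overline{f_k}]\equiv\sum_l\Xi_{lk}f_l$ mod $\mathcal K\oplus\overline{\mathcal H}$, $[e,f_k]\equiv\sum_l\Omega_{lk}f_l$ mod $\mathcal K\oplus\overline{\mathcal K}$, and $S^{0,2}=\Xi H^{-1}$, $S^{0,-2}=H\overline\Xi$.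 For $\mathbf H$ Hermitian invertible and $S$ symmetric let $\mathbb C\mathfrak g_-$ be the complex Heisenberg algebra with basis $g,f_a,\overline{f_a}$ and $[f_a,\overline{f_b}]=2i\mathbf H_{ab}g$, and let $\mathfrak{csp}$ be the algebra of its grading preserving derivations, with the induced conjugation $\sigma$. In $\mathfrak{csp}$, $L\in\mathfrak{gl}(2,\mathbb C)$ denotes the derivation that acts by $L$ on $(f_1,f_2)$, preserves the span of $\overline{f_1},\overline{f_2}$ and kills $g$, and $S$ denotes the derivation $\overline f\mapsto S\mathbf H f$. Put $\mathfrak g_{0,2}=\langle S\rangle$, $\mathfrak g_{0,-2}=\sigma(\mathfrak g_{0,2})$, let $\mathfrak g_{0,0}\subset\mathfrak{csp}$ be the subalgebra preserving $\langle f_1,f_2\rangle$, $\langle\overline{f_1},\overline{f_2}\rangle$, $\mathfrak g_{0,2}$, $\mathfrak g_{0,-2}$, and $\mathfrak g'_{0,0}=\mathfrak g_{0,0}\cap\mathfrak{gl}(2,\mathbb C)$. The *bigraded symbol* given by $(\mathbf H,S)$ is $\mathbb C\mathfrak g_-\oplus\mathfrak g_{0,-2}\oplus\mathfrak g_{0,0}\oplus\mathfrak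 g_{0,2}$; the *modified symbol* given by $(\mathbf H,S,\Omega)$ is $\mathbb C\mathfrak g_-\oplus(\langle\sigma(S+\Omega)\rangle+\mathfrak g_{0,0}+\langle S+\Omega\rangle)$. Equivalences are induced by isomorphisms of $\mathbb C\mathfrak g_-$ preserving the bigrading and commuting with conjugation. Consider the table, where $a,b,c,f,f'\in\mathbb C$, $\epsilon=\pm1$, $\lambda>1$, $0<\theta<\pi$, $\tau\ge0$ (real parameters), $D(x,y)=\left(\begin{smallmatrix}x&0\\0&y\end{smallmatrix}\right)$, $J=\left(\begin{smallmatrix}0&1\\1&0\end{smallmatrix}\right)$: | | $\mathbf H$ | $S^{0,2}$ | $\mathfrak g'_{0,0}$ | $\Re(\mathfrak g'_{0,0})$ | annihilator of $\Omega$ | $\Omega$ | $N_{0,2}$ | |---|---|---|---|---|---|---|---| | 1 | $D(1,\epsilon)$ | $D(1,\lambda)$ | $D(a,a)$ | $a=-\bar a$ | $a=0$ | $\left(\begin{smallmatrix}0&-\tau\lambda\\\tau&0\end{smallmatrix}\right)$ | $D(0,f)$ | | 2 | $J$ | $D(1,e^{i\theta})$ | $D(a,a)$ | $a=-\bar a$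 | $a=0$ | $\left(\begin{smallmatrix}0&-\tau e^{i\theta}\\\tau&0\end{smallmatrix}\right)$ | $D(0,f)$ | | 3 | $D(1,\epsilon)$ | $J$ | $D(a,b)$ | $a=-\bar a,\ b=-\bar b$ | | $0$ | $D(f,f')$ | | 4 | $D(1,\epsilon)$ | $D(1,0)$ | $D(a,b)$ | $a=-\bar a,\ b=-\bar b$ | $b=3a$ | $\left(\begin{smallmatrix}0&0\\\tau&0\end{smallmatrix}\right)$ | $D(0,f)$ | | 5 | $J$ | $J$ | $D(a,b)$ | $a=-\bar b$ | | $0$ | $D(f,f')$ | | 6 | $J$ | $\left(\begin{smallmatrix}1&1\\1&0\end{smallmatrix}\right)$ | $D(a,a)$ | $a=-\bar a$ | $a=0$ | $\left(\begin{smallmatrix}2\tau&\tau\\0&0\end{smallmatrix}\right)$ | $D(0,f)$ | | 7 | $J$ | $D(1,0)$ | $\left(\begin{smallmatrix}a&b\\0&c\end{smallmatrix}\right)$ | $a=-\bar c,\ b=-\bar b$ | | $0$ | $\left(\begin{smallmatrix}0&f\\f&f'\end{smallmatrix}\right)$ | An adapted frame $\phi$ near $p$ is *normalized* for a row if $H(p)=\mathbf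 H$ and $S^{0,2}(p)=S^{0,2}$ are those of the row, the derivative $e(S^{0,-2})(p)$ is a multiple of $S^{0,-2}(p)$, and $e(S^{0,2})(p)\in N_{0,2}+\langle S^{0,2}(p)\rangle$. **Proposition 2.4.** (1) Let $M\subset\mathbb C^4$ be a real analytic uniformly $2$-nondegenerate hypersurface and $p\in M$. The bigraded symbol of $M$ at $p$, given by $(H(p),S^{0,2}(p))$ for an adapted frame, is equivalent to that of exactly one pair $(\mathbf H,S^{0,2})$ of the table. There is exactly one entry $(\mathbf H,S^{0,2},\Omega)$ of the table for which there is an adapted frame near $p$, normalized for its row, with $\Omega(p)=\Omega$. For every frame $\phi$ normalized for a row, the modified symbol given by $(H(p),S^{0,2}(p),\Omega(p))$ is equivalent to that of exactly one entry; the values $\Omega(p)$ of the frames that are normalized for the row and coincide with $\phi$ at $p$ form one coset of $\mathfrak g'_{0,0}$. (2) For each row, $\mathfrak g'_{0,0}$ is the given space, $\mathfrak g_{0,0}$ is spanned by $\mathfrak g'_{0,0}$ and the grading element, and $(\mathbf H,S^{0,2},\Omega)$, $(\mathbf H,S^{0,2},\Omega')$ give the same modified symbol if and only if $\Omega'-\Omega\in\mathfrak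 g'_{0,0}$. The given real form $\Re(\mathfrak g'_{0,0})$ is the fixed point set of $\sigma$ on $\mathfrak g'_{0,0}$. With $$\mathrm{CU}(\mathbf H)=\{(u,U)\in\mathbb C^*\times \mathrm{GL}(2,\mathbb C): u\bar u^{-1}U^T\mathbf H\overline U=\mathbf H\},$$ $$G_{0,0}=\{(u,U):\langle U^{-1}S^{0,2}U^{-T}\rangle=\langle S^{0,2}\rangle,\ \langle U^T\mathbf H\overline{S^{0,2}}\mathbf H^TU\rangle=\langle\mathbf H\overline{S^{0,2}}\mathbf H^T\rangle\}$$ (both to be divided by $\{\pm(1,\mathrm{Id})\}$), the Lie algebra of the group $\mathrm{CU}(\mathbf H)\cap G_{0,0}$ is $\mathbb R\oplus\Re(\mathfrak g'_{0,0})$, the summand $\mathbb R$ corresponding to the grading element. (3) For each entry of the table, the stabilizer of $\Omega$ is the subgroup of those $(u,U)\in\mathrm{CU}(\mathbf H)\cap G_{0,0}$ such that $c\,U^{-1}\Omega U\equiv\Omega$ mod $\mathfrak g'_{0,0}$ for the $c\in\mathbb C^*$ with $c\,U^{-1}S^{0,2}U^{-T}=S^{0,2}$. Its Lie algebra is $\mathbb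 R\oplus\{X\in\Re(\mathfrak g'_{0,0}): X \text{ satisfies the annihilator condition}\}$ if $\tau>0$, and $\mathbb R\oplus\Re(\mathfrak g'_{0,0})$ if $\Omega=0$. (4) For each entry of the table let $(\mathbf S(\zeta),0)=\ln\big(\exp(S^{0,2}\zeta,\Omega\zeta)\exp(0,-\Omega\zeta)\big)$ in $\mathfrak{csp}$, where $(S,L)$ stands for $S+L$, and consider the hypersurface $$\Re(w)=z^TH(\zeta,\bar\zeta)\bar z+\Re\big(\bar z^TS(\zeta,\bar\zeta)\bar z\big),\qquad |\zeta|<\delta,$$ $$H(\zeta,\bar\zeta)=\tfrac12\big(\mathbf H(\mathrm{Id}-\overline{\mathbf S}\mathbf H^T\mathbf S\mathbf H)^{-1}+(\mathrm{Id}-\mathbf H\overline{\mathbf S}\mathbf H^T\mathbf S)^{-1}\mathbf H\big),\quad S(\zeta,\bar\zeta)=\mathbf H^T(\mathrm{Id}-\mathbf S\mathbf H\overline{\mathbf S}\mathbf H^T)^{-1}\mathbf S\mathbf H,$$ where $\mathbf S=\mathbf S(\zeta)$ and $z=(z_1,z_2)^T$. For all sufficiently small $\delta>0$ it is a uniformly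 $2$-nondegenerate real analytic hypersurface whose modified symbol at $0$ is represented by the given entry. The stabilizer of $\Omega$ acts on its germ at $0$ by symmetries $(w,z,\zeta)\mapsto(u^{-2}w,u^{-1}Uz,h_{(u,U)}(\zeta))$ with local biholomorphisms $h_{(u,U)}$ of $(\mathbb C,0)$ that are multiplicative in $(u,U)$. -/

import Mathlib

open scoped ComplexConjugate ContDiff Matrix Topology

noncomputable section

namespace CRSymbol

/-! ### Complex vector fields on `ℂ⁴` -/

/-- `ℂ⁴` with coordinates `(w, z₁, z₂, ζ) = (x 0, x 1, x 2, x 3)`. -/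
abbrev C4 := Fin 4 → ℂ

/-- `2 × 2` complex matrices. -/
abbrev Mat2 := Matrix (Fin 2) (Fin 2) ℂ

/-- Endomorphisms of a space `g₋₁,₁ ⊕ g₋₁,₋₁` with basis `f₁, f₂, f̄₁, f̄₂`. -/
abbrev Mat22 := Matrix (Fin 2 ⊕ Fin 2) (Fin 2 ⊕ Fin 2) ℂ

/-- Entrywise complex conjugate of a matrix. -/
def cbar {m n : Type*} (A : Matrix m n ℂ) : Matrix m n ℂ := A.map (starRingEnd ℂ)

/-- A complex vector field `∑ Aⱼ ∂/∂xⱼ + ∑ Bⱼ ∂/∂x̄ⱼ`, stored as the pair `(A, B)`. -/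
abbrev CVField := C4 → C4 × C4

/-- `∑ Aⱼ ∂h/∂xⱼ` at `x`. -/
def delHol {E : Type*} [NormedAddCommGroup E] [NormedSpace ℂ E] (h : C4 → E) (x A : C4) : E :=
  (1 / 2 : ℂ) • (fderiv ℝ h x A - Complex.I • fderiv ℝ h x (Complex.I • A))

/-- `∑ Bⱼ ∂h/∂x̄ⱼ` at `x`. -/
def delBar {E : Type*} [NormedAddCommGroup E] [NormedSpace ℂ E] (h : C4 → E) (x B : C4) : E :=
  (1 / 2 : ℂ) • (fderiv ℝ h x (star B) + Complex.I • fderiv ℝ h x (Complex.I • star B))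

/-- The derivative of `h` along the complex vector field `X`. -/
def applyField {E : Type*} [NormedAddCommGroup E] [NormedSpace ℂ E]
    (X : CVField) (h : C4 → E) (x : C4) : E :=
  delHol h x (X x).1 + delBar h x (X x).2

/-- Entrywise derivative of a matrix valued function along `X`. -/
def applyMat (X : CVField) (F : C4 → Mat2) (x : C4) : Mat2 :=
  Matrix.of fun i j => applyField X (fun y => F y i j) x

/-- Lie bracket of complex vector fields. -/
def lieBr (X Y : CVField) : CVField := fun x =>
  (applyField X (fun y => (Y y).1) x - applyField Y (fun y => (X y).1) x,
   applyField X (fun y => (Y y).2) x - applyField Y (fun y => (X y).2) x)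

/-- The `(1,0)` field `∑ Xⱼ ∂/∂xⱼ`. -/
def hol (X : C4 → C4) : CVField := fun x => (X x, 0)

/-- The `(0,1)` field conjugate to `hol X`. -/
def antihol (X : C4 → C4) : CVField := fun x => (0, star (X x))

/-! ### Real hypersurfaces, Levi form, uniform 2-nondegeneracy -/

/-- Data of a hypersurface `{x ∈ dom | ρ x = 0}` in `ℂ⁴`. -/
structure Hypersurface where
  dom : Set C4
  ρ : C4 → ℝ

namespace Hypersurface

/-- The underlying set of points. -/
def carrier (M : Hypersurface) : Set C4 := {x | x ∈ M.dom ∧ M.ρ x = 0}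

/-- `M` is a (smoothly embedded) real analytic hypersurface. -/
structure IsRealAnalytic (M : Hypersurface) : Prop where
  isOpen_dom : IsOpen M.dom
  analytic : AnalyticOnNhd ℝ M.ρ M.dom
  regular : ∀ x ∈ M.carrier, fderiv ℝ M.ρ x ≠ 0

/-- The fibre `ℋ_x` of the CR structure: the `(1,0)` vectors tangent to `M`. -/
def HFib (M : Hypersurface) (x : C4) : Set C4 :=
  {v | delHol (fun y => (M.ρ y : ℂ)) x v = 0}

/-- `ℋ_x ⊕ ℋ̄_x`. -/
def HHFib (M : Hypersurface) (x : C4) : Set (C4 × C4) :=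
  {v | v.1 ∈ M.HFib x ∧ star v.2 ∈ M.HFib x}

/-- `X` is a smooth section of `ℋ` over `M ∩ W` (given with an extension to `W`; brackets of
sections at points of `M` do not depend on the extension). -/
structure IsSection (M : Hypersurface) (W : Set C4) (X : C4 → C4) : Prop where
  smooth : ContDiffOn ℝ ∞ X W
  mem : ∀ x ∈ W, x ∈ M.carrier → X x ∈ M.HFib x

/-- The fibre `𝒦_x` of the Levi kernel, i.e. the left kernel of the Levi form
`(X, Y) ↦ (1/2i) [X, Ȳ] mod ℋ ⊕ ℋ̄` at `x`. -/
def KFib (M : Hypersurface) (x : C4) : Set C4 :=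
  {v | v ∈ M.HFib x ∧ ∀ (W : Set C4) (X Y : C4 → C4), IsOpen W → W ⊆ M.dom → x ∈ W →
    M.IsSection W X → M.IsSection W Y → X x = v → lieBr (hol X) (antihol Y) x ∈ M.HHFib x}

/-- `𝒦_x ⊕ ℋ̄_x`. -/
def KHFib (M : Hypersurface) (x : C4) : Set (C4 × C4) :=
  {v | v.1 ∈ M.KFib x ∧ star v.2 ∈ M.HFib x}

/-- `𝒦_x ⊕ 𝒦̄_x`. -/
def KKFib (M : Hypersurface) (x : C4) : Set (C4 × C4) :=
  {v | v.1 ∈ M.KFib x ∧ star v.2 ∈ M.KFib x}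

/-- The Levi form of `M` has rank 2 at `x`: the Levi kernel is a complex line
(`ℋ_x` being three dimensional). -/
def LeviRankTwo (M : Hypersurface) (x : C4) : Prop :=
  ∃ v ∈ M.KFib x, v ≠ 0 ∧ ∀ v' ∈ M.KFib x, ∃ c : ℂ, v' = c • v

/-- `M` is 2-nondegenerate at `x`: no section `X` of the Levi kernel with `X x ≠ 0` satisfies
`[X, Ȳ]_x ∈ 𝒦_x ⊕ ℋ̄_x` for all sections `Y` of `ℋ`. -/
def TwoNondegenerateAt (M : Hypersurface) (x : C4) : Prop :=
  ∀ (W : Set C4) (X : C4 → C4), IsOpen W → W ⊆ M.dom → x ∈ W → M.IsSection W X →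
    (∀ y ∈ W, y ∈ M.carrier → X y ∈ M.KFib y) → X x ≠ 0 →
    ∃ Y, M.IsSection W Y ∧ lieBr (hol X) (antihol Y) x ∉ M.KHFib x

/-- Real analytic uniformly 2-nondegenerate hypersurfaces in `ℂ⁴`. -/
structure IsUniformly2Nondegenerate (M : Hypersurface) : Prop where
  analytic : M.IsRealAnalytic
  leviRank : ∀ x ∈ M.carrier, M.LeviRankTwo x
  nondeg : ∀ x ∈ M.carrier, M.TwoNondegenerateAt x

end Hypersurface

/-- An adapted frame `(g, f₁, f₂, e, f̄₁, f̄₂, ē)` of `ℂTM` on a neighbourhood `W` of `p` in `M`,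
together with the matrix functions that it determines on `M ∩ W`:
`(1/2i)[f_a, f̄_b] ≡ H_{ab} g` modulo `ℋ ⊕ ℋ̄`, `[e, f̄_k] ≡ ∑ Ξ_{lk} f_l` modulo `𝒦 ⊕ ℋ̄` and
`[e, f_k] ≡ ∑ Ω_{lk} f_l` modulo `𝒦 ⊕ 𝒦̄`.
The real field `g` is stored through its `(1,0)` component. -/
structure AdaptedFrame (M : Hypersurface) (p : C4) where
  W : Set C4
  isOpen_W : IsOpen W
  W_subset : W ⊆ M.dom
  p_mem : p ∈ W
  g : C4 → C4
  f : Fin 2 → C4 → C4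
  e : C4 → C4
  smooth_g : ContDiffOn ℝ ∞ g W
  tangent_g : ∀ x ∈ W, x ∈ M.carrier → fderiv ℝ M.ρ x (g x) = 0
  transverse_g : ∀ x ∈ W, x ∈ M.carrier → g x ∉ M.HFib x
  section_f : ∀ a, M.IsSection W (f a)
  section_e : M.IsSection W e
  kernel_e : ∀ x ∈ W, x ∈ M.carrier → e x ∈ M.KFib x
  independent : ∀ x ∈ W, x ∈ M.carrier → LinearIndependent ℂ ![f 0 x, f 1 x, e x]
  H : C4 → Mat2
  Ξ : C4 → Mat2
  Ω : C4 → Mat2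
  smooth_H : ∀ i j, ContDiffOn ℝ ∞ (fun x => H x i j) W
  smooth_Ξ : ∀ i j, ContDiffOn ℝ ∞ (fun x => Ξ x i j) W
  smooth_Ω : ∀ i j, ContDiffOn ℝ ∞ (fun x => Ω x i j) W
  levi : ∀ x ∈ W, x ∈ M.carrier → ∀ a b,
    (1 / (2 * Complex.I)) • lieBr (hol (f a)) (antihol (f b)) x
      - H x a b • (g x, star (g x)) ∈ M.HHFib x
  bracket_Ξ : ∀ x ∈ W, x ∈ M.carrier → ∀ k,
    lieBr (hol e) (antihol (f k)) x - ∑ l, Ξ x l k • hol (f l) x ∈ M.KHFib x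
  bracket_Ω : ∀ x ∈ W, x ∈ M.carrier → ∀ k,
    lieBr (hol e) (hol (f k)) x - ∑ l, Ω x l k • hol (f l) x ∈ M.KKFib x

namespace AdaptedFrame

variable {M : Hypersurface} {p : C4}

/-- `S^{0,2}(φ) = Ξ H⁻¹`. -/
def S02 (φ : AdaptedFrame M p) (x : C4) : Mat2 := φ.Ξ x * (φ.H x)⁻¹

/-- `S^{0,-2}(φ) = H Ξ̄`. -/
def S0m2 (φ : AdaptedFrame M p) (x : C4) : Mat2 := φ.H x * cbar (φ.Ξ x)

/-- `φ` is normalized at `p` with respect to the normalization condition `(0, N)`: the class of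
`e(S^{0,-2})` modulo `S^{0,-2}` vanishes and the class of `e(S^{0,2})` modulo `S^{0,2}` lies
in `N`. -/
def NormalizedAt (φ : AdaptedFrame M p) (N : Set Mat2) : Prop :=
  (∃ c : ℂ, applyMat (hol φ.e) φ.S0m2 p = c • φ.S0m2 p) ∧
  ∃ A ∈ N, ∃ c : ℂ, applyMat (hol φ.e) φ.S02 p = A + c • φ.S02 p

/-- The two frames have the same value at `p`. -/
def SameAt (φ ψ : AdaptedFrame M p) : Prop :=
  φ.g p = ψ.g p ∧ (∀ a, φ.f a p = ψ.f a p) ∧ φ.e p = ψ.e p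

end AdaptedFrame

/-! ### Bigraded and modified symbols

With `H` the matrix of the Levi form in the basis `f₁, f₂`, the bracket of the Heisenberg algebra
is `[f_a, f̄_b] = 2i H_{ab} g`.  Grading preserving derivations are determined by their
restriction to `g₋₁`, hence are elements of `Mat22`. -/

/-- The skew form of the Heisenberg algebra on `g₋₁`, up to the factor `2i`. -/
def heisForm (H : Mat2) : Mat22 := Matrix.fromBlocks 0 H (-Hᵀ) 0

/-- `csp(g₋₁)`. -/
def csp (H : Mat2) : Submodule ℂ Mat22 where
  carrier := {D | ∃ c : ℂ, Dᵀ * heisForm H + heisForm H * D = c • heisForm H}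
  add_mem' := by
    rintro A B ⟨a, ha⟩ ⟨b, hb⟩
    refine ⟨a + b, ?_⟩
    rw [Matrix.transpose_add, Matrix.add_mul, Matrix.mul_add, add_smul, ← ha, ← hb]
    abel
  zero_mem' := ⟨0, by simp⟩
  smul_mem' := by
    rintro c A ⟨a, ha⟩
    refine ⟨c * a, ?_⟩
    rw [Matrix.transpose_smul, Matrix.smul_mul, Matrix.mul_smul, ← smul_add, ha, smul_smul]

/-- The antilinear involution of `csp(g₋₁)` induced by complex conjugation `f_a ↔ f̄_a`. -/
def sigma (D : Mat22) : Mat22 := (cbar D).submatrix Sum.swap Sum.swap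

/-- The grading element; it acts by `-1` on `g₋₁`. -/
def gradingElement : Mat22 := -1

/-- The element of `csp(g₋₁)_{0,0}` acting trivially on `g` and by `L` on `f₁, f₂`. -/
def ofGL (H L : Mat2) : Mat22 := Matrix.fromBlocks L 0 0 (-(H⁻¹ * Lᵀ * H))

/-- The element of `csp(g₋₁)_{0,2}` parametrized by `S`; it maps `f̄` to `f` by `Ξ = S H`. -/
def ofS (H S : Mat2) : Mat22 := Matrix.fromBlocks 0 (S * H) 0 0

/-- `σ_φ(L) = -(Hᵀ)⁻¹ L̄ᵀ Hᵀ`. -/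
def sigmaGL (H L : Mat2) : Mat2 := -((Hᵀ)⁻¹ * (cbar L)ᵀ * Hᵀ)

/-- `g_{0,2} = ι(𝒦)`. -/
def g02 (H S : Mat2) : Submodule ℂ Mat22 := Submodule.span ℂ {ofS H S}

/-- `g_{0,-2} = ι(𝒦̄)`. -/
def g0m2 (H S : Mat2) : Submodule ℂ Mat22 := Submodule.span ℂ {sigma (ofS H S)}

/-- `g_{0,0}`: the elements of `csp(g₋₁)` that preserve `g₋₁,₁`, `g₋₁,₋₁`, `g_{0,2}` and
`g_{0,-2}`. -/
def g00 (H S : Mat2) : Submodule ℂ Mat22 where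
  carrier := {D | D ∈ csp H ∧ D.toBlocks₁₂ = 0 ∧ D.toBlocks₂₁ = 0 ∧
    (∀ w ∈ g02 H S, D * w - w * D ∈ g02 H S) ∧ ∀ w ∈ g0m2 H S, D * w - w * D ∈ g0m2 H S}
  add_mem' := by
    rintro A B ⟨a1, a2, a3, a4, a5⟩ ⟨b1, b2, b3, b4, b5⟩
    have key : ∀ w, (A + B) * w - w * (A + B) = (A * w - w * A) + (B * w - w * B) := by
      intro w; noncomm_ring
    refine ⟨add_mem a1 b1, ?_, ?_, fun w hw => ?_, fun w hw => ?_⟩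
    · ext i j
      simpa [Matrix.toBlocks₁₂] using
        congrArg₂ (· + ·) (congrFun (congrFun a2 i) j) (congrFun (congrFun b2 i) j)
    · ext i j
      simpa [Matrix.toBlocks₂₁] using
        congrArg₂ (· + ·) (congrFun (congrFun a3 i) j) (congrFun (congrFun b3 i) j)
    · rw [key]; exact add_mem (a4 w hw) (b4 w hw)
    · rw [key]; exact add_mem (a5 w hw) (b5 w hw)
  zero_mem' := by
    refine ⟨zero_mem _, rfl, rfl, fun w _ => ?_, fun w _ => ?_⟩ <;> simp
  smul_mem' := by
    rintro c A ⟨a1, a2, a3, a4, a5⟩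
    have key : ∀ w, (c • A) * w - w * (c • A) = c • (A * w - w * A) := by
      intro w; rw [Matrix.smul_mul, Matrix.mul_smul, smul_sub]
    refine ⟨Submodule.smul_mem _ c a1, ?_, ?_, fun w hw => ?_, fun w hw => ?_⟩
    · ext i j
      simpa [Matrix.toBlocks₁₂] using congrArg (c * ·) (congrFun (congrFun a2 i) j)
    · ext i j
      simpa [Matrix.toBlocks₂₁] using congrArg (c * ·) (congrFun (congrFun a3 i) j)
    · rw [key]; exact Submodule.smul_mem _ c (a4 w hw)
    · rw [key]; exact Submodule.smul_mem _ c (a5 w hw)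

/-- `g'_{0,0} = g_{0,0} ∩ gl(2,ℂ)`. -/
def g00' (H S : Mat2) : Set Mat2 := {L | ofGL H L ∈ g00 H S}

/-- The degree zero part `g_{0,-2} ⊕ g_{0,0} ⊕ g_{0,2}` of the bigraded symbol. -/
def bigradedSymbol (H S : Mat2) : Submodule ℂ Mat22 := g0m2 H S ⊔ g00 H S ⊔ g02 H S

/-- `ι_φ(e) = (S^{0,2}, Ω)`. -/
def iotaMod (H S Ω : Mat2) : Mat22 := ofS H S + ofGL H Ω

/-- The part `g₀^mod = ι_φ(𝒦̄) + g_{0,0} + ι_φ(𝒦)` of the modified symbol. -/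
def modSymbol (H S Ω : Mat2) : Submodule ℂ Mat22 :=
  Submodule.span ℂ {sigma (iotaMod H S Ω)} ⊔ g00 H S ⊔ Submodule.span ℂ {iotaMod H S Ω}

/-- The map of `g₋₁` given by `A` on `g₋₁,₁` that commutes with complex conjugation. -/
def realMap (A : Mat2) : Mat22 := Matrix.fromBlocks A 0 0 (cbar A)

/-- `A` defines an isomorphism of bigraded Heisenberg algebras commuting with conjugation. -/
def IsHeisIso (H H' : Mat2) (A : GL (Fin 2) ℂ) : Prop :=
  ∃ r : ℝ, r ≠ 0 ∧ (A : Mat2)ᵀ * H' * cbar (A : Mat2) = (r : ℂ) • H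

/-- Equivalence of bigraded symbols. -/
def BigradedEquiv (H S H' S' : Mat2) : Prop :=
  ∃ A : GL (Fin 2) ℂ, IsHeisIso H H' A ∧
    ∀ D, D ∈ bigradedSymbol H S ↔
      realMap (A : Mat2) * D * (realMap (A : Mat2))⁻¹ ∈ bigradedSymbol H' S'

/-- Equivalence of modified symbols. -/
def ModEquiv (H S Ω H' S' Ω' : Mat2) : Prop :=
  ∃ A : GL (Fin 2) ℂ, IsHeisIso H H' A ∧
    ∀ D, D ∈ modSymbol H S Ω ↔
      realMap (A : Mat2) * D * (realMap (A : Mat2))⁻¹ ∈ modSymbol H' S' Ω'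

/-! ### The groups `CU(H)`, `G_{0,0}` and their Lie algebras

The groups are taken in `ℂ* × GL(2,ℂ)`, i.e. as preimages of the groups in the quotient by the
central subgroup `{(1, Id), (-1, -Id)}`; Lie algebras and the action below are not affected. -/

/-- `CU(H)`. -/
def CU (H : Mat2) : Set (ℂˣ × GL (Fin 2) ℂ) :=
  {k | ((k.1 : ℂ) * (conj (k.1 : ℂ))⁻¹) • ((k.2 : Mat2)ᵀ * H * cbar (k.2 : Mat2)) = H}

/-- `G_{0,0}`. -/
def G00 (H S : Mat2) : Set (ℂˣ × GL (Fin 2) ℂ) :=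
  {k | Submodule.span ℂ {((k.2⁻¹ : GL (Fin 2) ℂ) : Mat2) * S * ((k.2⁻¹ : GL (Fin 2) ℂ) : Mat2)ᵀ}
        = Submodule.span ℂ {S} ∧
      Submodule.span ℂ {(k.2 : Mat2)ᵀ * (H * cbar S * Hᵀ) * (k.2 : Mat2)}
        = Submodule.span ℂ {H * cbar S * Hᵀ}}

/-- The stabilizer of `Ω` in `CU(H) ∩ G_{0,0}`.  The element `(u, U)` replaces `S` by
`U⁻¹ S U⁻ᵀ` and `Ω` by `U⁻¹ Ω U`; after the rescaling of `e` by the factor `c` that restores `S`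
it maps `Ω` to `c U⁻¹ Ω U`, and `Ω` is only defined modulo `g'_{0,0}`. -/
def stabilizer (H S Ω : Mat2) : Set (ℂˣ × GL (Fin 2) ℂ) :=
  {k | k ∈ CU H ∩ G00 H S ∧ ∃ c : ℂ, c ≠ 0 ∧
    c • (((k.2⁻¹ : GL (Fin 2) ℂ) : Mat2) * S * ((k.2⁻¹ : GL (Fin 2) ℂ) : Mat2)ᵀ) = S ∧
    c • (((k.2⁻¹ : GL (Fin 2) ℂ) : Mat2) * Ω * (k.2 : Mat2)) - Ω ∈ g00' H S}

/-- The set underlies a subgroup. -/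
def IsSubgroupSet {G : Type*} [Group G] (A : Set G) : Prop := ∃ K : Subgroup G, (K : Set G) = A

/-- The Lie algebra of a closed subgroup of `ℂ* × GL(2,ℂ)`. -/
def lieAlg (K : Set (ℂˣ × GL (Fin 2) ℂ)) : Set (ℂ × Mat2) :=
  {y | ∀ s : ℝ, ∃ k ∈ K, (k.1 : ℂ) = Complex.exp ((s : ℂ) * y.1) ∧
    (k.2 : Mat2) = NormedSpace.exp ((s : ℂ) • y.2)}

/-! ### 2-nondegenerate models -/

/-- `H(ζ, ζ̄)` in terms of `H` and the value `s = S(ζ)`. -/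
def modelH (H s : Mat2) : Mat2 :=
  (1 / 2 : ℂ) • (H * (1 - cbar s * Hᵀ * s * H)⁻¹ + (1 - H * cbar s * Hᵀ * s)⁻¹ * H)

/-- `S(ζ, ζ̄)` in terms of `H` and the value `s = S(ζ)`. -/
def modelS (H s : Mat2) : Mat2 := Hᵀ * (1 - s * H * cbar s * Hᵀ)⁻¹ * s * H

/-- The coordinates `z = (z₁, z₂)`. -/
def zPart (x : C4) : Fin 2 → ℂ := ![x 1, x 2]

/-- The right hand side of the defining equation of the model given by `H` and `S(ζ)`. -/
def modelRHS (H : Mat2) (Sz : ℂ → Mat2) (x : C4) : ℝ :=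
  (zPart x ⬝ᵥ (modelH H (Sz (x 3)) *ᵥ star (zPart x))
    + ((star (zPart x) ⬝ᵥ (modelS H (Sz (x 3)) *ᵥ star (zPart x))).re : ℂ)).re

/-- The 2-nondegenerate model given by `H` and `S(ζ)`, over the disc `|ζ| < δ`. -/
def model (H : Mat2) (Sz : ℂ → Mat2) (δ : ℝ) : Hypersurface where
  dom := {x | ‖x 3‖ < δ}
  ρ := fun x => (x 0).re - modelRHS H Sz x

/-- The function `S(ζ)` with
`(S(ζ), 0) = ln (exp (S^{0,2} ζ, Ω ζ) exp (0, -Ω ζ))`.  The product is `1 + N` with `N` in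
`csp(g₋₁)_{0,2}`, so that `N² = 0` and the logarithm is `N`. -/
def distinguishedS (H S Ω : Mat2) (ζ : ℂ) : Mat2 :=
  (NormedSpace.exp (ζ • iotaMod H S Ω) * NormedSpace.exp (-(ζ • ofGL H Ω))).toBlocks₁₂ * H⁻¹

/-- The map `(w, z, ζ) ↦ (u⁻² w, u⁻¹ U z, h ζ)`. -/
def coordChange (k : ℂˣ × GL (Fin 2) ℂ) (h : ℂ → ℂ) (x : C4) : C4 :=
  let z' : Fin 2 → ℂ := (k.1 : ℂ)⁻¹ • ((k.2 : Mat2) *ᵥ zPart x)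
  ![((k.1 : ℂ) ^ 2)⁻¹ * x 0, z' 0, z' 1, h (x 3)]

/-! ### The table -/

/-- The bigraded symbols in the table, with their parameters. -/
inductive Row where
  | r1 (ε : ℤˣ) (lam : ℝ)
  | r2 (θ : ℝ)
  | r3 (ε : ℤˣ)
  | r4 (ε : ℤˣ)
  | r5
  | r6
  | r7

/-- `ε = ±1` as a complex number. -/
def sgn (ε : ℤˣ) : ℂ := ((ε : ℤ) : ℂ)

namespace Row

/-- The ranges of the parameters. -/
def Valid : Row → Prop
  | r1 _ lam => 1 < lam
  | r2 θ => 0 < θ ∧ θ < Real.pi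
  | _ => True

/-- The rows in which the parameter `τ` occurs. -/
def HasTau : Row → Prop
  | r1 _ _ => True
  | r2 _ => True
  | r4 _ => True
  | r6 => True
  | _ => False

/-- The column `H`. -/
def H : Row → Mat2
  | r1 ε _ => !![1, 0; 0, sgn ε]
  | r2 _ => !![0, 1; 1, 0]
  | r3 ε => !![1, 0; 0, sgn ε]
  | r4 ε => !![1, 0; 0, sgn ε]
  | r5 => !![0, 1; 1, 0]
  | r6 => !![0, 1; 1, 0]
  | r7 => !![0, 1; 1, 0]

/-- The column `S^{0,2}`. -/
def S : Row → Mat2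
  | r1 _ lam => !![1, 0; 0, (lam : ℂ)]
  | r2 θ => !![1, 0; 0, Complex.exp (Complex.I * θ)]
  | r3 _ => !![0, 1; 1, 0]
  | r4 _ => !![1, 0; 0, 0]
  | r5 => !![0, 1; 1, 0]
  | r6 => !![1, 1; 1, 0]
  | r7 => !![1, 0; 0, 0]

/-- The normalization conditions `N_{0,2}`. -/
def N02 : Row → Set Mat2
  | r1 _ _ => {A | ∃ c : ℂ, A = !![0, 0; 0, c]}
  | r2 _ => {A | ∃ c : ℂ, A = !![0, 0; 0, c]}
  | r3 _ => {A | ∃ c d : ℂ, A = !![c, 0; 0, d]}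
  | r4 _ => {A | ∃ c : ℂ, A = !![0, 0; 0, c]}
  | r5 => {A | ∃ c d : ℂ, A = !![c, 0; 0, d]}
  | r6 => {A | ∃ c : ℂ, A = !![0, 0; 0, c]}
  | r7 => {A | ∃ c d : ℂ, A = !![0, c; c, d]}

/-- The column `g'_{0,0}`. -/
def g : Row → Set Mat2
  | r1 _ _ => {A | ∃ a : ℂ, A = !![a, 0; 0, a]}
  | r2 _ => {A | ∃ a : ℂ, A = !![a, 0; 0, a]}
  | r3 _ => {A | ∃ a b : ℂ, A = !![a, 0; 0, b]}
  | r4 _ => {A | ∃ a b : ℂ, A = !![a, 0; 0, b]}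
  | r5 => {A | ∃ a b : ℂ, A = !![a, 0; 0, b]}
  | r6 => {A | ∃ a : ℂ, A = !![a, 0; 0, a]}
  | r7 => {A | ∃ a b c : ℂ, A = !![a, b; 0, c]}

/-- The column `Re(g'_{0,0})`. -/
def re : Row → Set Mat2
  | r1 _ _ => {A | ∃ a : ℂ, A = !![a, 0; 0, a] ∧ a = -conj a}
  | r2 _ => {A | ∃ a : ℂ, A = !![a, 0; 0, a] ∧ a = -conj a}
  | r3 _ => {A | ∃ a b : ℂ, A = !![a, 0; 0, b] ∧ a = -conj a ∧ b = -conj b}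
  | r4 _ => {A | ∃ a b : ℂ, A = !![a, 0; 0, b] ∧ a = -conj a ∧ b = -conj b}
  | r5 => {A | ∃ a b : ℂ, A = !![a, 0; 0, b] ∧ a = -conj b}
  | r6 => {A | ∃ a : ℂ, A = !![a, 0; 0, a] ∧ a = -conj a}
  | r7 => {A | ∃ a b c : ℂ, A = !![a, b; 0, c] ∧ a = -conj c ∧ b = -conj b}

/-- The condition "annihilator of `Ω`" of the table, in the rows that have one. -/
def annih : Row → Set Mat2
  | r1 _ _ => {A | ∃ a : ℂ, A = !![a, 0; 0, a] ∧ a = 0}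
  | r2 _ => {A | ∃ a : ℂ, A = !![a, 0; 0, a] ∧ a = 0}
  | r4 _ => {A | ∃ a b : ℂ, A = !![a, 0; 0, b] ∧ b = 3 * a}
  | r6 => {A | ∃ a : ℂ, A = !![a, 0; 0, a] ∧ a = 0}
  | _ => Set.univ

end Row

/-- An entry of the table: a row with its parameters, including `τ`. -/
structure Entry where
  row : Row
  τ : ℝ

namespace Entry

/-- The ranges of the parameters; `τ` is put to `0` in the rows that do not contain it. -/
def Valid (t : Entry) : Prop := t.row.Valid ∧ 0 ≤ t.τ ∧ (¬ t.row.HasTau → t.τ = 0)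

/-- The column of realizable `Ω`. -/
def Ω (t : Entry) : Mat2 :=
  match t.row with
  | .r1 _ lam => !![0, -((t.τ : ℂ) * lam); (t.τ : ℂ), 0]
  | .r2 θ => !![0, -((t.τ : ℂ) * Complex.exp (Complex.I * θ)); (t.τ : ℂ), 0]
  | .r4 _ => !![0, 0; (t.τ : ℂ), 0]
  | .r6 => !![2 * (t.τ : ℂ), (t.τ : ℂ); 0, 0]
  | _ => 0

/-- The real form, cut down by the annihilator condition when `Ω ≠ 0` (for `Ω = 0` there is
nothing to annihilate). -/
def stabAlg (t : Entry) : Set Mat2 := {A | A ∈ t.row.re ∧ (t.τ ≠ 0 → A ∈ t.row.annih)}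

/-- The distinguished model of the entry, over the disc `|ζ| < δ`. -/
def model (t : Entry) (δ : ℝ) : Hypersurface :=
  CRSymbol.model t.row.H (distinguishedS t.row.H t.row.S t.Ω) δ

end Entry

/-- The adapted frame `φ` has at `p` the bigraded symbol representative given by the row `r`, and is
normalized with respect to the normalization condition of that row. -/
def AdaptedFrame.IsNormalizedFor {M : Hypersurface} {p : C4} (φ : AdaptedFrame M p) (r : Row) :
    Prop :=
  φ.H p = r.H ∧ φ.S02 p = r.S ∧ φ.NormalizedAt r.N02

/-- The modified symbol of `M` at `p` is represented by the entry `t`. -/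
def HasModSymbol (M : Hypersurface) (p : C4) (t : Entry) : Prop :=
  ∃ φ : AdaptedFrame M p, φ.IsNormalizedFor t.row ∧ φ.Ω p = t.Ω

end CRSymbol

end

open CRSymbol

noncomputable section

namespace CRSymbol

/-! ### Calculus of complex derivations -/

section Calculus

variable {E : Type*} [NormedAddCommGroup E] [NormedSpace ℂ E]

/-! Geometry is reduced to matrices at one point. Derivatives along complex vectors tangent to `M`
see only the values on `M` (`dd_eq_zero_of_tan`), so the Levi form is the complex Hessian of `ρ`
restricted to `ℋ`. Where `ρ_j ≠ 0`, subtracting multiples of `∂/∂x_j` from the other coordinate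
fields gives sections `F_a` of `ℋ` that commute, and the Levi kernel is spanned by `e = ∑ c_a F_a`
with `c₂ = 1`. In this frame `Ξ` and `Ω` are the matrices of `-F̄_k c_l` and `-F_k c_l`.
Differentiating the kernel equations and using commutativity yields three facts: `S^{0,2}` is
symmetric, `e(c̄_a) = 0` on `M`, and `e(S^{0,-2}) ≡ Ωᵀ S^{0,-2} + S^{0,-2} Ω` modulo `S^{0,-2}`. The
first and the last hold for every adapted frame, because their form is invariant under changes of
frame (`S_symm`, `deriv_P`).

A change of frame acts at `p` through a matrix `U`, two scalars and `Y = e(U) U⁻¹`, and all of them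
can be prescribed (`exists_change`). `U` moves `(H, S)` by congruence; `Y` is added to `Ω`, and `Y S
+ S Yᵀ` is subtracted from `e(S)` modulo `S` (`Link`). By the third fact the normalization of
`e(S^{0,-2})` says that `Ω` preserves the line of `S^{0,-2}` infinitesimally, which means `Ω ∈ ⟨Ω₁⟩
+ g'_{0,0}` (`isNormalizedFor_iff`). The symmetric matrices are spanned by `S`, `N_{0,2}` and `T₁ =
Ω₁ S + S Ω₁ᵀ`, and `T₁` is not in the span of the others unless `Ω₁ = 0` (`exists_T₁`,
`T₁_eq_zero_or`), so the normalization of `e(S^{0,2})` fixes the multiple of `Ω₁`. Hence `Ω` is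
determined modulo `g'_{0,0}` by the value of the frame at `p`. In the rows with `τ` the
self-equivalences of the pair `(H, S)` multiply `Ω₁` by phases only (`residual`, `tau_eq`), so the
absolute value `τ` of the coefficient is the invariant.

The list of pairs comes from bringing `S` to `J` or `D(1,0)` by a congruence and reducing `H` with
the congruences that are left (`hasRow_rank_two`, `hasRow_rank_one`). The rows are told apart by `Ξ
Ξ̄`, which changes by conjugation and a positive factor, and by the sign of `det H`
(`Row.eq_of_rel`). Equivalences of symbols and the groups `CU(H) ∩ G_{0,0}` are expressed by the
matrix relation `Rel`; their Lie algebras follow by differentiating one-parameter groups.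

For a model, the right hand side of the defining equation is `Re(zᵀ y)`, where `y` solves `y = H (z̄
+ s̄ ȳ)`, `s = S(ζ)`. Because of this implicit equation the derivatives of `y` cancel in `∂ρ`
(`dd_Q`), and the Levi form, its kernel, `S^{0,2} = s'(ζ)` and `e(S^{0,2}) = s''(ζ)` become
explicit. The distinguished function has `s'(ζ) = exp(ζΩ) S exp(ζΩᵀ)`, so `s''(0) = Ω S + S Ωᵀ`. The
obvious frame has `Ω = 0` at the origin, and the change with `Y = Ω` makes it normalized with the
prescribed `Ω`. Stabilizer elements satisfy `U Ω = c Ω U` exactly, whence `S(cζ) = U S(ζ) Uᵀ`, and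
the maps with `h(ζ) = cζ` multiply `ρ` by a nonzero real number. -/

/-- The complexified derivative of `h` at `x`, as a linear form in the complex vector. -/
def dd (h : C4 → E) (x : C4) : C4 × C4 →ₗ[ℂ] E where
  toFun V := delHol h x V.1 + delBar h x V.2
  map_add' V W := by
    simp only [delHol, delBar, Prod.fst_add, Prod.snd_add, star_add, smul_add, map_add]
    module
  map_smul' c V := by
    -- The derivative is only real linear, so a complex scalar is split into real and imaginary
    -- part; `key'` treats the conjugate scalar that `star` produces in the second slot.
    have key : ∀ v : C4, fderiv ℝ h x (c • v) = (c.re : ℂ) • fderiv ℝ h x v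
        + (c.im : ℂ) • fderiv ℝ h x (Complex.I • v) := by
      intro v
      have : c • v = c.re • v + c.im • (Complex.I • v) := by
        ext i
        simp only [Pi.smul_apply, Pi.add_apply, smul_eq_mul, Complex.real_smul]
        linear_combination (-(v i)) * Complex.re_add_im c
      rw [this, map_add, map_smul, map_smul]
      simp
    have key' : ∀ v : C4, fderiv ℝ h x ((starRingEnd ℂ) c • v) = (c.re : ℂ) • fderiv ℝ h x v
        - (c.im : ℂ) • fderiv ℝ h x (Complex.I • v) := by
      intro v
      have : (starRingEnd ℂ) c • v = c.re • v - c.im • (Complex.I • v) := by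
        ext i
        simp only [Pi.smul_apply, Pi.sub_apply, smul_eq_mul, Complex.real_smul]
        have h1 := Complex.re_add_im ((starRingEnd ℂ) c)
        simp only [Complex.conj_re, Complex.conj_im, Complex.ofReal_neg] at h1
        linear_combination (-(v i)) * h1
      rw [this, map_sub, map_smul, map_smul]
      simp
    have hI : ∀ v : C4, fderiv ℝ h x (Complex.I • Complex.I • v) = - fderiv ℝ h x v := by
      intro v
      rw [smul_smul, Complex.I_mul_I, neg_one_smul, map_neg]
    have hc : c = c.re + c.im * Complex.I := (Complex.re_add_im c).symm
    simp only [delHol, delBar, Prod.smul_fst, Prod.smul_snd, star_smul, RCLike.star_def,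
      RingHom.id_apply, smul_comm Complex.I c, smul_comm Complex.I ((starRingEnd ℂ) c), key, key',
      hI]
    generalize fderiv ℝ h x V.1 = a
    generalize fderiv ℝ h x (Complex.I • V.1) = b
    generalize fderiv ℝ h x (star V.2) = a'
    generalize fderiv ℝ h x (Complex.I • star V.2) = b'
    conv_rhs => rw [hc]
    simp only [smul_add, smul_sub, smul_smul, smul_neg]
    match_scalars <;> ring_nf <;> simp only [Complex.I_sq] <;> ring

theorem applyField_eq (X : CVField) (h : C4 → E) (x : C4) : applyField X h x = dd h x (X x) := rfl

theorem dd_def (h : C4 → E) (x : C4) (V : C4 × C4) :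
    dd h x V = (1 / 2 : ℂ) • (fderiv ℝ h x V.1 - Complex.I • fderiv ℝ h x (Complex.I • V.1))
      + (1 / 2 : ℂ) • (fderiv ℝ h x (star V.2) + Complex.I • fderiv ℝ h x (Complex.I • star V.2)) :=
  rfl

theorem delHol_eq_dd (h : C4 → E) (x A : C4) : delHol h x A = dd h x (A, 0) := by
  simp [dd_def, delHol]

/-- `h` is smooth near `x`. -/
abbrev Sm (h : C4 → E) (x : C4) : Prop := ContDiffAt ℝ ∞ h x

theorem Sm.diff {h : C4 → E} {x : C4} (hh : Sm h x) : DifferentiableAt ℝ h x :=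
  hh.differentiableAt (by simp)

theorem dd_congr {h k : C4 → E} {x : C4} (hk : h =ᶠ[𝓝 x] k) : dd h x = dd k x := by
  refine LinearMap.ext fun V => ?_
  rw [dd_def, dd_def, hk.fderiv_eq]

theorem dd_add {h k : C4 → E} {x : C4} (hh : Sm h x) (hk : Sm k x) (V : C4 × C4) :
    dd (fun y => h y + k y) x V = dd h x V + dd k x V := by
  have := fderiv_fun_add hh.diff hk.diff
  simp only [dd_def, this, _root_.add_apply]
  module

theorem dd_sub {h k : C4 → E} {x : C4} (hh : Sm h x) (hk : Sm k x) (V : C4 × C4) :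
    dd (fun y => h y - k y) x V = dd h x V - dd k x V := by
  have := fderiv_fun_sub hh.diff hk.diff
  simp only [dd_def, this, _root_.sub_apply]
  module

theorem dd_neg (h : C4 → E) (x : C4) (V : C4 × C4) :
    dd (fun y => - h y) x V = - dd h x V := by
  have := fderiv_fun_neg (𝕜 := ℝ) (f := h) (x := x)
  simp only [dd_def, this, _root_.neg_apply]
  module

theorem dd_const (c : E) (x : C4) (V : C4 × C4) : dd (fun _ => c) x V = 0 := by
  simp [dd_def]

theorem dd_smul {c : C4 → ℂ} {h : C4 → E} {x : C4} (hc : Sm c x) (hh : Sm h x) (V : C4 × C4) :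
    dd (fun y => c y • h y) x V = c x • dd h x V + dd c x V • h x := by
  have := fderiv_fun_smul (𝕜 := ℝ) (𝕜' := ℂ) (c := c) (f := h) (x := x) hc.diff hh.diff
  simp only [dd_def, this, _root_.add_apply, _root_.smul_apply,
    ContinuousLinearMap.smulRight_apply]
  simp only [smul_add, smul_sub, add_smul, smul_smul, smul_eq_mul]
  module

theorem dd_mul {c h : C4 → ℂ} {x : C4} (hc : Sm c x) (hh : Sm h x) (V : C4 × C4) :
    dd (fun y => c y * h y) x V = c x * dd h x V + dd c x V * h x := dd_smul hc hh V

theorem dd_const_mul (c : ℂ) {h : C4 → ℂ} {x : C4} (hh : Sm h x) (V : C4 × C4) :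
    dd (fun y => c * h y) x V = c * dd h x V := by
  rw [dd_mul contDiffAt_const hh, dd_const]; simp

theorem dd_sum {ι : Type*} {s : Finset ι} {h : ι → C4 → E} {x : C4} (hh : ∀ i ∈ s, Sm (h i) x)
    (V : C4 × C4) : dd (fun y => ∑ i ∈ s, h i y) x V = ∑ i ∈ s, dd (h i) x V := by
  classical
  induction s using Finset.induction_on with
  | empty => simp [dd_const]
  | insert a s ha ih =>
    simp only [Finset.sum_insert ha]
    rw [dd_add (hh a (by simp)) (ContDiffAt.sum fun i hi => hh i (by simp [hi])),
      ih fun i hi => hh i (by simp [hi])]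

theorem dd_pi {ι : Type*} [Fintype ι] {h : C4 → ι → ℂ} {x : C4} (hh : DifferentiableAt ℝ h x)
    (V : C4 × C4) (i : ι) : dd h x V i = dd (fun y => h y i) x V := by
  have h1 : ∀ v, fderiv ℝ h x v i = fderiv ℝ (fun y => h y i) x v := by
    intro v
    rw [fderiv_apply hh i]
    rfl
  simp only [dd_def, Pi.add_apply, Pi.sub_apply, Pi.smul_apply, h1]

/-- The conjugate of a complex vector. -/
def cc (V : C4 × C4) : C4 × C4 := (star V.2, star V.1)

@[simp] theorem cc_mk (A B : C4) : cc (A, B) = (star B, star A) := rfl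

theorem dd_conj {h : C4 → ℂ} {x : C4} (V : C4 × C4) :
    conj (dd h x V) = dd (fun y => conj (h y)) x (cc V) := by
  have h1 : ∀ v, fderiv ℝ (fun y => conj (h y)) x v = conj (fderiv ℝ h x v) := by
    intro v
    exact congrArg (fun T => T v) (Complex.conjCLE.comp_fderiv (f := h) (x := x))
  simp only [dd_def, cc, h1, star_star, map_add, map_sub, smul_eq_mul, map_mul, Complex.conj_I,
    map_div₀, map_one, map_ofNat]
  ring

theorem Sm.conj {h : C4 → ℂ} {x : C4} (hh : Sm h x) : Sm (fun y => conj (h y)) x :=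
  Complex.conjCLE.contDiff.contDiffAt.comp x hh

theorem Sm.inv {h : C4 → ℂ} {x : C4} (hh : Sm h x) (h0 : h x ≠ 0) : Sm (fun y => (h y)⁻¹) x :=
  ContDiffAt.inv hh h0

theorem Sm.comp_apply {ι : Type*} [Fintype ι] {h : C4 → ι → ℂ} {x : C4} (hh : Sm h x) (i : ι) :
    Sm (fun y => h y i) x := contDiffAt_pi.1 hh i

theorem Sm.contDiffAt_fderiv {h : C4 → E} {x : C4} (hh : Sm h x) : ContDiffAt ℝ ∞ (fderiv ℝ h) x :=
  hh.fderiv_right (by simp)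

theorem Sm.dd {h : C4 → E} {x : C4} {V : C4 → C4 × C4} (hh : Sm h x)
    (hV : ContDiffAt ℝ ∞ V x) : Sm (fun y => dd h y (V y)) x := by
  have h1 : ContDiffAt ℝ ∞ (fun y => (V y).1) x := contDiffAt_fst.comp x hV
  have h2 : ContDiffAt ℝ ∞ (fun y => star (V y).2) x :=
    (starL' ℝ : C4 ≃L[ℝ] C4).contDiff.contDiffAt.comp x (contDiffAt_snd.comp x hV)
  simp only [dd_def]
  have k : ∀ {v : C4 → C4}, ContDiffAt ℝ ∞ v x → ContDiffAt ℝ ∞ (fun y => fderiv ℝ h y (v y)) x :=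
    fun hv => hh.contDiffAt_fderiv.clm_apply hv
  exact ((((k h1).sub ((k (h1.const_smul Complex.I)).const_smul Complex.I)).const_smul _)).add
    ((((k h2).add ((k (h2.const_smul Complex.I)).const_smul Complex.I)).const_smul _))

/-- Symmetry of the second real derivative, applied to the real directions that make up each
constant complex vector. All commutation relations below come from here. -/
theorem dd_comm {h : C4 → E} {x : C4} (hh : Sm h x) (V W : C4 × C4) :
    dd (fun y => dd h y V) x W = dd (fun y => dd h y W) x V := by
  have hs : IsSymmSndFDerivAt ℝ h x := hh.isSymmSndFDerivAt (by
    rw [minSmoothness_of_isRCLikeNormedField]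
    exact WithTop.coe_le_coe.2 (le_top : (2 : ℕ∞) ≤ ⊤))
  have h2 : DifferentiableAt ℝ (fderiv ℝ h) x := hh.contDiffAt_fderiv.differentiableAt (by simp)
  have ha : ∀ v, DifferentiableAt ℝ (fun y => fderiv ℝ h y v) x := fun v =>
    h2.clm_apply (differentiableAt_const v)
  have hd : ∀ v w, fderiv ℝ (fun y => fderiv ℝ h y v) x w = fderiv ℝ (fderiv ℝ h) x w v := by
    intro v w
    rw [fderiv_clm_apply h2 (differentiableAt_const v)]
    simp
  have key : ∀ V W, fderiv ℝ (fun y => dd h y V) x W =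
      (1 / 2 : ℂ) • (fderiv ℝ (fderiv ℝ h) x W V.1
        - Complex.I • fderiv ℝ (fderiv ℝ h) x W (Complex.I • V.1))
      + (1 / 2 : ℂ) • (fderiv ℝ (fderiv ℝ h) x W (star V.2)
        + Complex.I • fderiv ℝ (fderiv ℝ h) x W (Complex.I • star V.2)) := by
    intro V W
    simp only [dd_def]
    rw [fderiv_fun_add, fderiv_fun_const_smul, fderiv_fun_const_smul, fderiv_fun_sub,
      fderiv_fun_add, fderiv_fun_const_smul, fderiv_fun_const_smul]
    · simp only [_root_.add_apply, _root_.smul_apply,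
        _root_.sub_apply, hd]
    all_goals fun_prop (disch := exact ha _)
  rw [dd_def (fun y => dd h y V), dd_def (fun y => dd h y W)]
  simp only [key]
  have e1 := hs
  unfold IsSymmSndFDerivAt at e1
  rw [e1 W.1 V.1, e1 W.1 (Complex.I • V.1), e1 W.1 (star V.2), e1 W.1 (Complex.I • star V.2),
    e1 (Complex.I • W.1) V.1, e1 (Complex.I • W.1) (Complex.I • V.1),
    e1 (Complex.I • W.1) (star V.2), e1 (Complex.I • W.1) (Complex.I • star V.2),
    e1 (star W.2) V.1, e1 (star W.2) (Complex.I • V.1), e1 (star W.2) (star V.2),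
    e1 (star W.2) (Complex.I • star V.2), e1 (Complex.I • star W.2) V.1,
    e1 (Complex.I • star W.2) (Complex.I • V.1),
    e1 (Complex.I • star W.2) (star V.2), e1 (Complex.I • star W.2) (Complex.I • star V.2)]
  module

end Calculus

/-! ### Tangential calculus on a hypersurface -/

/-- The `i`-th coordinate vector of `ℂ⁴`. -/
abbrev bv (i : Fin 4) : C4 := Pi.single i 1

theorem eq_sum_bv (v : C4) : v = ∑ i, v i • bv i := by
  ext k; simp [bv, Finset.sum_apply, Pi.single_apply]

theorem dd_fst_eq_sum {E : Type*} [NormedAddCommGroup E] [NormedSpace ℂ E] (h : C4 → E) (x v : C4) :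
    dd h x (v, 0) = ∑ i, v i • dd h x (bv i, 0) := by
  conv_lhs => rw [eq_sum_bv v]
  have : ((∑ i, v i • bv i, 0) : C4 × C4) = ∑ i, v i • ((bv i, 0) : C4 × C4) := by
    ext <;> simp [Prod.fst_sum, Prod.snd_sum]
  rw [this, map_sum]
  exact Finset.sum_congr rfl fun i _ => map_smul _ _ _

theorem star_dd {X : C4 → C4} {x : C4} (hX : Sm X x) (V : C4 × C4) :
    star (dd X x V) = dd (fun y => star (X y)) x (cc V) := by
  have hX' : Sm (fun y => star (X y)) x :=
    (starL' ℝ : C4 ≃L[ℝ] C4).contDiff.contDiffAt.comp x hX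
  ext i
  rw [dd_pi hX'.diff, Pi.star_apply, dd_pi hX.diff]
  exact dd_conj V

theorem Sm.star {X : C4 → C4} {x : C4} (hX : Sm X x) : Sm (fun y => star (X y)) x :=
  (starL' ℝ : C4 ≃L[ℝ] C4).contDiff.contDiffAt.comp x hX

theorem star_dd' {X : C4 → C4} {x : C4} (hX : Sm X x) (V : C4 × C4) :
    star (dd (fun y => star (X y)) x V) = dd X x (cc V) := by
  rw [star_dd hX.star]; simp

/-- Product rule with a moving argument: one term differentiates the form with its argument frozen
at `x`, the other differentiates the argument. -/
theorem dd_dd_fst {h : C4 → ℂ} {X : C4 → C4} {x : C4} (hh : Sm h x) (hX : Sm X x) (W : C4 × C4) :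
    dd (fun y => dd h y (X y, 0)) x W =
      dd (fun y => dd h y (X x, 0)) x W + dd h x (dd X x W, 0) := by
  have hc : ∀ i, Sm (fun y => dd h y (bv i, 0)) x := fun i => hh.dd contDiffAt_const
  have hXi : ∀ i, Sm (fun y => X y i) x := hX.comp_apply
  have e1 : (fun y => dd h y (X y, 0)) = fun y => ∑ i, X y i * dd h y (bv i, 0) :=
    funext fun y => dd_fst_eq_sum h y (X y)
  have e2 : (fun y => dd h y (X x, 0)) = fun y => ∑ i, X x i * dd h y (bv i, 0) :=
    funext fun y => dd_fst_eq_sum h y (X x)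
  rw [e1, e2, dd_fst_eq_sum h x (dd X x W)]
  rw [dd_sum (h := fun i y => X y i * dd h y (bv i, 0)) fun i _ => (hXi i).mul (hc i),
    dd_sum (h := fun i y => X x i * dd h y (bv i, 0)) fun i _ => contDiffAt_const.mul (hc i),
    ← Finset.sum_add_distrib]
  refine Finset.sum_congr rfl fun i _ => ?_
  rw [dd_mul (hXi i) (hc i), dd_const_mul _ (hc i), dd_pi hX.diff, smul_eq_mul]

theorem lieBr_hol_antihol (X Y : C4 → C4) (x : C4) :
    lieBr (hol X) (antihol Y) x =
      (- dd X x (0, star (Y x)), dd (fun y => star (Y y)) x (X x, 0)) := by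
  have h0 : ∀ V, dd (fun _ : C4 => (0 : C4)) x V = 0 := dd_const 0 x
  simp only [lieBr, applyField_eq, hol, antihol, h0]
  simp

theorem lieBr_hol_hol (X Y : C4 → C4) (x : C4) :
    lieBr (hol X) (hol Y) x = (dd Y x (X x, 0) - dd X x (Y x, 0), 0) := by
  have h0 : ∀ V, dd (fun _ : C4 => (0 : C4)) x V = 0 := dd_const 0 x
  simp only [lieBr, applyField_eq, hol, h0]
  simp

namespace Hypersurface

variable (M : Hypersurface)

/-- The defining function as a complex valued function. -/
def ρc (y : C4) : ℂ := (M.ρ y : ℂ)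

/-- `∂ρ` at `x`. -/
def dr (x v : C4) : ℂ := dd M.ρc x (v, 0)

variable {M} {x p : C4}

theorem IsRealAnalytic.sm (hM : M.IsRealAnalytic) (hx : x ∈ M.dom) : ContDiffAt ℝ ∞ M.ρ x :=
  (hM.analytic x hx).contDiffAt

theorem IsRealAnalytic.smc (hM : M.IsRealAnalytic) (hx : x ∈ M.dom) : Sm M.ρc x :=
  Complex.ofRealCLM.contDiff.contDiffAt.comp x (hM.sm hx)

theorem IsRealAnalytic.sm_dr (hM : M.IsRealAnalytic) (hx : x ∈ M.dom) {X : C4 → C4}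
    (hX : Sm X x) : Sm (fun y => M.dr y (X y)) x :=
  (hM.smc hx).dd (hX.prodMk contDiffAt_const)

theorem mem_HFib {v : C4} : v ∈ M.HFib x ↔ M.dr x v = 0 := by
  rw [HFib, Set.mem_ofPred_eq, delHol_eq_dd]; rfl

theorem dd_ρc_snd (x v : C4) : dd M.ρc x (0, star v) = conj (M.dr x v) := by
  rw [dr, dd_conj]; simp [ρc]; rfl

theorem dr_add (x v w : C4) : M.dr x (v + w) = M.dr x v + M.dr x w := by
  rw [dr, dr, dr, ← map_add]; simp

theorem dr_smul (x : C4) (c : ℂ) (v : C4) : M.dr x (c • v) = c * M.dr x v := by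
  rw [dr, dr, ← smul_eq_mul, ← map_smul]; simp

theorem dr_neg (x v : C4) : M.dr x (-v) = - M.dr x v := by
  rw [← neg_one_smul ℂ v, dr_smul]; simp

theorem dr_sub (x v w : C4) : M.dr x (v - w) = M.dr x v - M.dr x w := by
  rw [sub_eq_add_neg, dr_add, dr_neg]; ring

theorem dr_zero (x : C4) : M.dr x 0 = 0 := by
  rw [← zero_smul ℂ (0 : C4), dr_smul, zero_mul]

theorem dr_sum (x : C4) {ι : Type*} (s : Finset ι) (v : ι → C4) :
    M.dr x (∑ i ∈ s, v i) = ∑ i ∈ s, M.dr x (v i) := by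
  classical
  induction s using Finset.induction_on with
  | empty => simp [dr_zero]
  | insert a s ha ih => rw [Finset.sum_insert ha, Finset.sum_insert ha, dr_add, ih]

theorem HFib_add {v w : C4} (hv : v ∈ M.HFib x) (hw : w ∈ M.HFib x) : v + w ∈ M.HFib x := by
  rw [mem_HFib] at *; rw [dr_add, hv, hw, add_zero]

theorem HFib_smul {v : C4} (c : ℂ) (hv : v ∈ M.HFib x) : c • v ∈ M.HFib x := by
  rw [mem_HFib] at *; rw [dr_smul, hv, mul_zero]

/-- A complex vector tangent to `M`. -/
def Tan (M : Hypersurface) (x : C4) (V : C4 × C4) : Prop := dd M.ρc x V = 0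

theorem tan_fst {v : C4} (hv : v ∈ M.HFib x) : M.Tan x (v, 0) := mem_HFib.1 hv

theorem tan_snd {v : C4} (hv : v ∈ M.HFib x) : M.Tan x (0, star v) := by
  rw [Tan, dd_ρc_snd, mem_HFib.1 hv, map_zero]

theorem fderiv_ofReal_comp {h : C4 → ℝ} (hh : DifferentiableAt ℝ h x) (v : C4) :
    fderiv ℝ (fun y => (h y : ℂ)) x v = (fderiv ℝ h x v : ℂ) := by
  have := (Complex.ofRealCLM.hasFDerivAt.comp x hh.hasFDerivAt).fderiv
  exact congrArg (fun T => T v) this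

theorem two_mul_re_dr (hM : M.IsRealAnalytic) (hx : x ∈ M.dom) (v : C4) :
    (fderiv ℝ M.ρ x v : ℝ) = 2 * (M.dr x v).re := by
  have hd : DifferentiableAt ℝ M.ρ x := (hM.sm hx).differentiableAt (by simp)
  have : M.dr x v = (1 / 2 : ℂ) * ((fderiv ℝ M.ρ x v : ℂ)
      - Complex.I * (fderiv ℝ M.ρ x (Complex.I • v) : ℂ)) := by
    have h1 : ∀ v, fderiv ℝ M.ρc x v = (fderiv ℝ M.ρ x v : ℂ) := fderiv_ofReal_comp hd
    simp [dr, dd_def, h1]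
  rw [this]
  simp

/-- Derivatives along tangent vectors only depend on the values on `M`. -/
theorem dd_eq_zero_of_tan (hM : M.IsRealAnalytic) (hx : x ∈ M.carrier) {h : C4 → ℂ} (hh : Sm h x)
    (h0 : ∀ᶠ y in 𝓝 x, y ∈ M.carrier → h y = 0) {V : C4 × C4} (hV : M.Tan x V) :
    dd h x V = 0 := by
  have hstr : HasStrictFDerivAt M.ρ (fderiv ℝ M.ρ x) x :=
    (hM.sm hx.1).hasStrictFDerivAt (by simp)
  have hdom : ∀ᶠ y in 𝓝 x, y ∈ M.dom := hM.isOpen_dom.mem_nhds hx.1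
  -- Lagrange multipliers: a real function vanishing on `M` has a constrained extremum at `x`, so
  -- its differential is a multiple of that of `ρ`. Real and imaginary part of `h` are treated
  -- separately.
  have main : ∀ k : C4 → ℝ, ContDiffAt ℝ ∞ k x → (∀ᶠ y in 𝓝 x, y ∈ M.carrier → k y = 0) →
      ∃ c : ℝ, fderiv ℝ k x = c • fderiv ℝ M.ρ x := by
    intro k hk hk0
    have hkx : k x = 0 := hk0.self_of_nhds hx
    have hext : IsLocalExtrOn k {y | M.ρ y = M.ρ x} x := by
      left
      have : ∀ᶠ y in 𝓝[{y | M.ρ y = M.ρ x}] x, k x ≤ k y := by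
        filter_upwards [nhdsWithin_le_nhds hk0, nhdsWithin_le_nhds hdom, self_mem_nhdsWithin]
          with y h1 h2 h3
        rw [h1 ⟨h2, h3.trans hx.2⟩, hkx]
      exact this
    obtain ⟨a, b, hab, he⟩ := hext.exists_multipliers_of_hasStrictFDerivAt_1d hstr
      (hk.hasStrictFDerivAt (by simp))
    -- Regularity of `ρ` at `x` keeps the multiplier of `k` from vanishing.
    have hb : b ≠ 0 := by
      rintro rfl
      simp only [zero_smul, add_zero, smul_eq_zero] at he
      rcases he with rfl | he
      · exact hab rfl
      · exact hM.regular x hx he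
    refine ⟨-(b⁻¹ * a), ?_⟩
    refine ContinuousLinearMap.ext fun v => ?_
    have hv : a * fderiv ℝ M.ρ x v + b * fderiv ℝ k x v = 0 := congrArg (fun T => T v) he
    change fderiv ℝ k x v = -(b⁻¹ * a) * fderiv ℝ M.ρ x v
    field_simp
    linarith
  obtain ⟨c, hc⟩ := main (fun y => (h y).re) (Complex.reCLM.contDiff.contDiffAt.comp x hh)
    (h0.mono fun y hy hy' => by simp [hy hy'])
  obtain ⟨d, hd⟩ := main (fun y => (h y).im) (Complex.imCLM.contDiff.contDiffAt.comp x hh)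
    (h0.mono fun y hy hy' => by simp [hy hy'])
  have hdρ : DifferentiableAt ℝ M.ρ x := hstr.differentiableAt
  have key : ∀ v, fderiv ℝ h x v = ((c : ℂ) + d * Complex.I) * fderiv ℝ M.ρc x v := by
    intro v
    have h1 : (fderiv ℝ h x v).re = fderiv ℝ (fun y => (h y).re) x v :=
      (congrArg (fun T => T v) (Complex.reCLM.hasFDerivAt.comp x hh.diff.hasFDerivAt).fderiv).symm
    have h2 : (fderiv ℝ h x v).im = fderiv ℝ (fun y => (h y).im) x v :=
      (congrArg (fun T => T v) (Complex.imCLM.hasFDerivAt.comp x hh.diff.hasFDerivAt).fderiv).symm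
    have h3 : fderiv ℝ M.ρc x v = (fderiv ℝ M.ρ x v : ℂ) := fderiv_ofReal_comp hdρ v
    rw [h3]
    apply Complex.ext
    · rw [h1, hc]; simp
    · rw [h2, hd]; simp
  have : dd h x V = ((c : ℂ) + d * Complex.I) * dd M.ρc x V := by
    simp only [dd_def, key, smul_eq_mul]; ring
  rw [this, hV, mul_zero]

theorem dd_congr_tan (hM : M.IsRealAnalytic) (hx : x ∈ M.carrier) {h k : C4 → ℂ} (hh : Sm h x)
    (hk : Sm k x) (h0 : ∀ᶠ y in 𝓝 x, y ∈ M.carrier → h y = k y) {V : C4 × C4} (hV : M.Tan x V) :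
    dd h x V = dd k x V := by
  have := dd_eq_zero_of_tan hM hx (hh.sub hk) (h0.mono fun y hy h => by simp [hy h]) hV
  rw [← sub_eq_zero, ← dd_sub hh hk]; exact this

theorem dd_congr_tan' (hM : M.IsRealAnalytic) (hx : x ∈ M.carrier) {h k : C4 → C4} (hh : Sm h x)
    (hk : Sm k x) (h0 : ∀ᶠ y in 𝓝 x, y ∈ M.carrier → h y = k y) {V : C4 × C4} (hV : M.Tan x V) :
    dd h x V = dd k x V := by
  ext i
  rw [dd_pi hh.diff, dd_pi hk.diff]
  exact dd_congr_tan hM hx (hh.comp_apply i) (hk.comp_apply i)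
    (h0.mono fun y hy h => by rw [hy h]) hV

/-! ### The Levi form and its kernel through the complex Hessian of `ρ`. -/

/-- The complex Hessian `∑ ρ_{j k̄} v_j w̄_k`. -/
def hess (M : Hypersurface) (x v w : C4) : ℂ := dd (fun y => M.dr y v) x (0, star w)

/-- `ρ` is real, so conjugation exchanges its `(1,0)` and `(0,1)` derivatives; second derivatives
commute. -/
theorem hess_conj (hM : M.IsRealAnalytic) (hx : x ∈ M.dom) (v w : C4) :
    conj (M.hess x v w) = M.hess x w v := by
  have h1 : (fun y => conj (M.dr y v)) = fun y => dd M.ρc y (0, star v) := by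
    funext y; rw [dd_ρc_snd]
  rw [hess, dd_conj, h1, cc_mk, star_star, star_zero, dd_comm (hM.smc hx)]
  rfl

theorem sm_dr_const (hM : M.IsRealAnalytic) (hx : x ∈ M.dom) (v : C4) :
    Sm (fun y => M.dr y v) x := hM.sm_dr hx contDiffAt_const

theorem hess_add_left (hM : M.IsRealAnalytic) (hx : x ∈ M.dom) (v v' w : C4) :
    M.hess x (v + v') w = M.hess x v w + M.hess x v' w := by
  simp only [hess, dr_add]
  rw [dd_add (sm_dr_const hM hx v) (sm_dr_const hM hx v')]

theorem hess_smul_left (hM : M.IsRealAnalytic) (hx : x ∈ M.dom) (c : ℂ) (v w : C4) :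
    M.hess x (c • v) w = c * M.hess x v w := by
  simp only [hess, dr_smul]
  rw [dd_const_mul _ (sm_dr_const hM hx v)]

theorem hess_sum_left (hM : M.IsRealAnalytic) (hx : x ∈ M.dom) {ι : Type*} (s : Finset ι)
    (v : ι → C4) (w : C4) : M.hess x (∑ i ∈ s, v i) w = ∑ i ∈ s, M.hess x (v i) w := by
  simp only [hess, dr_sum]
  rw [dd_sum fun i _ => sm_dr_const hM hx (v i)]

theorem hess_add_right (v w w' : C4) :
    M.hess x v (w + w') = M.hess x v w + M.hess x v w' := by
  simp only [hess]
  rw [← map_add]; simp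

theorem hess_smul_right (c : ℂ) (v w : C4) :
    M.hess x v (c • w) = conj c * M.hess x v w := by
  simp only [hess]
  rw [← smul_eq_mul, ← map_smul]; simp

theorem hess_sum_right {ι : Type*} (s : Finset ι) (v : C4) (w : ι → C4) :
    M.hess x v (∑ i ∈ s, w i) = ∑ i ∈ s, M.hess x v (w i) := by
  have : ((0, star (∑ i ∈ s, w i)) : C4 × C4) = ∑ i ∈ s, ((0, star (w i)) : C4 × C4) := by
    ext <;> simp [Prod.fst_sum, Prod.snd_sum]
  simp only [hess]
  rw [this, map_sum]

/-- `X` is a smooth section of `ℋ` near `x`. -/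
structure SecAt (M : Hypersurface) (x : C4) (X : C4 → C4) : Prop where
  sm : Sm X x
  mem : ∀ᶠ y in 𝓝 x, y ∈ M.carrier → X y ∈ M.HFib y

theorem IsSection.secAt {W : Set C4} {X : C4 → C4} (h : M.IsSection W X) (hW : IsOpen W)
    (hx : x ∈ W) : M.SecAt x X :=
  ⟨h.smooth.contDiffAt (hW.mem_nhds hx), Filter.mem_of_superset (hW.mem_nhds hx) h.mem⟩

/-- The identity `∂ρ(X) = 0` holds on `M` and may be differentiated along the tangent vector `w̄`.
The moving form contributes the Hessian, the moving argument the left hand side. This turns brackets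
of sections into values of the Hessian. -/
theorem dr_dd_snd (hM : M.IsRealAnalytic) (hx : x ∈ M.carrier) {X : C4 → C4} (hX : M.SecAt x X)
    {w : C4} (hw : w ∈ M.HFib x) : M.dr x (dd X x (0, star w)) = - M.hess x (X x) w := by
  have h0 := dd_eq_zero_of_tan hM hx (hM.sm_dr hx.1 hX.sm)
    (hX.mem.mono fun y hy hy' => mem_HFib.1 (hy hy')) (tan_snd hw)
  have h1 := dd_dd_fst (hM.smc hx.1) hX.sm (0, star w)
  have h2 : dd (fun y => M.dr y (X y)) x (0, star w) =
    M.hess x (X x) w + M.dr x (dd X x (0, star w)) := h1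
  rw [h0] at h2
  linear_combination -h2

theorem dr_dd_fst (hM : M.IsRealAnalytic) (hx : x ∈ M.carrier) {X : C4 → C4} (hX : M.SecAt x X)
    {w : C4} (hw : w ∈ M.HFib x) :
    M.dr x (dd X x (w, 0)) = - dd (fun y => M.dr y (X x)) x (w, 0) := by
  have h0 := dd_eq_zero_of_tan hM hx (hM.sm_dr hx.1 hX.sm)
    (hX.mem.mono fun y hy hy' => mem_HFib.1 (hy hy')) (tan_fst hw)
  have h1 := dd_dd_fst (hM.smc hx.1) hX.sm (w, 0)
  have h2 : dd (fun y => M.dr y (X y)) x (w, 0) =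
    dd (fun y => M.dr y (X x)) x (w, 0) + M.dr x (dd X x (w, 0)) := h1
  rw [h0] at h2
  linear_combination -h2

/-- The commutator of two sections of `ℋ` is a section of `ℋ`. -/
theorem bracket_mem_HFib (hM : M.IsRealAnalytic) (hx : x ∈ M.carrier) {X Y : C4 → C4}
    (hX : M.SecAt x X) (hY : M.SecAt x Y) :
    dd Y x (X x, 0) - dd X x (Y x, 0) ∈ M.HFib x := by
  have hXx := hX.mem.self_of_nhds hx
  have hYx := hY.mem.self_of_nhds hx
  rw [mem_HFib, dr_sub, dr_dd_fst hM hx hX hYx, dr_dd_fst hM hx hY hXx]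
  have := dd_comm (hM.smc hx.1) (X x, 0) (Y x, 0)
  simp only [dr]
  rw [this]; ring

theorem exists_dr_ne_zero (hM : M.IsRealAnalytic) (hx : x ∈ M.carrier) :
    ∃ j, M.dr x (bv j) ≠ 0 := by
  by_contra! h
  apply hM.regular x hx
  ext v
  have : M.dr x v = 0 := by
    conv_lhs => rw [eq_sum_bv v]
    rw [dr_sum]
    exact Finset.sum_eq_zero fun i _ => by rw [dr_smul, h i, mul_zero]
  rw [two_mul_re_dr hM hx.1, this]; simp

/-- The section of `ℋ` obtained from the constant field `v` by subtracting a multiple of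
`∂/∂x_j`. -/
def ext (M : Hypersurface) (j : Fin 4) (v : C4) (y : C4) : C4 :=
  v - (M.dr y v * (M.dr y (bv j))⁻¹) • bv j

theorem ext_mem {j : Fin 4} {y : C4} (hj : M.dr y (bv j) ≠ 0) (v : C4) : M.ext j v y ∈ M.HFib y := by
  rw [mem_HFib, ext, dr_sub, dr_smul]; field_simp; ring

theorem ext_eq {j : Fin 4} {v : C4} (hv : v ∈ M.HFib x) : M.ext j v x = v := by
  rw [ext, mem_HFib.1 hv]; simp

theorem ext_sm (hM : M.IsRealAnalytic) (hx : x ∈ M.dom) {j : Fin 4} (hj : M.dr x (bv j) ≠ 0)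
    (v : C4) : Sm (M.ext j v) x := by
  unfold ext
  exact contDiffAt_const.sub ((((sm_dr_const hM hx v).mul
    ((sm_dr_const hM hx (bv j)).inv hj))).smul contDiffAt_const)

theorem dr_ne_zero_near (hM : M.IsRealAnalytic) (hx : x ∈ M.dom) {j : Fin 4}
    (hj : M.dr x (bv j) ≠ 0) : ∀ᶠ y in 𝓝 x, M.dr y (bv j) ≠ 0 :=
  (sm_dr_const hM hx (bv j)).continuousAt.eventually_ne hj

theorem exists_isSection (hM : M.IsRealAnalytic) (hx : x ∈ M.carrier) :
    ∃ (j : Fin 4) (W : Set C4), IsOpen W ∧ W ⊆ M.dom ∧ x ∈ W ∧ (∀ y ∈ W, M.dr y (bv j) ≠ 0) ∧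
      ∀ v, M.IsSection W (M.ext j v) := by
  obtain ⟨j, hj⟩ := exists_dr_ne_zero hM hx
  obtain ⟨W, hW, hWo, hxW⟩ := mem_nhds_iff.1 ((dr_ne_zero_near hM hx.1 hj).and
    (hM.isOpen_dom.mem_nhds hx.1))
  refine ⟨j, W, hWo, fun y hy => (hW hy).2, hxW, fun y hy => (hW hy).1, fun v => ⟨?_, ?_⟩⟩
  · intro y hy
    exact (ext_sm hM (hW hy).2 (hW hy).1 v).contDiffWithinAt
  · intro y hy _
    exact ext_mem (hW hy).1 v

/-- `∂ρ` of the two components of the bracket (the second conjugated) is the same Hessian value up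
to sign and conjugation, so one scalar decides. -/
theorem lieBr_mem_HHFib_iff (hM : M.IsRealAnalytic) (hx : x ∈ M.carrier) {X Y : C4 → C4}
    (hX : M.SecAt x X) (hY : M.SecAt x Y) :
    lieBr (hol X) (antihol Y) x ∈ M.HHFib x ↔ M.hess x (X x) (Y x) = 0 := by
  have hXx := hX.mem.self_of_nhds hx
  have hYx := hY.mem.self_of_nhds hx
  rw [lieBr_hol_antihol, HHFib, Set.mem_ofPred_eq]
  simp only
  rw [star_dd' hY.sm, cc_mk, star_zero, mem_HFib, mem_HFib, dr_neg, dr_dd_snd hM hx hX hYx,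
    dr_dd_snd hM hx hY hXx, ← hess_conj hM hx.1]
  simp

/-- Every vector of `ℋ_x` is the value of a section `ext j v`, and the bracket condition depends on
the values at `x` only. The quantifier over sections thus becomes one over vectors. -/
theorem mem_KFib_iff (hM : M.IsRealAnalytic) (hx : x ∈ M.carrier) {v : C4} :
    v ∈ M.KFib x ↔ v ∈ M.HFib x ∧ ∀ w ∈ M.HFib x, M.hess x v w = 0 := by
  constructor
  · rintro ⟨hv, h⟩
    refine ⟨hv, fun w hw => ?_⟩
    obtain ⟨j, W, hWo, hWd, hxW, -, hs⟩ := exists_isSection hM hx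
    have := h W (M.ext j v) (M.ext j w) hWo hWd hxW (hs v) (hs w) (ext_eq hv)
    rw [lieBr_mem_HHFib_iff hM hx ((hs v).secAt hWo hxW) ((hs w).secAt hWo hxW), ext_eq hv,
      ext_eq hw] at this
    exact this
  · rintro ⟨hv, h⟩
    refine ⟨hv, fun W X Y hWo hWd hxW hX hY hXx => ?_⟩
    rw [lieBr_mem_HHFib_iff hM hx (hX.secAt hWo hxW) (hY.secAt hWo hxW), hXx]
    exact h _ (hY.mem x hxW hx)

theorem KFib_smul (hM : M.IsRealAnalytic) (hx : x ∈ M.carrier) {v : C4} (c : ℂ)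
    (hv : v ∈ M.KFib x) : c • v ∈ M.KFib x := by
  rw [mem_KFib_iff hM hx] at *
  exact ⟨HFib_smul c hv.1, fun w hw => by rw [hess_smul_left hM hx.1, hv.2 w hw, mul_zero]⟩

theorem KFib_add (hM : M.IsRealAnalytic) (hx : x ∈ M.carrier) {v v' : C4}
    (hv : v ∈ M.KFib x) (hv' : v' ∈ M.KFib x) : v + v' ∈ M.KFib x := by
  rw [mem_KFib_iff hM hx] at *
  exact ⟨HFib_add hv.1 hv'.1, fun w hw => by
    rw [hess_add_left hM hx.1, hv.2 w hw, hv'.2 w hw, add_zero]⟩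

theorem KFib_zero (hM : M.IsRealAnalytic) (hx : x ∈ M.carrier) : (0 : C4) ∈ M.KFib x := by
  rw [mem_KFib_iff hM hx, mem_HFib, dr_zero]
  exact ⟨rfl, fun w _ => by simpa using hess_smul_left hM hx.1 0 0 w⟩

theorem KFib_sub (hM : M.IsRealAnalytic) (hx : x ∈ M.carrier) {v v' : C4}
    (hv : v ∈ M.KFib x) (hv' : v' ∈ M.KFib x) : v - v' ∈ M.KFib x := by
  rw [sub_eq_add_neg, ← neg_one_smul ℂ v']
  exact KFib_add hM hx hv (KFib_smul hM hx _ hv')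

end Hypersurface

open Hypersurface

/-! ### Frames of fields and their structure functions -/

/-- The fields of an adapted frame, without the functions determined by them. -/
structure PreFrame (M : Hypersurface) (p : C4) where
  W : Set C4
  isOpen_W : IsOpen W
  W_subset : W ⊆ M.dom
  p_mem : p ∈ W
  g : C4 → C4
  f : Fin 2 → C4 → C4
  e : C4 → C4
  smooth_g : ContDiffOn ℝ ∞ g W
  tangent_g : ∀ x ∈ W, x ∈ M.carrier → fderiv ℝ M.ρ x (g x) = 0
  transverse_g : ∀ x ∈ W, x ∈ M.carrier → g x ∉ M.HFib x
  section_f : ∀ a, M.IsSection W (f a)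
  section_e : M.IsSection W e
  kernel_e : ∀ x ∈ W, x ∈ M.carrier → e x ∈ M.KFib x
  independent : ∀ x ∈ W, x ∈ M.carrier → LinearIndependent ℂ ![f 0 x, f 1 x, e x]

/-- The fields of an adapted frame. -/
def AdaptedFrame.toPre {M : Hypersurface} {p : C4} (φ : AdaptedFrame M p) : PreFrame M p where
  W := φ.W
  isOpen_W := φ.isOpen_W
  W_subset := φ.W_subset
  p_mem := φ.p_mem
  g := φ.g
  f := φ.f
  e := φ.e
  smooth_g := φ.smooth_g
  tangent_g := φ.tangent_g
  transverse_g := φ.transverse_g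
  section_f := φ.section_f
  section_e := φ.section_e
  kernel_e := φ.kernel_e
  independent := φ.independent

/-- Entrywise smoothness of the inverse of an invertible matrix function. -/
theorem sm_matrix_inv {n : Type*} [Fintype n] [DecidableEq n] {A : C4 → Matrix n n ℂ} {x : C4}
    (hA : ∀ i j, Sm (fun y => A y i j) x) (h0 : (A x).det ≠ 0) (i j : n) :
    Sm (fun y => (A y)⁻¹ i j) x := by
  have hdet : ∀ B : C4 → Matrix n n ℂ, (∀ i j, Sm (fun y => B y i j) x) →
      Sm (fun y => (B y).det) x := by
    intro B hB
    simp only [Matrix.det_apply']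
    exact ContDiffAt.sum fun σ _ => contDiffAt_const.mul (contDiffAt_prod fun k _ => hB _ _)
  have h1 : ∀ y, (A y)⁻¹ i j = ((A y).det)⁻¹ * ((A y).updateRow j (Pi.single i 1)).det := by
    intro y
    rw [Matrix.inv_def, Matrix.smul_apply, Matrix.adjugate_apply, Ring.inverse_eq_inv',
      smul_eq_mul]
  simp only [h1]
  refine ((hdet A hA).inv h0).mul (hdet _ fun k l => ?_)
  by_cases hk : k = j
  · subst hk; simp only [Matrix.updateRow_self]; exact contDiffAt_const
  · simp only [Matrix.updateRow_ne hk]; exact hA k l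

namespace PreFrame

variable {M : Hypersurface} {p x : C4} (φ : PreFrame M p)

theorem secf (hx : x ∈ φ.W) (a : Fin 2) : M.SecAt x (φ.f a) := (φ.section_f a).secAt φ.isOpen_W hx

theorem sece (hx : x ∈ φ.W) : M.SecAt x φ.e := φ.section_e.secAt φ.isOpen_W hx

theorem smg (hx : x ∈ φ.W) : Sm φ.g x := φ.smooth_g.contDiffAt (φ.isOpen_W.mem_nhds hx)

theorem f_mem (hx : x ∈ φ.W) (hxM : x ∈ M.carrier) (a : Fin 2) : φ.f a x ∈ M.HFib x :=
  (φ.section_f a).mem x hx hxM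

theorem e_mem (hx : x ∈ φ.W) (hxM : x ∈ M.carrier) : φ.e x ∈ M.HFib x :=
  φ.section_e.mem x hx hxM

/-- The matrix with columns `g, f₁, f₂, e`. -/
def mat (y : C4) : Matrix (Fin 4) (Fin 4) ℂ :=
  Matrix.of fun i k => ![φ.g y, φ.f 0 y, φ.f 1 y, φ.e y] k i

/-- The coefficients of a vector in the basis `g, f₁, f₂, e`. -/
def co (y v : C4) : Fin 4 → ℂ := (φ.mat y)⁻¹ *ᵥ v

theorem mat_mulVec (y : C4) (c : Fin 4 → ℂ) :
    φ.mat y *ᵥ c = c 0 • φ.g y + c 1 • φ.f 0 y + c 2 • φ.f 1 y + c 3 • φ.e y := by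
  ext i
  simp [mat, Matrix.mulVec, dotProduct, Fin.sum_univ_four]
  ring

theorem co_spec {y : C4} (hy : (φ.mat y).det ≠ 0) (v : C4) :
    v = φ.co y v 0 • φ.g y + φ.co y v 1 • φ.f 0 y + φ.co y v 2 • φ.f 1 y + φ.co y v 3 • φ.e y := by
  rw [← mat_mulVec, co, Matrix.mulVec_mulVec, Matrix.mul_nonsing_inv _ (isUnit_iff_ne_zero.2 hy),
    Matrix.one_mulVec]

theorem co_comb {y : C4} (hy : (φ.mat y).det ≠ 0) (c : Fin 4 → ℂ) :
    φ.co y (c 0 • φ.g y + c 1 • φ.f 0 y + c 2 • φ.f 1 y + c 3 • φ.e y) = c := by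
  rw [← mat_mulVec, co, Matrix.mulVec_mulVec, Matrix.nonsing_inv_mul _ (isUnit_iff_ne_zero.2 hy),
    Matrix.one_mulVec]

theorem indep (hx : x ∈ φ.W) (hxM : x ∈ M.carrier) {a b c : ℂ}
    (h : a • φ.f 0 x + b • φ.f 1 x + c • φ.e x = 0) : a = 0 ∧ b = 0 ∧ c = 0 := by
  have := Fintype.linearIndependent_iff.1 (φ.independent x hx hxM) ![a, b, c] (by
    simpa [Fin.sum_univ_three] using h)
  exact ⟨this 0, this 1, this 2⟩

theorem det_ne_zero (hx : x ∈ φ.W) (hxM : x ∈ M.carrier) : (φ.mat x).det ≠ 0 := by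
  intro h0
  obtain ⟨c, hc, hc0⟩ := Matrix.exists_mulVec_eq_zero_iff.2 h0
  rw [mat_mulVec] at hc0
  have h1 : c 0 = 0 := by
    have h2 := congrArg (M.dr x) hc0
    rw [dr_add, dr_add, dr_add, dr_smul, dr_smul, dr_smul, dr_smul, dr_zero,
      mem_HFib.1 (φ.f_mem hx hxM 0), mem_HFib.1 (φ.f_mem hx hxM 1),
      mem_HFib.1 (φ.e_mem hx hxM)] at h2
    have h3 : M.dr x (φ.g x) ≠ 0 := fun h => φ.transverse_g x hx hxM (mem_HFib.2 h)
    simpa [h3] using h2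
  rw [h1, zero_smul, zero_add] at hc0
  obtain ⟨h2, h3, h4⟩ := φ.indep hx hxM hc0
  apply hc
  ext i; fin_cases i <;> assumption

theorem sm_mat (hx : x ∈ φ.W) (i k : Fin 4) : Sm (fun y => φ.mat y i k) x := by
  fin_cases k
  · exact (φ.smg hx).comp_apply i
  · exact (φ.secf hx 0).sm.comp_apply i
  · exact (φ.secf hx 1).sm.comp_apply i
  · exact (φ.sece hx).sm.comp_apply i

theorem sm_co (hx : x ∈ φ.W) (h0 : (φ.mat x).det ≠ 0) {v : C4 → C4} (hv : Sm v x) (k : Fin 4) :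
    Sm (fun y => φ.co y (v y) k) x := by
  simp only [co, Matrix.mulVec, dotProduct]
  exact ContDiffAt.sum fun i _ => (sm_matrix_inv (φ.sm_mat hx) h0 k i).mul (hv.comp_apply i)

theorem continuousAt_det (hx : x ∈ φ.W) : ContinuousAt (fun y => (φ.mat y).det) x := by
  simp only [Matrix.det_apply']
  exact tendsto_finsetSum _ fun σ _ => tendsto_const_nhds.mul
    (tendsto_finsetProd _ fun k _ => (φ.sm_mat hx _ _).continuousAt)

theorem mem_HFib_iff (hx : x ∈ φ.W) (hxM : x ∈ M.carrier) {v : C4} :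
    v ∈ M.HFib x ↔ φ.co x v 0 = 0 := by
  have h3 : M.dr x (φ.g x) ≠ 0 := fun h => φ.transverse_g x hx hxM (mem_HFib.2 h)
  rw [mem_HFib]
  conv_lhs => rw [φ.co_spec (φ.det_ne_zero hx hxM) v]
  rw [dr_add, dr_add, dr_add, dr_smul, dr_smul, dr_smul, dr_smul,
    mem_HFib.1 (φ.f_mem hx hxM 0), mem_HFib.1 (φ.f_mem hx hxM 1),
    mem_HFib.1 (φ.e_mem hx hxM)]
  simp [h3]

theorem e_ne_zero (hx : x ∈ φ.W) (hxM : x ∈ M.carrier) : φ.e x ≠ 0 := by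
  intro h
  have := (φ.indep hx hxM (a := 0) (b := 0) (c := 1) (by simp [h])).2.2
  exact one_ne_zero this

theorem mem_KFib_iff_smul (hM : M.IsUniformly2Nondegenerate) (hx : x ∈ φ.W) (hxM : x ∈ M.carrier)
    {v : C4} : v ∈ M.KFib x ↔ ∃ c : ℂ, v = c • φ.e x := by
  constructor
  · intro hv
    obtain ⟨v₀, -, -, h⟩ := hM.leviRank x hxM
    obtain ⟨c, hc⟩ := h _ (φ.kernel_e x hx hxM)
    obtain ⟨d, hd⟩ := h v hv
    have hc0 : c ≠ 0 := by rintro rfl; exact φ.e_ne_zero hx hxM (by simp [hc])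
    refine ⟨d * c⁻¹, ?_⟩
    rw [hc, hd, smul_smul, mul_assoc, inv_mul_cancel₀ hc0, mul_one]
  · rintro ⟨c, rfl⟩
    exact KFib_smul hM.analytic hxM c (φ.kernel_e x hx hxM)

theorem mem_KFib_iff_co (hM : M.IsUniformly2Nondegenerate) (hx : x ∈ φ.W) (hxM : x ∈ M.carrier)
    {v : C4} : v ∈ M.KFib x ↔ φ.co x v 0 = 0 ∧ φ.co x v 1 = 0 ∧ φ.co x v 2 = 0 := by
  rw [φ.mem_KFib_iff_smul hM hx hxM]
  have hd := φ.det_ne_zero hx hxM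
  constructor
  · rintro ⟨c, rfl⟩
    have := φ.co_comb hd ![0, 0, 0, c]
    simp at this
    rw [this]; simp
  · rintro ⟨h0, h1, h2⟩
    refine ⟨φ.co x v 3, ?_⟩
    conv_lhs => rw [φ.co_spec hd v]
    rw [h0, h1, h2]; simp

/-- Tangency of the real field with `(1,0)` part `g` means `Re ∂ρ(g) = 0`. That the value is purely
imaginary is what makes `H` Hermitian. -/
theorem conj_dr_g (hM : M.IsRealAnalytic) (hx : x ∈ φ.W) (hxM : x ∈ M.carrier) :
    conj (M.dr x (φ.g x)) = - M.dr x (φ.g x) := by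
  have h := φ.tangent_g x hx hxM
  rw [two_mul_re_dr hM hxM.1] at h
  apply Complex.ext
  · rw [Complex.conj_re, Complex.neg_re]; linarith
  · simp

theorem dr_g_ne (hx : x ∈ φ.W) (hxM : x ∈ M.carrier) : M.dr x (φ.g x) ≠ 0 :=
  fun h => φ.transverse_g x hx hxM (mem_HFib.2 h)

theorem co_sub {y : C4} (v w : C4) (k : Fin 4) : φ.co y (v - w) k = φ.co y v k - φ.co y w k := by
  simp [co, Matrix.mulVec_sub]

theorem co_smul {y : C4} (c : ℂ) (v : C4) (k : Fin 4) : φ.co y (c • v) k = c * φ.co y v k := by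
  simp [co, Matrix.mulVec_smul]

theorem co_comb_f {y : C4} (hy : (φ.mat y).det ≠ 0) (c : Fin 2 → ℂ) :
    φ.co y (∑ l, c l • φ.f l y) = ![0, c 0, c 1, 0] := by
  have := φ.co_comb hy ![0, c 0, c 1, 0]
  simpa [Fin.sum_univ_two] using this

theorem co_g {y : C4} (hy : (φ.mat y).det ≠ 0) : φ.co y (φ.g y) = ![1, 0, 0, 0] := by
  have := φ.co_comb hy ![1, 0, 0, 0]
  simpa using this

/-- Every frame of fields determines an adapted frame. -/
theorem exists_adaptedFrame (hM : M.IsUniformly2Nondegenerate) (hpM : p ∈ M.carrier) :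
    ∃ ψ : AdaptedFrame M p, ψ.g = φ.g ∧ ψ.f = φ.f ∧ ψ.e = φ.e ∧ ψ.W ⊆ φ.W := by
  have hp : (φ.mat p).det ≠ 0 := φ.det_ne_zero φ.p_mem hpM
  have hA := hM.analytic
  -- The fields form a basis on `M` only; smooth coefficient functions need an open set on which the
  -- frame matrix is invertible.
  set W' : Set C4 := {y | y ∈ φ.W ∧ (φ.mat y).det ≠ 0} with hW'
  have hWo : IsOpen W' := by
    rw [isOpen_iff_mem_nhds]
    rintro y ⟨hy, hy0⟩
    exact (φ.isOpen_W.mem_nhds hy |> Filter.inter_mem <|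
      (φ.continuousAt_det hy).eventually_ne hy0)
  have smdd : ∀ {X V : C4 → C4} {y : C4}, Sm X y → Sm V y →
      Sm (fun z => dd X z (0, star (V z))) y := fun hX hV =>
    hX.dd (contDiffAt_const.prodMk hV.star)
  have smdd' : ∀ {X V : C4 → C4} {y : C4}, Sm X y → Sm V y →
      Sm (fun z => dd X z (V z, 0)) y := fun hX hV =>
    hX.dd (hV.prodMk contDiffAt_const)
  refine ⟨⟨W', hWo, fun y hy => φ.W_subset hy.1, ⟨φ.p_mem, hp⟩, φ.g, φ.f, φ.e,
    φ.smooth_g.mono fun y hy => hy.1, fun x hx => φ.tangent_g x hx.1,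
    fun x hx => φ.transverse_g x hx.1,
    fun a => ⟨(φ.section_f a).smooth.mono fun y hy => hy.1, fun x hx => (φ.section_f a).mem x hx.1⟩,
    ⟨φ.section_e.smooth.mono fun y hy => hy.1, fun x hx => φ.section_e.mem x hx.1⟩,
    fun x hx => φ.kernel_e x hx.1, fun x hx => φ.independent x hx.1,
    -- The structure functions are coefficients of the brackets: index 0 is the coefficient of `g`,
    -- and `![1, 2] l` that of `f_l`.
    fun y => Matrix.of fun a b =>
      1 / (2 * Complex.I) * φ.co y (- dd (φ.f a) y (0, star (φ.f b y))) 0,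
    fun y => Matrix.of fun l k => φ.co y (- dd φ.e y (0, star (φ.f k y))) (![1, 2] l),
    fun y => Matrix.of fun l k =>
      φ.co y (dd (φ.f k) y (φ.e y, 0) - dd φ.e y (φ.f k y, 0)) (![1, 2] l), ?_, ?_, ?_, ?_, ?_, ?_⟩,
    rfl, rfl, rfl, fun y hy => hy.1⟩
  · intro a b y hy
    refine (contDiffAt_const.mul (φ.sm_co hy.1 hy.2 (ContDiffAt.neg ?_) 0)).contDiffWithinAt
    exact smdd (φ.secf hy.1 a).sm (φ.secf hy.1 b).sm
  · intro l k y hy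
    refine (φ.sm_co hy.1 hy.2 (ContDiffAt.neg ?_) _).contDiffWithinAt
    exact smdd (φ.sece hy.1).sm (φ.secf hy.1 k).sm
  · intro l k y hy
    refine (φ.sm_co hy.1 hy.2 (ContDiffAt.sub ?_ ?_) _).contDiffWithinAt
    · exact smdd' (φ.secf hy.1 k).sm (φ.sece hy.1).sm
    · exact smdd' (φ.sece hy.1).sm (φ.secf hy.1 k).sm
  · intro x hx hxM a b
    have hI : (2 * Complex.I) ≠ 0 := by simp
    have hh : ∀ a b, M.hess x (φ.f a x) (φ.f b x) =
        φ.co x (- dd (φ.f a) x (0, star (φ.f b x))) 0 * M.dr x (φ.g x) := by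
      intro a b
      have h1 := dr_dd_snd hA hxM (φ.secf hx.1 a) (φ.f_mem hx.1 hxM b)
      have h2 := congrArg (M.dr x) (φ.co_spec hx.2 (- dd (φ.f a) x (0, star (φ.f b x))))
      rw [dr_add, dr_add, dr_add, dr_smul, dr_smul, dr_smul, dr_smul,
        mem_HFib.1 (φ.f_mem hx.1 hxM 0), mem_HFib.1 (φ.f_mem hx.1 hxM 1),
        mem_HFib.1 (φ.e_mem hx.1 hxM), dr_neg, h1] at h2
      simpa using h2
    -- The `(0,1)` component of the Levi identity needs the same coefficient as the `(1,0)`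
    -- component; this is the Hermitian symmetry of the Hessian together with `∂ρ(g)` being
    -- imaginary.
    have hc := hess_conj hA hxM.1 (φ.f a x) (φ.f b x)
    rw [hh, hh, map_mul, φ.conj_dr_g hA hx.1 hxM] at hc
    have hc' := mul_right_cancel₀ (φ.dr_g_ne hx.1 hxM)
      ((by linear_combination hc : - conj (φ.co x (- dd (φ.f a) x (0, star (φ.f b x))) 0)
        * M.dr x (φ.g x) = φ.co x (- dd (φ.f b) x (0, star (φ.f a x))) 0 * M.dr x (φ.g x)))
    rw [lieBr_hol_antihol, HHFib, Set.mem_ofPred_eq]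
    constructor
    · rw [φ.mem_HFib_iff hx.1 hxM]
      simp only [Prod.fst_sub, Prod.smul_fst]
      rw [co_sub, co_smul, co_smul, φ.co_g hx.2]
      simp
    · rw [φ.mem_HFib_iff hx.1 hxM]
      simp only [Prod.snd_sub, Prod.smul_snd, star_sub, star_smul, star_star]
      rw [star_dd' (φ.secf hx.1 b).sm, co_sub, co_smul, co_smul, φ.co_g hx.2, cc_mk, star_zero]
      have h3 : φ.co x (dd (φ.f b) x (0, star (φ.f a x))) 0 =
          - φ.co x (- dd (φ.f b) x (0, star (φ.f a x))) 0 := by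
        simp [co, Matrix.mulVec_neg]
      rw [h3, ← hc']
      simp
  · intro x hx hxM k
    rw [lieBr_hol_antihol, KHFib, Set.mem_ofPred_eq]
    have hk : φ.f k x ∈ M.HFib x := φ.f_mem hx.1 hxM k
    constructor
    · rw [φ.mem_KFib_iff_co hM hx.1 hxM]
      have h1 : (((- dd φ.e x (0, star (φ.f k x)), dd (fun y => star (φ.f k y)) x (φ.e x, 0)) -
        ∑ l, (Matrix.of fun l k => φ.co x (- dd φ.e x (0, star (φ.f k x))) (![1, 2] l)) l k •
          hol (φ.f l) x) : C4 × C4).1 = - dd φ.e x (0, star (φ.f k x)) -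
            ∑ l, φ.co x (- dd φ.e x (0, star (φ.f k x))) (![1, 2] l) • φ.f l x := by
        simp [hol]
      rw [h1, co_sub, co_sub, co_sub, φ.co_comb_f hx.2]
      refine ⟨?_, by simp, by simp⟩
      have h2 : - dd φ.e x (0, star (φ.f k x)) ∈ M.HFib x := by
        rw [mem_HFib, dr_neg, dr_dd_snd hA hxM (φ.sece hx.1) hk,
          ((mem_KFib_iff hA hxM).1 (φ.kernel_e x hx.1 hxM)).2 _ hk]; simp
      rw [(φ.mem_HFib_iff hx.1 hxM).1 h2]; simp
    · have h1 : (((- dd φ.e x (0, star (φ.f k x)), dd (fun y => star (φ.f k y)) x (φ.e x, 0)) -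
        ∑ l, (Matrix.of fun l k => φ.co x (- dd φ.e x (0, star (φ.f k x))) (![1, 2] l)) l k •
          hol (φ.f l) x) : C4 × C4).2 = dd (fun y => star (φ.f k y)) x (φ.e x, 0) := by
        simp [hol]
      rw [h1, star_dd' (φ.secf hx.1 k).sm, cc_mk, star_zero, mem_HFib,
        dr_dd_snd hA hxM (φ.secf hx.1 k) (φ.e_mem hx.1 hxM), ← hess_conj hA hxM.1,
        ((mem_KFib_iff hA hxM).1 (φ.kernel_e x hx.1 hxM)).2 _ hk]
      simp
  · intro x hx hxM k
    rw [lieBr_hol_hol, KKFib, Set.mem_ofPred_eq]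
    constructor
    · rw [φ.mem_KFib_iff_co hM hx.1 hxM]
      have h1 : (((dd (φ.f k) x (φ.e x, 0) - dd φ.e x (φ.f k x, 0), 0) -
        ∑ l, (Matrix.of fun l k => φ.co x (dd (φ.f k) x (φ.e x, 0) - dd φ.e x (φ.f k x, 0))
          (![1, 2] l)) l k • hol (φ.f l) x) : C4 × C4).1 =
          (dd (φ.f k) x (φ.e x, 0) - dd φ.e x (φ.f k x, 0)) -
            ∑ l, φ.co x (dd (φ.f k) x (φ.e x, 0) - dd φ.e x (φ.f k x, 0)) (![1, 2] l)
              • φ.f l x := by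
        simp [hol]
      rw [h1, co_sub, co_sub _ _ _ 1, co_sub _ _ _ 2, φ.co_comb_f hx.2]
      refine ⟨?_, by simp, by simp⟩
      rw [(φ.mem_HFib_iff hx.1 hxM).1 (bracket_mem_HFib hA hxM (φ.sece hx.1) (φ.secf hx.1 k))]
      simp
    · have h1 : (((dd (φ.f k) x (φ.e x, 0) - dd φ.e x (φ.f k x, 0), 0) -
        ∑ l, (Matrix.of fun l k => φ.co x (dd (φ.f k) x (φ.e x, 0) - dd φ.e x (φ.f k x, 0))
          (![1, 2] l)) l k • hol (φ.f l) x) : C4 × C4).2 = 0 := by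
        simp [hol]
      rw [h1, star_zero]
      exact KFib_zero hA hxM

end PreFrame

/-! ### Structure equations of an adapted frame. -/

namespace AdaptedFrame

variable {M : Hypersurface} {p x : C4} (φ : AdaptedFrame M p)

theorem secf (hx : x ∈ φ.W) (a : Fin 2) : M.SecAt x (φ.f a) := φ.toPre.secf hx a

theorem sece (hx : x ∈ φ.W) : M.SecAt x φ.e := φ.toPre.sece hx

theorem f_mem (hx : x ∈ φ.W) (hxM : x ∈ M.carrier) (a : Fin 2) : φ.f a x ∈ M.HFib x :=
  φ.toPre.f_mem hx hxM a

theorem e_mem (hx : x ∈ φ.W) (hxM : x ∈ M.carrier) : φ.e x ∈ M.HFib x := φ.toPre.e_mem hx hxM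

/-- Apply `∂ρ` to the `(1,0)` part of the Levi identity; everything in `ℋ` drops out. -/
theorem hess_f (hA : M.IsRealAnalytic) (hx : x ∈ φ.W) (hxM : x ∈ M.carrier) (a b : Fin 2) :
    M.hess x (φ.f a x) (φ.f b x) = 2 * Complex.I * φ.H x a b * M.dr x (φ.g x) := by
  have h := (φ.levi x hx hxM a b).1
  have h1 := dr_dd_snd hA hxM (φ.toPre.secf hx a) (φ.toPre.f_mem hx hxM b)
  rw [lieBr_hol_antihol, mem_HFib] at h
  simp only [Prod.fst_sub, Prod.smul_fst, dr_sub, dr_smul, dr_neg] at h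
  have h2 : M.dr x (dd (φ.f a) x (0, star (φ.f b x))) = - M.hess x (φ.f a x) (φ.f b x) := h1
  rw [h2] at h
  have hI : (2 * Complex.I) ≠ 0 := by simp
  field_simp at h
  linear_combination h

theorem hess_e (hA : M.IsRealAnalytic) (hx : x ∈ φ.W) (hxM : x ∈ M.carrier) {w : C4}
    (hw : w ∈ M.HFib x) : M.hess x (φ.e x) w = 0 :=
  ((mem_KFib_iff hA hxM).1 (φ.kernel_e x hx hxM)).2 w hw

theorem dd_e_snd (hM : M.IsUniformly2Nondegenerate) (hx : x ∈ φ.W) (hxM : x ∈ M.carrier)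
    (k : Fin 2) : ∃ c : ℂ, dd φ.e x (0, star (φ.f k x)) = - ∑ l, φ.Ξ x l k • φ.f l x + c • φ.e x := by
  have h := (φ.bracket_Ξ x hx hxM k).1
  obtain ⟨c, hc⟩ := (φ.toPre.mem_KFib_iff_smul hM hx hxM).1 h
  have h1 : (lieBr (hol φ.e) (antihol (φ.f k)) x - ∑ l, φ.Ξ x l k • hol (φ.f l) x).1 =
      - dd φ.e x (0, star (φ.f k x)) - ∑ l, φ.Ξ x l k • φ.f l x := by
    rw [lieBr_hol_antihol]; simp [hol]
  rw [h1] at hc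
  refine ⟨-c, ?_⟩
  rw [neg_smul, show c • φ.e x = c • φ.toPre.e x from rfl, ← hc]
  abel

theorem bracket_e_f (hM : M.IsUniformly2Nondegenerate) (hx : x ∈ φ.W) (hxM : x ∈ M.carrier)
    (k : Fin 2) : ∃ c : ℂ, dd (φ.f k) x (φ.e x, 0) - dd φ.e x (φ.f k x, 0) =
      ∑ l, φ.Ω x l k • φ.f l x + c • φ.e x := by
  have h := (φ.bracket_Ω x hx hxM k).1
  obtain ⟨c, hc⟩ := (φ.toPre.mem_KFib_iff_smul hM hx hxM).1 h
  have h1 : (lieBr (hol φ.e) (hol (φ.f k)) x - ∑ l, φ.Ω x l k • hol (φ.f l) x).1 =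
      dd (φ.f k) x (φ.e x, 0) - dd φ.e x (φ.f k x, 0) - ∑ l, φ.Ω x l k • φ.f l x := by
    rw [lieBr_hol_hol]; simp [hol]
  rw [h1] at hc
  refine ⟨c, ?_⟩
  rw [show c • φ.e x = c • φ.toPre.e x from rfl, ← hc]
  abel

theorem H_conj (hA : M.IsRealAnalytic) (hx : x ∈ φ.W) (hxM : x ∈ M.carrier) (a b : Fin 2) :
    conj (φ.H x a b) = φ.H x b a := by
  have h := hess_conj hA hxM.1 (φ.f a x) (φ.f b x)
  rw [φ.hess_f hA hx hxM, φ.hess_f hA hx hxM] at h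
  simp only [map_mul, Complex.conj_I, map_ofNat] at h
  have h1 : conj (M.dr x (φ.g x)) = - M.dr x (φ.g x) := φ.toPre.conj_dr_g hA hx hxM
  rw [h1] at h
  have h2 : M.dr x (φ.g x) ≠ 0 := φ.toPre.dr_g_ne hx hxM
  refine mul_right_cancel₀ (mul_ne_zero (by simp : 2 * Complex.I ≠ 0) h2) ?_
  linear_combination h

/-- A left null vector of `H` would give a combination of `f₁, f₂` in the Levi kernel, hence a
multiple of `e`, against independence of the frame. -/
theorem det_H (hM : M.IsUniformly2Nondegenerate) (hx : x ∈ φ.W) (hxM : x ∈ M.carrier) :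
    (φ.H x).det ≠ 0 := by
  have hA := hM.analytic
  intro h0
  obtain ⟨c, hc, hc0⟩ := Matrix.exists_vecMul_eq_zero_iff.2 h0
  have hfm : ∀ a, φ.f a x ∈ M.HFib x := φ.toPre.f_mem hx hxM
  have hk : ∑ a, c a • φ.f a x ∈ M.KFib x := by
    rw [mem_KFib_iff hA hxM]
    refine ⟨?_, fun w hw => ?_⟩
    · rw [mem_HFib, dr_sum]
      exact Finset.sum_eq_zero fun a _ => by rw [dr_smul, mem_HFib.1 (hfm a), mul_zero]
    · have hw0 := (φ.toPre.mem_HFib_iff hx hxM).1 hw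
      have hw1 : w = φ.toPre.co x w 1 • φ.f 0 x + φ.toPre.co x w 2 • φ.f 1 x
          + φ.toPre.co x w 3 • φ.e x := by
        conv_lhs => rw [φ.toPre.co_spec (φ.toPre.det_ne_zero hx hxM) w, hw0, zero_smul, zero_add]
        rfl
      have he : ∀ a, M.hess x (φ.f a x) (φ.e x) = 0 := fun a => by
        rw [← hess_conj hA hxM.1, φ.hess_e hA hx hxM (hfm a), map_zero]
      have h1 : ∀ b, ∑ a, c a * φ.H x a b = 0 := fun b => congrFun hc0 b
      rw [hess_sum_left hA hxM.1, hw1]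
      simp only [hess_smul_left hA hxM.1, hess_add_right, hess_smul_right, φ.hess_f hA hx hxM, he]
      have h10 := h1 0
      have h11 := h1 1
      simp only [Fin.sum_univ_two] at h10 h11 ⊢
      linear_combination (2 * Complex.I * M.dr x (φ.g x)) *
        (conj (φ.toPre.co x w 1) * h10 + conj (φ.toPre.co x w 2) * h11)
  obtain ⟨d, hd⟩ := (φ.toPre.mem_KFib_iff_smul hM hx hxM).1 hk
  have := φ.toPre.indep hx hxM (a := c 0) (b := c 1) (c := -d) (by
    rw [neg_smul, ← hd, Fin.sum_univ_two]
    exact add_neg_cancel _)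
  apply hc
  ext i; fin_cases i
  · exact this.1
  · exact this.2.1

end AdaptedFrame

/-! ### Commuting sections of `ℋ` -/

namespace Hypersurface

variable {M : Hypersurface} {j : Fin 4} {x : C4}

/-- The coefficient `∂ρ(v) / ρ_j`. -/
def R (M : Hypersurface) (j : Fin 4) (v y : C4) : ℂ := M.dr y v * (M.dr y (bv j))⁻¹

theorem ext_eq_R (v y : C4) : M.ext j v y = v - M.R j v y • bv j := rfl

/-- The derivative along the `(1,0)` field `ext j v`. -/
def Fd (M : Hypersurface) (j : Fin 4) (v : C4) (h : C4 → ℂ) (y : C4) : ℂ :=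
  dd h y (M.ext j v y, 0)

/-- The derivative along the `(0,1)` field conjugate to `ext j v`. -/
def Gd (M : Hypersurface) (j : Fin 4) (v : C4) (h : C4 → ℂ) (y : C4) : ℂ :=
  dd h y (0, star (M.ext j v y))

theorem Fd_eq (v : C4) (h : C4 → ℂ) (y : C4) :
    M.Fd j v h y = dd h y (v, 0) - M.R j v y * dd h y (bv j, 0) := by
  rw [Fd, ext_eq_R, ← smul_eq_mul, ← map_smul, ← map_sub]; simp

theorem conj_Gd (v : C4) (h : C4 → ℂ) (y : C4) :
    conj (M.Gd j v h y) = M.Fd j v (fun z => conj (h z)) y := by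
  rw [Gd, dd_conj, Fd]; simp

theorem conj_Fd (v : C4) (h : C4 → ℂ) (y : C4) :
    conj (M.Fd j v h y) = M.Gd j v (fun z => conj (h z)) y := by
  rw [Fd, dd_conj, Gd]; simp

theorem sm_R (hA : M.IsRealAnalytic) (hx : x ∈ M.dom) (hj : M.dr x (bv j) ≠ 0) (v : C4) :
    Sm (M.R j v) x :=
  (sm_dr_const hA hx v).mul ((sm_dr_const hA hx (bv j)).inv hj)

theorem sm_Fd (hA : M.IsRealAnalytic) (hx : x ∈ M.dom) (hj : M.dr x (bv j) ≠ 0) (v : C4)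
    {h : C4 → ℂ} (hh : Sm h x) : Sm (M.Fd j v h) x :=
  hh.dd ((ext_sm hA hx hj v).prodMk contDiffAt_const)

theorem sm_Gd (hA : M.IsRealAnalytic) (hx : x ∈ M.dom) (hj : M.dr x (bv j) ≠ 0) (v : C4)
    {h : C4 → ℂ} (hh : Sm h x) : Sm (M.Gd j v h) x :=
  hh.dd (contDiffAt_const.prodMk (ext_sm hA hx hj v).star)

theorem dd_R (hA : M.IsRealAnalytic) (hx : x ∈ M.dom) (hj : M.dr x (bv j) ≠ 0) (v : C4)
    (V : C4 × C4) : dd (M.R j v) x V * M.dr x (bv j) =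
      dd (fun y => M.dr y v) x V - M.R j v x * dd (fun y => M.dr y (bv j)) x V := by
  have h1 : (fun y => M.dr y v) =ᶠ[𝓝 x] fun y => M.R j v y * M.dr y (bv j) := by
    filter_upwards [dr_ne_zero_near hA hx hj] with y hy
    rw [R, mul_assoc, inv_mul_cancel₀ hy, mul_one]
  rw [dd_congr h1, dd_mul (sm_R hA hx hj v) (sm_dr_const hA hx _)]
  ring

/-- Multiplied by `ρ_j`, both sides become the same expression in the symmetric second derivatives
of `ρ`. Up to sign their difference is the only coefficient of the commutator of `ext j v` and `ext
j w`, so these fields commute, also off `M`. -/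
theorem Fd_R_comm (hA : M.IsRealAnalytic) (hx : x ∈ M.dom) (hj : M.dr x (bv j) ≠ 0) (v w : C4) :
    M.Fd j v (M.R j w) x = M.Fd j w (M.R j v) x := by
  refine mul_right_cancel₀ hj ?_
  have c := fun v w : C4 => dd_comm (hA.smc hx) (v, 0) (w, 0)
  have d : ∀ v w, dd (fun y => M.dr y v) x (w, 0) = dd (fun y => M.dr y w) x (v, 0) := c
  rw [Fd_eq, Fd_eq, sub_mul, sub_mul, mul_assoc, mul_assoc, dd_R hA hx hj, dd_R hA hx hj,
    dd_R hA hx hj, dd_R hA hx hj, d w v, d w (bv j), d v (bv j)]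
  ring

theorem Fd_comm (hA : M.IsRealAnalytic) (hx : x ∈ M.dom) (hj : M.dr x (bv j) ≠ 0) (v w : C4)
    {h : C4 → ℂ} (hh : Sm h x) : M.Fd j v (M.Fd j w h) x = M.Fd j w (M.Fd j v h) x := by
  have e : ∀ v, M.Fd j v h = fun y => dd h y (v, 0) - M.R j v y * dd h y (bv j, 0) :=
    fun v => funext fun y => Fd_eq v h y
  have hc : ∀ v, Sm (fun y => dd h y (v, 0)) x := fun v => hh.dd contDiffAt_const
  have key : ∀ v w, M.Fd j v (M.Fd j w h) x =
      dd (fun y => dd h y (w, 0)) x (v, 0) - M.R j w x * dd (fun y => dd h y (bv j, 0)) x (v, 0)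
      - M.R j v x * (dd (fun y => dd h y (w, 0)) x (bv j, 0)
        - M.R j w x * dd (fun y => dd h y (bv j, 0)) x (bv j, 0))
      - M.Fd j v (M.R j w) x * dd h x (bv j, 0) := by
    intro v w
    have hd : ∀ V, dd (M.Fd j w h) x V = dd (fun y => dd h y (w, 0)) x V
        - (M.R j w x * dd (fun y => dd h y (bv j, 0)) x V
          + dd (M.R j w) x V * dd h x (bv j, 0)) := by
      intro V
      rw [e w, dd_sub (hc w) ((sm_R hA hx hj w).mul (hc _)), dd_mul (sm_R hA hx hj w) (hc _)]
    rw [Fd_eq v, Fd_eq v, hd, hd]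
    ring
  rw [key, key, Fd_R_comm hA hx hj v w, dd_comm hh (w, 0) (v, 0), dd_comm hh (bv j, 0) (v, 0),
    dd_comm hh (bv j, 0) (w, 0)]
  ring

theorem Gd_comm (hA : M.IsRealAnalytic) (hx : x ∈ M.dom) (hj : M.dr x (bv j) ≠ 0) (v w : C4)
    {h : C4 → ℂ} (hh : Sm h x) : M.Gd j v (M.Gd j w h) x = M.Gd j w (M.Gd j v h) x := by
  have e : ∀ v w, M.Gd j v (M.Gd j w h) x =
      conj (M.Fd j v (M.Fd j w (fun z => conj (h z))) x) := by
    intro v w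
    rw [conj_Fd]
    congr 1
    funext z
    rw [conj_Fd]; simp
  rw [e, e, Fd_comm hA hx hj v w hh.conj]

/-- The coefficient of `∂/∂x_j` in the bracket of `ext j v` with the conjugate of `ext j w`. -/
def B (M : Hypersurface) (j : Fin 4) (v w : C4) : C4 → ℂ := M.Gd j w (M.R j v)

theorem sm_B (hA : M.IsRealAnalytic) (hx : x ∈ M.dom) (hj : M.dr x (bv j) ≠ 0) (v w : C4) :
    Sm (M.B j v w) x := sm_Gd hA hx hj w (sm_R hA hx hj v)

theorem B_mul_dr (hA : M.IsRealAnalytic) (hx : x ∈ M.dom) (hj : M.dr x (bv j) ≠ 0) (v w : C4) :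
    M.B j v w x * M.dr x (bv j) = M.hess x (M.ext j v x) (M.ext j w x) := by
  have h1 : M.ext j v x = v + (-M.R j v x) • bv j := by rw [ext_eq_R]; module
  rw [B, Gd, dd_R hA hx hj, h1, hess_add_left hA hx, hess_smul_left hA hx]
  simp only [hess]
  ring

/-- `B` is itself an `F̄`-derivative of `R`, and the fields `F̄` commute. This is the source of the
symmetry of `S^{0,2}`. -/
theorem Gd_B_comm (hA : M.IsRealAnalytic) (hx : x ∈ M.dom) (hj : M.dr x (bv j) ≠ 0) (u v w : C4) :
    M.Gd j u (M.B j v w) x = M.Gd j w (M.B j v u) x := Gd_comm hA hx hj u w (sm_R hA hx hj v)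

theorem conj_B (hA : M.IsRealAnalytic) (hx : x ∈ M.dom) (hj : M.dr x (bv j) ≠ 0) (v w : C4) :
    conj (M.B j v w x) * conj (M.dr x (bv j)) = M.B j w v x * M.dr x (bv j) := by
  rw [← map_mul, B_mul_dr hA hx hj, hess_conj hA hx, B_mul_dr hA hx hj]

/-- The conjugate of `Gd_B_comm`. Hermitian symmetry reads `B_{vw} = μ · conj B_{wv}` with `μ = ρ̄_j
/ ρ_j`, so `F_u B_{vw}` minus the logarithmic derivative of `μ` times `B_{vw}` is `μ · conj (F̄_u
B_{wv})`, which is symmetric in `u` and `v`. -/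
theorem exists_Fd_B_comm (hA : M.IsRealAnalytic) (hx : x ∈ M.dom) (hj : M.dr x (bv j) ≠ 0) :
    ∃ ν : C4 → ℂ, ∀ u v w, M.Fd j u (M.B j v w) x - ν u * M.B j v w x =
      M.Fd j v (M.B j u w) x - ν v * M.B j u w x := by
  set μ : C4 → ℂ := fun y => conj (M.dr y (bv j)) * (M.dr y (bv j))⁻¹ with hμ
  have hμs : Sm μ x := (sm_dr_const hA hx (bv j)).conj.mul ((sm_dr_const hA hx (bv j)).inv hj)
  have hμ0 : μ x ≠ 0 := mul_ne_zero ((map_ne_zero _).2 hj) (inv_ne_zero hj)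
  have hB : ∀ v w y, y ∈ M.dom → M.dr y (bv j) ≠ 0 → M.B j v w y = conj (M.B j w v y) * μ y := by
    intro v w y hy hy'
    have := conj_B hA hy hy' w v
    simp only [hμ]
    rw [← mul_assoc, this]; field_simp
  refine ⟨fun u => M.Fd j u μ x * (μ x)⁻¹, fun u v w => ?_⟩
  have key : ∀ u v, M.Fd j u (M.B j v w) x - M.Fd j u μ x * (μ x)⁻¹ * M.B j v w x =
      conj (M.Gd j u (M.B j w v) x) * μ x := by
    intro u v
    have h1 : M.B j v w =ᶠ[𝓝 x] fun y => conj (M.B j w v y) * μ y := by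
      filter_upwards [dr_ne_zero_near hA hx hj, hA.isOpen_dom.mem_nhds hx] with y hy hy'
      exact hB v w y hy' hy
    have h2 : M.Fd j u (M.B j v w) x = conj (M.B j w v x) * M.Fd j u μ x
        + M.Fd j u (fun z => conj (M.B j w v z)) x * μ x := by
      rw [Fd, dd_congr h1, dd_mul (sm_B hA hx hj w v).conj hμs]; rfl
    rw [h2, hB v w x hx hj, conj_Gd]
    field_simp
    ring
  rw [key, key, Gd_B_comm hA hx hj]

theorem dd_ext (hA : M.IsRealAnalytic) (hx : x ∈ M.dom) (hj : M.dr x (bv j) ≠ 0) (v : C4)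
    (V : C4 × C4) : dd (M.ext j v) x V = - dd (M.R j v) x V • bv j := by
  have h1 : M.ext j v = fun y => v - M.R j v y • bv j := rfl
  have h2 : Sm (fun y => M.R j v y • bv j) x := (sm_R hA hx hj v).smul contDiffAt_const
  rw [h1, dd_sub contDiffAt_const h2, dd_const, dd_smul (sm_R hA hx hj v) contDiffAt_const,
    dd_const]
  simp

end Hypersurface

/-! ### Charts and the kernel field `e = ∑ c_a F_a`. -/

/-- A choice of coordinates near `p` with `ρ_j ≠ 0`. -/
structure Chart (M : Hypersurface) (p : C4) where
  j : Fin 4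
  τ : Fin 3 → Fin 4
  τ_ne : ∀ a, τ a ≠ j
  τ_inj : Function.Injective τ
  τ_surj : ∀ i, i ≠ j → ∃ a, τ a = i
  W : Set C4
  isOpen_W : IsOpen W
  W_subset : W ⊆ M.dom
  p_mem : p ∈ W
  dr_ne : ∀ x ∈ W, M.dr x (bv j) ≠ 0

/-- A chart such that the Levi form is nondegenerate on the first two of the commuting fields
`ext j (bv (τ a))`, and `∑ c_a ext j (bv (τ a))`, `c₂ = 1`, spans the Levi kernel. -/
structure KernelChart (M : Hypersurface) (p : C4) extends Chart M p where
  c : Fin 3 → C4 → ℂ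
  sm_c : ∀ a, ∀ x ∈ W, Sm (c a) x
  c_two : ∀ x, c 2 x = 1
  ker : ∀ x ∈ W, x ∈ M.carrier → ∀ b, ∑ a, c a x * M.B j (bv (τ a)) (bv (τ b)) x = 0
  det_ne : ∀ x ∈ W, x ∈ M.carrier →
    M.B j (bv (τ 0)) (bv (τ 0)) x * M.B j (bv (τ 1)) (bv (τ 1)) x
      - M.B j (bv (τ 0)) (bv (τ 1)) x * M.B j (bv (τ 1)) (bv (τ 0)) x ≠ 0

namespace Chart

variable {M : Hypersurface} {p x : C4} (κ : Chart M p)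

/-- The commuting fields. -/
def F (a : Fin 3) : C4 → C4 := M.ext κ.j (bv (κ.τ a))

/-- The matrix of the Levi form up to a factor. -/
def Bm (a b : Fin 3) : C4 → ℂ := M.B κ.j (bv (κ.τ a)) (bv (κ.τ b))

theorem F_apply (a b : Fin 3) (y : C4) : κ.F a y (κ.τ b) = if a = b then 1 else 0 := by
  have h1 : (κ.τ b = κ.τ a) ↔ a = b := ⟨fun h => (κ.τ_inj h).symm, fun h => by rw [h]⟩
  simp [F, Hypersurface.ext, bv, Pi.single_apply, κ.τ_ne b, h1]

theorem smF (hA : M.IsRealAnalytic) (hx : x ∈ κ.W) (a : Fin 3) : Sm (κ.F a) x :=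
  ext_sm hA (κ.W_subset hx) (κ.dr_ne x hx) _

theorem smB (hA : M.IsRealAnalytic) (hx : x ∈ κ.W) (a b : Fin 3) : Sm (κ.Bm a b) x :=
  sm_B hA (κ.W_subset hx) (κ.dr_ne x hx) _ _

theorem F_mem (hx : x ∈ κ.W) (a : Fin 3) : κ.F a x ∈ M.HFib x := ext_mem (κ.dr_ne x hx) _

theorem hess_F (hA : M.IsRealAnalytic) (hx : x ∈ κ.W) (a b : Fin 3) :
    M.hess x (κ.F a x) (κ.F b x) = κ.Bm a b x * M.dr x (bv κ.j) :=
  (B_mul_dr hA (κ.W_subset hx) (κ.dr_ne x hx) _ _).symm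

/-- The fields `F_a` have coordinates `δ_{ab}` in the directions `τ b`, so the difference of the two
sides is a multiple of `∂/∂x_j`; lying in `ℋ`, it is zero. -/
theorem eq_sum_F (hx : x ∈ κ.W) {v : C4} (hv : v ∈ M.HFib x) :
    v = ∑ a, v (κ.τ a) • κ.F a x := by
  set w := v - ∑ a, v (κ.τ a) • κ.F a x with hw
  have hwt : ∀ b, w (κ.τ b) = 0 := by
    intro b
    simp [hw, Finset.sum_apply, Chart.F_apply]
  have hwj : w = w κ.j • bv κ.j := by
    ext i
    by_cases hi : i = κ.j
    · subst hi; simp [bv]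
    · obtain ⟨a, rfl⟩ := κ.τ_surj i hi
      simp [hwt, bv, κ.τ_ne a]
  have hwm : M.dr x w = 0 := by
    rw [hw, dr_sub, mem_HFib.1 hv, dr_sum, zero_sub, neg_eq_zero]
    exact Finset.sum_eq_zero fun a _ => by rw [dr_smul, mem_HFib.1 (κ.F_mem hx a), mul_zero]
  rw [hwj, dr_smul] at hwm
  have h0 : w κ.j = 0 := (mul_eq_zero.1 hwm).resolve_right (κ.dr_ne x hx)
  rw [h0, zero_smul] at hwj
  exact sub_eq_zero.1 (hw ▸ hwj)

theorem mem_KFib_iff_B (hA : M.IsRealAnalytic) (hx : x ∈ κ.W) (hxM : x ∈ M.carrier) {v : C4}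
    (hv : v ∈ M.HFib x) : v ∈ M.KFib x ↔ ∀ b, ∑ a, v (κ.τ a) * κ.Bm a b x = 0 := by
  have key : ∀ b, M.hess x v (κ.F b x) = (∑ a, v (κ.τ a) * κ.Bm a b x) * M.dr x (bv κ.j) := by
    intro b
    conv_lhs => rw [κ.eq_sum_F hx hv]
    rw [hess_sum_left hA hxM.1, Finset.sum_mul]
    exact Finset.sum_congr rfl fun a _ => by rw [hess_smul_left hA hxM.1, κ.hess_F hA hx]; ring
  rw [mem_KFib_iff hA hxM]
  constructor
  · rintro ⟨-, h⟩ b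
    have := h _ (κ.F_mem hx b)
    rw [key] at this
    exact (mul_eq_zero.1 this).resolve_right (κ.dr_ne x hx)
  · intro h
    refine ⟨hv, fun w hw => ?_⟩
    rw [κ.eq_sum_F hx hw, hess_sum_right]
    exact Finset.sum_eq_zero fun b _ => by rw [hess_smul_right, key, h b]; simp

end Chart

namespace KernelChart

variable {M : Hypersurface} {p x : C4} (κ : KernelChart M p)

/-- The kernel field. -/
def e (y : C4) : C4 := ∑ a, κ.c a y • κ.F a y

theorem sme (hA : M.IsRealAnalytic) (hx : x ∈ κ.W) : Sm κ.e x :=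
  ContDiffAt.sum fun a _ => (κ.sm_c a x hx).smul (κ.smF hA hx a)

theorem e_mem (hx : x ∈ κ.W) : κ.e x ∈ M.HFib x := by
  rw [mem_HFib, e, dr_sum]
  exact Finset.sum_eq_zero fun a _ => by rw [dr_smul, mem_HFib.1 (κ.F_mem hx a), mul_zero]

theorem e_apply (a : Fin 3) (y : C4) : κ.e y (κ.τ a) = κ.c a y := by
  simp [e, Finset.sum_apply, Chart.F_apply]

theorem e_mem_KFib (hA : M.IsRealAnalytic) (hx : x ∈ κ.W) (hxM : x ∈ M.carrier) :
    κ.e x ∈ M.KFib x := by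
  rw [κ.mem_KFib_iff_B hA hx hxM (κ.e_mem hx)]
  simp only [e_apply]
  exact κ.ker x hx hxM

theorem eq_zero_of_B (hx : x ∈ κ.W) (hxM : x ∈ M.carrier) {a b : ℂ}
    (h0 : a * κ.Bm 0 0 x + b * κ.Bm 1 0 x = 0) (h1 : a * κ.Bm 0 1 x + b * κ.Bm 1 1 x = 0) :
    a = 0 ∧ b = 0 := by
  have hd := κ.det_ne x hx hxM
  change κ.Bm 0 0 x * κ.Bm 1 1 x - κ.Bm 0 1 x * κ.Bm 1 0 x ≠ 0 at hd
  constructor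
  · refine (mul_eq_zero.1 (?_ : a * _ = 0)).resolve_right hd
    linear_combination κ.Bm 1 1 x * h0 - κ.Bm 1 0 x * h1
  · refine (mul_eq_zero.1 (?_ : b * _ = 0)).resolve_right hd
    linear_combination κ.Bm 0 0 x * h1 - κ.Bm 0 1 x * h0

/-- Since `c₂ = 1`, subtracting the right hand side removes the last coordinate, and on the first
two fields the Levi form is nondegenerate. -/
theorem KFib_eq (hA : M.IsRealAnalytic) (hx : x ∈ κ.W) (hxM : x ∈ M.carrier) {v : C4}
    (hv : v ∈ M.KFib x) : v = v (κ.τ 2) • κ.e x := by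
  set w := v - v (κ.τ 2) • κ.e x with hw
  have hwK : w ∈ M.KFib x :=
    KFib_sub hA hxM hv (KFib_smul hA hxM _ (κ.e_mem_KFib hA hx hxM))
  have hwH : w ∈ M.HFib x := hwK.1
  have h2 : w (κ.τ 2) = 0 := by simp [hw, e_apply, κ.c_two]
  have h := (κ.mem_KFib_iff_B hA hx hxM hwH).1 hwK
  have e0 := h 0
  have e1 := h 1
  simp only [Fin.sum_univ_three, h2, zero_mul, add_zero] at e0 e1
  obtain ⟨w0, w1⟩ := κ.eq_zero_of_B hx hxM e0 e1
  have := κ.eq_sum_F hx hwH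
  rw [Fin.sum_univ_three, w0, w1, h2] at this
  simp only [zero_smul, add_zero] at this
  exact sub_eq_zero.1 (hw ▸ this)

theorem e_ne_zero (y : C4) : κ.e y ≠ 0 := by
  intro h
  have := κ.e_apply 2 y
  rw [h, κ.c_two] at this
  simp at this

theorem leviRankTwo (hA : M.IsRealAnalytic) (hx : x ∈ κ.W) (hxM : x ∈ M.carrier) :
    M.LeviRankTwo x :=
  ⟨κ.e x, κ.e_mem_KFib hA hx hxM, κ.e_ne_zero x, fun _ hv => ⟨_, κ.KFib_eq hA hx hxM hv⟩⟩

/-- The frame of fields given by a chart. -/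
def pre (hA : M.IsRealAnalytic) : PreFrame M p where
  W := κ.W
  isOpen_W := κ.isOpen_W
  W_subset := κ.W_subset
  p_mem := κ.p_mem
  -- The factor gives `∂ρ(g) = i/2`, which is purely imaginary, so the real field with this `(1,0)`
  -- part is tangent to `M`.
  g := fun y => (Complex.I * (2 * M.dr y (bv κ.j))⁻¹) • bv κ.j
  f := fun k => κ.F k.castSucc
  e := κ.e
  smooth_g := fun x hx => by
    have := (sm_dr_const hA (κ.W_subset hx) (bv κ.j))
    exact ((contDiffAt_const.mul ((contDiffAt_const.mul this).inv
      (mul_ne_zero two_ne_zero (κ.dr_ne x hx)))).smul contDiffAt_const).contDiffWithinAt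
  tangent_g := fun x hx hxM => by
    have h0 := κ.dr_ne x hx
    rw [two_mul_re_dr hA hxM.1, dr_smul]
    have : Complex.I * (2 * M.dr x (bv κ.j))⁻¹ * M.dr x (bv κ.j) = Complex.I / 2 := by
      field_simp
    rw [this]; simp
  transverse_g := fun x hx hxM => by
    have h0 := κ.dr_ne x hx
    rw [mem_HFib, dr_smul]
    simp [h0]
  section_f := fun a =>
    ⟨fun x hx => (κ.smF hA hx _).contDiffWithinAt, fun x hx _ => κ.F_mem hx _⟩
  section_e := ⟨fun x hx => (κ.sme hA hx).contDiffWithinAt, fun x hx _ => κ.e_mem hx⟩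
  kernel_e := fun x hx hxM => κ.e_mem_KFib hA hx hxM
  independent := fun x hx hxM => by
    rw [Fintype.linearIndependent_iff]
    intro g hg
    have h : ∀ b, (∑ i, g i • ![κ.F 0 x, κ.F 1 x, κ.e x] i) (κ.τ b) = 0 := fun b => by
      have : (∑ i, g i • ![κ.F 0 x, κ.F 1 x, κ.e x] i) = 0 := hg
      rw [this]; rfl
    have h0 := h 0
    have h1 := h 1
    have h2 := h 2
    simp [Fin.sum_univ_three, Chart.F_apply, e_apply, κ.c_two] at h0 h1 h2
    rw [h2] at h0 h1
    intro i; fin_cases i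
    · simpa using h0
    · simpa using h1
    · exact h2

/-- The derivative along the kernel field. -/
def ed (h : C4 → ℂ) (y : C4) : ℂ := dd h y (κ.e y, 0)

theorem ed_eq (h : C4 → ℂ) (y : C4) :
    κ.ed h y = ∑ a, κ.c a y * M.Fd κ.j (bv (κ.τ a)) h y := by
  have : ((κ.e y, 0) : C4 × C4) = ∑ a, κ.c a y • ((κ.F a y, 0) : C4 × C4) := by
    ext <;> simp [e, Prod.fst_sum, Prod.snd_sum]
  rw [ed, this, map_sum]
  exact Finset.sum_congr rfl fun a _ => by rw [map_smul]; rfl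

/-- `F_a h`. -/
abbrev D (a : Fin 3) (h : C4 → ℂ) : C4 → ℂ := M.Fd κ.j (bv (κ.τ a)) h

/-- `F̄_a h`. -/
abbrev Db (a : Fin 3) (h : C4 → ℂ) : C4 → ℂ := M.Gd κ.j (bv (κ.τ a)) h

theorem D_c_two (a : Fin 3) (y : C4) : κ.D a (κ.c 2) y = 0 := by
  have : κ.c 2 = fun _ => (1 : ℂ) := funext κ.c_two
  simp [D, Fd, this, dd_const]

theorem Db_c_two (a : Fin 3) (y : C4) : κ.Db a (κ.c 2) y = 0 := by
  have : κ.c 2 = fun _ => (1 : ℂ) := funext κ.c_two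
  simp [Db, Gd, this, dd_const]

theorem dd_ker (hA : M.IsRealAnalytic) (hx : x ∈ κ.W) (hxM : x ∈ M.carrier) {V : C4 × C4}
    (hV : M.Tan x V) (b : Fin 3) :
    ∑ a, (κ.c a x * dd (κ.Bm a b) x V + dd (κ.c a) x V * κ.Bm a b x) = 0 := by
  have hs : ∀ a ∈ Finset.univ, Sm (fun y => κ.c a y * κ.Bm a b y) x := fun a _ =>
    (κ.sm_c a x hx).mul (κ.smB hA hx a b)
  have h0 := dd_eq_zero_of_tan hA hxM (ContDiffAt.sum hs)
    (Filter.mem_of_superset (κ.isOpen_W.mem_nhds hx) fun y hy hyM => κ.ker y hy hyM b) hV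
  rw [dd_sum hs] at h0
  rw [← h0]
  exact Finset.sum_congr rfl fun a _ => (dd_mul (κ.sm_c a x hx) (κ.smB hA hx a b) V).symm

/-- The symmetry of `Ξᵀ H`. -/
theorem Db_symm (hA : M.IsRealAnalytic) (hx : x ∈ κ.W) (hxM : x ∈ M.carrier) (b c : Fin 3) :
    ∑ a, κ.Db c (κ.c a) x * κ.Bm a b x = ∑ a, κ.Db b (κ.c a) x * κ.Bm a c x := by
  -- The kernel equation with index `b` is differentiated along `F̄_c`, the one with index `c` along
  -- `F̄_b`. The derivatives of `B` agree by commutativity and cancel in the difference.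
  have h1 := κ.dd_ker hA hx hxM (tan_snd (κ.F_mem hx c)) b
  have h2 := κ.dd_ker hA hx hxM (tan_snd (κ.F_mem hx b)) c
  have h3 : ∀ a, dd (κ.Bm a b) x (0, star (κ.F c x)) = dd (κ.Bm a c) x (0, star (κ.F b x)) :=
    fun a => Gd_B_comm hA hxM.1 (κ.dr_ne x hx) _ _ _
  rw [Finset.sum_add_distrib] at h1 h2
  simp only [h3] at h1
  change _ + ∑ a, κ.Db c (κ.c a) x * κ.Bm a b x = 0 at h1
  change _ + ∑ a, κ.Db b (κ.c a) x * κ.Bm a c x = 0 at h2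
  linear_combination h1 - h2

/-- In `∑ c_c F_c B_{ab}` the identity `exists_Fd_B_comm` exchanges `c` and `a`. The sum `∑ c_c F_a
B_{cb}` equals `-∑ F_a(c_c) B_{cb}` by differentiating the kernel equation, and the kernel equation
itself removes the term with the scalar of `F_a`. -/
theorem exists_ed_B (hA : M.IsRealAnalytic) (hx : x ∈ κ.W) (hxM : x ∈ M.carrier) :
    ∃ ν : ℂ, ∀ a b, κ.ed (κ.Bm a b) x = - ∑ c, κ.D a (κ.c c) x * κ.Bm c b x + ν * κ.Bm a b x := by
  obtain ⟨ν, hν⟩ := exists_Fd_B_comm (j := κ.j) hA hxM.1 (κ.dr_ne x hx)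
  refine ⟨∑ c, κ.c c x * ν (bv (κ.τ c)), fun a b => ?_⟩
  have h1 := κ.dd_ker hA hx hxM (tan_fst (κ.F_mem hx a)) b
  have h2 : ∀ c, κ.D c (κ.Bm a b) x - ν (bv (κ.τ c)) * κ.Bm a b x =
    κ.D a (κ.Bm c b) x - ν (bv (κ.τ a)) * κ.Bm c b x := fun c => hν _ _ _
  have h3 : ∑ c, (κ.c c x * κ.D a (κ.Bm c b) x + κ.D a (κ.c c) x * κ.Bm c b x) = 0 := h1
  have h4 : ∑ c, κ.c c x * κ.Bm c b x = 0 := κ.ker x hx hxM b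
  rw [ed_eq]
  have h5 : ∀ c, κ.D c (κ.Bm a b) x = κ.D a (κ.Bm c b) x - ν (bv (κ.τ a)) * κ.Bm c b x
    + ν (bv (κ.τ c)) * κ.Bm a b x := fun c => by linear_combination h2 c
  change ∑ c, κ.c c x * κ.D c (κ.Bm a b) x = _
  simp only [h5]
  simp only [Fin.sum_univ_three] at *
  linear_combination h3 - ν (bv (κ.τ a)) * h4

/-- Conjugating the kernel equation gives `∑ B_{ab} c̄_b = 0` on `M`. Applying `e` and inserting
`exists_ed_B`, all terms with undifferentiated `c̄` vanish and `∑ B_{ab} e(c̄_b) = 0` remains; `c̄₂`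
is constant and the other block is invertible. -/
theorem ed_conj_c (hA : M.IsRealAnalytic) (hx : x ∈ κ.W) (hxM : x ∈ M.carrier) (a : Fin 3) :
    κ.ed (fun y => conj (κ.c a y)) x = 0 := by
  have hB : ∀ y ∈ κ.W, ∀ a b, conj (κ.Bm b a y) * conj (M.dr y (bv κ.j)) =
      κ.Bm a b y * M.dr y (bv κ.j) := fun y hy a b => conj_B hA (κ.W_subset hy) (κ.dr_ne y hy) _ _
  have hk : ∀ y ∈ κ.W, y ∈ M.carrier → ∀ a, ∑ b, κ.Bm a b y * conj (κ.c b y) = 0 := by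
    intro y hy hyM a
    have h1 := congrArg (starRingEnd ℂ) (κ.ker y hy hyM a)
    have h2 : (∑ b, κ.Bm a b y * conj (κ.c b y)) * M.dr y (bv κ.j) = 0 := by
      rw [map_zero, map_sum] at h1
      rw [Finset.sum_mul, ← zero_mul (conj (M.dr y (bv κ.j))), ← h1, Finset.sum_mul]
      refine Finset.sum_congr rfl fun b _ => ?_
      have := hB y hy a b
      rw [map_mul]
      change _ = conj (κ.c b y) * conj (κ.Bm b a y) * conj (M.dr y (bv κ.j))
      linear_combination (-conj (κ.c b y)) * this
    exact (mul_eq_zero.1 h2).resolve_right (κ.dr_ne y hy)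
  obtain ⟨ν, hν⟩ := κ.exists_ed_B hA hx hxM
  have h0 : ∀ a, ∑ b, κ.Bm a b x * κ.ed (fun y => conj (κ.c b y)) x = 0 := by
    intro a
    have hs : ∀ b ∈ Finset.univ, Sm (fun y => κ.Bm a b y * conj (κ.c b y)) x := fun b _ =>
      (κ.smB hA hx a b).mul (κ.sm_c b x hx).conj
    have h0 := dd_eq_zero_of_tan hA hxM (ContDiffAt.sum hs)
      (Filter.mem_of_superset (κ.isOpen_W.mem_nhds hx) fun y hy hyM => hk y hy hyM a)
      (tan_fst (κ.e_mem hx))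
    rw [dd_sum hs] at h0
    have h1 : ∀ b, dd (fun y => κ.Bm a b y * conj (κ.c b y)) x (κ.e x, 0) =
        κ.Bm a b x * κ.ed (fun y => conj (κ.c b y)) x + κ.ed (κ.Bm a b) x * conj (κ.c b x) :=
      fun b => dd_mul (κ.smB hA hx a b) (κ.sm_c b x hx).conj _
    simp only [h1, hν] at h0
    have k0 := hk x hx hxM 0
    have k1 := hk x hx hxM 1
    have k2 := hk x hx hxM 2
    have ka := hk x hx hxM a
    simp only [Fin.sum_univ_three] at *
    linear_combination h0 + κ.D a (κ.c 0) x * k0 + κ.D a (κ.c 1) x * k1 + κ.D a (κ.c 2) x * k2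
      - ν * ka
  have h2 : κ.ed (fun y => conj (κ.c 2 y)) x = 0 := by
    have : (fun y => conj (κ.c 2 y)) = fun _ => (1 : ℂ) := funext fun y => by simp [κ.c_two]
    rw [ed, this, dd_const]
  have e0 := h0 0
  have e1 := h0 1
  simp only [Fin.sum_univ_three, h2, mul_zero, add_zero] at e0 e1
  have hd := κ.det_ne x hx hxM
  change κ.Bm 0 0 x * κ.Bm 1 1 x - κ.Bm 0 1 x * κ.Bm 1 0 x ≠ 0 at hd
  fin_cases a
  · refine (mul_eq_zero.1 (?_ : κ.ed _ x * _ = 0)).resolve_right hd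
    simp only [Fin.zero_eta]
    linear_combination κ.Bm 1 1 x * e0 - κ.Bm 0 1 x * e1
  · refine (mul_eq_zero.1 (?_ : κ.ed _ x * _ = 0)).resolve_right hd
    simp only [Fin.mk_one]
    linear_combination κ.Bm 0 0 x * e1 - κ.Bm 1 0 x * e0
  · exact h2

/-- The equation `e(c̄_l) = 0` holds on `M`, so it may be differentiated along the tangent field
`F_k`, which commutes with every `F_a`. -/
theorem ed_D_conj_c (hA : M.IsRealAnalytic) (hx : x ∈ κ.W) (hxM : x ∈ M.carrier) (k l : Fin 3) :
    κ.ed (κ.D k (fun y => conj (κ.c l y))) x =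
      - ∑ a, κ.D k (κ.c a) x * κ.D a (fun y => conj (κ.c l y)) x := by
  have hsm : Sm (fun y => conj (κ.c l y)) x := (κ.sm_c l x hx).conj
  have hs : ∀ a ∈ Finset.univ, Sm (fun y => κ.c a y * κ.D a (fun y => conj (κ.c l y)) y) x :=
    fun a _ => (κ.sm_c a x hx).mul (sm_Fd hA hxM.1 (κ.dr_ne x hx) _ hsm)
  have h0 := dd_eq_zero_of_tan hA hxM (ContDiffAt.sum hs)
    (Filter.mem_of_superset (κ.isOpen_W.mem_nhds hx) fun y hy hyM => by
      have := κ.ed_conj_c hA hy hyM l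
      rw [ed_eq] at this
      exact this) (tan_fst (κ.F_mem hx k))
  rw [dd_sum hs] at h0
  have h1 : ∀ a, dd (fun y => κ.c a y * κ.D a (fun y => conj (κ.c l y)) y) x (κ.F k x, 0) =
      κ.c a x * κ.D k (κ.D a (fun y => conj (κ.c l y))) x
        + κ.D k (κ.c a) x * κ.D a (fun y => conj (κ.c l y)) x := fun a =>
    dd_mul (κ.sm_c a x hx) (sm_Fd hA hxM.1 (κ.dr_ne x hx) _ hsm) _
  have h2 : ∀ a, κ.D k (κ.D a (fun y => conj (κ.c l y))) x =
      κ.D a (κ.D k (fun y => conj (κ.c l y))) x := fun a =>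
    Fd_comm hA hxM.1 (κ.dr_ne x hx) _ _ hsm
  simp only [h1, h2, Finset.sum_add_distrib] at h0
  rw [ed_eq]
  linear_combination h0

end KernelChart

namespace KernelChart

variable {M : Hypersurface} {p x : C4} (κ : KernelChart M p)

theorem dd_e (hA : M.IsRealAnalytic) (hx : x ∈ κ.W) (V : C4 × C4) :
    dd κ.e x V = ∑ a, dd (κ.c a) x V • κ.F a x
      - (∑ a, κ.c a x * dd (M.R κ.j (bv (κ.τ a))) x V) • bv κ.j := by
  have hs : ∀ a ∈ Finset.univ, Sm (fun y => κ.c a y • κ.F a y) x := fun a _ =>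
    (κ.sm_c a x hx).smul (κ.smF hA hx a)
  have h1 : κ.e = fun y => ∑ a, κ.c a y • κ.F a y := rfl
  rw [h1, dd_sum hs, Finset.sum_smul, ← Finset.sum_sub_distrib]
  refine Finset.sum_congr rfl fun a _ => ?_
  have h2 : dd (κ.F a) x V = - dd (M.R κ.j (bv (κ.τ a))) x V • bv κ.j :=
    dd_ext hA (κ.W_subset hx) (κ.dr_ne x hx) _ V
  rw [dd_smul (κ.sm_c a x hx) (κ.smF hA hx a), h2]
  module

/-- The coefficient of `∂/∂x_j` is the left side of the kernel equation. -/
theorem dd_e_F_bar (hA : M.IsRealAnalytic) (hx : x ∈ κ.W) (hxM : x ∈ M.carrier) (b : Fin 3) :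
    dd κ.e x (0, star (κ.F b x)) = ∑ a, κ.Db b (κ.c a) x • κ.F a x := by
  rw [κ.dd_e hA hx]
  have := κ.ker x hx hxM b
  change ∑ a, κ.c a x * dd (M.R κ.j (bv (κ.τ a))) x (0, star (κ.F b x)) = 0 at this
  rw [this, zero_smul, sub_zero]
  rfl

/-- The sum of the Levi kernel and its conjugate is involutive. -/
theorem dd_e_e_bar (hA : M.IsRealAnalytic) (hx : x ∈ κ.W) (hxM : x ∈ M.carrier) :
    dd κ.e x (0, star (κ.e x)) = 0 := by
  have h1 : ((0, star (κ.e x)) : C4 × C4) = ∑ b, conj (κ.c b x) • ((0, star (κ.F b x)) : C4 × C4) := by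
    ext <;> simp [e, Prod.fst_sum, Prod.snd_sum]
  rw [h1, map_sum]
  simp only [map_smul, κ.dd_e_F_bar hA hx hxM, Finset.smul_sum, smul_smul]
  rw [Finset.sum_comm]
  refine Finset.sum_eq_zero fun a _ => ?_
  rw [← Finset.sum_smul]
  have h2 := congrArg (starRingEnd ℂ) (κ.ed_conj_c hA hx hxM a)
  rw [ed_eq, map_sum, map_zero] at h2
  have h3 : ∑ b, conj (κ.c b x) * κ.Db b (κ.c a) x = 0 := by
    rw [← h2]
    refine Finset.sum_congr rfl fun b _ => ?_
    rw [map_mul, conj_Fd]; simp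
  rw [h3, zero_smul]

/-- The `∂/∂x_j` terms cancel because the fields `F_a` commute; only the coefficients `c_a` are
differentiated. -/
theorem bracket_e_F (hA : M.IsRealAnalytic) (hx : x ∈ κ.W) (b : Fin 3) :
    dd (κ.F b) x (κ.e x, 0) - dd κ.e x (κ.F b x, 0) = - ∑ a, κ.D b (κ.c a) x • κ.F a x := by
  have h2 : dd (κ.F b) x (κ.e x, 0) = - κ.ed (M.R κ.j (bv (κ.τ b))) x • bv κ.j :=
    dd_ext hA (κ.W_subset hx) (κ.dr_ne x hx) _ _
  rw [h2, κ.dd_e hA hx, ed_eq]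
  have h3 : ∀ a, M.Fd κ.j (bv (κ.τ a)) (M.R κ.j (bv (κ.τ b))) x =
      dd (M.R κ.j (bv (κ.τ a))) x (κ.F b x, 0) := fun a =>
    Fd_R_comm hA (κ.W_subset hx) (κ.dr_ne x hx) _ _
  simp only [h3]
  change _ - (∑ a, κ.D b (κ.c a) x • κ.F a x - _) = _
  module

variable (φ : AdaptedFrame M p)

/-- `φ` consists of the fields given by the chart. -/
structure IsFrame (κ : KernelChart M p) (φ : AdaptedFrame M p) : Prop where
  W_subset : φ.W ⊆ κ.W
  g : φ.g = fun y => (Complex.I * (2 * M.dr y (bv κ.j))⁻¹) • bv κ.j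
  f : ∀ k, φ.f k = κ.F k.castSucc
  e : φ.e = κ.e

theorem exists_isFrame (hM : M.IsUniformly2Nondegenerate) (hp : p ∈ M.carrier) :
    ∃ φ : AdaptedFrame M p, κ.IsFrame φ := by
  obtain ⟨φ, h1, h2, h3, h4⟩ := (κ.pre hM.analytic).exists_adaptedFrame hM hp
  exact ⟨φ, h4, h1, fun k => congrFun h2 k, h3⟩

variable {κ φ}

theorem IsFrame.H_eq (h : κ.IsFrame φ) (hA : M.IsRealAnalytic) (hx : x ∈ φ.W)
    (hxM : x ∈ M.carrier) (a b : Fin 2) :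
    φ.H x a b = - (M.dr x (bv κ.j) * κ.Bm a.castSucc b.castSucc x) := by
  have h0 := κ.dr_ne x (h.W_subset hx)
  have h1 := φ.hess_f hA hx hxM a b
  rw [h.f, h.f, κ.hess_F hA (h.W_subset hx), h.g, dr_smul] at h1
  field_simp at h1
  rw [Complex.I_sq] at h1
  linear_combination h1

/-- The coordinate `τ 2`, in which `c₂ = 1` is constant, shows that the undetermined multiple of `e`
vanishes; the coordinates `τ 0` and `τ 1` then give `Ξ` without correction. -/
theorem IsFrame.Ξ_eq (h : κ.IsFrame φ) (hM : M.IsUniformly2Nondegenerate) (hx : x ∈ φ.W)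
    (hxM : x ∈ M.carrier) (l k : Fin 2) :
    φ.Ξ x l k = - κ.Db k.castSucc (κ.c l.castSucc) x := by
  obtain ⟨c, hc⟩ := φ.dd_e_snd hM hx hxM k
  have h1 := κ.dd_e_F_bar hM.analytic (h.W_subset hx) hxM k.castSucc
  rw [h.e, h.f, h1] at hc
  simp only [h.f, Fin.sum_univ_two, Fin.sum_univ_three, Db_c_two] at hc
  have h2 : ∀ b, _ = _ := fun b => congrFun hc (κ.τ b)
  have e0 := h2 0
  have e1 := h2 1
  have e2 := h2 2
  simp [Chart.F_apply, e_apply, c_two] at e0 e1 e2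
  rw [← e2] at e0 e1
  fin_cases l
  · change κ.Db k.castSucc (κ.c 0) x = _ at e0
    simp only [Fin.zero_eta, Fin.castSucc_zero]
    rw [e0]; simp
  · change κ.Db k.castSucc (κ.c 1) x = _ at e1
    simp only [Fin.mk_one, Fin.castSucc_one]
    rw [e1]; simp

theorem IsFrame.Ω_eq (h : κ.IsFrame φ) (hM : M.IsUniformly2Nondegenerate) (hx : x ∈ φ.W)
    (hxM : x ∈ M.carrier) (l k : Fin 2) :
    φ.Ω x l k = - κ.D k.castSucc (κ.c l.castSucc) x := by
  obtain ⟨c, hc⟩ := φ.bracket_e_f hM hx hxM k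
  have h1 := κ.bracket_e_F hM.analytic (h.W_subset hx) k.castSucc
  rw [h.e, h.f, h1] at hc
  simp only [h.f, Fin.sum_univ_two, Fin.sum_univ_three, D_c_two] at hc
  have h2 : ∀ b, _ = _ := fun b => congrFun hc (κ.τ b)
  have e0 := h2 0
  have e1 := h2 1
  have e2 := h2 2
  simp [Chart.F_apply, e_apply, c_two] at e0 e1 e2
  rw [← e2] at e0 e1
  fin_cases l
  · change -κ.D k.castSucc (κ.c 0) x = _ at e0
    simp only [Fin.zero_eta, Fin.castSucc_zero]
    rw [e0]; simp
  · change -κ.D k.castSucc (κ.c 1) x = _ at e1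
    simp only [Fin.mk_one, Fin.castSucc_one]
    rw [e1]; simp

end KernelChart

/-! ### Existence of kernel charts and involutivity of `𝒦 ⊕ 𝒦̄`. -/

theorem exists_coordinates : ∀ i j : Fin 4, i ≠ j → ∃ a b : Fin 4,
    Function.Injective ![a, b, i] ∧ (∀ k, ![a, b, i] k ≠ j) ∧
      ∀ l, l ≠ j → ∃ k, ![a, b, i] k = l := by decide

/-- The Levi kernel of a uniformly 2-nondegenerate hypersurface is given by a chart. -/
theorem exists_kernelChart {M : Hypersurface} {p : C4} (hA : M.IsRealAnalytic)
    (hR : ∀ x ∈ M.carrier, M.LeviRankTwo x) (hp : p ∈ M.carrier) : Nonempty (KernelChart M p) := by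
  obtain ⟨j, W, hWo, hWd, hpW, hj, -⟩ := exists_isSection hA hp
  obtain ⟨v, hvK, hv0, hvu⟩ := hR p hp
  -- A direction in which the kernel vector at `p` does not vanish serves as the third coordinate,
  -- so that `c₂` can be normalized to 1.
  have hvi : ∃ i, i ≠ j ∧ v i ≠ 0 := by
    by_contra! h
    apply hv0
    have h1 : v = v j • bv j := by
      ext i
      by_cases hi : i = j
      · subst hi; simp [bv]
      · simp [h i hi, bv, hi]
    have h2 := mem_HFib.1 hvK.1
    rw [h1, dr_smul] at h2
    rw [h1, (mul_eq_zero.1 h2).resolve_right (hj p hpW), zero_smul]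
  obtain ⟨i, hij, hvi⟩ := hvi
  obtain ⟨a, b, hinj, hne, hsurj⟩ := exists_coordinates i j hij
  let κ : Chart M p := ⟨j, ![a, b, i], hne, hinj, hsurj, W, hWo, hWd, hpW, hj⟩
  have hcj : ∀ x ∈ W, ∀ a b, conj (κ.Bm b a x) * conj (M.dr x (bv j)) =
      κ.Bm a b x * M.dr x (bv j) := fun y hy a b => conj_B hA (hWd hy) (hj y hy) _ _
  -- A left null vector of the first two columns would, by the conjugated kernel equations for `v`,
  -- annihilate the third column too. It would give a kernel vector whose third coordinate is zero,
  -- hence one independent of `v`.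
  have hdet : κ.Bm 0 0 p * κ.Bm 1 1 p - κ.Bm 0 1 p * κ.Bm 1 0 p ≠ 0 := by
    intro h0
    have hk := (κ.mem_KFib_iff_B hA hpW hp hvK.1).1 hvK
    have hk' : ∀ a, ∑ b, κ.Bm a b p * conj (v (κ.τ b)) = 0 := by
      intro a
      have h1 := congrArg (starRingEnd ℂ) (hk a)
      refine (mul_eq_zero.1 (?_ : _ * M.dr p (bv j) = 0)).resolve_right (hj p hpW)
      rw [map_zero, map_sum] at h1
      rw [Finset.sum_mul, ← zero_mul (conj (M.dr p (bv j))), ← h1, Finset.sum_mul]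
      refine Finset.sum_congr rfl fun b _ => ?_
      rw [map_mul]
      linear_combination (-conj (v (κ.τ b))) * hcj p hpW a b
    have hdm : (!![κ.Bm 0 0 p, κ.Bm 0 1 p; κ.Bm 1 0 p, κ.Bm 1 1 p] : Mat2).det = 0 := by
      rw [Matrix.det_fin_two_of]; exact h0
    obtain ⟨u, hu, hu0⟩ := Matrix.exists_vecMul_eq_zero_iff.2 hdm
    have u0 := congrFun hu0 0
    have u1 := congrFun hu0 1
    simp [Matrix.vecMul, dotProduct, Fin.sum_univ_two] at u0 u1
    have hv2 : conj (v (κ.τ 2)) ≠ 0 := (map_ne_zero _).2 hvi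
    have u2 : u 0 * κ.Bm 0 2 p + u 1 * κ.Bm 1 2 p = 0 := by
      refine (mul_eq_zero.1 (?_ : _ * conj (v (κ.τ 2)) = 0)).resolve_right hv2
      have k0 := hk' 0
      have k1 := hk' 1
      simp only [Fin.sum_univ_three] at k0 k1
      linear_combination u 0 * k0 + u 1 * k1 - conj (v (κ.τ 0)) * u0 - conj (v (κ.τ 1)) * u1
    set w := u 0 • κ.F 0 p + u 1 • κ.F 1 p with hw
    have hwH : w ∈ M.HFib p :=
      HFib_add (HFib_smul _ (κ.F_mem hpW 0)) (HFib_smul _ (κ.F_mem hpW 1))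
    have w0 : w (κ.τ 0) = u 0 := by simp [hw, Chart.F_apply]
    have w1 : w (κ.τ 1) = u 1 := by simp [hw, Chart.F_apply]
    have w2 : w (κ.τ 2) = 0 := by simp [hw, Chart.F_apply]
    have hwK : w ∈ M.KFib p := by
      rw [κ.mem_KFib_iff_B hA hpW hp hwH]
      intro b
      rw [Fin.sum_univ_three, w0, w1, w2]
      fin_cases b
      · simpa using u0
      · simpa using u1
      · simpa using u2
    obtain ⟨c, hc⟩ := hvu w hwK
    have hc0 : c = 0 := by
      have h3 := congrFun hc (κ.τ 2)
      rw [w2] at h3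
      simpa [show v (κ.τ 2) ≠ 0 from hvi] using h3.symm
    rw [hc, hc0, zero_smul] at w0 w1
    apply hu
    ext k; fin_cases k
    · exact w0.symm
    · exact w1.symm
  set Δ : C4 → ℂ := fun y => κ.Bm 0 0 y * κ.Bm 1 1 y - κ.Bm 0 1 y * κ.Bm 1 0 y with hΔ
  have hΔs : ∀ x ∈ W, Sm Δ x := fun x hx =>
    ((κ.smB hA hx 0 0).mul (κ.smB hA hx 1 1)).sub ((κ.smB hA hx 0 1).mul (κ.smB hA hx 1 0))
  set W' : Set C4 := {y | y ∈ W ∧ Δ y ≠ 0} with hW'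
  have hW'o : IsOpen W' := by
    rw [isOpen_iff_mem_nhds]
    rintro y ⟨hy, hy0⟩
    exact Filter.inter_mem (hWo.mem_nhds hy) ((hΔs y hy).continuousAt.eventually_ne hy0)
  -- These are the solutions, by Cramer's rule, of the kernel equations with last coefficient 1.
  have hcs : ∀ x ∈ W', ∀ a : Fin 3, Sm (![fun y => (κ.Bm 2 1 y * κ.Bm 1 0 y
      - κ.Bm 2 0 y * κ.Bm 1 1 y) * (Δ y)⁻¹, fun y => (κ.Bm 2 0 y * κ.Bm 0 1 y
      - κ.Bm 2 1 y * κ.Bm 0 0 y) * (Δ y)⁻¹, fun _ => 1] a) x := by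
    rintro x ⟨hx, hx0⟩ a
    fin_cases a
    · exact (((κ.smB hA hx 2 1).mul (κ.smB hA hx 1 0)).sub
        ((κ.smB hA hx 2 0).mul (κ.smB hA hx 1 1))).mul ((hΔs x hx).inv hx0)
    · exact (((κ.smB hA hx 2 0).mul (κ.smB hA hx 0 1)).sub
        ((κ.smB hA hx 2 1).mul (κ.smB hA hx 0 0))).mul ((hΔs x hx).inv hx0)
    · exact contDiffAt_const
  refine ⟨⟨⟨j, ![a, b, i], hne, hinj, hsurj, W', hW'o, fun y hy => hWd hy.1, ⟨hpW, hdet⟩,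
    fun x hx => hj x hx.1⟩, _, fun a x hx => hcs x hx a, fun x => rfl, ?_, fun x hx _ => hx.2⟩⟩
  intro x hx hxM
  obtain ⟨v, hvK, hv0, -⟩ := hR x hxM
  have hk := (κ.mem_KFib_iff_B hA hx.1 hxM hvK.1).1 hvK
  have k0 := hk 0
  have k1 := hk 1
  have k2 := hk 2
  simp only [Fin.sum_univ_three] at k0 k1 k2
  have hΔx : Δ x ≠ 0 := hx.2
  have e0 : v (κ.τ 0) * Δ x =
      v (κ.τ 2) * (κ.Bm 2 1 x * κ.Bm 1 0 x - κ.Bm 2 0 x * κ.Bm 1 1 x) := by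
    simp only [hΔ]
    linear_combination κ.Bm 1 1 x * k0 - κ.Bm 1 0 x * k1
  have e1 : v (κ.τ 1) * Δ x =
      v (κ.τ 2) * (κ.Bm 2 0 x * κ.Bm 0 1 x - κ.Bm 2 1 x * κ.Bm 0 0 x) := by
    simp only [hΔ]
    linear_combination κ.Bm 0 0 x * k1 - κ.Bm 0 1 x * k0
  have hv2 : v (κ.τ 2) ≠ 0 := by
    intro h2
    apply hv0
    rw [h2, zero_mul] at e0 e1
    rw [κ.eq_sum_F hx.1 hvK.1, Fin.sum_univ_three, h2, (mul_eq_zero.1 e0).resolve_right hΔx,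
      (mul_eq_zero.1 e1).resolve_right hΔx]
    simp
  have key : ∀ b, (κ.Bm 2 1 x * κ.Bm 1 0 x - κ.Bm 2 0 x * κ.Bm 1 1 x) * (Δ x)⁻¹ * κ.Bm 0 b x
      + (κ.Bm 2 0 x * κ.Bm 0 1 x - κ.Bm 2 1 x * κ.Bm 0 0 x) * (Δ x)⁻¹ * κ.Bm 1 b x
      + 1 * κ.Bm 2 b x = 0 := by
    intro b
    have kb := hk b
    simp only [Fin.sum_univ_three] at kb
    refine (mul_eq_zero.1 (?_ : v (κ.τ 2) * _ = 0)).resolve_left hv2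
    field_simp
    linear_combination Δ x * kb - κ.Bm 0 b x * e0 - κ.Bm 1 b x * e1
  intro b
  have := key b
  rw [Fin.sum_univ_three]
  exact this

namespace AdaptedFrame

variable {M : Hypersurface} {p x : C4} (φ : AdaptedFrame M p)

/-- The bracket of `e` with its conjugate lies in `𝒦 ⊕ 𝒦̄`. -/
theorem dd_e_e_bar (hM : M.IsUniformly2Nondegenerate) (hx : x ∈ φ.W) (hxM : x ∈ M.carrier) :
    ∃ c : ℂ, dd φ.e x (0, star (φ.e x)) = c • φ.e x := by
  have hA := hM.analytic
  obtain ⟨κ⟩ := exists_kernelChart hA hM.leviRank hxM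
  have hes := (φ.toPre.sece hx).sm
  have hc : Sm (fun y => φ.e y (κ.τ 2)) x := hes.comp_apply _
  -- On `M` the field `e` is a function times the kernel field of a chart, whose derivative along
  -- its own conjugate is zero; only the derivative of the factor is left.
  have heq : ∀ᶠ y in 𝓝 x, y ∈ M.carrier → φ.e y = φ.e y (κ.τ 2) • κ.e y := by
    filter_upwards [φ.isOpen_W.mem_nhds hx, κ.isOpen_W.mem_nhds κ.p_mem] with y h1 h2 h3
    exact κ.KFib_eq hA h2 h3 (φ.kernel_e y h1 h3)
  have h1 := dd_congr_tan' hA hxM hes (hc.smul (κ.sme hA κ.p_mem)) heq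
    (tan_snd (φ.toPre.e_mem hx hxM))
  have hex := heq.self_of_nhds hxM
  have hd : dd κ.e x (0, star (φ.e x)) = 0 := by
    have h2 : ((0, star (φ.e x)) : C4 × C4) =
        conj (φ.e x (κ.τ 2)) • ((0, star (κ.e x)) : C4 × C4) := by
      conv_lhs => rw [hex]
      ext <;> simp
    rw [h2, map_smul, κ.dd_e_e_bar hA κ.p_mem hxM, smul_zero]
  have h3 : dd (fun y => φ.e y (κ.τ 2) • κ.e y) x (0, star (φ.e x)) =
      φ.e x (κ.τ 2) • dd κ.e x (0, star (φ.e x))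
        + dd (fun y => φ.e y (κ.τ 2)) x (0, star (φ.e x)) • κ.e x :=
    dd_smul hc (κ.sme hA κ.p_mem) _
  have h0 : φ.e x (κ.τ 2) ≠ 0 := by
    intro h0
    rw [h0, zero_smul] at hex
    exact φ.toPre.e_ne_zero hx hxM hex
  rw [hd, smul_zero, zero_add] at h3
  refine ⟨dd (fun y => φ.e y (κ.τ 2)) x (0, star (φ.e x)) * (φ.e x (κ.τ 2))⁻¹, ?_⟩
  have h4 : dd φ.e x (0, star (φ.e x)) =
    dd (fun y => φ.e y (κ.τ 2)) x (0, star (φ.e x)) • κ.e x := h1.trans h3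
  have hk : κ.e x = (φ.e x (κ.τ 2))⁻¹ • φ.e x := by
    rw [eq_inv_smul_iff₀ h0]; exact hex.symm
  rw [h4, mul_smul, ← hk]

end AdaptedFrame

/-! ### Derivatives of matrix functions -/

/-- Entrywise smoothness of a matrix function. -/
def Smm (F : C4 → Mat2) (x : C4) : Prop := ∀ i j, Sm (fun y => F y i j) x

/-- Entrywise derivative of a matrix function. -/
def dm (F : C4 → Mat2) (x : C4) (V : C4 × C4) : Mat2 :=
  Matrix.of fun i j => dd (fun y => F y i j) x V

theorem applyMat_eq (X : CVField) (F : C4 → Mat2) (x : C4) : applyMat X F x = dm F x (X x) := rfl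

theorem Smm.mul {F G : C4 → Mat2} {x : C4} (hF : Smm F x) (hG : Smm G x) :
    Smm (fun y => F y * G y) x := fun i j => by
  simp only [Matrix.mul_apply, Fin.sum_univ_two]
  exact ((hF i 0).mul (hG 0 j)).add ((hF i 1).mul (hG 1 j))

theorem Smm.transpose {F : C4 → Mat2} {x : C4} (hF : Smm F x) : Smm (fun y => (F y)ᵀ) x :=
  fun i j => hF j i

theorem Smm.cbar {F : C4 → Mat2} {x : C4} (hF : Smm F x) : Smm (fun y => cbar (F y)) x :=
  fun i j => (hF i j).conj

theorem Smm.smul {F : C4 → Mat2} {c : C4 → ℂ} {x : C4} (hc : Sm c x) (hF : Smm F x) :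
    Smm (fun y => c y • F y) x := fun i j => hc.mul (hF i j)

theorem Smm.inv {F : C4 → Mat2} {x : C4} (hF : Smm F x) (h0 : (F x).det ≠ 0) :
    Smm (fun y => (F y)⁻¹) x := fun i j => sm_matrix_inv hF h0 i j

theorem dm_mul {F G : C4 → Mat2} {x : C4} (hF : Smm F x) (hG : Smm G x) (V : C4 × C4) :
    dm (fun y => F y * G y) x V = dm F x V * G x + F x * dm G x V := by
  ext i j
  simp only [dm, Matrix.of_apply, Matrix.add_apply, Matrix.mul_apply, Fin.sum_univ_two]
  rw [dd_add ((hF i 0).mul (hG 0 j)) ((hF i 1).mul (hG 1 j)), dd_mul (hF i 0) (hG 0 j),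
    dd_mul (hF i 1) (hG 1 j)]
  ring

theorem dm_transpose (F : C4 → Mat2) (x : C4) (V : C4 × C4) :
    dm (fun y => (F y)ᵀ) x V = (dm F x V)ᵀ := rfl

theorem dm_smul {F : C4 → Mat2} {c : C4 → ℂ} {x : C4} (hc : Sm c x) (hF : Smm F x) (V : C4 × C4) :
    dm (fun y => c y • F y) x V = c x • dm F x V + dd c x V • F x := by
  ext i j
  exact dd_mul hc (hF i j) V

theorem dm_smul_vec (F : C4 → Mat2) (x : C4) (c : ℂ) (V : C4 × C4) :
    dm F x (c • V) = c • dm F x V := by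
  ext i j
  simp [dm]

theorem dm_congr_tan {M : Hypersurface} {x : C4} (hA : M.IsRealAnalytic) (hx : x ∈ M.carrier)
    {F G : C4 → Mat2} (hF : Smm F x) (hG : Smm G x)
    (h0 : ∀ᶠ y in 𝓝 x, y ∈ M.carrier → F y = G y) {V : C4 × C4} (hV : M.Tan x V) :
    dm F x V = dm G x V := by
  ext i j
  exact dd_congr_tan hA hx (hF i j) (hG i j) (h0.mono fun y hy h => by rw [hy h]) hV

theorem cbar_mul (A B : Mat2) : cbar (A * B) = cbar A * cbar B := by
  simp [cbar, Matrix.map_mul]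

theorem cbar_smul (c : ℂ) (A : Mat2) : cbar (c • A) = conj c • cbar A := by
  ext i j; simp [cbar]

theorem det_cbar (A : Mat2) : (cbar A).det = conj A.det := by
  simp [cbar, Matrix.det_fin_two]

theorem cbar_cbar (A : Mat2) : cbar (cbar A) = A := by
  ext i j; simp [cbar]

theorem cbar_transpose (A : Mat2) : cbar Aᵀ = (cbar A)ᵀ := rfl

/-! ### Changes of adapted frames and the transformation laws of `H`, `Ξ`, `Ω`, `S`. -/

namespace AdaptedFrame

variable {M : Hypersurface} {p x : C4} (φ ψ : AdaptedFrame M p)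

theorem smmH (hx : x ∈ φ.W) : Smm φ.H x := fun i j =>
  (φ.smooth_H i j).contDiffAt (φ.isOpen_W.mem_nhds hx)

theorem smmΞ (hx : x ∈ φ.W) : Smm φ.Ξ x := fun i j =>
  (φ.smooth_Ξ i j).contDiffAt (φ.isOpen_W.mem_nhds hx)

theorem smmS (hM : M.IsUniformly2Nondegenerate) (hx : x ∈ φ.W) (hxM : x ∈ M.carrier) :
    Smm φ.S02 x := (φ.smmΞ hx).mul ((φ.smmH hx).inv (φ.det_H hM hx hxM))

theorem smmP (hx : x ∈ φ.W) : Smm φ.S0m2 x := (φ.smmH hx).mul (φ.smmΞ hx).cbar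

/-- A change of adapted frames near `p`. -/
structure Change where
  U : C4 → Mat2
  v : Fin 2 → C4 → ℂ
  c : C4 → ℂ
  r : C4 → ℂ
  smU : ∀ᶠ x in 𝓝 p, Smm U x
  smv : ∀ᶠ x in 𝓝 p, ∀ k, Sm (v k) x
  smc : ∀ᶠ x in 𝓝 p, Sm c x
  smr : ∀ᶠ x in 𝓝 p, Sm r x
  f_eq : ∀ᶠ x in 𝓝 p, x ∈ M.carrier →
    ∀ k, ψ.f k x = ∑ l, U x l k • φ.f l x + v k x • φ.e x
  e_eq : ∀ᶠ x in 𝓝 p, x ∈ M.carrier → ψ.e x = c x • φ.e x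
  g_eq : ∀ᶠ x in 𝓝 p, x ∈ M.carrier → M.dr x (ψ.g x) = r x * M.dr x (φ.g x)

theorem nonempty_change (hM : M.IsUniformly2Nondegenerate) (hp : p ∈ M.carrier) :
    ∃ χ : Change φ ψ, φ.SameAt ψ → χ.U p = 1 ∧ χ.c p = 1 ∧ χ.r p = 1 := by
  have hA := hM.analytic
  have hdp := φ.toPre.det_ne_zero φ.p_mem hp
  have hd : ∀ᶠ x in 𝓝 p, (φ.toPre.mat x).det ≠ 0 :=
    (φ.toPre.continuousAt_det φ.p_mem).eventually_ne hdp
  have h1 : ∀ᶠ x in 𝓝 p, x ∈ φ.W := φ.isOpen_W.mem_nhds φ.p_mem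
  have h2 : ∀ᶠ x in 𝓝 p, x ∈ ψ.W := ψ.isOpen_W.mem_nhds ψ.p_mem
  refine ⟨⟨fun y => Matrix.of fun l k => φ.toPre.co y (ψ.f k y) (![1, 2] l),
    fun k y => φ.toPre.co y (ψ.f k y) 3, fun y => φ.toPre.co y (ψ.e y) 3,
    fun y => φ.toPre.co y (ψ.g y) 0, ?_, ?_, ?_, ?_, ?_, ?_, ?_⟩, ?_⟩
  · filter_upwards [hd, h1, h2] with x a b c l k
    exact φ.toPre.sm_co b a (ψ.secf c k).sm _
  · filter_upwards [hd, h1, h2] with x a b c k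
    exact φ.toPre.sm_co b a (ψ.secf c k).sm _
  · filter_upwards [hd, h1, h2] with x a b c
    exact φ.toPre.sm_co b a (ψ.sece c).sm _
  · filter_upwards [hd, h1, h2] with x a b c
    exact φ.toPre.sm_co b a (ψ.toPre.smg c) _
  · filter_upwards [hd, h1, h2] with x a b c hxM k
    have h3 := (φ.toPre.mem_HFib_iff b hxM).1 (ψ.f_mem c hxM k)
    have h4 := φ.toPre.co_spec a (ψ.f k x)
    rw [h3, zero_smul, zero_add] at h4
    rw [Fin.sum_univ_two]
    exact h4
  · filter_upwards [hd, h1, h2] with x a b c hxM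
    have h3 := (φ.toPre.mem_KFib_iff_co hM b hxM).1 (ψ.kernel_e x c hxM)
    have h4 := φ.toPre.co_spec a (ψ.e x)
    rw [h3.1, h3.2.1, h3.2.2, zero_smul, zero_smul, zero_smul, zero_add, zero_add, zero_add] at h4
    exact h4
  · filter_upwards [hd, h1, h2] with x a b c hxM
    have h4 := congrArg (M.dr x) (φ.toPre.co_spec a (ψ.g x))
    rw [dr_add, dr_add, dr_add, dr_smul, dr_smul, dr_smul, dr_smul,
      mem_HFib.1 (φ.toPre.f_mem b hxM 0), mem_HFib.1 (φ.toPre.f_mem b hxM 1),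
      mem_HFib.1 (φ.toPre.e_mem b hxM)] at h4
    simp only [mul_zero, add_zero] at h4
    exact h4
  · rintro ⟨hg, hf, he⟩
    refine ⟨?_, ?_, ?_⟩
    · have k0 := φ.toPre.co_comb hdp ![0, 1, 0, 0]
      have k1 := φ.toPre.co_comb hdp ![0, 0, 1, 0]
      simp at k0 k1
      change φ.toPre.co p (φ.f 0 p) = _ at k0
      change φ.toPre.co p (φ.f 1 p) = _ at k1
      rw [hf] at k0 k1
      ext l k
      fin_cases k <;> fin_cases l <;> simp [k0, k1]
    · have k0 := φ.toPre.co_comb hdp ![0, 0, 0, 1]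
      simp at k0
      change φ.toPre.co p (φ.e p) = _ at k0
      rw [he] at k0
      change φ.toPre.co p (ψ.e p) 3 = 1
      rw [k0]; simp
    · have k0 := φ.toPre.co_g hdp
      change φ.toPre.co p (φ.g p) = _ at k0
      rw [hg] at k0
      change φ.toPre.co p (ψ.g p) 0 = 1
      rw [k0]; simp

namespace Change

variable {φ ψ} (χ : Change φ ψ)

/-- The neighbourhood conditions of a change of frames, at one point. -/
structure At (x : C4) : Prop where
  mem : x ∈ φ.W
  mem' : x ∈ ψ.W
  smU : Smm χ.U x
  smv : ∀ k, Sm (χ.v k) x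
  smc : Sm χ.c x
  smr : Sm χ.r x
  f_eq : ∀ᶠ y in 𝓝 x, y ∈ M.carrier →
    ∀ k, ψ.f k y = ∑ l, χ.U y l k • φ.f l y + χ.v k y • φ.e y
  e_eq : ∀ᶠ y in 𝓝 x, y ∈ M.carrier → ψ.e y = χ.c y • φ.e y
  g_eq : M.dr x (ψ.g x) = χ.r x * M.dr x (φ.g x)

theorem eventually_at : ∀ᶠ x in 𝓝 p, x ∈ M.carrier → χ.At x := by
  filter_upwards [φ.isOpen_W.mem_nhds φ.p_mem, ψ.isOpen_W.mem_nhds ψ.p_mem, χ.smU, χ.smv, χ.smc,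
    χ.smr, χ.f_eq.eventually_nhds, χ.e_eq.eventually_nhds, χ.g_eq] with x a b c d e f g h i hx
  exact ⟨a, b, c, d, e, f, g, h, i hx⟩

variable {χ}

theorem At.c_ne (h : χ.At x) (hxM : x ∈ M.carrier) : χ.c x ≠ 0 := by
  intro h0
  have := h.e_eq.self_of_nhds hxM
  rw [h0, zero_smul] at this
  exact ψ.toPre.e_ne_zero h.mem' hxM this

theorem At.r_ne (h : χ.At x) (hxM : x ∈ M.carrier) : χ.r x ≠ 0 := by
  intro h0
  have := h.g_eq
  rw [h0, zero_mul] at this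
  exact ψ.toPre.dr_g_ne h.mem' hxM this

theorem At.conj_r (h : χ.At x) (hA : M.IsRealAnalytic) (hxM : x ∈ M.carrier) :
    conj (χ.r x) = χ.r x := by
  have h1 : conj (M.dr x (ψ.g x)) = - M.dr x (ψ.g x) := ψ.toPre.conj_dr_g hA h.mem' hxM
  have h2 : conj (M.dr x (φ.g x)) = - M.dr x (φ.g x) := φ.toPre.conj_dr_g hA h.mem hxM
  have h3 : M.dr x (φ.g x) ≠ 0 := φ.toPre.dr_g_ne h.mem hxM
  rw [h.g_eq, map_mul, h2] at h1
  refine mul_right_cancel₀ h3 ?_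
  linear_combination -h1

theorem At.H_eq (h : χ.At x) (hA : M.IsRealAnalytic) (hxM : x ∈ M.carrier) :
    χ.r x • ψ.H x = (χ.U x)ᵀ * φ.H x * cbar (χ.U x) := by
  ext a b
  have h3 : M.dr x (φ.g x) ≠ 0 := φ.toPre.dr_g_ne h.mem hxM
  have h1 := ψ.hess_f hA h.mem' hxM a b
  have hf := h.f_eq.self_of_nhds hxM
  have hfm : ∀ a, φ.f a x ∈ M.HFib x := φ.f_mem h.mem hxM
  have hem : φ.e x ∈ M.HFib x := φ.e_mem h.mem hxM
  have he : ∀ a, M.hess x (φ.f a x) (φ.e x) = 0 := fun a => by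
    rw [← hess_conj hA hxM.1, φ.hess_e hA h.mem hxM (hfm a), map_zero]
  rw [hf, hf, h.g_eq] at h1
  simp only [Fin.sum_univ_two, hess_add_left hA hxM.1, hess_smul_left hA hxM.1, hess_add_right,
    hess_smul_right, φ.hess_f hA h.mem hxM, he, φ.hess_e hA h.mem hxM (hfm _),
    φ.hess_e hA h.mem hxM hem] at h1
  refine mul_right_cancel₀ (mul_ne_zero (by simp : 2 * Complex.I ≠ 0) h3) ?_
  simp only [Matrix.smul_apply, smul_eq_mul, Matrix.mul_apply, Matrix.transpose_apply,
    Fin.sum_univ_two, cbar, Matrix.map_apply]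
  linear_combination -h1

theorem At.det_U (h : χ.At x) (hM : M.IsUniformly2Nondegenerate) (hxM : x ∈ M.carrier) :
    (χ.U x).det ≠ 0 := by
  intro h0
  have h1 := congrArg Matrix.det (h.H_eq hM.analytic hxM)
  rw [Matrix.det_mul, Matrix.det_mul, Matrix.det_transpose, h0, zero_mul, zero_mul,
    Matrix.det_smul, mul_eq_zero] at h1
  rcases h1 with h1 | h1
  · exact h.r_ne hxM (by simpa using h1)
  · exact ψ.det_H hM h.mem' hxM h1

theorem At.eq_of_comb (h : χ.At x) (hxM : x ∈ M.carrier) {A B : Fin 2 → ℂ} {c d : ℂ}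
    (hAB : ∑ l, A l • φ.f l x + c • φ.e x = ∑ l, B l • φ.f l x + d • φ.e x) : A = B := by
  have := φ.toPre.indep h.mem hxM (a := A 0 - B 0) (b := A 1 - B 1) (c := c - d) (by
    change (A 0 - B 0) • φ.f 0 x + (A 1 - B 1) • φ.f 1 x + (c - d) • φ.e x = 0
    rw [Fin.sum_univ_two, Fin.sum_univ_two] at hAB
    rw [← sub_eq_zero] at hAB
    rw [← hAB]; module)
  ext i; fin_cases i
  · exact sub_eq_zero.1 this.1
  · exact sub_eq_zero.1 this.2.1

theorem At.dd_e (h : χ.At x) (hA : M.IsRealAnalytic) (hxM : x ∈ M.carrier) {V : C4 × C4}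
    (hV : M.Tan x V) : dd ψ.e x V = χ.c x • dd φ.e x V + dd χ.c x V • φ.e x := by
  have h1 : Sm φ.e x := (φ.sece h.mem).sm
  rw [dd_congr_tan' hA hxM (ψ.sece h.mem').sm (h.smc.smul h1) h.e_eq hV]
  exact dd_smul h.smc h1 V

/-- The law is tensorial modulo `e`: the derivative of `c` and, by `dd_e_e_bar`, the `e`-components
of the new `f_k` contribute only multiples of `e`. -/
theorem At.Ξ_eq (h : χ.At x) (hM : M.IsUniformly2Nondegenerate) (hxM : x ∈ M.carrier) :
    χ.U x * ψ.Ξ x = χ.c x • (φ.Ξ x * cbar (χ.U x)) := by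
  have hA := hM.analytic
  have key : ∀ k, (fun l => (χ.U x * ψ.Ξ x) l k) =
      fun l => (χ.c x • (φ.Ξ x * cbar (χ.U x))) l k := by
    intro k
    have hfm := ψ.f_mem h.mem' hxM k
    have h1 := h.dd_e hA hxM (tan_snd hfm)
    obtain ⟨d, hd⟩ := ψ.dd_e_snd hM h.mem' hxM k
    obtain ⟨d0, hd0⟩ := φ.dd_e_snd hM h.mem hxM 0
    obtain ⟨d1, hd1⟩ := φ.dd_e_snd hM h.mem hxM 1
    obtain ⟨d2, hd2⟩ := φ.dd_e_e_bar hM h.mem hxM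
    have hf := h.f_eq.self_of_nhds hxM
    have hex := h.e_eq.self_of_nhds hxM
    have h2 : dd φ.e x (0, star (ψ.f k x)) = conj (χ.U x 0 k) • dd φ.e x (0, star (φ.f 0 x))
        + conj (χ.U x 1 k) • dd φ.e x (0, star (φ.f 1 x))
        + conj (χ.v k x) • dd φ.e x (0, star (φ.e x)) := by
      rw [← map_smul, ← map_smul, ← map_smul, ← map_add, ← map_add, hf, Fin.sum_univ_two]
      simp
    rw [hd0, hd1, hd2] at h2
    change dd ψ.e x (0, star (ψ.f k x)) =
      χ.c x • dd φ.e x (0, star (ψ.f k x)) + dd χ.c x (0, star (ψ.f k x)) • φ.e x at h1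
    rw [hd, h2, hex] at h1
    simp only [hf, Fin.sum_univ_two] at h1
    refine h.eq_of_comb hxM (c := - (d * χ.c x) + ψ.Ξ x 0 k * χ.v 0 x + ψ.Ξ x 1 k * χ.v 1 x)
      (d := - (χ.c x * (conj (χ.U x 0 k) * d0 + conj (χ.U x 1 k) * d1 + conj (χ.v k x) * d2)
        + dd χ.c x (0, star (χ.U x 0 k • φ.f 0 x + χ.U x 1 k • φ.f 1 x + χ.v k x • φ.e x)))) ?_
    simp only [Fin.sum_univ_two, Matrix.mul_apply, Matrix.smul_apply, cbar, Matrix.map_apply,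
      smul_eq_mul]
    linear_combination (norm := module) -h1
  ext l k
  exact congrFun (key k) l

/-- Unlike `Ξ`, the bracket of two holomorphic fields differentiates `U`; its derivative along `e`
is the only inhomogeneous term modulo `e`. -/
theorem At.Ω_eq (h : χ.At x) (hM : M.IsUniformly2Nondegenerate) (hxM : x ∈ M.carrier) :
    χ.U x * ψ.Ω x = χ.c x • (φ.Ω x * χ.U x + dm χ.U x (φ.e x, 0)) := by
  have hA := hM.analytic
  have key : ∀ k, (fun l => (χ.U x * ψ.Ω x) l k) =
      fun l => (χ.c x • (φ.Ω x * χ.U x + dm χ.U x (φ.e x, 0))) l k := by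
    intro k
    have hfm := ψ.f_mem h.mem' hxM k
    have hem := ψ.e_mem h.mem' hxM
    have h1 := h.dd_e hA hxM (tan_fst hfm)
    obtain ⟨d, hd⟩ := ψ.bracket_e_f hM h.mem' hxM k
    obtain ⟨d0, hd0⟩ := φ.bracket_e_f hM h.mem hxM 0
    obtain ⟨d1, hd1⟩ := φ.bracket_e_f hM h.mem hxM 1
    have hf := h.f_eq.self_of_nhds hxM
    have hex := h.e_eq.self_of_nhds hxM
    have sf : ∀ l, Sm (φ.f l) x := fun l => (φ.secf h.mem l).sm
    have se : Sm φ.e x := (φ.sece h.mem).sm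
    have s1 : ∀ l ∈ Finset.univ, Sm (fun y => χ.U y l k • φ.f l y) x := fun l _ =>
      (h.smU l k).smul (sf l)
    have s2 : Sm (fun y => χ.v k y • φ.e y) x := (h.smv k).smul se
    have h3 : dd (ψ.f k) x (ψ.e x, 0) = χ.c x • (∑ l, (χ.U x l k • dd (φ.f l) x (φ.e x, 0)
        + dd (fun y => χ.U y l k) x (φ.e x, 0) • φ.f l x)
        + (χ.v k x • dd φ.e x (φ.e x, 0) + dd (χ.v k) x (φ.e x, 0) • φ.e x)) := by
      rw [dd_congr_tan' hA hxM (ψ.secf h.mem' k).sm ((ContDiffAt.sum s1).add s2)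
        (h.f_eq.mono fun y hy hyM => hy hyM k) (tan_fst hem), hex]
      have h4 : ((χ.c x • φ.e x, 0) : C4 × C4) = χ.c x • (φ.e x, 0) := by simp
      rw [h4, map_smul]
      congr 1
      have h5 := dd_add (ContDiffAt.sum s1) s2 (φ.e x, 0)
      refine h5.trans ?_
      rw [dd_sum s1, dd_smul (h.smv k) se]
      congr 1
      exact Finset.sum_congr rfl fun l _ => dd_smul (h.smU l k) (sf l) _
    have h2 : dd φ.e x (ψ.f k x, 0) = χ.U x 0 k • dd φ.e x (φ.f 0 x, 0)
        + χ.U x 1 k • dd φ.e x (φ.f 1 x, 0) + χ.v k x • dd φ.e x (φ.e x, 0) := by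
      rw [← map_smul, ← map_smul, ← map_smul, ← map_add, ← map_add, hf, Fin.sum_univ_two]
      simp
    change dd ψ.e x (ψ.f k x, 0) =
      χ.c x • dd φ.e x (ψ.f k x, 0) + dd χ.c x (ψ.f k x, 0) • φ.e x at h1
    rw [h3, h1, h2, hex] at hd
    generalize dd χ.c x (ψ.f k x, 0) = q at hd
    simp only [hf, Fin.sum_univ_two] at hd hd0 hd1
    refine h.eq_of_comb hxM (c := d * χ.c x + ψ.Ω x 0 k * χ.v 0 x + ψ.Ω x 1 k * χ.v 1 x)
      (d := χ.c x * (dd (χ.v k) x (φ.e x, 0)) - q + χ.c x * χ.U x 0 k * d0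
        + χ.c x * χ.U x 1 k * d1) ?_
    simp only [Fin.sum_univ_two, Matrix.mul_apply, Matrix.smul_apply, Matrix.add_apply, dm,
      Matrix.of_apply, smul_eq_mul]
    linear_combination (norm := module) -hd + (χ.c x * χ.U x 0 k) • hd0 + (χ.c x * χ.U x 1 k) • hd1
  ext l k
  exact congrFun (key k) l

/-- Insert `Ξ = S H` in the laws for `H` and `Ξ` and cancel the invertible factor `H Ū` on the
right. -/
theorem At.S_eq (h : χ.At x) (hM : M.IsUniformly2Nondegenerate) (hxM : x ∈ M.carrier) :
    χ.U x * ψ.S02 x * (χ.U x)ᵀ = (χ.c x * χ.r x) • φ.S02 x := by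
  have hH := h.H_eq hM.analytic hxM
  have hΞ := h.Ξ_eq hM hxM
  have hU := isUnit_iff_ne_zero.2 (h.det_U hM hxM)
  have dH := isUnit_iff_ne_zero.2 (φ.det_H hM h.mem hxM)
  have dH' := isUnit_iff_ne_zero.2 (ψ.det_H hM h.mem' hxM)
  have hr := h.r_ne hxM
  have hS : φ.S02 x * φ.H x = φ.Ξ x := by
    rw [S02, Matrix.mul_assoc, Matrix.nonsing_inv_mul _ dH, Matrix.mul_one]
  have hS' : ψ.S02 x * ψ.H x = ψ.Ξ x := by
    rw [S02, Matrix.mul_assoc, Matrix.nonsing_inv_mul _ dH', Matrix.mul_one]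
  have hUb : IsUnit (cbar (χ.U x)).det := by
    rw [det_cbar]; exact isUnit_iff_ne_zero.2 ((map_ne_zero _).2 (h.det_U hM hxM))
  have h1 : (χ.U x * ψ.S02 x * (χ.U x)ᵀ) * (φ.H x * cbar (χ.U x)) =
      ((χ.c x * χ.r x) • φ.S02 x) * (φ.H x * cbar (χ.U x)) := by
    calc _ = χ.U x * ψ.S02 x * ((χ.U x)ᵀ * φ.H x * cbar (χ.U x)) := by
          simp only [Matrix.mul_assoc]
      _ = χ.r x • (χ.U x * (ψ.S02 x * ψ.H x)) := by
          rw [← hH, Matrix.mul_smul, Matrix.mul_assoc]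
      _ = _ := by
          rw [hS', hΞ, smul_smul, Matrix.smul_mul, ← Matrix.mul_assoc, hS, mul_comm]
  have h2 : IsUnit (φ.H x * cbar (χ.U x)) := by
    rw [Matrix.isUnit_iff_isUnit_det, Matrix.det_mul]; exact dH.mul hUb
  exact h2.mul_right_cancel h1

theorem At.P_eq (h : χ.At x) (hM : M.IsUniformly2Nondegenerate) (hxM : x ∈ M.carrier) :
    χ.r x • ψ.S0m2 x = conj (χ.c x) • ((χ.U x)ᵀ * φ.S0m2 x * χ.U x) := by
  have hH := h.H_eq hM.analytic hxM
  have hΞ := congrArg cbar (h.Ξ_eq hM hxM)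
  rw [cbar_mul, cbar_smul, cbar_mul, cbar_cbar] at hΞ
  rw [S0m2, S0m2, ← Matrix.smul_mul, hH, Matrix.mul_assoc _ (cbar (χ.U x)), hΞ, Matrix.mul_smul]
  simp only [Matrix.mul_assoc]

/-- The derivatives along `e` of the structure functions under a change of frames. -/
theorem derivatives (χ : Change φ ψ) (hM : M.IsUniformly2Nondegenerate) (hp : p ∈ M.carrier) :
    (∃ k : ℂ, χ.U p * applyMat (hol ψ.e) ψ.S02 p * (χ.U p)ᵀ
      + χ.c p • (dm χ.U p (φ.e p, 0) * ψ.S02 p * (χ.U p)ᵀ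
        + χ.U p * ψ.S02 p * (dm χ.U p (φ.e p, 0))ᵀ) =
      k • φ.S02 p + (χ.c p ^ 2 * χ.r p) • applyMat (hol φ.e) φ.S02 p) ∧
    ∃ k : ℂ, χ.r p • applyMat (hol ψ.e) ψ.S0m2 p = k • ψ.S0m2 p + (χ.c p * conj (χ.c p)) •
      ((dm χ.U p (φ.e p, 0))ᵀ * φ.S0m2 p * χ.U p + (χ.U p)ᵀ * applyMat (hol φ.e) φ.S0m2 p * χ.U p
        + (χ.U p)ᵀ * φ.S0m2 p * dm χ.U p (φ.e p, 0)) := by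
  have hA := hM.analytic
  have hat := χ.eventually_at
  have h := hat.self_of_nhds hp
  have hex := h.e_eq.self_of_nhds hp
  have hV : ((ψ.e p, 0) : C4 × C4) = χ.c p • (φ.e p, 0) := by rw [hex]; simp
  have htan := tan_fst (φ.e_mem h.mem hp)
  have sU := h.smU
  have sS := φ.smmS hM h.mem hp
  have sS' := ψ.smmS hM h.mem' hp
  have sP := φ.smmP h.mem
  have sP' := ψ.smmP h.mem'
  have e1 : ∀ F, applyMat (hol ψ.e) F p = χ.c p • dm F p (φ.e p, 0) := by
    intro F
    change dm F p (ψ.e p, 0) = _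
    rw [hV, dm_smul_vec]
  have e2 : ∀ F, applyMat (hol φ.e) F p = dm F p (φ.e p, 0) := fun F => rfl
  constructor
  · have h1 := dm_congr_tan hA hp ((sU.mul sS').mul sU.transpose) (sS.smul (h.smc.mul h.smr))
      (hat.mono fun y hy hyM => (hy hyM).S_eq hM hyM) htan
    rw [dm_mul (sU.mul sS') sU.transpose, dm_mul sU sS', dm_transpose,
      dm_smul (h.smc.mul h.smr) sS] at h1
    refine ⟨χ.c p * dd (fun y => χ.c y * χ.r y) p (φ.e p, 0), ?_⟩
    have h2 := congrArg (fun A => χ.c p • A) h1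
    rw [e1, e2]
    change χ.c p • _ = χ.c p • ((χ.c p * χ.r p) • _ + dd (fun y => χ.c y * χ.r y) p _ • _) at h2
    simp only [smul_add, Matrix.add_mul, smul_smul, Matrix.mul_smul, Matrix.smul_mul] at h2 ⊢
    change _ = (χ.c p * (χ.c p * χ.r p)) • _ + _ at h2
    rw [show χ.c p ^ 2 * χ.r p = χ.c p * (χ.c p * χ.r p) by ring]
    rw [add_comm ((χ.c p * _) • φ.S02 p)]
    refine Eq.trans ?_ h2
    change _ = χ.c p • (dm χ.U p (φ.e p, 0) * ψ.S02 p * (χ.U p)ᵀ)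
      + χ.c p • (χ.U p * dm ψ.S02 p (φ.e p, 0) * (χ.U p)ᵀ)
      + χ.c p • (χ.U p * ψ.S02 p * (dm χ.U p (φ.e p, 0))ᵀ)
    abel
  · have h1 := dm_congr_tan hA hp (sP'.smul h.smr) (((sU.transpose.mul sP).mul sU).smul h.smc.conj)
      (hat.mono fun y hy hyM => (hy hyM).P_eq hM hyM) htan
    have hP := h.P_eq hM hp
    rw [dm_smul h.smr sP', dm_smul h.smc.conj ((sU.transpose.mul sP).mul sU),
      dm_mul (sU.transpose.mul sP) sU, dm_mul sU.transpose sP, dm_transpose] at h1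
    have hc0 : conj (χ.c p) ≠ 0 := (map_ne_zero _).2 (h.c_ne hp)
    have h3 : (χ.U p)ᵀ * φ.S0m2 p * χ.U p = (χ.r p * (conj (χ.c p))⁻¹) • ψ.S0m2 p := by
      rw [mul_comm, mul_smul, hP, smul_smul, inv_mul_cancel₀ hc0, one_smul]
    refine ⟨χ.c p * (dd (fun y => conj (χ.c y)) p (φ.e p, 0) * (χ.r p * (conj (χ.c p))⁻¹)
      - dd χ.r p (φ.e p, 0)), ?_⟩
    rw [e1, e2]
    change _ + _ = conj (χ.c p) • ((_ * φ.S0m2 p + (χ.U p)ᵀ * _) * χ.U p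
      + (χ.U p)ᵀ * φ.S0m2 p * _)
      + dd (fun y => conj (χ.c y)) p _ • ((χ.U p)ᵀ * φ.S0m2 p * χ.U p) at h1
    rw [h3] at h1
    simp only [Matrix.add_mul] at h1
    linear_combination (norm := module) χ.c p • h1

end Change

end AdaptedFrame

/-! ### Identities valid in every adapted frame, and the freedom in choosing a frame. -/

theorem transpose_mul_inv_eq {Ξ H : Mat2} (hH : IsUnit H.det) (h : Ξᵀ * H = Hᵀ * Ξ) :
    (Ξ * H⁻¹)ᵀ = Ξ * H⁻¹ := by
  have hHt : IsUnit (Hᵀ).det := by rwa [Matrix.det_transpose]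
  have h1 : Hᵀ * (Ξ * H⁻¹)ᵀ * H = Hᵀ * (Ξ * H⁻¹) * H := by
    rw [Matrix.transpose_mul, Matrix.transpose_nonsing_inv, ← Matrix.mul_assoc,
      Matrix.mul_nonsing_inv _ hHt, Matrix.one_mul, h, Matrix.mul_assoc, Matrix.mul_assoc,
      Matrix.nonsing_inv_mul _ hH, Matrix.mul_one]
  have u1 : IsUnit H := (Matrix.isUnit_iff_isUnit_det _).2 hH
  have u2 : IsUnit Hᵀ := (Matrix.isUnit_iff_isUnit_det _).2 hHt
  exact u2.mul_left_cancel (u1.mul_right_cancel h1)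

namespace KernelChart

variable {M : Hypersurface} {p x : C4} {κ : KernelChart M p} {φ : AdaptedFrame M p}

theorem IsFrame.S_symm (h : κ.IsFrame φ) (hM : M.IsUniformly2Nondegenerate) (hx : x ∈ φ.W)
    (hxM : x ∈ M.carrier) : (φ.S02 x)ᵀ = φ.S02 x := by
  refine transpose_mul_inv_eq (isUnit_iff_ne_zero.2 (φ.det_H hM hx hxM)) ?_
  ext k j
  have hs := κ.Db_symm hM.analytic (h.W_subset hx) hxM j.castSucc k.castSucc
  simp only [Fin.sum_univ_three, Db_c_two, zero_mul, add_zero] at hs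
  simp only [Matrix.mul_apply, Matrix.transpose_apply, Fin.sum_univ_two,
    h.H_eq hM.analytic hx hxM, h.Ξ_eq hM hx hxM, Fin.castSucc_zero, Fin.castSucc_one]
  linear_combination M.dr x (bv κ.j) * hs

/-- The derivative of `S^{0,-2}` along `e`, modulo `S^{0,-2}`, is determined by `Ω`. -/
theorem IsFrame.deriv_P (h : κ.IsFrame φ) (hM : M.IsUniformly2Nondegenerate) (hp : p ∈ M.carrier) :
    ∃ γ : ℂ, applyMat (hol φ.e) φ.S0m2 p =
      (φ.Ω p)ᵀ * φ.S0m2 p + φ.S0m2 p * φ.Ω p + γ • φ.S0m2 p := by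
  have hA := hM.analytic
  have hpW := h.W_subset φ.p_mem
  have hj := κ.dr_ne p hpW
  -- `S^{0,-2}` is `ρ_j ∑ B_{al} F_k(c̄_l)`. Under `e` the factor `B` produces the term with `Ωᵀ`
  -- (`exists_ed_B`), and the factor `F_k(c̄_l)` the term with `Ω` (`ed_D_conj_c`).
  have hP : ∀ y ∈ φ.W, y ∈ M.carrier → ∀ a k, φ.S0m2 y a k = M.dr y (bv κ.j) *
      (κ.Bm a.castSucc 0 y * κ.D k.castSucc (fun z => conj (κ.c 0 z)) y
        + κ.Bm a.castSucc 1 y * κ.D k.castSucc (fun z => conj (κ.c 1 z)) y) := by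
    intro y hy hyM a k
    simp only [AdaptedFrame.S0m2, Matrix.mul_apply, Fin.sum_univ_two, cbar, Matrix.map_apply,
      h.H_eq hA hy hyM, h.Ξ_eq hM hy hyM, map_neg, conj_Gd, Fin.castSucc_zero, Fin.castSucc_one]
    ring
  have sB : ∀ a b, Sm (κ.Bm a b) p := κ.smB hA hpW
  have sD : ∀ k l, Sm (κ.D k (fun z => conj (κ.c l z))) p := fun k l =>
    sm_Fd hA hp.1 hj _ (κ.sm_c l p hpW).conj
  have sj : Sm (fun y => M.dr y (bv κ.j)) p := sm_dr_const hA hp.1 _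
  obtain ⟨ν, hν⟩ := κ.exists_ed_B hA hpW hp
  refine ⟨dd (fun y => M.dr y (bv κ.j)) p (κ.e p, 0) * (M.dr p (bv κ.j))⁻¹ + ν, ?_⟩
  ext a k
  have hev : ∀ᶠ y in 𝓝 p, y ∈ M.carrier → φ.S0m2 y a k = M.dr y (bv κ.j) *
      (κ.Bm a.castSucc 0 y * κ.D k.castSucc (fun z => conj (κ.c 0 z)) y
        + κ.Bm a.castSucc 1 y * κ.D k.castSucc (fun z => conj (κ.c 1 z)) y) :=
    Filter.mem_of_superset (φ.isOpen_W.mem_nhds φ.p_mem) fun y hy hyM => hP y hy hyM a k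
  have s1 : ∀ l, Sm (fun y => κ.Bm a.castSucc l y * κ.D k.castSucc (fun z => conj (κ.c l z)) y) p :=
    fun l => (sB _ _).mul (sD _ _)
  have h1 : applyMat (hol φ.e) φ.S0m2 p a k = _ :=
    dd_congr_tan hA hp (φ.smmP φ.p_mem a k) (sj.mul ((s1 0).add (s1 1))) hev
      (tan_fst (φ.e_mem φ.p_mem hp))
  rw [h1]
  have h2 := dd_mul sj ((s1 0).add (s1 1)) (φ.e p, 0)
  refine h2.trans ?_
  have h3 : ∀ l, dd (fun y => κ.Bm a.castSucc l y * κ.D k.castSucc (fun z => conj (κ.c l z)) y) p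
      (κ.e p, 0) = κ.Bm a.castSucc l p * κ.ed (κ.D k.castSucc (fun z => conj (κ.c l z))) p
        + κ.ed (κ.Bm a.castSucc l) p * κ.D k.castSucc (fun z => conj (κ.c l z)) p :=
    fun l => dd_mul (sB _ _) (sD _ _) _
  have h4 : dd (fun y => κ.Bm a.castSucc 0 y * κ.D k.castSucc (fun z => conj (κ.c 0 z)) y
      + κ.Bm a.castSucc 1 y * κ.D k.castSucc (fun z => conj (κ.c 1 z)) y) p (κ.e p, 0) = _ :=
    dd_add (s1 0) (s1 1) _
  have h5 : dd (fun y => κ.Bm a.castSucc 0 y * κ.D k.castSucc (fun z => conj (κ.c 0 z)) y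
      + κ.Bm a.castSucc 1 y * κ.D k.castSucc (fun z => conj (κ.c 1 z)) y) p (φ.e p, 0) =
      dd (fun y => κ.Bm a.castSucc 0 y * κ.D k.castSucc (fun z => conj (κ.c 0 z)) y
      + κ.Bm a.castSucc 1 y * κ.D k.castSucc (fun z => conj (κ.c 1 z)) y) p (κ.e p, 0) := by
    rw [h.e]
  rw [h5, h4, h3, h3, h.e]
  simp only [Matrix.add_apply, Matrix.smul_apply, Matrix.mul_apply, Matrix.transpose_apply,
    Fin.sum_univ_two, hP p φ.p_mem hp, h.Ω_eq hM φ.p_mem hp, hν, κ.ed_D_conj_c hA hpW hp,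
    Fin.sum_univ_three, D_c_two, Fin.castSucc_zero, Fin.castSucc_one, smul_eq_mul, Pi.add_apply,
    zero_mul, add_zero]
  field_simp
  ring

end KernelChart

namespace AdaptedFrame

variable {M : Hypersurface} {p x : C4} (φ : AdaptedFrame M p)

/-- The law `U S' Uᵀ = c r S` carries symmetry from the frame of a chart to any other one. Having it
on a neighbourhood in `M` allows it to be differentiated. -/
theorem S_symm_near (hM : M.IsUniformly2Nondegenerate) (hp : p ∈ M.carrier) :
    ∀ᶠ x in 𝓝 p, x ∈ M.carrier → (φ.S02 x)ᵀ = φ.S02 x := by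
  obtain ⟨κ⟩ := exists_kernelChart hM.analytic hM.leviRank hp
  obtain ⟨φ₀, h₀⟩ := κ.exists_isFrame hM hp
  obtain ⟨χ, -⟩ := φ₀.nonempty_change φ hM hp
  filter_upwards [χ.eventually_at] with x h hxM
  have hs := h₀.S_symm hM (h hxM).mem hxM
  have h1 := (h hxM).S_eq hM hxM
  have hU := isUnit_iff_ne_zero.2 ((h hxM).det_U hM hxM)
  have u1 : IsUnit (χ.U x) := (Matrix.isUnit_iff_isUnit_det _).2 hU
  have u2 : IsUnit (χ.U x)ᵀ := (Matrix.isUnit_iff_isUnit_det _).2 (by rwa [Matrix.det_transpose])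
  refine u1.mul_left_cancel (u2.mul_right_cancel ?_)
  rw [h1]
  have h2 := congrArg Matrix.transpose h1
  rw [Matrix.transpose_mul, Matrix.transpose_mul, Matrix.transpose_transpose,
    Matrix.transpose_smul, hs] at h2
  rw [← h2, Matrix.mul_assoc]

theorem S_symm (hM : M.IsUniformly2Nondegenerate) (hp : p ∈ M.carrier) :
    (φ.S02 p)ᵀ = φ.S02 p := (φ.S_symm_near hM hp).self_of_nhds hp

theorem deriv_S_symm (hM : M.IsUniformly2Nondegenerate) (hp : p ∈ M.carrier) :
    (applyMat (hol φ.e) φ.S02 p)ᵀ = applyMat (hol φ.e) φ.S02 p := by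
  have hs := φ.smmS hM φ.p_mem hp
  exact dm_congr_tan hM.analytic hp hs.transpose hs (φ.S_symm_near hM hp)
    (tan_fst (φ.e_mem φ.p_mem hp))

/-- The identity is known in the frame of a chart. A change of frame turns `Ω` into `c U⁻¹ (Ω U +
e(U))`, and the extra terms with `e(U)` are exactly those that arise when the law of `S^{0,-2}` is
differentiated, so the form of the identity is invariant. -/
theorem deriv_P (hM : M.IsUniformly2Nondegenerate) (hp : p ∈ M.carrier) :
    ∃ γ : ℂ, applyMat (hol φ.e) φ.S0m2 p =
      (φ.Ω p)ᵀ * φ.S0m2 p + φ.S0m2 p * φ.Ω p + γ • φ.S0m2 p := by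
  obtain ⟨κ⟩ := exists_kernelChart hM.analytic hM.leviRank hp
  obtain ⟨φ₀, h₀⟩ := κ.exists_isFrame hM hp
  obtain ⟨χ, -⟩ := φ₀.nonempty_change φ hM hp
  have h := χ.eventually_at.self_of_nhds hp
  obtain ⟨γ, hγ⟩ := h₀.deriv_P hM hp
  obtain ⟨k, hk⟩ := (χ.derivatives hM hp).2
  have hP := h.P_eq hM hp
  have hΩ := h.Ω_eq hM hp
  have hr := h.r_ne hp
  rw [hγ] at hk
  set U := χ.U p
  set X := dm χ.U p (φ₀.e p, 0)
  set P := φ₀.S0m2 p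
  set P' := φ.S0m2 p
  set Ω := φ₀.Ω p
  set Ω' := φ.Ω p
  have hΩt : Ω'ᵀ * Uᵀ = χ.c p • (Uᵀ * Ωᵀ + Xᵀ) := by
    rw [← Matrix.transpose_mul, hΩ, Matrix.transpose_smul, Matrix.transpose_add,
      Matrix.transpose_mul]
  have key : χ.r p • (Ω'ᵀ * P' + P' * Ω') = (χ.c p * conj (χ.c p)) •
      (Xᵀ * P * U + Uᵀ * (Ωᵀ * P) * U + Uᵀ * (P * Ω) * U + Uᵀ * P * X) := by
    rw [smul_add, ← Matrix.mul_smul, ← Matrix.smul_mul, hP, Matrix.mul_smul, Matrix.smul_mul,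
      ← Matrix.mul_assoc, ← Matrix.mul_assoc, hΩt, Matrix.mul_assoc (Uᵀ * P) U Ω', hΩ]
    simp only [Matrix.smul_mul, Matrix.mul_smul, Matrix.add_mul, Matrix.mul_add, Matrix.mul_assoc,
      smul_smul, smul_add]
    module
  refine ⟨(χ.r p)⁻¹ * k + χ.c p * γ, ?_⟩
  have hfin : χ.r p • applyMat (hol φ.e) φ.S0m2 p = χ.r p • (Ω'ᵀ * P' + P' * Ω' +
      ((χ.r p)⁻¹ * k + χ.c p * γ) • P') := by
    rw [hk, smul_add (χ.r p) (Ω'ᵀ * P' + P' * Ω'), key, smul_smul, show χ.r p * ((χ.r p)⁻¹ * k + χ.c p * γ) =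
      k + χ.c p * γ * χ.r p by field_simp, add_smul k, mul_smul (χ.c p * γ), hP]
    simp only [Matrix.mul_add, Matrix.add_mul, Matrix.mul_smul, Matrix.smul_mul, smul_add,
      smul_smul]
    module
  exact smul_right_injective _ hr hfin

/-- If `S` vanished, so would `Ξ`, and `[e, Ȳ]` would lie in `𝒦 ⊕ ℋ̄` at `p` for every section `Y`,
the direction `ē` being covered by `dd_e_e_bar`. This contradicts 2-nondegeneracy. -/
theorem S_ne_zero (hM : M.IsUniformly2Nondegenerate) (hp : p ∈ M.carrier) : φ.S02 p ≠ 0 := by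
  have hA := hM.analytic
  intro h0
  have hΞ : φ.Ξ p = 0 := by
    have : φ.S02 p * φ.H p = φ.Ξ p := by
      rw [S02, Matrix.mul_assoc,
        Matrix.nonsing_inv_mul _ (isUnit_iff_ne_zero.2 (φ.det_H hM φ.p_mem hp)), Matrix.mul_one]
    rw [← this, h0, Matrix.zero_mul]
  obtain ⟨Y, hY, hn⟩ := hM.nondeg p hp φ.W φ.e φ.isOpen_W φ.W_subset φ.p_mem φ.section_e φ.kernel_e
    (φ.toPre.e_ne_zero φ.p_mem hp)
  apply hn
  have hYs := hY.secAt φ.isOpen_W φ.p_mem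
  have hYp := hY.mem p φ.p_mem hp
  rw [lieBr_hol_antihol, KHFib, Set.mem_ofPred_eq]
  constructor
  · have hc := φ.toPre.co_spec (φ.toPre.det_ne_zero φ.p_mem hp) (Y p)
    rw [(φ.toPre.mem_HFib_iff φ.p_mem hp).1 hYp, zero_smul, zero_add] at hc
    have h1 : dd φ.e p (0, star (Y p)) =
        conj (φ.toPre.co p (Y p) 1) • dd φ.e p (0, star (φ.f 0 p))
        + conj (φ.toPre.co p (Y p) 2) • dd φ.e p (0, star (φ.f 1 p))
        + conj (φ.toPre.co p (Y p) 3) • dd φ.e p (0, star (φ.e p)) := by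
      rw [← map_smul, ← map_smul, ← map_smul, ← map_add, ← map_add]
      congr 1
      conv_lhs => rw [hc]
      simp [toPre]
    obtain ⟨d0, hd0⟩ := φ.dd_e_snd hM φ.p_mem hp 0
    obtain ⟨d1, hd1⟩ := φ.dd_e_snd hM φ.p_mem hp 1
    obtain ⟨d2, hd2⟩ := φ.dd_e_e_bar hM φ.p_mem hp
    rw [hd0, hd1, hd2, hΞ] at h1
    rw [φ.toPre.mem_KFib_iff_smul hM φ.p_mem hp]
    refine ⟨-(conj (φ.toPre.co p (Y p) 1) * d0 + conj (φ.toPre.co p (Y p) 2) * d1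
      + conj (φ.toPre.co p (Y p) 3) * d2), ?_⟩
    change - dd φ.e p (0, star (Y p)) = _ • φ.e p
    rw [h1]
    simp only [Matrix.zero_apply, zero_smul, Finset.sum_const_zero, neg_zero, zero_add]
    module
  · simp only
    rw [star_dd' hYs.sm, cc_mk, star_zero, mem_HFib, dr_dd_snd hA hp hYs (φ.e_mem φ.p_mem hp),
      ← hess_conj hA hp.1, φ.hess_e hA φ.p_mem hp hYp]
    simp

theorem H_herm (hM : M.IsUniformly2Nondegenerate) (hp : p ∈ M.carrier) :
    cbar (φ.H p) = (φ.H p)ᵀ := by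
  ext a b
  exact φ.H_conj hM.analytic φ.p_mem hp a b

theorem S_mul_H (hM : M.IsUniformly2Nondegenerate) (hp : p ∈ M.carrier) :
    φ.S02 p * φ.H p = φ.Ξ p := by
  rw [S02, Matrix.mul_assoc,
    Matrix.nonsing_inv_mul _ (isUnit_iff_ne_zero.2 (φ.det_H hM φ.p_mem hp)), Matrix.mul_one]

theorem P_eq (hM : M.IsUniformly2Nondegenerate) (hp : p ∈ M.carrier) :
    φ.S0m2 p = φ.H p * cbar (φ.S02 p) * (φ.H p)ᵀ := by
  rw [S0m2, ← φ.S_mul_H hM hp, cbar_mul, φ.H_herm hM hp, Matrix.mul_assoc]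

theorem dd_coord (i : Fin 4) (x : C4) (V : C4 × C4) : dd (fun y : C4 => y i) x V = V.1 i := by
  have h : ∀ v, fderiv ℝ (fun y : C4 => y i) x v = v i := fun v =>
    congrArg (fun T => T v) (ContinuousLinearMap.proj (R := ℝ) (φ := fun _ : Fin 4 => ℂ) i).fderiv
  simp only [dd_def, h, Pi.smul_apply, smul_eq_mul]
  linear_combination (-(1 / 2) * V.1 i + (1 / 2) * star V.2 i) * Complex.I_mul_I

/-- Adapted frames may be changed with arbitrary first order data at `p`. -/
theorem exists_change (hM : M.IsUniformly2Nondegenerate) (hp : p ∈ M.carrier) {U₀ : Mat2}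
    (hU : U₀.det ≠ 0) (X : Mat2) {c : ℂ} (hc : c ≠ 0) {r : ℝ} (hr : r ≠ 0) :
    ∃ (ψ : AdaptedFrame M p) (χ : Change φ ψ), χ.U p = U₀ ∧ dm χ.U p (φ.e p, 0) = X ∧
      χ.c p = c ∧ χ.r p = r ∧ (U₀ = 1 → c = 1 → r = 1 → ψ.SameAt φ) := by
  have hA := hM.analytic
  obtain ⟨i, hi⟩ : ∃ i, φ.e p i ≠ 0 := by
    by_contra! h
    exact φ.toPre.e_ne_zero φ.p_mem hp (funext h)
  -- An affine function with `ℓ(p) = 0` and `e(ℓ)(p) = 1`; hence `U₀ + ℓ X` has the prescribed value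
  -- and the prescribed derivative along `e` at `p`.
  set ℓ : C4 → ℂ := fun y => (φ.e p i)⁻¹ * (y i - p i) with hℓ
  have sc : ∀ x, Sm (fun y : C4 => y i) x := fun x =>
    (ContinuousLinearMap.proj (R := ℝ) (φ := fun _ : Fin 4 => ℂ) i).contDiff.contDiffAt
  have sℓ : ∀ x, Sm ℓ x := fun x => contDiffAt_const.mul ((sc x).sub contDiffAt_const)
  have hℓp : ℓ p = 0 := by simp [hℓ]
  have dℓ : dd ℓ p (φ.e p, 0) = 1 := by
    rw [hℓ, dd_const_mul _ ((sc p).sub contDiffAt_const), dd_sub (sc p) contDiffAt_const, dd_const,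
      dd_coord]
    simp [hi]
  set U : C4 → Mat2 := fun y => U₀ + ℓ y • X with hUdef
  have sU : ∀ x, Smm U x := fun x a b => contDiffAt_const.add ((sℓ x).mul contDiffAt_const)
  have hUp : U p = U₀ := by simp [hUdef, hℓp]
  have sdet : ∀ x, Sm (fun y => (U y).det) x := fun x => by
    simp only [Matrix.det_fin_two]
    exact ((sU x 0 0).mul (sU x 1 1)).sub ((sU x 0 1).mul (sU x 1 0))
  have hWo : IsOpen {y | y ∈ φ.W ∧ (U y).det ≠ 0} := by
    rw [isOpen_iff_mem_nhds]
    rintro y ⟨hy, hy0⟩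
    exact Filter.inter_mem (φ.isOpen_W.mem_nhds hy) ((sdet y).continuousAt.eventually_ne hy0)
  have sf : ∀ k, ∀ x ∈ φ.W, Sm (fun y => ∑ l, U y l k • φ.f l y) x := fun k x hx =>
    ContDiffAt.sum fun l _ => (sU x l k).smul (φ.secf hx l).sm
  let ψ₀ : PreFrame M p :=
    { W := {y | y ∈ φ.W ∧ (U y).det ≠ 0}
      isOpen_W := hWo
      W_subset := fun y hy => φ.W_subset hy.1
      p_mem := ⟨φ.p_mem, by rw [hUp]; exact hU⟩
      g := fun y => (r : ℂ) • φ.g y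
      f := fun k y => ∑ l, U y l k • φ.f l y
      e := fun y => c • φ.e y
      smooth_g := fun x hx => ((φ.toPre.smg hx.1).const_smul _).contDiffWithinAt
      tangent_g := fun x hx hxM => by
        have h1 := φ.tangent_g x hx.1 hxM
        have h2 : ((r : ℂ) • φ.g x) = r • φ.g x := by ext; simp
        rw [h2, map_smul, h1, smul_zero]
      transverse_g := fun x hx hxM h => φ.transverse_g x hx.1 hxM (by
        rw [mem_HFib, dr_smul] at h
        rw [mem_HFib]
        exact (mul_eq_zero.1 h).resolve_left (by exact_mod_cast hr))
      section_f := fun k => ⟨fun x hx => (sf k x hx.1).contDiffWithinAt, fun x hx hxM => by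
        rw [mem_HFib, dr_sum]
        exact Finset.sum_eq_zero fun l _ => by
          rw [dr_smul, mem_HFib.1 (φ.f_mem hx.1 hxM l), mul_zero]⟩
      section_e := ⟨fun x hx => ((φ.sece hx.1).sm.const_smul _).contDiffWithinAt,
        fun x hx hxM => HFib_smul _ (φ.e_mem hx.1 hxM)⟩
      kernel_e := fun x hx hxM => KFib_smul hA hxM _ (φ.kernel_e x hx.1 hxM)
      independent := fun x hx hxM => by
        rw [Fintype.linearIndependent_iff]
        intro g hg
        have hg' : g 0 • (∑ l, U x l 0 • φ.f l x) + g 1 • (∑ l, U x l 1 • φ.f l x)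
            + g 2 • (c • φ.e x) = 0 := by
          rw [Fin.sum_univ_three] at hg
          exact hg
        simp only [Fin.sum_univ_two] at hg'
        have h1 := φ.toPre.indep hx.1 hxM (a := g 0 * U x 0 0 + g 1 * U x 0 1)
          (b := g 0 * U x 1 0 + g 1 * U x 1 1) (c := g 2 * c) (by
            change _ • φ.f 0 x + _ • φ.f 1 x + _ • φ.e x = 0
            rw [← hg']; module)
        have hd : U x 0 0 * U x 1 1 - U x 0 1 * U x 1 0 ≠ 0 := by
          rw [← Matrix.det_fin_two]; exact hx.2
        obtain ⟨e0, e1, e2⟩ := h1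
        intro i
        fin_cases i
        · refine (mul_eq_zero.1 (?_ : g 0 * _ = 0)).resolve_right hd
          linear_combination U x 1 1 * e0 - U x 0 1 * e1
        · refine (mul_eq_zero.1 (?_ : g 1 * _ = 0)).resolve_right hd
          linear_combination U x 0 0 * e1 - U x 1 0 * e0
        · exact (mul_eq_zero.1 e2).resolve_right hc }
  obtain ⟨ψ, hg, hf, he, hW⟩ := ψ₀.exists_adaptedFrame hM hp
  refine ⟨ψ, ⟨U, fun _ _ => 0, fun _ => c, fun _ => r, Filter.Eventually.of_forall sU,
    Filter.Eventually.of_forall fun _ _ => contDiffAt_const,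
    Filter.Eventually.of_forall fun _ => contDiffAt_const,
    Filter.Eventually.of_forall fun _ => contDiffAt_const,
    Filter.Eventually.of_forall fun x _ k => ?_, Filter.Eventually.of_forall fun x _ => ?_,
    Filter.Eventually.of_forall fun x _ => ?_⟩, hUp, ?_, rfl, rfl, ?_⟩
  · rw [hf, zero_smul, add_zero]
  · rw [he]
  · rw [hg, dr_smul]
  · ext a b
    have h1 : dd (fun y => U y a b) p (φ.e p, 0) = dd ℓ p (φ.e p, 0) * X a b := by
      have h2 : (fun y => U y a b) = fun y => U₀ a b + X a b * ℓ y := by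
        funext y; simp [hUdef, mul_comm]
      rw [h2, dd_add contDiffAt_const (contDiffAt_const.mul (sℓ p)), dd_const,
        dd_const_mul _ (sℓ p)]
      ring
    change dd (fun y => U y a b) p (φ.e p, 0) = X a b
    rw [h1, dℓ, one_mul]
  · rintro h1 rfl rfl
    refine ⟨?_, fun a => ?_, ?_⟩
    · rw [hg]; simp [ψ₀]
    · rw [hf]
      change ∑ l, U p l a • φ.f l p = _
      rw [hUp, h1]
      fin_cases a <;> simp [Matrix.one_apply]
    · rw [he]; simp [ψ₀]

theorem exists_frame (hM : M.IsUniformly2Nondegenerate) (hp : p ∈ M.carrier) :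
    Nonempty (AdaptedFrame M p) := by
  obtain ⟨κ⟩ := exists_kernelChart hM.analytic hM.leviRank hp
  obtain ⟨φ₀, -⟩ := κ.exists_isFrame hM hp
  exact ⟨φ₀⟩

end AdaptedFrame

/-! ### Degree zero parts of bigraded and modified symbols -/

theorem cbar_one : cbar (1 : Mat2) = 1 := by
  simp [cbar, Matrix.map_one]

theorem cbar_zero : cbar (0 : Mat2) = 0 := by
  simp [cbar]

theorem cbar_add (A B : Mat2) : cbar (A + B) = cbar A + cbar B := by
  ext; simp [cbar]

theorem cbar_inv (A : Mat2) : cbar A⁻¹ = (cbar A)⁻¹ := by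
  ext i j
  fin_cases i <;> fin_cases j <;>
    simp [cbar, Matrix.inv_def, Matrix.adjugate_fin_two, Matrix.det_fin_two]

/-- Viewing the bigraded symbol as a modified symbol lets one equivalence criterion serve both. -/
theorem bigradedSymbol_eq (H S : Mat2) : bigradedSymbol H S = modSymbol H S 0 := by
  have h : iotaMod H S 0 = ofS H S := by simp [iotaMod, ofGL]
  rw [bigradedSymbol, modSymbol, h, g02, g0m2]

theorem bigradedEquiv_iff {H S H' S' : Mat2} :
    BigradedEquiv H S H' S' ↔ ModEquiv H S 0 H' S' 0 := by
  simp only [BigradedEquiv, ModEquiv, bigradedSymbol_eq]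

theorem ofGL_add (H L L' : Mat2) : ofGL H (L + L') = ofGL H L + ofGL H L' := by
  simp [ofGL, Matrix.fromBlocks_add, Matrix.mul_add, Matrix.add_mul]
  abel

theorem ofGL_smul (H : Mat2) (c : ℂ) (L : Mat2) : ofGL H (c • L) = c • ofGL H L := by
  simp [ofGL, Matrix.fromBlocks_smul]

theorem ofGL_sub (H L L' : Mat2) : ofGL H (L - L') = ofGL H L - ofGL H L' := by
  rw [sub_eq_add_neg, ← neg_one_smul ℂ, ofGL_add, ofGL_smul]
  module

theorem ofS_smul (H : Mat2) (c : ℂ) (S : Mat2) : ofS H (c • S) = c • ofS H S := by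
  simp [ofS, Matrix.fromBlocks_smul]

theorem sigma_fromBlocks (A B C D : Mat2) :
    sigma (Matrix.fromBlocks A B C D) =
      Matrix.fromBlocks (cbar D) (cbar C) (cbar B) (cbar A) := by
  ext (i | i) (j | j) <;> rfl

theorem sigma_add (D E : Mat22) : sigma (D + E) = sigma D + sigma E := by
  ext i j; simp [sigma, cbar]

theorem sigma_smul (c : ℂ) (D : Mat22) : sigma (c • D) = conj c • sigma D := by
  ext i j; simp [sigma, cbar]

theorem sigma_mul (D E : Mat22) : sigma (D * E) = sigma D * sigma E := by
  simp only [sigma, cbar, Matrix.map_mul]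
  exact (Matrix.submatrix_mul_equiv _ _ Sum.swap (Equiv.sumComm (Fin 2) (Fin 2)) Sum.swap).symm

theorem sigma_one : sigma 1 = 1 := by
  rw [← Matrix.fromBlocks_one, sigma_fromBlocks, cbar_one]
  congr 1 <;> ext <;> simp [cbar]

/-- The pair `(H, S)` consists of an invertible Hermitian matrix and a nonzero matrix. -/
structure IsPair (H S : Mat2) : Prop where
  herm : cbar H = Hᵀ
  unit : IsUnit H.det
  ne : S ≠ 0

section

variable {H S : Mat2}

namespace IsPair

theorem unit_transpose (h : IsPair H S) : IsUnit (Hᵀ).det := by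
  rw [Matrix.det_transpose]; exact h.unit

theorem mul_inv (h : IsPair H S) : H * H⁻¹ = 1 := Matrix.mul_nonsing_inv _ h.unit

theorem inv_mul (h : IsPair H S) : H⁻¹ * H = 1 := Matrix.nonsing_inv_mul _ h.unit

theorem transpose_inv_mul (h : IsPair H S) : Hᵀ⁻¹ * Hᵀ = 1 :=
  Matrix.nonsing_inv_mul _ h.unit_transpose

theorem mul_inv_cancel (h : IsPair H S) (B : Mat2) : H * (H⁻¹ * B) = B :=
  Matrix.mul_nonsing_inv_cancel_left _ _ h.unit

theorem inv_mul_cancel (h : IsPair H S) (B : Mat2) : H⁻¹ * (H * B) = B :=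
  Matrix.nonsing_inv_mul_cancel_left _ _ h.unit

theorem transpose_inv_mul_cancel (h : IsPair H S) (B : Mat2) : Hᵀ⁻¹ * (Hᵀ * B) = B :=
  Matrix.nonsing_inv_mul_cancel_left _ _ h.unit_transpose

end IsPair

/-- The `csp` condition with factor `c` determines the lower block, `c - H⁻¹ Lᵀ H`. Splitting off
`-c/2` times the grading element leaves a derivation that kills `g`. -/
theorem mem_g00_iff (h : IsPair H S) {D : Mat22} :
    D ∈ g00 H S ↔ ∃ c : ℂ, ∃ L ∈ g00' H S, D = c • gradingElement + ofGL H L := by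
  have hH := h.unit
  have hgr : gradingElement ∈ g00 H S := by
    refine ⟨⟨-2, ?_⟩, ?_, ?_, fun w _ => ?_, fun w _ => ?_⟩
    · simp only [gradingElement, Matrix.transpose_neg, Matrix.transpose_one, neg_mul, one_mul,
        mul_neg, mul_one]
      module
    · ext i j; simp [gradingElement, Matrix.toBlocks₁₂]
    · ext i j; simp [gradingElement, Matrix.toBlocks₂₁]
    · simp [gradingElement]
    · simp [gradingElement]
  constructor
  · intro hD
    obtain ⟨⟨c, hc⟩, h12, h21, -⟩ := id hD
    have hDb : D = Matrix.fromBlocks D.toBlocks₁₁ 0 0 D.toBlocks₂₂ := by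
      conv_lhs => rw [← Matrix.fromBlocks_toBlocks D, h12, h21]
    set L := D.toBlocks₁₁
    set N := D.toBlocks₂₂
    have h1 : Lᵀ * H + H * N = c • H := by
      have := congrArg Matrix.toBlocks₁₂ hc
      rw [hDb, heisForm, Matrix.fromBlocks_transpose, Matrix.fromBlocks_multiply,
        Matrix.fromBlocks_multiply, Matrix.fromBlocks_add, Matrix.fromBlocks_smul] at this
      simpa using this
    have hN : N = c • 1 - H⁻¹ * Lᵀ * H := by
      have h2 : H⁻¹ * (Lᵀ * H + H * N) = H⁻¹ * (c • H) := by rw [h1]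
      rw [Matrix.mul_add, Matrix.nonsing_inv_mul_cancel_left _ _ hH, Matrix.mul_smul,
        Matrix.nonsing_inv_mul _ hH, ← Matrix.mul_assoc] at h2
      rw [← h2]; abel
    have key : D = (-(c / 2)) • gradingElement + ofGL H (L - (c / 2) • 1) := by
      rw [hDb, hN, gradingElement, ofGL, ← Matrix.fromBlocks_one, Matrix.fromBlocks_neg,
        Matrix.fromBlocks_smul, Matrix.fromBlocks_add]
      congr 1
      · module
      · simp
      · simp
      · rw [Matrix.transpose_sub, Matrix.transpose_smul, Matrix.transpose_one, Matrix.mul_sub,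
          Matrix.sub_mul, Matrix.mul_smul, Matrix.smul_mul, Matrix.mul_one,
          Matrix.nonsing_inv_mul _ hH]
        module
    refine ⟨_, _, ?_, key⟩
    have : ofGL H (L - (c / 2) • 1) = D - (-(c / 2)) • gradingElement := by
      conv_rhs => rw [key]
      abel
    change ofGL H _ ∈ g00 H S
    rw [this]
    exact sub_mem hD (Submodule.smul_mem _ _ hgr)
  · rintro ⟨c, L, hL, rfl⟩
    exact add_mem (Submodule.smul_mem _ _ hgr) hL

theorem sigma_ofS (h : IsPair H S) (T : Mat2) :
    sigma (ofS H T) = Matrix.fromBlocks 0 0 (cbar T * Hᵀ) 0 := by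
  rw [ofS, sigma_fromBlocks, cbar_mul, h.herm]
  congr 1 <;> ext <;> simp [cbar]

theorem sigma_ofGL (h : IsPair H S) (L : Mat2) : sigma (ofGL H L) = ofGL H (sigmaGL H L) := by
  have hHt := h.unit_transpose
  rw [ofGL, sigma_fromBlocks, ofGL, sigmaGL]
  congr 1
  · rw [← neg_one_smul ℂ, cbar_smul, cbar_mul, cbar_mul, cbar_inv, h.herm, cbar_transpose]
    simp
  · ext; simp [cbar]
  · ext; simp [cbar]
  · rw [Matrix.transpose_neg, Matrix.transpose_mul, Matrix.transpose_mul,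
      Matrix.transpose_nonsing_inv, Matrix.transpose_transpose, Matrix.transpose_transpose]
    simp [Matrix.mul_assoc, h.inv_mul_cancel, h.inv_mul]

/-- `H S̄ Hᵀ` is `S^{0,-2}`. -/
def Pm (H S : Mat2) : Mat2 := H * cbar S * Hᵀ

theorem cbar_Pm (h : IsPair H S) : cbar (Pm H S) = Hᵀ * S * H := by
  rw [Pm, cbar_mul, cbar_mul, cbar_cbar, cbar_transpose, h.herm, Matrix.transpose_transpose]

theorem IsPair.P_ne (h : IsPair H S) : Pm H S ≠ 0 := by
  intro h0
  have hHt := h.unit_transpose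
  have h1 : Hᵀ * S * H = 0 := by
    rw [← cbar_Pm h, h0]; ext; simp [cbar]
  apply h.ne
  have h2 : (Hᵀ)⁻¹ * (Hᵀ * S * H) * H⁻¹ = S := by
    simp [Matrix.mul_assoc, h.mul_inv, h.transpose_inv_mul_cancel]
  rw [← h2, h1]; simp

theorem commutator_ofS (h : IsPair H S) (L T : Mat2) :
    ofGL H L * ofS H T - ofS H T * ofGL H L = ofS H (L * T + T * Lᵀ) := by
  rw [ofGL, ofS, ofS, Matrix.fromBlocks_multiply, Matrix.fromBlocks_multiply,
    sub_eq_add_neg, Matrix.fromBlocks_neg, Matrix.fromBlocks_add]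
  congr 1 <;> simp [Matrix.mul_assoc, h.mul_inv_cancel, Matrix.add_mul]

theorem commutator_sigma_ofS (h : IsPair H S) (L : Mat2) :
    ofGL H L * sigma (ofS H S) - sigma (ofS H S) * ofGL H L =
      Matrix.fromBlocks 0 0 (-(H⁻¹ * (Lᵀ * Pm H S + Pm H S * L))) 0 := by
  rw [ofGL, sigma_ofS h, Matrix.fromBlocks_multiply, Matrix.fromBlocks_multiply,
    sub_eq_add_neg, Matrix.fromBlocks_neg, Matrix.fromBlocks_add, Pm]
  congr 1 <;> simp [Matrix.mul_assoc, h.inv_mul_cancel, Matrix.mul_add]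
  abel

theorem ofS_injective (hH : IsUnit H.det) {T T' : Mat2} (h : ofS H T = ofS H T') : T = T' := by
  have h1 : T * H = T' * H := congrArg Matrix.toBlocks₁₂ h
  have h2 : T * H * H⁻¹ = T' * H * H⁻¹ := by rw [h1]
  simpa [Matrix.mul_assoc, Matrix.mul_nonsing_inv _ hH] using h2

/-- The commutator of `L` with `g_{0,2}` acts on `S` by `L S + S Lᵀ`, and that with `g_{0,-2}` acts
on `H S̄ Hᵀ` by `-(Lᵀ P + P L)`. The remaining conditions are automatic for `ofGL`. -/
theorem mem_g00'_iff (h : IsPair H S) {L : Mat2} :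
    L ∈ g00' H S ↔ (∃ a : ℂ, L * S + S * Lᵀ = a • S) ∧
      ∃ b : ℂ, Lᵀ * Pm H S + Pm H S * L = b • Pm H S := by
  have hP : sigma (ofS H S) = Matrix.fromBlocks 0 0 (H⁻¹ * Pm H S) 0 := by
    rw [sigma_ofS h, Pm]; simp [Matrix.mul_assoc, h.inv_mul_cancel]
  constructor
  · rintro ⟨-, -, -, h1, h2⟩
    have h1' := h1 _ (Submodule.mem_span_singleton_self _)
    have h2' := h2 _ (Submodule.mem_span_singleton_self _)
    rw [commutator_ofS h] at h1'
    rw [commutator_sigma_ofS h] at h2'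
    obtain ⟨a, ha⟩ := Submodule.mem_span_singleton.1 h1'
    obtain ⟨b, hb⟩ := Submodule.mem_span_singleton.1 h2'
    refine ⟨⟨a, ?_⟩, ⟨-b, ?_⟩⟩
    · rw [← ofS_smul] at ha
      exact (ofS_injective h.unit ha).symm
    · rw [hP, Matrix.fromBlocks_smul] at hb
      have h3 : b • (H⁻¹ * Pm H S) = -(H⁻¹ * (Lᵀ * Pm H S + Pm H S * L)) :=
        congrArg Matrix.toBlocks₂₁ hb
      have h4 : H * (b • (H⁻¹ * Pm H S)) = H * -(H⁻¹ * (Lᵀ * Pm H S + Pm H S * L)) := by rw [h3]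
      rw [Matrix.mul_smul, Matrix.mul_neg, Matrix.mul_nonsing_inv_cancel_left _ _ h.unit,
        Matrix.mul_nonsing_inv_cancel_left _ _ h.unit] at h4
      rw [neg_smul, h4, neg_neg]
  · rintro ⟨⟨a, ha⟩, ⟨b, hb⟩⟩
    refine ⟨⟨0, ?_⟩, ?_, ?_, fun w hw => ?_, fun w hw => ?_⟩
    · rw [ofGL, heisForm, Matrix.fromBlocks_transpose, Matrix.fromBlocks_multiply,
        Matrix.fromBlocks_multiply, Matrix.fromBlocks_add, zero_smul, ← Matrix.fromBlocks_zero]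
      congr 1 <;> simp [Matrix.mul_assoc, h.mul_inv_cancel, Matrix.transpose_mul,
        Matrix.transpose_nonsing_inv, h.transpose_inv_mul]
    · simp [ofGL]
    · simp [ofGL]
    · obtain ⟨c, rfl⟩ := Submodule.mem_span_singleton.1 hw
      rw [Matrix.mul_smul, Matrix.smul_mul, ← smul_sub, commutator_ofS h, ha, ofS_smul]
      exact Submodule.smul_mem _ _ (Submodule.smul_mem _ _ (Submodule.mem_span_singleton_self _))
    · obtain ⟨c, rfl⟩ := Submodule.mem_span_singleton.1 hw
      have : ofGL H L * sigma (ofS H S) - sigma (ofS H S) * ofGL H L =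
          (-b) • sigma (ofS H S) := by
        rw [commutator_sigma_ofS h, hb, hP, Matrix.fromBlocks_smul]
        congr 1 <;> simp
      rw [Matrix.mul_smul, Matrix.smul_mul, ← smul_sub, this]
      exact Submodule.smul_mem _ _ (Submodule.smul_mem _ _ (Submodule.mem_span_singleton_self _))

/-- `g'_{0,0}` as a subspace of `gl(2, ℂ)`. -/
def g00'Sub (H S : Mat2) : Submodule ℂ Mat2 where
  carrier := g00' H S
  add_mem' := fun {a b} ha hb => by
    change ofGL H (a + b) ∈ g00 H S
    rw [ofGL_add]; exact add_mem ha hb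
  zero_mem' := by
    change ofGL H 0 ∈ g00 H S
    have : ofGL H 0 = 0 := by simp [ofGL]
    rw [this]; exact zero_mem _
  smul_mem' := fun c {a} ha => by
    change ofGL H (c • a) ∈ g00 H S
    rw [ofGL_smul]; exact Submodule.smul_mem _ _ ha

theorem mem_g00'Sub {L : Mat2} : L ∈ g00'Sub H S ↔ L ∈ g00' H S := Iff.rfl

/-- The involution exchanges the two conditions of `mem_g00'_iff`: the conjugate of either one for
`L` is, up to factors of `H`, the other one for `σ(L)`. -/
theorem sigmaGL_mem (h : IsPair H S) {L : Mat2} (hL : L ∈ g00' H S) : sigmaGL H L ∈ g00' H S := by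
  have hHt := h.unit_transpose
  obtain ⟨⟨a, ha⟩, ⟨b, hb⟩⟩ := (mem_g00'_iff h).1 hL
  refine (mem_g00'_iff h).2 ⟨⟨-conj b, ?_⟩, ⟨-conj a, ?_⟩⟩
  · have h1 := congrArg cbar hb
    rw [cbar_smul, cbar_Pm h] at h1
    have h1' : (cbar L)ᵀ * (Hᵀ * S * H) + Hᵀ * S * H * cbar L = conj b • (Hᵀ * S * H) := by
      rw [← h1, ← cbar_Pm h, ← cbar_transpose, ← cbar_mul, ← cbar_mul, ← cbar_add]
    have h2 : (Hᵀ)⁻¹ * ((cbar L)ᵀ * (Hᵀ * S * H) + Hᵀ * S * H * cbar L) * H⁻¹ =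
      (Hᵀ)⁻¹ * (conj b • (Hᵀ * S * H)) * H⁻¹ := by rw [h1']
    simp only [sigmaGL, Matrix.transpose_neg, Matrix.transpose_mul, Matrix.transpose_nonsing_inv,
      Matrix.transpose_transpose]
    simp only [Matrix.mul_add, Matrix.add_mul, Matrix.mul_assoc, Matrix.mul_smul, Matrix.smul_mul,
      Matrix.mul_nonsing_inv _ h.unit, Matrix.mul_one,
      Matrix.nonsing_inv_mul_cancel_left _ _ hHt] at h2
    rw [neg_smul, ← h2]
    simp only [Matrix.neg_mul, Matrix.mul_neg, Matrix.mul_assoc]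
    abel
  · have h1 := congrArg cbar ha
    rw [cbar_smul] at h1
    have h1' : cbar L * cbar S + cbar S * (cbar L)ᵀ = conj a • cbar S := by
      rw [← h1, ← cbar_transpose, ← cbar_mul, ← cbar_mul, ← cbar_add]
    have h2 : H * (cbar L * cbar S + cbar S * (cbar L)ᵀ) * Hᵀ =
      H * (conj a • cbar S) * Hᵀ := by rw [h1']
    simp only [sigmaGL, Pm, Matrix.transpose_neg, Matrix.transpose_mul,
      Matrix.transpose_nonsing_inv, Matrix.transpose_transpose]
    simp only [Matrix.mul_add, Matrix.add_mul, Matrix.mul_assoc, Matrix.mul_smul,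
      Matrix.smul_mul] at h2
    simp only [Matrix.neg_mul, Matrix.mul_neg, Matrix.mul_assoc,
      Matrix.nonsing_inv_mul_cancel_left _ _ h.unit, Matrix.mul_nonsing_inv_cancel_left _ _ hHt]
    rw [neg_smul, ← h2]
    abel

theorem iotaMod_mem (H S Ω : Mat2) : iotaMod H S Ω ∈ modSymbol H S Ω :=
  Submodule.mem_sup_right (Submodule.mem_span_singleton_self _)

theorem g00_le_modSymbol (H S Ω : Mat2) : g00 H S ≤ modSymbol H S Ω :=
  le_sup_of_le_left le_sup_right

theorem sigma_iotaMod_mem (H S Ω : Mat2) : sigma (iotaMod H S Ω) ∈ modSymbol H S Ω :=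
  Submodule.mem_sup_left (Submodule.mem_sup_left (Submodule.mem_span_singleton_self _))

/-- Compare blocks. The lower left one excludes the generator `σ(ι)`, the upper right one determines
the coefficient `y` of `ι`, and what is left must belong to `g_{0,0}`. -/
theorem iota_mem_modSymbol_iff (h : IsPair H S) {T L Ω : Mat2} :
    ofS H T + ofGL H L ∈ modSymbol H S Ω ↔ ∃ y : ℂ, T = y • S ∧ L - y • Ω ∈ g00' H S := by
  constructor
  · intro hm
    obtain ⟨u, hu, v, hv, huv⟩ := Submodule.mem_sup.1 hm
    obtain ⟨u₁, hu₁, E, hE, rfl⟩ := Submodule.mem_sup.1 hu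
    obtain ⟨x, rfl⟩ := Submodule.mem_span_singleton.1 hu₁
    obtain ⟨y, rfl⟩ := Submodule.mem_span_singleton.1 hv
    obtain ⟨d, K, hK, rfl⟩ := (mem_g00_iff h).1 hE
    have hx : x = 0 := by
      have h1 := congrArg Matrix.toBlocks₂₁ huv
      have h2 : x • (cbar S * Hᵀ) = 0 := by
        rw [iotaMod, sigma_add, sigma_ofS h, sigma_ofGL h, ofGL, ofGL, ofGL, ofGL, ofS, ofS,
          gradingElement, ← Matrix.fromBlocks_one] at h1
        simpa only [Matrix.toBlocks_fromBlocks₂₁, smul_zero, neg_zero, add_zero, zero_add, Matrix.fromBlocks_add, Matrix.fromBlocks_smul, Matrix.fromBlocks_neg] using h1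
      refine (smul_eq_zero.1 h2).resolve_right fun h3 => h.P_ne ?_
      rw [Pm, Matrix.mul_assoc, h3, Matrix.mul_zero]
    subst hx
    have hT : T = y • S := by
      have h1 := congrArg Matrix.toBlocks₁₂ huv
      apply ofS_injective h.unit
      rw [zero_smul, iotaMod, ofGL, ofGL, ofGL, ofS, ofS,
          gradingElement, ← Matrix.fromBlocks_one] at h1
      have h2 : y • (S * H) = T * H := by
        simpa only [Matrix.toBlocks_fromBlocks₁₂, smul_zero, neg_zero, add_zero, zero_add, Matrix.fromBlocks_add, Matrix.fromBlocks_smul, Matrix.fromBlocks_neg] using h1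
      rw [ofS, ofS, Matrix.smul_mul, h2]
    refine ⟨y, hT, ?_⟩
    change ofGL H (L - y • Ω) ∈ g00 H S
    have : ofGL H (L - y • Ω) = d • gradingElement + ofGL H K := by
      rw [zero_smul, zero_add, iotaMod, smul_add, hT, ofS_smul] at huv
      rw [ofGL_sub, ofGL_smul, sub_eq_iff_eq_add]
      linear_combination (norm := module) -huv
    rw [this]; exact hE
  · rintro ⟨y, rfl, hL⟩
    have : ofS H (y • S) + ofGL H L = ofGL H (L - y • Ω) + y • iotaMod H S Ω := by
      rw [ofGL_sub, ofGL_smul, ofS_smul, iotaMod]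
      module
    rw [this]
    exact add_mem (g00_le_modSymbol _ _ _ hL) (Submodule.smul_mem _ _ (iotaMod_mem _ _ _))

theorem sigma_mem_g00 (h : IsPair H S) {D : Mat22} (hD : D ∈ g00 H S) : sigma D ∈ g00 H S := by
  obtain ⟨c, L, hL, rfl⟩ := (mem_g00_iff h).1 hD
  refine (mem_g00_iff h).2 ⟨conj c, _, sigmaGL_mem h hL, ?_⟩
  rw [sigma_add, sigma_smul, sigma_ofGL h, gradingElement, ← neg_one_smul ℂ (1 : Mat22),
    sigma_smul, sigma_one]
  simp

theorem sigma_mem_modSymbol (h : IsPair H S) {Ω : Mat2} {D : Mat22} (hD : D ∈ modSymbol H S Ω) :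
    sigma D ∈ modSymbol H S Ω := by
  have hss : ∀ E, sigma (sigma E) = E := fun E => by
    ext (i | i) (j | j) <;> simp [sigma, cbar]
  obtain ⟨u, hu, v, hv, rfl⟩ := Submodule.mem_sup.1 hD
  obtain ⟨u₁, hu₁, E, hE, rfl⟩ := Submodule.mem_sup.1 hu
  obtain ⟨x, rfl⟩ := Submodule.mem_span_singleton.1 hu₁
  obtain ⟨y, rfl⟩ := Submodule.mem_span_singleton.1 hv
  rw [sigma_add, sigma_add, sigma_smul, sigma_smul, hss]
  exact add_mem (add_mem (Submodule.smul_mem _ _ (iotaMod_mem _ _ _))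
    (g00_le_modSymbol _ _ _ (sigma_mem_g00 h hE)))
    (Submodule.smul_mem _ _ (sigma_iotaMod_mem _ _ _))

/-- The modified symbol is stable under `σ`, so the inclusion is tested on `ι` alone, whose
coefficient is 1 because `S ≠ 0`. -/
theorem modSymbol_le_iff (h : IsPair H S) {Ω Ω' : Mat2} :
    modSymbol H S Ω' ≤ modSymbol H S Ω ↔ Ω' - Ω ∈ g00' H S := by
  constructor
  · intro hle
    obtain ⟨y, hy, hL⟩ := (iota_mem_modSymbol_iff h).1 (hle (iotaMod_mem H S Ω'))
    have : y = 1 := by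
      have h1 : (y - 1) • S = 0 := by rw [sub_smul, ← hy, one_smul, sub_self]
      exact sub_eq_zero.1 ((smul_eq_zero.1 h1).resolve_right h.ne)
    rwa [this, one_smul] at hL
  · intro hL
    have h1 : iotaMod H S Ω' ∈ modSymbol H S Ω :=
      (iota_mem_modSymbol_iff h).2 ⟨1, (one_smul _ _).symm, by rwa [one_smul]⟩
    refine sup_le (sup_le ?_ (g00_le_modSymbol _ _ _)) ?_
    · exact (Submodule.span_singleton_le_iff_mem _ _).2 (sigma_mem_modSymbol h h1)
    · exact (Submodule.span_singleton_le_iff_mem _ _).2 h1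

theorem modSymbol_eq_iff (h : IsPair H S) {Ω Ω' : Mat2} :
    modSymbol H S Ω' = modSymbol H S Ω ↔ Ω' - Ω ∈ g00' H S := by
  refine ⟨fun he => (modSymbol_le_iff h).1 he.le, fun hL =>
    le_antisymm ((modSymbol_le_iff h).2 hL) ((modSymbol_le_iff h).2 ?_)⟩
  rw [← neg_sub]
  exact (g00'Sub H S).neg_mem hL

end

/-! ### Equivalences in terms of matrices -/

/-- `A` maps the pair `(H, S)` to the pair `(H', S')` up to scale. -/
structure Rel (H S H' S' A : Mat2) (r : ℝ) (c : ℂ) : Prop where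
  unit : IsUnit A.det
  r_ne : r ≠ 0
  c_ne : c ≠ 0
  form : Aᵀ * H' * cbar A = (r : ℂ) • H
  symm : A * S * Aᵀ = c • S'

section

variable {H S H' S' H'' S'' A A' : Mat2} {r r' : ℝ} {c c' : ℂ}

namespace Rel

theorem refl (H S : Mat2) : Rel H S H S 1 1 1 :=
  ⟨by simp, one_ne_zero, one_ne_zero, by simp [cbar_one], by simp⟩

theorem inv (h : Rel H S H' S' A r c) : Rel H' S' H S A⁻¹ r⁻¹ c⁻¹ := by
  have hu := h.unit
  have hut : IsUnit (Aᵀ).det := by rwa [Matrix.det_transpose]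
  have huc : IsUnit (cbar A).det := by
    rw [det_cbar]; exact hu.map (starRingEnd ℂ)
  have hr : (r : ℂ) ≠ 0 := by exact_mod_cast h.r_ne
  refine ⟨by rw [Matrix.det_nonsing_inv]; simpa using hu, inv_ne_zero h.r_ne,
    inv_ne_zero h.c_ne, ?_, ?_⟩
  · have h1 : (r : ℂ)⁻¹ • ((Aᵀ)⁻¹ * (Aᵀ * H' * cbar A) * (cbar A)⁻¹) =
      (r : ℂ)⁻¹ • ((Aᵀ)⁻¹ * ((r : ℂ) • H) * (cbar A)⁻¹) := by rw [h.form]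
    rw [Matrix.mul_smul, Matrix.smul_mul, smul_smul, inv_mul_cancel₀ hr, one_smul,
      ← Matrix.mul_assoc, Matrix.nonsing_inv_mul_cancel_left _ _ hut,
      Matrix.mul_nonsing_inv_cancel_right _ _ huc] at h1
    rw [Matrix.transpose_nonsing_inv, cbar_inv, ← h1]
    push_cast
    rfl
  · have h1 : c⁻¹ • (A⁻¹ * (A * S * Aᵀ) * (Aᵀ)⁻¹) = c⁻¹ • (A⁻¹ * (c • S') * (Aᵀ)⁻¹) := by
      rw [h.symm]
    rw [Matrix.mul_smul, Matrix.smul_mul, smul_smul, inv_mul_cancel₀ h.c_ne, one_smul,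
      ← Matrix.mul_assoc, Matrix.nonsing_inv_mul_cancel_left _ _ hu,
      Matrix.mul_nonsing_inv_cancel_right _ _ hut] at h1
    rw [Matrix.transpose_nonsing_inv, ← h1]

theorem trans (h : Rel H S H' S' A r c) (h' : Rel H' S' H'' S'' A' r' c') :
    Rel H S H'' S'' (A' * A) (r' * r) (c * c') := by
  refine ⟨by rw [Matrix.det_mul]; exact h'.unit.mul h.unit, mul_ne_zero h'.r_ne h.r_ne,
    mul_ne_zero h.c_ne h'.c_ne, ?_, ?_⟩
  · calc (A' * A)ᵀ * H'' * cbar (A' * A) = Aᵀ * (A'ᵀ * H'' * cbar A') * cbar A := by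
          rw [Matrix.transpose_mul, cbar_mul]; simp only [Matrix.mul_assoc]
      _ = _ := by
          rw [h'.form, Matrix.mul_smul, Matrix.smul_mul, h.form, smul_smul]; push_cast; rfl
  · calc A' * A * S * (A' * A)ᵀ = A' * (A * S * Aᵀ) * A'ᵀ := by
          rw [Matrix.transpose_mul]; simp only [Matrix.mul_assoc]
      _ = _ := by rw [h.symm, Matrix.mul_smul, Matrix.smul_mul, h'.symm, smul_smul]

theorem unit_transpose (h : Rel H S H' S' A r c) : IsUnit (Aᵀ).det := by
  rw [Matrix.det_transpose]; exact h.unit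

theorem unit_cbar (h : Rel H S H' S' A r c) : IsUnit (cbar A).det := by
  rw [det_cbar]; exact h.unit.map (starRingEnd ℂ)

theorem r_ne' (h : Rel H S H' S' A r c) : (r : ℂ) ≠ 0 := by exact_mod_cast h.r_ne

/-- `S^{0,-2}` transforms in the dual way. -/
theorem P_eq (h : Rel H S H' S' A r c) (h' : IsPair H' S') (h₀ : IsPair H S) :
    Aᵀ * Pm H' S' * A = ((r : ℂ) ^ 2 / conj c) • Pm H S := by
  have hc : conj c ≠ 0 := (map_ne_zero _).2 h.c_ne
  have h1 : cbar S' = (conj c)⁻¹ • (cbar A * cbar S * (cbar A)ᵀ) := by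
    rw [← cbar_transpose, ← cbar_mul, ← cbar_mul, h.symm, cbar_smul, smul_smul,
      inv_mul_cancel₀ hc, one_smul]
  have h2 : (cbar A)ᵀ * H'ᵀ * A = (r : ℂ) • Hᵀ := by
    have := congrArg Matrix.transpose h.form
    have h3 := congrArg cbar h.form
    rw [cbar_mul, cbar_mul, cbar_cbar, cbar_smul, cbar_transpose, h'.herm, h₀.herm,
      Complex.conj_ofReal] at h3
    exact h3
  calc Aᵀ * Pm H' S' * A
      = (conj c)⁻¹ • ((Aᵀ * H' * cbar A) * cbar S * ((cbar A)ᵀ * H'ᵀ * A)) := by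
        rw [Pm, h1]
        simp only [Matrix.mul_smul, Matrix.smul_mul, Matrix.mul_assoc]
    _ = _ := by
        rw [h.form, h2, Pm]
        simp only [Matrix.mul_smul, Matrix.smul_mul, Matrix.mul_assoc, smul_smul]
        congr 1
        ring

theorem stab_conj (h : Rel H S H' S' A r c) (h₀ : IsPair H S) (h' : IsPair H' S') {L : Mat2}
    (hL : ∃ b : ℂ, Lᵀ * Pm H S + Pm H S * L = b • Pm H S) :
    ∃ b : ℂ, (A * L * A⁻¹)ᵀ * Pm H' S' + Pm H' S' * (A * L * A⁻¹) = b • Pm H' S' := by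
  obtain ⟨b, hb⟩ := hL
  have hAi : A⁻¹ * A = 1 := Matrix.nonsing_inv_mul _ h.unit
  have hAi' : Aᵀ * (A⁻¹)ᵀ = 1 := by rw [← Matrix.transpose_mul, hAi, Matrix.transpose_one]
  have hP : Pm H' S' = ((r : ℂ) ^ 2 / conj c) • ((A⁻¹)ᵀ * Pm H S * A⁻¹) := by
    have h1 : (A⁻¹)ᵀ * (Aᵀ * Pm H' S' * A) * A⁻¹ = Pm H' S' := by
      rw [Matrix.transpose_nonsing_inv, ← Matrix.mul_assoc,
        Matrix.nonsing_inv_mul_cancel_left _ _ h.unit_transpose,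
        Matrix.mul_nonsing_inv_cancel_right _ _ h.unit]
    rw [← h1, h.P_eq h' h₀, Matrix.mul_smul, Matrix.smul_mul]
  refine ⟨b, ?_⟩
  calc (A * L * A⁻¹)ᵀ * Pm H' S' + Pm H' S' * (A * L * A⁻¹)
      = ((r : ℂ) ^ 2 / conj c) • ((A⁻¹)ᵀ * (Lᵀ * (Aᵀ * (A⁻¹)ᵀ) * Pm H S
        + Pm H S * (A⁻¹ * A) * L) * A⁻¹) := by
        rw [hP]
        simp only [Matrix.transpose_mul, Matrix.mul_smul, Matrix.smul_mul, Matrix.mul_add,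
          Matrix.add_mul, Matrix.mul_assoc, smul_add]
    _ = b • Pm H' S' := by
        rw [hAi, hAi', Matrix.mul_one, Matrix.mul_one, hb, hP, Matrix.mul_smul, Matrix.smul_mul,
          smul_comm]

theorem conj_mem (h : Rel H S H' S' A r c) (h₀ : IsPair H S) (h' : IsPair H' S') {L : Mat2}
    (hL : L ∈ g00' H S) : A * L * A⁻¹ ∈ g00' H' S' := by
  obtain ⟨⟨a, ha⟩, hb⟩ := (mem_g00'_iff h₀).1 hL
  have hAi : A⁻¹ * A = 1 := Matrix.nonsing_inv_mul _ h.unit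
  have hAi' : Aᵀ * (A⁻¹)ᵀ = 1 := by rw [← Matrix.transpose_mul, hAi, Matrix.transpose_one]
  have hS : S' = c⁻¹ • (A * S * Aᵀ) := by
    rw [h.symm, smul_smul, inv_mul_cancel₀ h.c_ne, one_smul]
  refine (mem_g00'_iff h').2 ⟨⟨a, ?_⟩, h.stab_conj h₀ h' hb⟩
  calc A * L * A⁻¹ * S' + S' * (A * L * A⁻¹)ᵀ = c⁻¹ • (A * (L * (A⁻¹ * A) * S
        + S * (Aᵀ * (A⁻¹)ᵀ) * Lᵀ) * Aᵀ) := by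
        rw [hS]
        simp only [Matrix.transpose_mul, Matrix.mul_smul, Matrix.smul_mul, Matrix.mul_add,
          Matrix.add_mul, Matrix.mul_assoc, smul_add]
    _ = a • S' := by
        rw [hAi, hAi', Matrix.mul_one, Matrix.mul_one, ha, hS, Matrix.mul_smul, Matrix.smul_mul,
          smul_comm]

end Rel

theorem realMap_inv (hA : IsUnit A.det) : (realMap A)⁻¹ = realMap A⁻¹ := by
  have hc : IsUnit (cbar A).det := by rw [det_cbar]; exact hA.map (starRingEnd ℂ)
  refine Matrix.inv_eq_right_inv ?_
  rw [realMap, realMap, Matrix.fromBlocks_multiply, cbar_inv, ← Matrix.fromBlocks_one]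
  simp [Matrix.mul_nonsing_inv _ hA, Matrix.mul_nonsing_inv _ hc]

theorem ad_ofS (hA : IsUnit A.det) (hr : r ≠ 0) (hf : Aᵀ * H' * cbar A = (r : ℂ) • H) (T : Mat2) :
    realMap A * ofS H T * (realMap A)⁻¹ = ofS H' ((r : ℂ)⁻¹ • (A * T * Aᵀ)) := by
  have hc : IsUnit (cbar A).det := by rw [det_cbar]; exact hA.map (starRingEnd ℂ)
  have hr' : (r : ℂ) ≠ 0 := by exact_mod_cast hr
  have hH : H = (r : ℂ)⁻¹ • (Aᵀ * H' * cbar A) := by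
    rw [hf, smul_smul, inv_mul_cancel₀ hr', one_smul]
  rw [realMap_inv hA, realMap, realMap, ofS, ofS, Matrix.fromBlocks_multiply,
    Matrix.fromBlocks_multiply, cbar_inv]
  congr 1
  · simp
  · rw [hH]
    simp [Matrix.mul_assoc, Matrix.mul_nonsing_inv _ hc]
  · simp
  · simp

theorem ad_ofGL (h₀ : IsUnit H.det) (h₁ : IsUnit H'.det) (hA : IsUnit A.det) (hr : r ≠ 0)
    (hf : Aᵀ * H' * cbar A = (r : ℂ) • H) (L : Mat2) :
    realMap A * ofGL H L * (realMap A)⁻¹ = ofGL H' (A * L * A⁻¹) := by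
  have hc : IsUnit (cbar A).det := by rw [det_cbar]; exact hA.map (starRingEnd ℂ)
  have ht : IsUnit (Aᵀ).det := by rwa [Matrix.det_transpose]
  have hr' : (r : ℂ) ≠ 0 := by exact_mod_cast hr
  have e1 : H * (cbar A)⁻¹ = (r : ℂ)⁻¹ • (Aᵀ * H') := by
    have hH : H = (r : ℂ)⁻¹ • (Aᵀ * H' * cbar A) := by
      rw [hf, smul_smul, inv_mul_cancel₀ hr', one_smul]
    rw [hH, Matrix.smul_mul, Matrix.mul_nonsing_inv_cancel_right _ _ hc]
  have e2 : cbar A * H⁻¹ = (r : ℂ) • (H'⁻¹ * (Aᵀ)⁻¹) := by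
    have h1 : H'⁻¹ * ((Aᵀ)⁻¹ * (Aᵀ * H' * cbar A) * H⁻¹) =
      H'⁻¹ * ((Aᵀ)⁻¹ * ((r : ℂ) • H) * H⁻¹) := by rw [hf]
    simpa only [Matrix.mul_assoc, Matrix.nonsing_inv_mul_cancel_left _ _ ht, Matrix.mul_smul,
      Matrix.smul_mul, Matrix.nonsing_inv_mul_cancel_left _ _ h₁, Matrix.mul_nonsing_inv _ h₀,
      Matrix.mul_one] using h1
  rw [realMap_inv hA, realMap, realMap, ofGL, ofGL, Matrix.fromBlocks_multiply,
    Matrix.fromBlocks_multiply, cbar_inv]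
  congr 1
  · simp
  · simp
  · simp
  · have : cbar A * H⁻¹ * Lᵀ * (H * (cbar A)⁻¹) = H'⁻¹ * (A * L * A⁻¹)ᵀ * H' := by
      rw [e1, e2]
      simp only [Matrix.smul_mul, Matrix.mul_smul, smul_smul, Matrix.transpose_mul,
        Matrix.transpose_nonsing_inv, Matrix.mul_assoc, inv_mul_cancel₀ hr', one_smul]
    rw [← this]
    simp [Matrix.mul_assoc]

theorem ad_sigma (hA : IsUnit A.det) (D : Mat22) :
    realMap A * sigma D * (realMap A)⁻¹ = sigma (realMap A * D * (realMap A)⁻¹) := by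
  have : ∀ B : Mat2, sigma (realMap B) = realMap B := fun B => by
    rw [realMap, sigma_fromBlocks, cbar_cbar]
    congr 1 <;> ext <;> simp [cbar]
  rw [realMap_inv hA, sigma_mul, sigma_mul, this, this]

/-- The symbol is generated by `ι`, `σ(ι)` and `g_{0,0}`. Conjugation turns the `S`-part of `ι` into
`r⁻¹ A S Aᵀ = (c/r) S'`, which explains the factor `c/r` in front of `Ω'`. -/
theorem Rel.ad_mem (h : Rel H S H' S' A r c) (h₀ : IsPair H S) (h' : IsPair H' S') {Ω Ω' : Mat2}
    (hΩ : A * Ω * A⁻¹ - (c / r) • Ω' ∈ g00' H' S') {D : Mat22} (hD : D ∈ modSymbol H S Ω) :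
    realMap A * D * (realMap A)⁻¹ ∈ modSymbol H' S' Ω' := by
  have hι : realMap A * iotaMod H S Ω * (realMap A)⁻¹ ∈ modSymbol H' S' Ω' := by
    rw [iotaMod, Matrix.mul_add, Matrix.add_mul, ad_ofS h.unit h.r_ne h.form,
      ad_ofGL h₀.unit h'.unit h.unit h.r_ne h.form, iota_mem_modSymbol_iff h']
    refine ⟨c / r, ?_, hΩ⟩
    rw [h.symm, smul_smul, div_eq_inv_mul]
  obtain ⟨u, hu, v, hv, rfl⟩ := Submodule.mem_sup.1 hD
  obtain ⟨u₁, hu₁, E, hE, rfl⟩ := Submodule.mem_sup.1 hu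
  obtain ⟨x, rfl⟩ := Submodule.mem_span_singleton.1 hu₁
  obtain ⟨y, rfl⟩ := Submodule.mem_span_singleton.1 hv
  obtain ⟨d, K, hK, rfl⟩ := (mem_g00_iff h₀).1 hE
  have hR : IsUnit (realMap A).det := by
    rw [realMap, Matrix.det_fromBlocks_zero₂₁]
    exact h.unit.mul h.unit_cbar
  have hgr : realMap A * gradingElement * (realMap A)⁻¹ = gradingElement := by
    rw [gradingElement, Matrix.mul_neg, Matrix.mul_one, Matrix.neg_mul,
      Matrix.mul_nonsing_inv _ hR]
  simp only [Matrix.mul_add, Matrix.add_mul, Matrix.mul_smul, Matrix.smul_mul,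
    ad_sigma h.unit, hgr, ad_ofGL h₀.unit h'.unit h.unit h.r_ne h.form]
  refine add_mem (add_mem (Submodule.smul_mem _ _ (sigma_mem_modSymbol h' hι)) ?_)
    (Submodule.smul_mem _ _ hι)
  exact g00_le_modSymbol _ _ _ ((mem_g00_iff h').2 ⟨d, _, h.conj_mem h₀ h' hK, rfl⟩)

theorem Rel.mod_inv (h : Rel H S H' S' A r c) (h₀ : IsPair H S) (h' : IsPair H' S') {Ω Ω' : Mat2}
    (hΩ : A * Ω * A⁻¹ - (c / r) • Ω' ∈ g00' H' S') :
    A⁻¹ * Ω' * A⁻¹⁻¹ - (c⁻¹ / (r⁻¹ : ℝ)) • Ω ∈ g00' H S := by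
  have h1 := h.inv.conj_mem h' h₀ hΩ
  have h2 := (g00'Sub H S).smul_mem (-(r / c)) h1
  have hL : A⁻¹ * Ω' * A⁻¹⁻¹ - (c⁻¹ / (r⁻¹ : ℝ)) • Ω =
      (-(r / c)) • (A⁻¹ * (A * Ω * A⁻¹ - (c / r) • Ω') * A⁻¹⁻¹) := by
    have hr' := h.r_ne'
    have hc := h.c_ne
    have e1 : -(↑r / c) * (c / ↑r) = -1 := by field_simp
    have e2 : c⁻¹ / ((r⁻¹ : ℝ) : ℂ) = r / c := by push_cast; field_simp
    rw [Matrix.mul_sub, Matrix.sub_mul, Matrix.nonsing_inv_nonsing_inv _ h.unit,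
      Matrix.mul_assoc A, Matrix.nonsing_inv_mul_cancel_left _ _ h.unit,
      Matrix.nonsing_inv_mul_cancel_right _ _ h.unit, smul_sub, Matrix.mul_smul,
      Matrix.smul_mul, smul_smul, e1, e2]
    module
  rw [hL]; exact h2

theorem Rel.mod_trans (h' : Rel H' S' H'' S'' A' r' c')
    (p' : IsPair H' S') (p'' : IsPair H'' S'') {Ω Ω' Ω'' : Mat2}
    (hΩ : A * Ω * A⁻¹ - (c / r) • Ω' ∈ g00' H' S')
    (hΩ' : A' * Ω' * A'⁻¹ - (c' / r') • Ω'' ∈ g00' H'' S'') :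
    A' * A * Ω * (A' * A)⁻¹ - (c * c' / (r' * r : ℝ)) • Ω'' ∈ g00' H'' S'' := by
  have e : A' * A * Ω * (A' * A)⁻¹ - (c * c' / (r' * r : ℝ)) • Ω'' =
      A' * (A * Ω * A⁻¹ - (c / r) • Ω') * A'⁻¹ +
        (c / r) • (A' * Ω' * A'⁻¹ - (c' / r') • Ω'') := by
    rw [Matrix.mul_inv_rev, Matrix.mul_sub, Matrix.sub_mul]
    simp only [Matrix.mul_assoc, Matrix.mul_smul, Matrix.smul_mul, smul_sub, smul_smul]
    push_cast
    have : c / (r : ℂ) * (c' / r') = c * c' / (r' * r) := by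
      rw [div_mul_div_comm, mul_comm (r : ℂ)]
    rw [this]
    module
  rw [e]
  exact (g00'Sub H'' S'').add_mem (h'.conj_mem p' p'' hΩ) ((g00'Sub H'' S'').smul_mem _ hΩ')

/-- In the forward direction the image of `ι` has some coefficient `y` with respect to the new `ι`,
and `c = r y`; it is nonzero since `A S Aᵀ ≠ 0`. The converse is `Rel.ad_mem` for the relation and
for its inverse. -/
theorem modEquiv_iff (h₀ : IsPair H S) (h' : IsPair H' S') {Ω Ω' : Mat2} :
    ModEquiv H S Ω H' S' Ω' ↔ ∃ (A : Mat2) (r : ℝ) (c : ℂ), Rel H S H' S' A r c ∧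
      A * Ω * A⁻¹ - (c / r) • Ω' ∈ g00' H' S' := by
  constructor
  · rintro ⟨A, ⟨r, hr, hf⟩, hm⟩
    have hA : IsUnit (A : Mat2).det := (Matrix.isUnit_iff_isUnit_det _).1 A.isUnit
    have hr' : (r : ℂ) ≠ 0 := by exact_mod_cast hr
    have h1 := (hm _).1 (iotaMod_mem H S Ω)
    rw [iotaMod, Matrix.mul_add, Matrix.add_mul, ad_ofS hA hr hf,
      ad_ofGL h₀.unit h'.unit hA hr hf, iota_mem_modSymbol_iff h'] at h1
    obtain ⟨y, hy, hL⟩ := h1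
    have hy' : (A : Mat2) * S * (A : Mat2)ᵀ = (r * y) • S' := by
      rw [mul_smul, ← hy, smul_smul, mul_inv_cancel₀ hr', one_smul]
    refine ⟨A, r, r * y, ⟨hA, hr, fun h0 => h₀.ne ?_, hf, hy'⟩, ?_⟩
    · rw [h0, zero_smul] at hy'
      have hAt : IsUnit ((A : Mat2)ᵀ).det := by rwa [Matrix.det_transpose]
      have h2 : (A : Mat2)⁻¹ * ((A : Mat2) * S * (A : Mat2)ᵀ) * ((A : Mat2)ᵀ)⁻¹ = S := by
        rw [← Matrix.mul_assoc, Matrix.nonsing_inv_mul_cancel_left _ _ hA,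
          Matrix.mul_nonsing_inv_cancel_right _ _ hAt]
      rw [← h2, hy', Matrix.mul_zero, Matrix.zero_mul]
    · rwa [mul_div_cancel_left₀ _ hr']
  · rintro ⟨A, r, c, h, hΩ⟩
    refine ⟨Matrix.GeneralLinearGroup.mk'' A h.unit, ⟨r, h.r_ne, h.form⟩, fun D => ⟨fun hD =>
      h.ad_mem h₀ h' hΩ hD, fun hD => ?_⟩⟩
    change realMap A * D * (realMap A)⁻¹ ∈ _ at hD
    have hΩ' := h.mod_inv h₀ h' hΩ
    have h3 := h.inv.ad_mem h' h₀ hΩ' hD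
    have hR : IsUnit (realMap A).det := by
      rw [realMap, Matrix.det_fromBlocks_zero₂₁]
      exact h.unit.mul h.unit_cbar
    have hi : IsUnit (A⁻¹).det := h.inv.unit
    rw [realMap_inv hi, Matrix.nonsing_inv_nonsing_inv _ h.unit, ← realMap_inv h.unit,
      ← Matrix.mul_assoc, Matrix.nonsing_inv_mul_cancel_right _ _ hR,
      Matrix.nonsing_inv_mul_cancel_left _ _ hR] at h3
    exact h3

theorem bigradedEquiv_iff_rel (h₀ : IsPair H S) (h' : IsPair H' S') :
    BigradedEquiv H S H' S' ↔ ∃ (A : Mat2) (r : ℝ) (c : ℂ), Rel H S H' S' A r c := by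
  rw [bigradedEquiv_iff, modEquiv_iff h₀ h']
  refine ⟨fun ⟨A, r, c, h, _⟩ => ⟨A, r, c, h⟩, fun ⟨A, r, c, h⟩ => ⟨A, r, c, h, ?_⟩⟩
  simp only [Matrix.mul_zero, Matrix.zero_mul, smul_zero, sub_zero]
  exact (g00'Sub H' S').zero_mem

end

/-! ### Explicit `2 × 2` matrices -/

section

variable (a b c d a' b' c' d' : ℂ)

theorem of_eq_of_iff : (!![a, b; c, d] : Mat2) = !![a', b'; c', d'] ↔
    a = a' ∧ b = b' ∧ c = c' ∧ d = d' := by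
  constructor
  · intro h
    exact ⟨congrFun (congrFun h 0) 0, congrFun (congrFun h 0) 1, congrFun (congrFun h 1) 0,
      congrFun (congrFun h 1) 1⟩
  · rintro ⟨rfl, rfl, rfl, rfl⟩; rfl

theorem of_eq_zero_iff : (!![a, b; c, d] : Mat2) = 0 ↔ a = 0 ∧ b = 0 ∧ c = 0 ∧ d = 0 := by
  rw [Matrix.eta_fin_two (0 : Mat2), of_eq_of_iff]; rfl

theorem transpose_of : (!![a, b; c, d] : Mat2)ᵀ = !![a, c; b, d] := by
  ext i j; fin_cases i <;> fin_cases j <;> rfl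

theorem cbar_of : cbar !![a, b; c, d] = !![conj a, conj b; conj c, conj d] := by
  ext i j; fin_cases i <;> fin_cases j <;> rfl

theorem smul_of (k : ℂ) : k • (!![a, b; c, d] : Mat2) = !![k * a, k * b; k * c, k * d] := by
  ext i j; fin_cases i <;> fin_cases j <;> rfl

theorem add_of : (!![a, b; c, d] + !![a', b'; c', d'] : Mat2) =
    !![a + a', b + b'; c + c', d + d'] := by
  ext i j; fin_cases i <;> fin_cases j <;> rfl

theorem sub_of : (!![a, b; c, d] - !![a', b'; c', d'] : Mat2) =
    !![a - a', b - b'; c - c', d - d'] := by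
  ext i j; fin_cases i <;> fin_cases j <;> rfl

theorem exists_eq_of (X : Mat2) : ∃ a b c d : ℂ, X = !![a, b; c, d] :=
  ⟨_, _, _, _, Matrix.eta_fin_two X⟩

end

theorem sgn_mul_self (ε : ℤˣ) : sgn ε * sgn ε = 1 := by
  rcases Int.units_eq_one_or ε with rfl | rfl <;> simp [sgn]

theorem conj_sgn (ε : ℤˣ) : conj (sgn ε) = sgn ε := by
  simp [sgn]

theorem sgn_ne_zero (ε : ℤˣ) : sgn ε ≠ 0 := by
  intro h; have := sgn_mul_self ε; simp [h] at this

theorem conj_exp_I (θ : ℝ) : conj (Complex.exp (Complex.I * θ)) * Complex.exp (Complex.I * θ) = 1 := by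
  rw [← Complex.exp_conj, ← Complex.exp_add]
  simp

/-- Otherwise `exp(iθ)` equals its conjugate, and `sin θ = 0`. -/
theorem exp_I_sq_ne_one {θ : ℝ} (h0 : 0 < θ) (h1 : θ < Real.pi) :
    Complex.exp (Complex.I * θ) * Complex.exp (Complex.I * θ) ≠ 1 := by
  intro h
  have h2 : (Complex.exp (Complex.I * θ) - conj (Complex.exp (Complex.I * θ)))
      * Complex.exp (Complex.I * θ) = 0 := by
    linear_combination h - conj_exp_I θ
  have h3 := congrArg Complex.im ((mul_eq_zero.1 h2).resolve_right (Complex.exp_ne_zero _))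
  rw [mul_comm, Complex.exp_mul_I] at h3
  simp [← Complex.ofReal_sin, ← Complex.ofReal_cos] at h3
  have := Real.sin_pos_of_pos_of_lt_pi h0 h1
  linarith

/-! ### The rows of the table -/

namespace Row

variable {r : Row}

/-- The column `Ω` at `τ = 1`. -/
def Ω₁ : Row → Mat2
  | r1 _ lam => !![0, -(lam : ℂ); 1, 0]
  | r2 θ => !![0, -Complex.exp (Complex.I * θ); 1, 0]
  | r4 _ => !![0, 0; 1, 0]
  | r6 => !![2, 1; 0, 0]
  | _ => 0

theorem _root_.CRSymbol.Entry.Ω_eq (t : Entry) : t.Ω = (t.τ : ℂ) • t.row.Ω₁ := by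
  obtain ⟨row, τ⟩ := t
  cases row <;> simp [Entry.Ω, Ω₁, mul_comm]

theorem isPair (hr : r.Valid) : IsPair r.H r.S := by
  refine ⟨?_, ?_, ?_⟩
  · cases r <;> simp [H, cbar_of, transpose_of, conj_sgn]
  · cases r <;> simp [H, Matrix.det_fin_two, sgn_ne_zero]
  · cases r <;> simp [S, of_eq_zero_iff]

theorem S_symm : (r.S)ᵀ = r.S := by
  cases r <;> simp [S, transpose_of]

/-- The column `S^{0,-2}`. -/
def P : Row → Mat2
  | r1 _ lam => !![1, 0; 0, (lam : ℂ)]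
  | r2 θ => !![conj (Complex.exp (Complex.I * θ)), 0; 0, 1]
  | r3 ε => !![0, sgn ε; sgn ε, 0]
  | r4 _ => !![1, 0; 0, 0]
  | r5 => !![0, 1; 1, 0]
  | r6 => !![0, 1; 1, 1]
  | r7 => !![0, 0; 0, 1]

theorem Pm_eq (r : Row) : Pm r.H r.S = r.P := by
  cases r with
  | r1 ε lam =>
    simp only [Pm, H, S, P, cbar_of, transpose_of, Matrix.mul_fin_two, of_eq_of_iff]
    simp
    linear_combination (lam : ℂ) * sgn_mul_self ε
  | _ => simp [Pm, H, S, P, cbar_of, transpose_of, Matrix.mul_fin_two,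
      -Matrix.cons_mul]

theorem g_add {X Y : Mat2} (hX : X ∈ r.g) (hY : Y ∈ r.g) : X + Y ∈ r.g := by
  cases r <;> simp only [g, Set.mem_ofPred_eq] at * <;>
  first
  | (obtain ⟨a, rfl⟩ := hX; obtain ⟨b, rfl⟩ := hY; exact ⟨a + b, by simp⟩)
  | (obtain ⟨a, b, rfl⟩ := hX; obtain ⟨a', b', rfl⟩ := hY
     exact ⟨a + a', b + b', by simp⟩)
  | (obtain ⟨a, b, c, rfl⟩ := hX; obtain ⟨a', b', c', rfl⟩ := hY
     exact ⟨a + a', b + b', c + c', by simp⟩)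

theorem g_smul {X : Mat2} (k : ℂ) (hX : X ∈ r.g) : k • X ∈ r.g := by
  cases r <;> simp only [g, Set.mem_ofPred_eq] at * <;>
  first
  | (obtain ⟨a, rfl⟩ := hX; exact ⟨k * a, by simp⟩)
  | (obtain ⟨a, b, rfl⟩ := hX; exact ⟨k * a, k * b, by simp⟩)
  | (obtain ⟨a, b, c, rfl⟩ := hX; exact ⟨k * a, k * b, k * c, by simp⟩)

theorem N02_add {X Y : Mat2} (hX : X ∈ r.N02) (hY : Y ∈ r.N02) : X + Y ∈ r.N02 := by
  cases r <;> simp only [N02, Set.mem_ofPred_eq] at * <;>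
  first
  | (obtain ⟨a, rfl⟩ := hX; obtain ⟨b, rfl⟩ := hY; exact ⟨a + b, by simp⟩)
  | (obtain ⟨a, b, rfl⟩ := hX; obtain ⟨a', b', rfl⟩ := hY
     exact ⟨a + a', b + b', by simp⟩)

theorem N02_smul {X : Mat2} (k : ℂ) (hX : X ∈ r.N02) : k • X ∈ r.N02 := by
  cases r <;> simp only [N02, Set.mem_ofPred_eq] at * <;>
  first
  | (obtain ⟨a, rfl⟩ := hX; exact ⟨k * a, by simp⟩)
  | (obtain ⟨a, b, rfl⟩ := hX; exact ⟨k * a, k * b, by simp⟩)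

/-- The infinitesimal stabilizer of the line spanned by `S^{0,-2}`. -/
theorem stab_iff (hr : r.Valid) {X : Mat2} :
    (∃ b : ℂ, Xᵀ * r.P + r.P * X = b • r.P) ↔ ∃ t : ℂ, X - t • r.Ω₁ ∈ r.g := by
  -- In every row the condition is a linear system for the entries. Its solutions are `g'_{0,0}`
  -- plus the line of `Ω₁`, whose coefficient `t` is one of the off-diagonal entries; `Ω₁ = 0` in
  -- the rows without `τ`.
  obtain ⟨x, y, z, w, rfl⟩ := exists_eq_of X
  cases r with
  | r1 ε lam =>
    have hl : (lam : ℂ) ≠ 0 := by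
      have : (1 : ℝ) < lam := hr
      exact_mod_cast (by positivity : lam ≠ 0)
    simp only [P, Ω₁, g, transpose_of, Matrix.mul_fin_two, add_of, smul_of, sub_of, of_eq_of_iff,
      Set.mem_ofPred_eq]
    constructor
    · rintro ⟨b, h1, h2, h3, h4⟩
      refine ⟨z, x, by ring, by linear_combination h2, by ring, ?_⟩
      have : (lam : ℂ) * (w - x) = 0 := by linear_combination (1 / 2) * h4 - (1 / 2) * lam * h1
      linear_combination (mul_eq_zero.1 this).resolve_left hl
    · rintro ⟨t, a, h1, h2, h3, h4⟩
      refine ⟨2 * a, ?_, ?_, ?_, ?_⟩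
      · linear_combination 2 * h1
      · linear_combination h2 + lam * h3
      · linear_combination h2 + lam * h3
      · linear_combination 2 * lam * h4
  | r2 θ =>
    have he := conj_exp_I θ
    set E := Complex.exp (Complex.I * θ)
    have hE : conj E ≠ 0 := by intro h; rw [h] at he; simp at he
    simp only [P, Ω₁, g, transpose_of, Matrix.mul_fin_two, add_of, smul_of, sub_of, of_eq_of_iff,
      Set.mem_ofPred_eq]
    constructor
    · rintro ⟨b, h1, h2, h3, h4⟩
      refine ⟨z, x, by ring, ?_, by ring, ?_⟩
      · linear_combination E * h2 - y * he
      · have : (conj E) * (w - x) = 0 := by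
          linear_combination (1 / 2) * conj E * h4 - (1 / 2) * h1
        linear_combination (mul_eq_zero.1 this).resolve_left hE
    · rintro ⟨t, a, h1, h2, h3, h4⟩
      refine ⟨2 * a, ?_, ?_, ?_, ?_⟩
      · linear_combination 2 * conj E * h1
      · linear_combination conj E * h2 + h3 - t * he
      · linear_combination conj E * h2 + h3 - t * he
      · linear_combination 2 * h4
  | r3 ε =>
    have hs := sgn_ne_zero ε
    simp only [P, Ω₁, g, transpose_of, Matrix.mul_fin_two, add_of, smul_of, sub_zero, smul_zero,
      of_eq_of_iff, Set.mem_ofPred_eq]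
    constructor
    · rintro ⟨b, h1, h2, h3, h4⟩
      have h1' : sgn ε * z = 0 := by linear_combination (1 / 2) * h1
      have h4' : sgn ε * y = 0 := by linear_combination (1 / 2) * h4
      exact ⟨0, x, w, rfl, (mul_eq_zero.1 h4').resolve_left hs,
        (mul_eq_zero.1 h1').resolve_left hs, rfl⟩
    · rintro ⟨t, a, b, rfl, rfl, rfl, rfl⟩
      exact ⟨x + w, by ring, by ring, by ring, by ring⟩
  | r4 ε =>
    simp only [P, Ω₁, g, transpose_of, Matrix.mul_fin_two, add_of, smul_of, sub_of, of_eq_of_iff,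
      Set.mem_ofPred_eq]
    constructor
    · rintro ⟨b, h1, h2, h3, h4⟩
      exact ⟨z, x, w, by ring, by linear_combination h2, by ring, by ring⟩
    · rintro ⟨t, a, b, h1, h2, h3, h4⟩
      exact ⟨2 * x, by ring, by linear_combination h2, by linear_combination h2, by ring⟩
  | r5 =>
    simp only [P, Ω₁, g, transpose_of, Matrix.mul_fin_two, add_of, smul_of, sub_zero, smul_zero,
      of_eq_of_iff, Set.mem_ofPred_eq]
    constructor
    · rintro ⟨b, h1, h2, h3, h4⟩
      exact ⟨0, x, w, rfl, by linear_combination (1 / 2) * h4, by linear_combination (1 / 2) * h1,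
        rfl⟩
    · rintro ⟨t, a, b, rfl, rfl, rfl, rfl⟩
      exact ⟨x + w, by ring, by ring, by ring, by ring⟩
  | r6 =>
    simp only [P, Ω₁, g, transpose_of, Matrix.mul_fin_two, add_of, smul_of, sub_of, of_eq_of_iff,
      Set.mem_ofPred_eq]
    constructor
    · rintro ⟨b, h1, h2, h3, h4⟩
      refine ⟨y, w, ?_, by ring, by linear_combination (1 / 2) * h1, by ring⟩
      linear_combination h2 - h4 - (1 / 2) * h1
    · rintro ⟨t, a, h1, h2, h3, h4⟩
      refine ⟨2 * a + 2 * t, ?_, ?_, ?_, ?_⟩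
      · linear_combination 2 * h3
      · linear_combination h1 + h3 + h4
      · linear_combination h1 + h3 + h4
      · linear_combination 2 * h2 + 2 * h4
  | r7 =>
    simp only [P, Ω₁, g, transpose_of, Matrix.mul_fin_two, add_of, smul_of, sub_zero, smul_zero,
      of_eq_of_iff, Set.mem_ofPred_eq]
    constructor
    · rintro ⟨b, h1, h2, h3, h4⟩
      exact ⟨0, x, y, w, rfl, rfl, by linear_combination h2, rfl⟩
    · rintro ⟨t, a, b, c, rfl, rfl, rfl, rfl⟩
      exact ⟨2 * w, by ring, by ring, by ring, by ring⟩

theorem g_symm {X : Mat2} (hX : X ∈ r.g) : ∃ a : ℂ, X * r.S + r.S * Xᵀ = a • r.S := by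
  cases r <;> simp only [g, Set.mem_ofPred_eq] at hX
  case r3 | r5 =>
    obtain ⟨a, b, rfl⟩ := hX
    refine ⟨a + b, ?_⟩
    simp only [S, transpose_of, Matrix.mul_fin_two, add_of, smul_of, of_eq_of_iff]
    refine ⟨?_, ?_, ?_, ?_⟩ <;> ring
  case r4 =>
    obtain ⟨a, b, rfl⟩ := hX
    refine ⟨2 * a, ?_⟩
    simp only [S, transpose_of, Matrix.mul_fin_two, add_of, smul_of, of_eq_of_iff]
    refine ⟨?_, ?_, ?_, ?_⟩ <;> ring
  case r7 =>
    obtain ⟨a, b, c, rfl⟩ := hX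
    refine ⟨2 * a, ?_⟩
    simp only [S, transpose_of, Matrix.mul_fin_two, add_of, smul_of, of_eq_of_iff]
    refine ⟨?_, ?_, ?_, ?_⟩ <;> ring
  all_goals
    obtain ⟨a, rfl⟩ := hX
    refine ⟨2 * a, ?_⟩
    simp only [S, transpose_of, Matrix.mul_fin_two, add_of, smul_of, of_eq_of_iff]
    refine ⟨?_, ?_, ?_, ?_⟩ <;> ring

/-- The symmetric matrix by which `Ω₁` moves `S^{0,2}`. -/
def T₁ (r : Row) : Mat2 := r.Ω₁ * r.S + r.S * (r.Ω₁)ᵀ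

/-- `T₁` is independent of `S` and `N_{0,2}` whenever `Ω₁ ≠ 0`; in rows 1 and 2 this is `λ² ≠ 1` and
`exp(2iθ) ≠ 1`. Hence the normalization of `e(S^{0,2})` fixes the multiple of `Ω₁`. Concluding `t Ω₁
= 0` rather than `t = 0` includes the rows with `Ω₁ = 0`. -/
theorem T₁_eq_zero_or (hr : r.Valid) {t k : ℂ} {N : Mat2} (hN : N ∈ r.N02)
    (h : t • r.T₁ = N + k • r.S) : t • r.Ω₁ = 0 := by
  cases r with
  | r1 ε lam =>
    obtain ⟨f, rfl⟩ := hN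
    have hl : (1 : ℂ) - lam * lam ≠ 0 := by
      have h1 : (1 : ℝ) < lam := hr
      have : (1 : ℝ) - lam * lam ≠ 0 := by nlinarith
      exact_mod_cast this
    simp only [T₁, Ω₁, S, transpose_of, Matrix.mul_fin_two, add_of, smul_of, of_eq_of_iff] at h
    have h2 : t * (1 - lam * lam) = 0 := by linear_combination h.2.1
    rw [(mul_eq_zero.1 h2).resolve_right hl, zero_smul]
  | r2 θ =>
    obtain ⟨f, rfl⟩ := hN
    have hl := sub_ne_zero.2 (exp_I_sq_ne_one hr.1 hr.2).symm
    simp only [T₁, Ω₁, S, transpose_of, Matrix.mul_fin_two, add_of, smul_of, of_eq_of_iff] at h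
    have h2 : t * (1 - Complex.exp (Complex.I * θ) * Complex.exp (Complex.I * θ)) = 0 := by
      linear_combination h.2.1
    rw [(mul_eq_zero.1 h2).resolve_right hl, zero_smul]
  | r4 ε =>
    obtain ⟨f, rfl⟩ := hN
    simp only [T₁, Ω₁, S, transpose_of, Matrix.mul_fin_two, add_of, smul_of, of_eq_of_iff] at h
    have h2 : t = 0 := by linear_combination h.2.1
    rw [h2, zero_smul]
  | r6 =>
    obtain ⟨f, rfl⟩ := hN
    simp only [T₁, Ω₁, S, transpose_of, Matrix.mul_fin_two, add_of, smul_of, of_eq_of_iff] at h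
    have h2 : t = 0 := by linear_combination (1 / 4) * h.1 - (1 / 4) * h.2.1
    rw [h2, zero_smul]
  | _ => simp [Ω₁]

/-- Symmetric matrices have dimension three, and `N_{0,2}` has dimension one where `T₁ ≠ 0` and two
otherwise, so the three summands fill the space. This is the existence counterpart of
`T₁_eq_zero_or`. -/
theorem exists_T₁ (hr : r.Valid) {T : Mat2} (hT : Tᵀ = T) :
    ∃ t k : ℂ, ∃ N ∈ r.N02, T = t • r.T₁ + N + k • r.S := by
  obtain ⟨x, y, z, w, rfl⟩ := exists_eq_of T
  rw [transpose_of, of_eq_of_iff] at hT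
  obtain rfl : z = y := hT.2.1
  cases r with
  | r1 ε lam =>
    have hl : (1 : ℂ) - lam * lam ≠ 0 := by
      have h1 : (1 : ℝ) < lam := hr
      have : (1 : ℝ) - lam * lam ≠ 0 := by nlinarith
      exact_mod_cast this
    refine ⟨z / (1 - lam * lam), x, _, ⟨w - x * lam, rfl⟩, ?_⟩
    simp only [T₁, Ω₁, S, transpose_of, Matrix.mul_fin_two, add_of, smul_of, of_eq_of_iff]
    refine ⟨by ring, ?_, ?_, by ring⟩ <;> linear_combination -(div_mul_cancel₀ z hl)
  | r2 θ =>
    have hl := sub_ne_zero.2 (exp_I_sq_ne_one hr.1 hr.2).symm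
    refine ⟨z / (1 - Complex.exp (Complex.I * θ) * Complex.exp (Complex.I * θ)), x, _,
      ⟨w - x * Complex.exp (Complex.I * θ), rfl⟩, ?_⟩
    simp only [T₁, Ω₁, S, transpose_of, Matrix.mul_fin_two, add_of, smul_of, of_eq_of_iff]
    set E := Complex.exp (Complex.I * θ)
    refine ⟨by ring, ?_, ?_, by ring⟩ <;> linear_combination -(div_mul_cancel₀ z hl)
  | r3 ε =>
    refine ⟨0, z, _, ⟨x, w, rfl⟩, ?_⟩
    simp [S]
  | r4 ε =>
    refine ⟨z, x, _, ⟨w, rfl⟩, ?_⟩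
    simp [T₁, Ω₁, S, transpose_of]
  | r5 =>
    refine ⟨0, z, _, ⟨x, w, rfl⟩, ?_⟩
    simp [S]
  | r6 =>
    refine ⟨(x - z) / 4, (3 * z - x) / 2, _, ⟨w, rfl⟩, ?_⟩
    simp only [T₁, Ω₁, S, transpose_of, Matrix.mul_fin_two, add_of, smul_of, of_eq_of_iff]
    refine ⟨?_, ?_, ?_, ?_⟩ <;> ring
  | r7 =>
    refine ⟨0, x, _, ⟨z, w, rfl⟩, ?_⟩
    simp [S]

theorem zero_mem_N02 (r : Row) : (0 : Mat2) ∈ r.N02 := by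
  have h : ∀ {X : Mat2}, X ∈ r.N02 → (0 : Mat2) ∈ r.N02 := fun hX => by
    simpa using N02_smul 0 hX
  cases r <;> first | exact h ⟨0, rfl⟩ | exact h ⟨0, 0, rfl⟩

/-- Preserving the line of `S^{0,-2}` leaves `t Ω₁ + g'_{0,0}`; preserving the line of `S` as well
forces `t T₁ ∈ ⟨S⟩`, hence `t Ω₁ = 0`. -/
theorem g00'_eq (hr : r.Valid) : g00' r.H r.S = r.g := by
  ext X
  rw [mem_g00'_iff (isPair hr), Pm_eq, stab_iff hr]
  constructor
  · rintro ⟨⟨a, ha⟩, t, ht⟩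
    obtain ⟨b, hb⟩ := g_symm ht
    have h1 : t • r.T₁ = 0 + (a - b) • r.S := by
      simp only [Matrix.sub_mul, Matrix.mul_sub, Matrix.transpose_sub, Matrix.transpose_smul,
        Matrix.smul_mul, Matrix.mul_smul] at hb
      rw [T₁]
      linear_combination (norm := module) ha - hb
    rw [T₁_eq_zero_or hr r.zero_mem_N02 h1, sub_zero] at ht
    exact ht
  · intro hX
    exact ⟨g_symm hX, 0, by simpa using hX⟩

theorem mem_g00_iff (hr : r.Valid) (D : Mat22) :
    D ∈ g00 r.H r.S ↔ ∃ c : ℂ, ∃ L ∈ r.g, D = c • gradingElement + ofGL r.H L := by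
  rw [CRSymbol.mem_g00_iff (isPair hr), g00'_eq hr]

theorem modSymbol_eq_iff (hr : r.Valid) (Ω Ω' : Mat2) :
    modSymbol r.H r.S Ω' = modSymbol r.H r.S Ω ↔ Ω' - Ω ∈ r.g := by
  rw [CRSymbol.modSymbol_eq_iff (isPair hr), g00'_eq hr]

end Row

theorem sigmaGL_eq_iff {H S L : Mat2} (h : IsPair H S) :
    sigmaGL H L = L ↔ Lᵀ * H + H * cbar L = 0 := by
  rw [sigmaGL]
  constructor
  · intro e
    have e1 : Hᵀ * -((Hᵀ)⁻¹ * (cbar L)ᵀ * Hᵀ) = Hᵀ * L := by rw [e]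
    rw [Matrix.mul_neg, Matrix.mul_assoc, Matrix.mul_nonsing_inv_cancel_left _ _ h.unit_transpose]
      at e1
    have e2 := congrArg Matrix.transpose e1
    simp only [Matrix.transpose_neg, Matrix.transpose_mul, Matrix.transpose_transpose] at e2
    rw [← e2]; abel
  · intro e
    have e2 := congrArg Matrix.transpose e
    simp only [Matrix.transpose_add, Matrix.transpose_mul, Matrix.transpose_transpose,
      Matrix.transpose_zero] at e2
    have e3 : (cbar L)ᵀ * Hᵀ = -(Hᵀ * L) := by
      rw [eq_neg_iff_add_eq_zero, add_comm]; exact e2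
    rw [Matrix.mul_assoc, e3, Matrix.mul_neg, neg_neg, h.transpose_inv_mul_cancel]

/-! ### Invariants of a pair -/

/-- `Ξ Ξ̄` for `Ξ = S H`. -/
def Nm (H S : Mat2) : Mat2 := S * H * cbar (S * H)

section

variable {H S H' S' A : Mat2} {r : ℝ} {c : ℂ}

/-- `Ξ = S H` transforms like the matrix of an antilinear map, `c S' H' Ā = r A S H`. Composed with
its conjugate it changes by conjugation with `A` and the positive factor `r²/|c|²`. -/
theorem Rel.N_eq (h : Rel H S H' S' A r c) :
    Nm H' S' * A = ((r ^ 2 / Complex.normSq c : ℝ) : ℂ) • (A * Nm H S) := by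
  have hc := h.c_ne
  have hcc : conj c ≠ 0 := (map_ne_zero _).2 hc
  have h1 : c • (S' * H' * cbar A) = (r : ℂ) • (A * (S * H)) := by
    rw [← Matrix.smul_mul, ← Matrix.smul_mul, ← h.symm, Matrix.mul_assoc, Matrix.mul_assoc,
      ← Matrix.mul_assoc Aᵀ, h.form]
    simp only [Matrix.mul_smul, Matrix.mul_assoc]
  have h2 := congrArg cbar h1
  rw [cbar_smul, cbar_smul, Complex.conj_ofReal, cbar_mul, cbar_mul A, cbar_cbar] at h2
  have h3 : (c * conj c) • (Nm H' S' * A) = ((r : ℂ) ^ 2) • (A * Nm H S) := by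
    calc (c * conj c) • (Nm H' S' * A) = c • (S' * H' * (conj c • (cbar (S' * H') * A))) := by
          rw [Nm, Matrix.mul_smul, smul_smul, Matrix.mul_assoc]
      _ = (r : ℂ) • (c • (S' * H' * cbar A) * cbar (S * H)) := by
          rw [h2]
          simp only [Matrix.mul_smul, Matrix.smul_mul, Matrix.mul_assoc, smul_comm c]
      _ = _ := by
          rw [h1, Nm, Matrix.smul_mul, smul_smul, Matrix.mul_assoc, pow_two]
  have h4 : (c * conj c) ≠ 0 := mul_ne_zero hc hcc
  rw [Complex.ofReal_div, ← Complex.mul_conj, Complex.ofReal_pow, div_eq_inv_mul, mul_smul, ← h3,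
    smul_smul, inv_mul_cancel₀ h4, one_smul]

theorem Rel.trace_det (h : Rel H S H' S' A r c) : ∃ k : ℝ, 0 < k ∧
    Nm H' S' * A = (k : ℂ) • (A * Nm H S) ∧ (Nm H' S').trace = k * (Nm H S).trace ∧
    (Nm H' S').det = k ^ 2 * (Nm H S).det := by
  have hu := h.unit
  have hN := h.N_eq
  refine ⟨r ^ 2 / Complex.normSq c, div_pos (sq_pos_of_ne_zero h.r_ne) (Complex.normSq_pos.2 h.c_ne),
    hN, ?_, ?_⟩
  · set k := r ^ 2 / Complex.normSq c
    have h1 : Nm H' S' = (k : ℂ) • (A * Nm H S * A⁻¹) := by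
      rw [← Matrix.smul_mul, ← hN, Matrix.mul_nonsing_inv_cancel_right _ _ hu]
    rw [h1, Matrix.trace_smul, Matrix.trace_mul_comm, Matrix.nonsing_inv_mul_cancel_left _ _ hu,
      smul_eq_mul]
  · have h1 := congrArg Matrix.det hN
    rw [Matrix.det_mul, Matrix.det_smul, Matrix.det_mul, Fintype.card_fin] at h1
    refine mul_right_cancel₀ hu.ne_zero ?_
    rw [h1]; ring

/-- Taking determinants, the factor is `|det A|²/r²`; the sign of `det H` is therefore an invariant.
-/
theorem Rel.det_form (h : Rel H S H' S' A r c) : ∃ s : ℝ, 0 < s ∧ H.det = s * H'.det := by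
  have h1 := congrArg Matrix.det h.form
  rw [Matrix.det_mul, Matrix.det_mul, Matrix.det_transpose, det_cbar, Matrix.det_smul,
    Fintype.card_fin] at h1
  have hr := h.r_ne'
  refine ⟨Complex.normSq A.det / r ^ 2, div_pos (Complex.normSq_pos.2 h.unit.ne_zero)
    (sq_pos_of_ne_zero h.r_ne), ?_⟩
  push_cast
  rw [← Complex.mul_conj]
  field_simp
  linear_combination -h1

end

namespace Row

theorem re_eq {r : Row} (hr : r.Valid) : r.re = {L | L ∈ r.g ∧ sigmaGL r.H L = L} := by
  have conj_eq : ∀ a b : ℂ, a + conj b = 0 ↔ a = -conj b := fun a b => eq_neg_iff_add_eq_zero.symm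
  have conj_eq' : ∀ a b : ℂ, b + conj a = 0 ↔ a = -conj b := fun a b => by
    rw [conj_eq]
    constructor <;> (rintro rfl; simp)
  ext L
  rw [Set.mem_ofPred_eq, sigmaGL_eq_iff (isPair hr)]
  cases r with
  | r3 ε =>
    have hs := sgn_ne_zero ε
    simp only [re, g, Set.mem_ofPred_eq, H]
    constructor
    · rintro ⟨a, b, rfl, h1, h2⟩
      refine ⟨⟨a, b, rfl⟩, ?_⟩
      simp only [transpose_of, cbar_of, Matrix.mul_fin_two, add_of, of_eq_zero_iff]
      simp
      exact ⟨(conj_eq _ _).2 h1, by linear_combination sgn ε * (conj_eq _ _).2 h2⟩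
    · rintro ⟨⟨a, b, rfl⟩, h⟩
      simp only [transpose_of, cbar_of, Matrix.mul_fin_two, add_of, of_eq_zero_iff] at h
      simp at h
      refine ⟨a, b, rfl, (conj_eq _ _).1 h.1, (conj_eq _ _).1 ?_⟩
      refine (mul_eq_zero.1 (?_ : sgn ε * _ = 0)).resolve_left hs
      linear_combination h.2
  | r4 ε =>
    have hs := sgn_ne_zero ε
    simp only [re, g, Set.mem_ofPred_eq, H]
    constructor
    · rintro ⟨a, b, rfl, h1, h2⟩
      refine ⟨⟨a, b, rfl⟩, ?_⟩
      simp only [transpose_of, cbar_of, Matrix.mul_fin_two, add_of, of_eq_zero_iff]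
      simp
      exact ⟨(conj_eq _ _).2 h1, by linear_combination sgn ε * (conj_eq _ _).2 h2⟩
    · rintro ⟨⟨a, b, rfl⟩, h⟩
      simp only [transpose_of, cbar_of, Matrix.mul_fin_two, add_of, of_eq_zero_iff] at h
      simp at h
      refine ⟨a, b, rfl, (conj_eq _ _).1 h.1, (conj_eq _ _).1 ?_⟩
      refine (mul_eq_zero.1 (?_ : sgn ε * _ = 0)).resolve_left hs
      linear_combination h.2
  | r5 =>
    simp only [re, g, Set.mem_ofPred_eq, H]
    constructor
    · rintro ⟨a, b, rfl, h1⟩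
      refine ⟨⟨a, b, rfl⟩, ?_⟩
      simp only [transpose_of, cbar_of, Matrix.mul_fin_two, add_of, of_eq_zero_iff]
      simp
      exact ⟨(conj_eq _ _).2 h1, (conj_eq' _ _).2 h1⟩
    · rintro ⟨⟨a, b, rfl⟩, h⟩
      simp only [transpose_of, cbar_of, Matrix.mul_fin_two, add_of, of_eq_zero_iff] at h
      simp at h
      exact ⟨a, b, rfl, (conj_eq _ _).1 h.1⟩
  | r7 =>
    simp only [re, g, Set.mem_ofPred_eq, H]
    constructor
    · rintro ⟨a, b, c, rfl, h1, h2⟩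
      refine ⟨⟨a, b, c, rfl⟩, ?_⟩
      simp only [transpose_of, cbar_of, Matrix.mul_fin_two, add_of, of_eq_zero_iff]
      simp
      exact ⟨(conj_eq _ _).2 h1, (conj_eq' _ _).2 h1, (conj_eq _ _).2 h2⟩
    · rintro ⟨⟨a, b, c, rfl⟩, h⟩
      simp only [transpose_of, cbar_of, Matrix.mul_fin_two, add_of, of_eq_zero_iff] at h
      simp at h
      exact ⟨a, b, c, rfl, (conj_eq _ _).1 h.1, (conj_eq _ _).1 h.2.2⟩
  | r1 ε lam =>
    simp only [re, g, Set.mem_ofPred_eq, H]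
    constructor
    · rintro ⟨a, rfl, h1⟩
      refine ⟨⟨a, rfl⟩, ?_⟩
      simp only [transpose_of, cbar_of, Matrix.mul_fin_two, add_of, of_eq_zero_iff]
      simp
      exact ⟨(conj_eq _ _).2 h1, by linear_combination sgn ε * (conj_eq _ _).2 h1⟩
    · rintro ⟨⟨a, rfl⟩, h⟩
      simp only [transpose_of, cbar_of, Matrix.mul_fin_two, add_of, of_eq_zero_iff] at h
      simp at h
      exact ⟨a, rfl, (conj_eq _ _).1 h.1⟩
  | _ =>
    simp only [re, g, Set.mem_ofPred_eq, H]
    constructor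
    · rintro ⟨a, rfl, h1⟩
      refine ⟨⟨a, rfl⟩, ?_⟩
      simp only [transpose_of, cbar_of, Matrix.mul_fin_two, add_of, of_eq_zero_iff]
      simp
      exact (conj_eq _ _).2 h1
    · rintro ⟨⟨a, rfl⟩, h⟩
      simp only [transpose_of, cbar_of, Matrix.mul_fin_two, add_of, of_eq_zero_iff] at h
      simp at h
      exact ⟨a, rfl, (conj_eq _ _).1 h⟩

/-- `Ξ Ξ̄` for the pair of a row. -/
def N : Row → Mat2
  | r1 _ lam => !![1, 0; 0, (lam : ℂ) ^ 2]
  | r2 θ => !![conj (Complex.exp (Complex.I * θ)), 0; 0, Complex.exp (Complex.I * θ)]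
  | r3 ε => !![sgn ε, 0; 0, sgn ε]
  | r4 _ => !![1, 0; 0, 0]
  | r5 => !![1, 0; 0, 1]
  | r6 => !![1, 2; 0, 1]
  | r7 => !![0, 0; 0, 0]

theorem Nm_eq (r : Row) : Nm r.H r.S = r.N := by
  cases r <;> simp only [Nm, H, S, N, cbar_of, transpose_of, Matrix.mul_fin_two, of_eq_of_iff]
  case r1 ε lam =>
    simp [conj_sgn]
    linear_combination (lam : ℂ) ^ 2 * sgn_mul_self ε
  all_goals norm_num [conj_sgn]

/-- The trace of `Ξ Ξ̄`. -/
def trN : Row → ℝ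
  | r1 _ lam => 1 + lam ^ 2
  | r2 θ => 2 * Real.cos θ
  | r3 ε => 2 * (ε : ℤ)
  | r4 _ => 1
  | r5 => 2
  | r6 => 2
  | r7 => 0

/-- The determinant of `Ξ Ξ̄`. -/
def detN : Row → ℝ
  | r1 _ lam => lam ^ 2
  | r4 _ => 0
  | r7 => 0
  | _ => 1

/-- The determinant of the Levi form. -/
def detH : Row → ℝ
  | r1 ε _ => (ε : ℤ)
  | r3 ε => (ε : ℤ)
  | r4 ε => (ε : ℤ)
  | _ => -1

theorem trace_N (r : Row) : (r.N).trace = r.trN := by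
  cases r with
  | r2 θ =>
    simp only [N, trN, Matrix.trace_fin_two_of, ← Complex.exp_conj]
    push_cast
    rw [Complex.cos]
    simp [mul_comm]
    ring
  | _ => simp [N, trN, Matrix.trace_fin_two_of, sgn] <;> norm_num <;> ring

theorem det_N (r : Row) : (r.N).det = r.detN := by
  cases r with
  | r2 θ => simp [N, detN, Matrix.det_fin_two, conj_exp_I]
  | r3 ε => simp [N, detN, Matrix.det_fin_two, sgn_mul_self]
  | _ => simp [N, detN, Matrix.det_fin_two]

theorem det_H (r : Row) : (r.H).det = r.detH := by
  cases r <;> simp [H, detH, Matrix.det_fin_two, sgn]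

theorem unit_eq {ε ε' : ℤˣ} {s : ℝ} (hs : 0 < s) (h : ((ε : ℤ) : ℝ) = s * ((ε' : ℤ) : ℝ)) :
    ε = ε' := by
  rcases Int.units_eq_one_or ε with rfl | rfl <;> rcases Int.units_eq_one_or ε' with rfl | rfl <;>
    first | rfl | (norm_num at h; linarith)

/-- A scale invariant of `Ξ Ξ̄`. -/
def inv (r : Row) : ℝ := r.trN * |r.trN| / r.detN

/-- `(1 + λ²)² > 4 λ²`, strictly because `λ² ≠ 1`. -/
theorem inv_r1 {ε : ℤˣ} {lam : ℝ} (h : 1 < lam) : 4 < (r1 ε lam).inv := by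
  have h0 : 0 < lam ^ 2 := by positivity
  have h1 : 0 < 1 + lam ^ 2 := by positivity
  rw [inv, trN, detN, abs_of_pos h1, lt_div_iff₀ h0]
  nlinarith [sq_pos_of_pos (by nlinarith : 0 < lam ^ 2 - 1)]

theorem inv_r2 {θ : ℝ} (h : (r2 θ).Valid) : -4 < (r2 θ).inv ∧ (r2 θ).inv < 4 := by
  obtain ⟨h0, h1⟩ := h
  have hs := Real.sin_pos_of_pos_of_lt_pi h0 h1
  have hsq := Real.sin_sq_add_cos_sq θ
  simp only [inv, trN, detN, div_one, abs_mul, abs_two]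
  rcases abs_cases (Real.cos θ) with ⟨e, _⟩ | ⟨e, _⟩ <;> rw [e] <;> constructor <;> nlinarith

/-- Rows 4 and 7 are those with `det Ξ Ξ̄ = 0`, and the trace separates them. Elsewhere `tr |tr| /
det` exceeds 4 in row 1, lies strictly between -4 and 4 in row 2 and is ±4 in rows 3, 5 and 6. If
row 3 has the value 4, then `ε = 1` and `det H > 0`, unlike in rows 5 and 6; these differ by the
Jordan type of `Ξ Ξ̄`. The invariant and the sign of `det H` also recover the parameters. -/
theorem eq_of_rel {r r' : Row} (hr : r.Valid) (hr' : r'.Valid) {A : Mat2} {ρ : ℝ} {c : ℂ}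
    (h : Rel r.H r.S r'.H r'.S A ρ c) : r = r' := by
  obtain ⟨k, hk, hN, ht, hd⟩ := h.trace_det
  obtain ⟨s, hs, hH⟩ := h.det_form
  rw [Nm_eq, Nm_eq] at hN ht hd
  rw [trace_N, trace_N] at ht
  rw [det_N, det_N] at hd
  rw [det_H, det_H] at hH
  norm_cast at ht hd hH
  have hv : r'.inv = r.inv := by
    rw [inv, inv, ht, hd, abs_mul, abs_of_pos hk]
    by_cases h0 : r.detN = 0
    · simp [h0]
    · field_simp
  have hd0 : r'.detN = 0 ↔ r.detN = 0 := by
    rw [hd]; simp [hk.ne']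
  have ht0 : r'.trN = 0 ↔ r.trN = 0 := by
    rw [ht]; simp [hk.ne']
  -- `Ξ Ξ̄` is the identity in row 5 and a nontrivial Jordan block in row 6; the traces force the
  -- factor `k` to be 1.
  have hsc : ¬ (r = r5 ∧ r' = r6) ∧ ¬ (r = r6 ∧ r' = r5) := by
    have hA := h.unit.ne_zero
    obtain ⟨x, y, z, w, rfl⟩ := exists_eq_of A
    rw [Matrix.det_fin_two_of] at hA
    refine ⟨?_, ?_⟩
    · rintro ⟨rfl, rfl⟩
      have hk1 : k = 1 := by simp only [trN] at ht; linarith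
      subst hk1
      simp only [N, Matrix.mul_fin_two, smul_of, of_eq_of_iff] at hN
      obtain ⟨e1, e2, e3, e4⟩ := hN
      push_cast at e1 e2
      exact hA (by linear_combination (1 / 2) * x * e2 - (1 / 2) * y * e1)
    · rintro ⟨rfl, rfl⟩
      have hk1 : k = 1 := by simp only [trN] at ht; linarith
      subst hk1
      simp only [N, Matrix.mul_fin_two, smul_of, of_eq_of_iff] at hN
      obtain ⟨e1, e2, e3, e4⟩ := hN
      push_cast at e2 e4
      exact hA (by linear_combination -(1 / 2) * w * e2 + (1 / 2) * y * e4)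
  clear ht hd hN h
  have r3v : ∀ ε, (r3 ε).inv = 4 ∧ (r3 ε).detH = 1 ∨ (r3 ε).inv = -4 ∧ (r3 ε).detH = -1 := by
    intro ε
    rcases Int.units_eq_one_or ε with rfl | rfl
    · left; norm_num [inv, trN, detN, detH]
    · right; norm_num [inv, trN, detN, detH]
  have r5v : r5.inv = 4 := by norm_num [inv, trN, detN]
  have r6v : r6.inv = 4 := by norm_num [inv, trN, detN]
  have r1d : ∀ ε lam, (r1 ε lam).Valid → (r1 ε lam).detN ≠ 0 := fun ε lam h => by
    have : 1 < lam := h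
    simp only [detN]; positivity
  cases r with
  | r1 ε lam =>
    have b := inv_r1 (ε := ε) hr
    cases r' with
    | r1 ε' mu =>
      have hl : 1 < lam := hr
      have hm : 1 < mu := hr'
      obtain rfl : ε = ε' := unit_eq hs hH
      have e1 : 0 < 1 + lam ^ 2 := by positivity
      have e2 : 0 < 1 + mu ^ 2 := by positivity
      simp only [inv, trN, detN, abs_of_pos e1, abs_of_pos e2] at hv
      rw [div_eq_div_iff (by positivity) (by positivity)] at hv
      have e3 : (1 + mu ^ 2) * lam = (1 + lam ^ 2) * mu := by
        refine (pow_left_inj₀ (by positivity) (by positivity) two_ne_zero).1 ?_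
        linear_combination hv
      -- Injectivity of `λ + 1/λ` for `λ > 1`.
      have e4 : (lam - mu) * (lam * mu - 1) = 0 := by linear_combination -e3
      have e5 : lam * mu - 1 ≠ 0 := by nlinarith
      rw [sub_eq_zero.1 ((mul_eq_zero.1 e4).resolve_right e5)]
    | r2 θ => have := inv_r2 hr'; linarith
    | r3 ε' => rcases r3v ε' with ⟨h1, _⟩ | ⟨h1, _⟩ <;> linarith
    | r4 ε' => exact absurd (hd0.1 rfl) (r1d _ _ hr)
    | r5 => linarith
    | r6 => linarith
    | r7 => exact absurd (hd0.1 rfl) (r1d _ _ hr)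
  | r2 θ =>
    have b := inv_r2 hr
    cases r' with
    | r1 ε' mu => have := inv_r1 (ε := ε') hr'; linarith
    | r2 φ =>
      have e : Real.cos φ = Real.cos θ := by
        simp only [inv, trN, detN, div_one, abs_mul, abs_two] at hv
        rcases abs_cases (Real.cos φ) with ⟨e1, _⟩ | ⟨e1, _⟩ <;>
        rcases abs_cases (Real.cos θ) with ⟨e2, _⟩ | ⟨e2, _⟩ <;> rw [e1, e2] at hv <;> nlinarith
      rw [Real.injOn_cos ⟨hr'.1.le, hr'.2.le⟩ ⟨hr.1.le, hr.2.le⟩ e]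
    | r3 ε' => rcases r3v ε' with ⟨h1, _⟩ | ⟨h1, _⟩ <;> linarith
    | r4 ε' => exact absurd (hd0.1 rfl) one_ne_zero
    | r5 => linarith
    | r6 => linarith
    | r7 => exact absurd (hd0.1 rfl) one_ne_zero
  | r3 ε =>
    cases r' with
    | r1 ε' mu =>
      have := inv_r1 (ε := ε') hr'
      rcases r3v ε with ⟨h1, _⟩ | ⟨h1, _⟩ <;> linarith
    | r2 φ =>
      have := inv_r2 hr'
      rcases r3v ε with ⟨h1, _⟩ | ⟨h1, _⟩ <;> linarith
    | r3 ε' => rw [unit_eq hs hH]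
    | r4 ε' => exact absurd (hd0.1 rfl) one_ne_zero
    | r5 =>
      have : r5.detH = -1 := rfl
      rcases r3v ε with ⟨h1, h2⟩ | ⟨h1, h2⟩
      · rw [h2, this] at hH; linarith
      · linarith
    | r6 =>
      have : r6.detH = -1 := rfl
      rcases r3v ε with ⟨h1, h2⟩ | ⟨h1, h2⟩
      · rw [h2, this] at hH; linarith
      · linarith
    | r7 => exact absurd (hd0.1 rfl) one_ne_zero
  | r4 ε =>
    cases r' with
    | r4 ε' => rw [unit_eq hs hH]
    | r1 ε' mu => exact absurd (hd0.2 rfl) (r1d _ _ hr')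
    | r7 => exact absurd (ht0.1 rfl) one_ne_zero
    | _ => exact absurd (hd0.2 rfl) one_ne_zero
  | r5 =>
    cases r' with
    | r1 ε' mu => have := inv_r1 (ε := ε') hr'; linarith
    | r2 φ => have := inv_r2 hr'; linarith
    | r3 ε' =>
      have : r5.detH = -1 := rfl
      rcases r3v ε' with ⟨h1, h2⟩ | ⟨h1, h2⟩
      · rw [h2, this] at hH; linarith
      · linarith
    | r5 => rfl
    | r6 => exact absurd ⟨rfl, rfl⟩ hsc.1
    | _ => exact absurd (hd0.1 rfl) one_ne_zero
  | r6 =>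
    cases r' with
    | r1 ε' mu => have := inv_r1 (ε := ε') hr'; linarith
    | r2 φ => have := inv_r2 hr'; linarith
    | r3 ε' =>
      have : r6.detH = -1 := rfl
      rcases r3v ε' with ⟨h1, h2⟩ | ⟨h1, h2⟩
      · rw [h2, this] at hH; linarith
      · linarith
    | r6 => rfl
    | r5 => exact absurd ⟨rfl, rfl⟩ hsc.2
    | _ => exact absurd (hd0.1 rfl) one_ne_zero
  | r7 =>
    cases r' with
    | r7 => rfl
    | r1 ε' mu => exact absurd (hd0.2 rfl) (r1d _ _ hr')
    | r4 ε' => exact absurd (ht0.2 rfl) one_ne_zero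
    | _ => exact absurd (hd0.2 rfl) one_ne_zero

end Row

/-! ### Normal forms of pairs -/

/-- A congruence that normalizes `S` is compensated by pulling `H` back, which stays Hermitian and
invertible; only the normal forms of `S` remain to be treated. -/
theorem Rel.of_symm {H S S₀ B : Mat2} {c : ℂ} (h : IsPair H S) (hB : B.det ≠ 0) (hc : c ≠ 0)
    (hS : B * S₀ * Bᵀ = c • S) :
    Rel (Bᵀ * H * cbar B) S₀ H S B 1 c ∧ IsPair (Bᵀ * H * cbar B) S₀ := by
  refine ⟨⟨isUnit_iff_ne_zero.2 hB, one_ne_zero, hc, by simp, hS⟩, ⟨?_, ?_, ?_⟩⟩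
  · rw [cbar_mul, cbar_mul, cbar_cbar, h.herm]
    simp only [Matrix.transpose_mul, Matrix.transpose_transpose, Matrix.mul_assoc]
    rfl
  · rw [Matrix.det_mul, Matrix.det_mul, Matrix.det_transpose, det_cbar]
    exact ((isUnit_iff_ne_zero.2 hB).mul h.unit).mul
      (isUnit_iff_ne_zero.2 ((map_ne_zero _).2 hB))
  · rintro rfl
    rw [Matrix.mul_zero, Matrix.zero_mul] at hS
    exact h.ne ((smul_eq_zero.1 hS.symm).resolve_left hc)

theorem exists_herm_eq {H : Mat2} (h : cbar H = Hᵀ) :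
    ∃ (p d : ℝ) (q : ℂ), H = !![(p : ℂ), q; conj q, (d : ℂ)] := by
  obtain ⟨x, y, z, w, rfl⟩ := exists_eq_of H
  rw [cbar_of, transpose_of, of_eq_of_iff] at h
  obtain ⟨h1, h2, h3, h4⟩ := h
  refine ⟨x.re, w.re, y, ?_⟩
  rw [of_eq_of_iff]
  exact ⟨(Complex.conj_eq_iff_re.1 h1).symm, rfl, h2.symm, (Complex.conj_eq_iff_re.1 h4).symm⟩

/-- A nondegenerate binary quadratic form is a product of two independent linear factors, which are
the columns of `B`; `δ` is a square root of the discriminant `-det S`. -/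
theorem exists_rank_two {S : Mat2} (hS : Sᵀ = S) (hd : S.det ≠ 0) :
    ∃ (B : Mat2) (c : ℂ), B.det ≠ 0 ∧ c ≠ 0 ∧ B * !![0, 1; 1, 0] * Bᵀ = c • S := by
  obtain ⟨a, b, b', d, rfl⟩ := exists_eq_of S
  rw [transpose_of, of_eq_of_iff] at hS
  obtain rfl : b' = b := hS.2.1
  rw [Matrix.det_fin_two_of] at hd
  by_cases ha : a = 0
  · subst ha
    have hb : b' ≠ 0 := by rintro rfl; simp at hd
    refine ⟨!![0, 2 * b'; 1, d], 2, by simpa [Matrix.det_fin_two_of] using hb, two_ne_zero, ?_⟩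
    simp only [transpose_of, Matrix.mul_fin_two, smul_of, of_eq_of_iff]
    refine ⟨?_, ?_, ?_, ?_⟩ <;> ring
  · obtain ⟨δ, hδ⟩ := IsAlgClosed.exists_pow_nat_eq (b' ^ 2 - a * d) two_pos
    have hδ0 : δ ≠ 0 := by
      rintro rfl
      apply hd
      linear_combination hδ
    refine ⟨!![a, a; b' + δ, b' - δ], 2 * a, ?_, by simpa using ha, ?_⟩
    · rw [Matrix.det_fin_two_of]
      have : a * (b' - δ) - a * (b' + δ) = -2 * (a * δ) := by ring
      rw [this]
      simp [ha, hδ0]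
    · simp only [transpose_of, Matrix.mul_fin_two, smul_of, of_eq_of_iff]
      refine ⟨by ring, by ring, by ring, by linear_combination -2 * hδ⟩

/-- A symmetric matrix of rank one is a multiple of the square of one of its nonzero columns. -/
theorem exists_rank_one {S : Mat2} (hS : Sᵀ = S) (h0 : S ≠ 0) (hd : S.det = 0) :
    ∃ (B : Mat2) (c : ℂ), B.det ≠ 0 ∧ c ≠ 0 ∧ B * !![1, 0; 0, 0] * Bᵀ = c • S := by
  obtain ⟨a, b, b', d, rfl⟩ := exists_eq_of S
  rw [transpose_of, of_eq_of_iff] at hS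
  obtain rfl : b' = b := hS.2.1
  rw [Matrix.det_fin_two_of] at hd
  by_cases ha : a = 0
  · subst ha
    obtain rfl : b' = 0 := by simpa using hd
    have hd0 : d ≠ 0 := by rintro rfl; exact h0 (by simp [of_eq_zero_iff])
    refine ⟨!![0, 1; 1, 0], d⁻¹, by simp [Matrix.det_fin_two_of], inv_ne_zero hd0, ?_⟩
    simp only [transpose_of, Matrix.mul_fin_two, smul_of, of_eq_of_iff]
    simp [hd0]
  · refine ⟨!![a, 0; b', 1], a, by simpa [Matrix.det_fin_two_of] using ha, ha, ?_⟩
    simp only [transpose_of, Matrix.mul_fin_two, smul_of, of_eq_of_iff]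
    refine ⟨by ring, by ring, by ring, by linear_combination -hd⟩

/-- The pair `(H, S)` is related to some row. -/
def HasRow (H S : Mat2) : Prop :=
  ∃ r : Row, r.Valid ∧ ∃ (B : Mat2) (ρ : ℝ) (c : ℂ), Rel r.H r.S H S B ρ c

theorem HasRow.of_rel {H S H' S' B : Mat2} {ρ : ℝ} {c : ℂ} (h : HasRow H' S')
    (hr : Rel H' S' H S B ρ c) : HasRow H S := by
  obtain ⟨r, hv, B', ρ', c', h'⟩ := h
  exact ⟨r, hv, _, _, _, h'.trans hr⟩

/-- Upper triangular congruences preserve the line of `D(1,0)`. If the first basis vector is not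
isotropic for `H`, the second is made orthogonal to it, which gives row 4 with `ε` the sign of `det
H`; if it is isotropic, row 7 results. -/
theorem hasRow_rank_one {p d : ℝ} {q : ℂ} (hd : (p * d - q * conj q : ℂ) ≠ 0) :
    HasRow !![(p : ℂ), q; conj q, (d : ℂ)] !![1, 0; 0, 0] := by
  by_cases hp : p = 0
  · subst hp
    have hq : q ≠ 0 := by rintro rfl; simp at hd
    have hq' : conj q ≠ 0 := (map_ne_zero _).2 hq
    -- The off-diagonal entry makes the second basis vector isotropic, the lower one scales its
    -- product with the first to 1.
    refine ⟨.r7, trivial, !![1, -(d / (2 * (q * conj q))); 0, (conj q)⁻¹], 1, 1, ⟨?_, one_ne_zero,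
      one_ne_zero, ?_, ?_⟩⟩
    · rw [Matrix.det_fin_two_of, isUnit_iff_ne_zero]; simpa using hq
    · simp only [Row.H, cbar_of, transpose_of, Matrix.mul_fin_two, smul_of, of_eq_of_iff]
      simp
      rw [show conj (2 : ℂ) = 2 from map_ofNat _ 2]
      field_simp
      norm_num
    · simp only [Row.S, transpose_of, Matrix.mul_fin_two, smul_of, of_eq_of_iff]
      simp
  · have hpc : (p : ℂ) ≠ 0 := by exact_mod_cast hp
    set D : ℝ := p * d - Complex.normSq q with hD
    have hDc : (D : ℂ) = p * d - q * conj q := by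
      rw [hD, Complex.mul_conj]; push_cast; ring
    have hD0 : D ≠ 0 := by
      intro h0; apply hd; rw [← hDc, h0]; simp
    have hs : 0 < √|D| := Real.sqrt_pos.2 (abs_pos.2 hD0)
    set y : ℝ := |p| / √|D| with hy
    have hy0 : y ≠ 0 := (div_pos (abs_pos.2 hp) hs).ne'
    have hyy : y * y * |D| = p * p := by
      rw [hy, div_mul_div_comm, Real.mul_self_sqrt (abs_nonneg _), abs_mul_abs_self]
      field_simp
    obtain ⟨ε, hε⟩ : ∃ ε : ℤˣ, D = (ε : ℤ) * |D| := by
      rcases lt_or_gt_of_ne hD0 with h | h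
      · exact ⟨-1, by rw [abs_of_neg h]; simp⟩
      · exact ⟨1, by rw [abs_of_pos h]; simp⟩
    have hyD : (y : ℂ) * y * D = sgn ε * (p * p) := by
      have : y * y * D = (ε : ℤ) * (p * p) := by rw [← hyy]; conv_lhs => rw [hε]
                                                 ring
      rw [sgn]; exact_mod_cast this
    rw [hDc] at hyD
    refine ⟨.r4 ε, trivial, !![1, -(conj q * y / p); 0, y], p, 1, ⟨?_, hp, one_ne_zero, ?_, ?_⟩⟩
    · rw [Matrix.det_fin_two_of, isUnit_iff_ne_zero]; simpa using hy0
    · simp only [Row.H, cbar_of, transpose_of, Matrix.mul_fin_two, smul_of, of_eq_of_iff]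
      simp
      refine ⟨by field_simp; ring, by field_simp; ring, ?_⟩
      field_simp
      linear_combination hyD
    · simp only [Row.S, transpose_of, Matrix.mul_fin_two, smul_of, of_eq_of_iff]
      simp

/-- For `q = 0` this is row 3. For `η = 1` the vectors `(1,-1)` and `(1,1)` diagonalize both forms
and give row 1 with `λ = (1+q)/|1-q|`; for `η = -1` one gets row 2 with `θ` twice the argument of `q
+ i`. -/
theorem hasRow_reduced {q : ℝ} (hq : 0 ≤ q) {η : ℝ} (hη : η = 1 ∨ η = -1) (hd : η - q * q ≠ 0) :
    HasRow !![(1 : ℂ), q; q, η] !![0, 1; 1, 0] := by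
  rcases hq.eq_or_lt with rfl | hq
  · obtain ⟨ε, hε⟩ : ∃ ε : ℤˣ, (η : ℂ) = sgn ε := by
      rcases hη with rfl | rfl
      · exact ⟨1, by simp [sgn]⟩
      · exact ⟨-1, by simp [sgn]⟩
    refine ⟨.r3 ε, trivial, 1, 1, 1, ?_⟩
    have := Rel.refl (Row.r3 ε).H (Row.r3 ε).S
    rw [hε]
    simpa [Row.H, Row.S] using this
  rcases hη with rfl | rfl
  · have h1 : 1 - q ≠ 0 := by
      intro h; apply hd; nlinarith
    have ha : 0 < |1 - q| := abs_pos.2 h1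
    obtain ⟨ε, hε⟩ : ∃ ε : ℤˣ, 1 - q = (ε : ℤ) * |1 - q| := by
      rcases lt_or_gt_of_ne h1 with h | h
      · exact ⟨-1, by rw [abs_of_neg h]; simp⟩
      · exact ⟨1, by rw [abs_of_pos h]; simp⟩
    set lam := (1 + q) / |1 - q| with hlam
    have hl1 : 1 < lam := by
      rw [hlam, lt_div_iff₀ ha, one_mul, abs_lt]; constructor <;> linarith
    have hl0 : 0 < lam := by linarith
    have hle : lam * (1 - q) = (ε : ℤ) * (1 + q) := by
      rw [hε, hlam]; field_simp
    have hle' : (lam : ℂ) * (1 - q) = sgn ε * (1 + q) := by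
      rw [sgn]; exact_mod_cast hle
    -- Two conditions on `x` must hold at once: `x² = -λ` cancels the diagonal of the symmetric
    -- form, and `|x|² = λ` makes the Hermitian form a multiple of `D(1, ε)`.
    set x : ℂ := Complex.I * (√lam : ℝ) with hx
    have hs : ((√lam : ℝ) : ℂ) * (√lam : ℝ) = lam := by
      exact_mod_cast Real.mul_self_sqrt hl0.le
    have hxx : x * x = -lam := by
      rw [hx]; linear_combination Complex.I * Complex.I * hs + lam * Complex.I_mul_I
    have hxc : x * conj x = lam := by
      rw [hx, map_mul, Complex.conj_I, Complex.conj_ofReal]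
      linear_combination -(Complex.I * Complex.I * hs) - lam * Complex.I_mul_I
    have hx0 : x ≠ 0 := by
      intro h; rw [h] at hxx; simp at hxx; linarith
    refine ⟨.r1 ε lam, hl1, !![x, 1; -x, 1], (ε : ℤ) * (2 + 2 * q), 2 * lam, ⟨?_, ?_, ?_, ?_, ?_⟩⟩
    · rw [Matrix.det_fin_two_of, isUnit_iff_ne_zero]
      have : x * 1 - 1 * -x = 2 * x := by ring
      rw [this]; simpa using hx0
    · have : ((ε : ℤ) : ℝ) ≠ 0 := by exact_mod_cast ε.ne_zero
      exact mul_ne_zero this (by positivity)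
    · have : (lam : ℂ) ≠ 0 := by exact_mod_cast hl0.ne'
      simpa using this
    · have e : (((ε : ℤ) * (2 + 2 * q) : ℝ) : ℂ) = sgn ε * (2 + 2 * q) := by
        rw [sgn]; push_cast; rfl
      rw [e]
      have e2 := sgn_mul_self ε
      simp only [Row.H, cbar_of, transpose_of, Matrix.mul_fin_two, smul_of, of_eq_of_iff, map_neg,
        map_one, Complex.ofReal_one]
      refine ⟨?_, by ring, by ring, ?_⟩
      · linear_combination (2 - 2 * (q : ℂ)) * hxc + 2 * hle'
      · linear_combination (-2 - 2 * (q : ℂ)) * e2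
    · simp only [Row.S, transpose_of, Matrix.mul_fin_two, smul_of, of_eq_of_iff]
      refine ⟨?_, ?_, ?_, ?_⟩
      · linear_combination hxx
      · linear_combination -hxx
      · linear_combination -hxx
      · linear_combination hxx
  · set z : ℂ := q + Complex.I with hz
    have hz0 : z ≠ 0 := by
      intro h; have := congrArg Complex.im h; simp [hz] at this
    set φ := Complex.arg z with hφ
    set m : ℝ := ‖z‖ with hm
    have hm0 : 0 < m := norm_pos_iff.2 hz0
    have hmc : (m : ℂ) ≠ 0 := by exact_mod_cast hm0.ne'
    have hzu : (m : ℂ) * Complex.exp (φ * Complex.I) = z := Complex.norm_mul_exp_arg_mul_I z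
    have hφ1 : 0 < φ ∧ φ < Real.pi / 2 := by
      refine ⟨?_, ?_⟩
      · refine lt_of_le_of_ne (Complex.arg_nonneg_iff.2 (by simp [hz])) fun h => ?_
        have := Complex.arg_eq_zero_iff.1 (hφ ▸ h.symm)
        simp [hz] at this
      · exact lt_of_abs_lt ((Complex.abs_arg_lt_pi_div_two_iff).2 (Or.inl (by simpa [hz] using hq)))
    set u := Complex.exp (φ * Complex.I) with hu
    have huc : u * conj u = 1 := by
      rw [hu, ← Complex.exp_conj, ← Complex.exp_add]; simp
    have hE : Complex.exp (Complex.I * (2 * φ : ℝ)) = u * u := by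
      rw [hu, ← Complex.exp_add]; congr 1; push_cast; ring
    have hu0 : u ≠ 0 := Complex.exp_ne_zero _
    have hI := Complex.I_mul_I
    have hcu : (m : ℂ) * conj u = q - Complex.I := by
      have := congrArg conj hzu
      simpa [hz, map_mul, Complex.conj_ofReal, sub_eq_add_neg] using this
    refine ⟨.r2 (2 * φ), ⟨by linarith [hφ1.1], by linarith [hφ1.2]⟩,
      !![Complex.I * u, 1; -u, -Complex.I], -(2 * m), -(2 * Complex.I * (u * u)),
      ⟨?_, ?_, ?_, ?_, ?_⟩⟩
    · rw [Matrix.det_fin_two_of, isUnit_iff_ne_zero]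
      have : Complex.I * u * -Complex.I - 1 * -u = 2 * u := by linear_combination -u * hI
      rw [this]; simpa using hu0
    · exact neg_ne_zero.2 (by positivity)
    · simp [hu0]
    · simp only [Row.H, cbar_of, transpose_of, Matrix.mul_fin_two, smul_of, of_eq_of_iff, map_neg,
        map_one, map_mul, Complex.conj_I]
      push_cast
      refine ⟨?_, ?_, ?_, ?_⟩
      · linear_combination -(u * conj u) * hI
      · linear_combination q * u * hI - 2 * u * hcu.symm - 2 * m * huc
      · linear_combination q * conj u * hI - 2 * conj u * hzu.symm - 2 * m * huc
      · linear_combination hI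
    · rw [Row.S, hE]
      simp only [transpose_of, Matrix.mul_fin_two, smul_of, of_eq_of_iff]
      refine ⟨?_, ?_, ?_, ?_⟩
      · linear_combination u * u * hI
      · ring
      · ring
      · linear_combination u * u * hI

/-- Diagonal matrices and the swap preserve the line of `J`. Both diagonal entries of `H` zero gives
row 5, exactly one zero gives row 6; otherwise rescaling makes the diagonal `1, ±1` and the
off-diagonal entry nonnegative, as in `hasRow_reduced`. -/
theorem hasRow_rank_two {p d : ℝ} {q : ℂ} (hd : (p * d - q * conj q : ℂ) ≠ 0) :
    HasRow !![(p : ℂ), q; conj q, (d : ℂ)] !![0, 1; 1, 0] := by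
  by_cases hp : p = 0
  · subst hp
    have hq : q ≠ 0 := by rintro rfl; simp at hd
    have hq' : conj q ≠ 0 := (map_ne_zero _).2 hq
    by_cases hd0 : d = 0
    · subst hd0
      refine ⟨.r5, trivial, !![1, 0; 0, (conj q)⁻¹], 1, (conj q)⁻¹, ⟨?_, one_ne_zero,
        inv_ne_zero hq', ?_, ?_⟩⟩
      · rw [Matrix.det_fin_two_of, isUnit_iff_ne_zero]; simpa using hq
      · simp only [Row.H, cbar_of, transpose_of, Matrix.mul_fin_two, smul_of, of_eq_of_iff]
        simp [hq]
      · simp only [Row.S, transpose_of, Matrix.mul_fin_two, smul_of, of_eq_of_iff]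
        simp
    · have hdc : (d : ℂ) ≠ 0 := by exact_mod_cast hd0
      refine ⟨.r6, trivial, !![2 * (d / (2 * q)), -(d / (2 * q)); 0, 1], d, d / q, ⟨?_, hd0,
        div_ne_zero hdc hq, ?_, ?_⟩⟩
      · rw [Matrix.det_fin_two_of, isUnit_iff_ne_zero]; simp [hq, hd0]
      · simp only [Row.H, cbar_of, transpose_of, Matrix.mul_fin_two, smul_of, of_eq_of_iff]
        simp
        rw [show conj (2 : ℂ) = 2 from map_ofNat _ 2]
        refine ⟨?_, ?_, ?_⟩ <;> field_simp <;> ring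
      · simp only [Row.S, transpose_of, Matrix.mul_fin_two, smul_of, of_eq_of_iff]
        refine ⟨?_, ?_, ?_, ?_⟩ <;> field_simp <;> ring
  have hpc : (p : ℂ) ≠ 0 := by exact_mod_cast hp
  by_cases hd0 : d = 0
  · subst hd0
    have hq : q ≠ 0 := by rintro rfl; simp at hd
    have hq' : conj q ≠ 0 := (map_ne_zero _).2 hq
    refine ⟨.r6, trivial, !![0, 1; 2 * (p / (2 * conj q)), -(p / (2 * conj q))], p, p / conj q,
      ⟨?_, hp, div_ne_zero hpc hq', ?_, ?_⟩⟩
    · rw [Matrix.det_fin_two_of, isUnit_iff_ne_zero]; simp [hq, hp]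
    · simp only [Row.H, cbar_of, transpose_of, Matrix.mul_fin_two, smul_of, of_eq_of_iff]
      simp
      rw [show conj (2 : ℂ) = 2 from map_ofNat _ 2]
      refine ⟨?_, ?_, ?_⟩ <;> field_simp <;> ring
    · simp only [Row.S, transpose_of, Matrix.mul_fin_two, smul_of, of_eq_of_iff]
      refine ⟨?_, ?_, ?_, ?_⟩ <;> field_simp <;> ring
  have hdc : (d : ℂ) ≠ 0 := by exact_mod_cast hd0
  have sign : ∀ x : ℝ, x ≠ 0 → ∃ s : ℝ, (s = 1 ∨ s = -1) ∧ x = s * |x| := by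
    intro x hx
    rcases lt_or_gt_of_ne hx with h | h
    · exact ⟨-1, Or.inr rfl, by rw [abs_of_neg h]; ring⟩
    · exact ⟨1, Or.inl rfl, by rw [abs_of_pos h]; ring⟩
  obtain ⟨s, hs, hps⟩ := sign p hp
  obtain ⟨s', hs', hds⟩ := sign d hd0
  have hss : s * s = 1 := by rcases hs with rfl | rfl <;> norm_num
  have hss' : s' * s' = 1 := by rcases hs' with rfl | rfl <;> norm_num
  have hs0 : s ≠ 0 := by rintro rfl; simp at hss
  -- A phase with `q ē = s |q|`: after division by the sign `s` of `p` the off-diagonal entry is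
  -- real and nonnegative.
  obtain ⟨e, hee, heq⟩ : ∃ e : ℂ, e * conj e = 1 ∧ q * conj e = s * ‖q‖ := by
    by_cases hq : q = 0
    · exact ⟨1, by simp, by simp [hq]⟩
    · have hn : (‖q‖ : ℂ) ≠ 0 := by exact_mod_cast (norm_pos_iff.2 hq).ne'
      have hqq : q * conj q = ‖q‖ * ‖q‖ := by
        rw [Complex.mul_conj, Complex.normSq_eq_norm_sq]; push_cast; ring
      have hsc : (s : ℂ) * s = 1 := by exact_mod_cast hss
      refine ⟨s * q / ‖q‖, ?_, ?_⟩
      · simp only [map_div₀, map_mul, Complex.conj_ofReal]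
        field_simp
        linear_combination q * conj q * hsc + hqq
      · simp only [map_div₀, map_mul, Complex.conj_ofReal]
        field_simp
        linear_combination s * hqq
  have hp' : 0 < |p| := abs_pos.2 hp
  have hd' : 0 < |d| := abs_pos.2 hd0
  set t : ℝ := (√|p|)⁻¹ with ht
  set v : ℝ := (√|d|)⁻¹ with hv
  have ht0 : 0 < t := inv_pos.2 (Real.sqrt_pos.2 hp')
  have hv0 : 0 < v := inv_pos.2 (Real.sqrt_pos.2 hd')
  have htt : t * t * p = s := by
    have : t * t * |p| = 1 := by
      rw [ht, ← mul_inv, Real.mul_self_sqrt hp'.le, inv_mul_cancel₀ hp'.ne']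
    rw [hps]; linear_combination s * this
  have hvv : v * v * d = s' := by
    have : v * v * |d| = 1 := by
      rw [hv, ← mul_inv, Real.mul_self_sqrt hd'.le, inv_mul_cancel₀ hd'.ne']
    rw [hds]; linear_combination s' * this
  have he0 : e ≠ 0 := by rintro rfl; simp at hee
  have hred := hasRow_reduced (q := ‖q‖ * t * v) (η := s * s') (by positivity) (by
    rcases hs with rfl | rfl <;> rcases hs' with rfl | rfl <;> norm_num) (by
    intro h0
    apply hd
    have h1 : (t * t) * (v * v) * (p * d - ‖q‖ * ‖q‖) = 0 := by
      linear_combination h0 + (v * v * d) * htt + s * hvv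
    have h2 := (mul_eq_zero.1 h1).resolve_left (by positivity)
    rw [Complex.mul_conj, Complex.normSq_eq_norm_sq]
    have h3 : p * d - ‖q‖ ^ 2 = 0 := by linear_combination h2
    exact_mod_cast h3)
  refine hred.of_rel (B := !![(t : ℂ), 0; 0, v * e]) (ρ := s) (c := t * v * e) ⟨?_, hs0, ?_, ?_, ?_⟩
  · rw [Matrix.det_fin_two_of, isUnit_iff_ne_zero]; simp [ht0.ne', hv0.ne', he0]
  · simp [ht0.ne', hv0.ne', he0]
  · have htc : (t : ℂ) * t * p = s := by exact_mod_cast htt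
    have hvc : (v : ℂ) * v * d = s' := by exact_mod_cast hvv
    have hsc : (s : ℂ) * s = 1 := by exact_mod_cast hss
    have heq' := congrArg conj heq
    simp only [map_mul, Complex.conj_conj, Complex.conj_ofReal] at heq'
    simp only [cbar_of, transpose_of, Matrix.mul_fin_two, smul_of, of_eq_of_iff, map_mul,
      Complex.conj_ofReal, map_zero]
    push_cast
    refine ⟨?_, ?_, ?_, ?_⟩
    · linear_combination htc
    · linear_combination t * v * heq
    · linear_combination t * v * heq'
    · linear_combination e * conj e * hvc + s' * hee - s' * hsc
  · simp only [transpose_of, Matrix.mul_fin_two, smul_of, of_eq_of_iff]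
    refine ⟨?_, ?_, ?_, ?_⟩ <;> ring

theorem IsPair.hasRow {H S : Mat2} (h : IsPair H S) (hS : Sᵀ = S) : HasRow H S := by
  by_cases hd : S.det = 0
  · obtain ⟨B, c, hB, hc, e⟩ := exists_rank_one hS h.ne hd
    obtain ⟨h1, h2⟩ := Rel.of_symm h hB hc e
    refine HasRow.of_rel ?_ h1
    obtain ⟨p, d, q, hH⟩ := exists_herm_eq h2.herm
    have := h2.unit
    rw [hH] at this ⊢
    rw [Matrix.det_fin_two_of] at this
    exact hasRow_rank_one this.ne_zero
  · obtain ⟨B, c, hB, hc, e⟩ := exists_rank_two hS hd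
    obtain ⟨h1, h2⟩ := Rel.of_symm h hB hc e
    refine HasRow.of_rel ?_ h1
    obtain ⟨p, d, q, hH⟩ := exists_herm_eq h2.herm
    have := h2.unit
    rw [hH] at this ⊢
    rw [Matrix.det_fin_two_of] at this
    exact hasRow_rank_two this.ne_zero

/-! ### Self-equivalences of a row and invariance of `τ`. -/

namespace Row

variable {r : Row} {A : Mat2} {ρ : ℝ} {c : ℂ}

/-- The self-equivalences of a row that contains `τ` are diagonal. -/
theorem residual (hr : r.Valid) (hT : r.HasTau) (h : Rel r.H r.S r.H r.S A ρ c) :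
    ‖c / (ρ : ℂ)‖ = 1 ∧ ∃ x y : ℂ, A = !![x, 0; 0, y] ∧ x ≠ 0 ∧ ‖x‖ = ‖y‖ ∧ (r = r6 → x = y) := by
  -- Trace or determinant forces `k = 1`, so `A` commutes with `Ξ Ξ̄`. Distinct eigenvalues make `A`
  -- diagonal in rows 1, 2 and 4; in row 6 the Jordan block leaves one off-diagonal entry, which the
  -- condition on `S` removes. The conditions on `H` and `S` then give the absolute values.
  obtain ⟨k, hk, hN, ht, hd⟩ := h.trace_det
  rw [Nm_eq] at hN ht hd
  rw [trace_N] at ht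
  rw [det_N] at hd
  norm_cast at ht hd
  have hform := h.form
  have hsymm := h.symm
  have hu := h.unit.ne_zero
  have hρ := h.r_ne
  have hρn : 0 < |ρ| := abs_pos.2 hρ
  clear h
  obtain ⟨x, y, z, w, rfl⟩ := exists_eq_of A
  have norm_of : ∀ {a b : ℂ} {s : ℝ}, a * conj b = s → ‖a‖ * ‖b‖ = |s| := fun {a b s} e => by
    have := congrArg norm e
    simpa using this
  have norm_sq : ∀ {a b : ℂ}, a * a = b → ‖a‖ * ‖a‖ = ‖b‖ := fun {a b} e => by
    rw [← e, norm_mul]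
  have hcρ : ‖c‖ = |ρ| → ‖c / (ρ : ℂ)‖ = 1 := fun e => by
    rw [norm_div, e, Complex.norm_real, Real.norm_eq_abs, div_self hρn.ne']
  have hxy : ∀ {a b : ℝ}, 0 ≤ a → 0 ≤ b → a * a = b * b → a = b := fun ha hb e =>
    (mul_self_inj_of_nonneg ha hb).1 e
  cases r with
  | r1 ε lam =>
    have hl : 1 < lam := hr
    have hk1 : k = 1 := by
      have h1 : (1 + lam ^ 2) ≠ 0 := by positivity
      simp only [trN] at ht
      refine mul_right_cancel₀ h1 ?_
      linarith
    subst hk1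
    simp only [N, Matrix.mul_fin_two, smul_of, of_eq_of_iff] at hN
    have hl' : (1 : ℂ) - lam ^ 2 ≠ 0 := by
      have : (1 : ℝ) - lam ^ 2 ≠ 0 := by nlinarith
      exact_mod_cast this
    obtain ⟨-, e2, e3, -⟩ := hN
    push_cast at e2 e3
    obtain rfl : y = 0 := (mul_eq_zero.1 (by linear_combination e2 :
      (1 - (lam : ℂ) ^ 2) * y = 0)).resolve_left hl'
    obtain rfl : z = 0 := (mul_eq_zero.1 (by linear_combination -e3 :
      (1 - (lam : ℂ) ^ 2) * z = 0)).resolve_left hl'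
    have hl0 : (lam : ℂ) ≠ 0 := by
      have : lam ≠ 0 := by positivity
      exact_mod_cast this
    simp only [H, S, transpose_of, cbar_of, Matrix.mul_fin_two, smul_of, of_eq_of_iff, map_zero]
      at hform hsymm
    have f1 := norm_of (by linear_combination hform.1 : x * conj x = (ρ : ℝ))
    have f2 := norm_of (s := ρ) (mul_left_cancel₀ (sgn_ne_zero ε)
      (by linear_combination hform.2.2.2 : sgn ε * (w * conj w) = sgn ε * ρ))
    have f3 := norm_sq (by linear_combination hsymm.1 : x * x = c)
    refine ⟨hcρ (by rw [← f3, f1]), x, w, rfl, ?_, hxy (norm_nonneg _) (norm_nonneg _)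
      (by rw [f1, f2]), by simp⟩
    rintro rfl; simp at hu
  | r2 θ =>
    have hk1 : k = 1 := by
      simp only [detN] at hd
      nlinarith
    subst hk1
    simp only [N, Matrix.mul_fin_two, smul_of, of_eq_of_iff] at hN
    have hE := exp_I_sq_ne_one hr.1 hr.2
    have hE0 : Complex.exp (Complex.I * θ) ≠ 0 := Complex.exp_ne_zero _
    have hc := conj_exp_I θ
    set E := Complex.exp (Complex.I * θ) with hEdef
    have hl' : 1 - E * E ≠ 0 := sub_ne_zero.2 hE.symm
    obtain ⟨-, e2, e3, -⟩ := hN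
    push_cast at e2 e3
    obtain rfl : y = 0 := (mul_eq_zero.1 (by linear_combination E * e2 - y * hc :
      (1 - E * E) * y = 0)).resolve_left hl'
    obtain rfl : z = 0 := (mul_eq_zero.1 (by linear_combination -E * e3 - z * hc :
      (1 - E * E) * z = 0)).resolve_left hl'
    simp only [H, S, transpose_of, cbar_of, Matrix.mul_fin_two, smul_of, of_eq_of_iff, map_zero]
      at hform hsymm
    have f1 := norm_of (by linear_combination hform.2.1 : x * conj w = (ρ : ℝ))
    have f3 := norm_sq (by linear_combination hsymm.1 : x * x = c)
    have f4 := norm_sq (mul_left_cancel₀ hE0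
      (by linear_combination hsymm.2.2.2 : E * (w * w) = E * c))
    have f5 : ‖x‖ = ‖w‖ := hxy (norm_nonneg _) (norm_nonneg _) (by rw [f3, f4])
    refine ⟨hcρ (by rw [← f3, ← f1, ← f5]), x, w, rfl, ?_, f5, by simp⟩
    rintro rfl; simp at hu
  | r4 ε =>
    have hk1 : k = 1 := by simp only [trN] at ht; linarith
    subst hk1
    simp only [N, Matrix.mul_fin_two, smul_of, of_eq_of_iff] at hN
    obtain ⟨-, e2, e3, -⟩ := hN
    push_cast at e2 e3
    obtain rfl : y = 0 := by linear_combination e2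
    obtain rfl : z = 0 := by linear_combination -e3
    simp only [H, S, transpose_of, cbar_of, Matrix.mul_fin_two, smul_of, of_eq_of_iff, map_zero]
      at hform hsymm
    have f1 := norm_of (by linear_combination hform.1 : x * conj x = (ρ : ℝ))
    have f2 := norm_of (s := ρ) (mul_left_cancel₀ (sgn_ne_zero ε)
      (by linear_combination hform.2.2.2 : sgn ε * (w * conj w) = sgn ε * ρ))
    have f3 := norm_sq (by linear_combination hsymm.1 : x * x = c)
    refine ⟨hcρ (by rw [← f3, f1]), x, w, rfl, ?_, hxy (norm_nonneg _) (norm_nonneg _)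
      (by rw [f1, f2]), by simp⟩
    rintro rfl; simp at hu
  | r6 =>
    have hk1 : k = 1 := by simp only [trN] at ht; linarith
    subst hk1
    simp only [N, Matrix.mul_fin_two, smul_of, of_eq_of_iff] at hN
    obtain ⟨e1, e2, e3, e4⟩ := hN
    push_cast at e1 e2 e3
    obtain rfl : z = 0 := by linear_combination (1 / 2) * e1
    obtain rfl : w = x := by linear_combination (1 / 2) * e2
    have hw : w ≠ 0 := by rintro rfl; simp at hu
    simp only [H, S, transpose_of, cbar_of, Matrix.mul_fin_two, smul_of, of_eq_of_iff, map_zero]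
      at hform hsymm
    have hy : w * y = 0 := by linear_combination (1 / 2) * (hsymm.1 - hsymm.2.1)
    obtain rfl : y = 0 := (mul_eq_zero.1 hy).resolve_left hw
    have f1 := norm_of (by linear_combination hform.2.1 : w * conj w = (ρ : ℝ))
    have f3 := norm_sq (by linear_combination hsymm.2.1 : w * w = c)
    exact ⟨hcρ (by rw [← f3, f1]), w, w, rfl, hw, rfl, fun _ => rfl⟩
  | _ => exact absurd hT id

theorem N02_conj (hT : r.HasTau) {x y : ℂ} {X : Mat2} (hX : X ∈ r.N02) :
    (!![x, 0; 0, y] : Mat2) * X * (!![x, 0; 0, y] : Mat2)ᵀ ∈ r.N02 := by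
  cases r with
  | r3 | r5 | r7 => exact absurd hT id
  | _ =>
    obtain ⟨f, rfl⟩ := hX
    refine ⟨y * f * y, ?_⟩
    simp only [transpose_of, Matrix.mul_fin_two, of_eq_of_iff]
    refine ⟨?_, ?_, ?_, ?_⟩ <;> ring

/-- By `residual` the conjugation and the factor `c/ρ` change the coefficient of `Ω₁` by phases
only. An entry that is unaffected by `g'_{0,0}` is compared in absolute value. -/
theorem tau_eq (hr : r.Valid) (hT : r.HasTau) (h : Rel r.H r.S r.H r.S A ρ c) {τ τ' : ℝ}
    (h0 : 0 ≤ τ) (h0' : 0 ≤ τ')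
    (hΩ : A * ((τ : ℂ) • r.Ω₁) * A⁻¹ - (c / ρ) • ((τ' : ℂ) • r.Ω₁) ∈ r.g) : τ = τ' := by
  obtain ⟨hc, x, y, rfl, hx, hxy, h6⟩ := residual hr hT h
  set k := c / (ρ : ℂ)
  set G := !![x, 0; 0, y] * ((τ : ℂ) • r.Ω₁) * (!![x, 0; 0, y])⁻¹ - k • ((τ' : ℂ) • r.Ω₁) with hG
  have e : (τ : ℂ) • (!![x, 0; 0, y] * r.Ω₁) = (k * τ') • (r.Ω₁ * !![x, 0; 0, y]) +
      G * !![x, 0; 0, y] := by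
    rw [hG, Matrix.sub_mul, Matrix.nonsing_inv_mul_cancel_right _ _ h.unit]
    simp only [Matrix.smul_mul, Matrix.mul_smul, smul_smul]
    abel
  have hx' : 0 < ‖x‖ := norm_pos_iff.2 hx
  have fin : ∀ {a b : ℂ}, ‖a‖ = ‖x‖ → ‖b‖ = ‖x‖ → (τ : ℂ) * a = k * τ' * b → τ = τ' := by
    intro a b ha hb hab
    have := congrArg norm hab
    rw [norm_mul, norm_mul, norm_mul, hc, ha, hb, one_mul, Complex.norm_of_nonneg h0,
      Complex.norm_of_nonneg h0'] at this
    exact mul_right_cancel₀ hx'.ne' this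
  clear_value G
  cases r with
  | r1 ε lam =>
    obtain ⟨a, rfl⟩ := hΩ
    simp only [Ω₁, Matrix.mul_fin_two, smul_of, add_of, of_eq_of_iff] at e
    exact fin hxy.symm rfl (by linear_combination e.2.2.1)
  | r2 θ =>
    obtain ⟨a, rfl⟩ := hΩ
    simp only [Ω₁, Matrix.mul_fin_two, smul_of, add_of, of_eq_of_iff] at e
    exact fin hxy.symm rfl (by linear_combination e.2.2.1)
  | r4 ε =>
    obtain ⟨a, b, rfl⟩ := hΩ
    simp only [Ω₁, Matrix.mul_fin_two, smul_of, add_of, of_eq_of_iff] at e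
    exact fin hxy.symm rfl (by linear_combination e.2.2.1)
  | r6 =>
    obtain ⟨a, rfl⟩ := hΩ
    simp only [Ω₁, Matrix.mul_fin_two, smul_of, add_of, of_eq_of_iff] at e
    exact fin rfl hxy.symm (by linear_combination e.2.1)
  | _ => exact absurd hT id

theorem Ω₁_eq_zero (hT : ¬ r.HasTau) : r.Ω₁ = 0 := by
  cases r <;> first | rfl | exact absurd trivial hT

/-- Scalars of modulus 1 keep `H` and multiply `S` by `u²`, hence rotate the coefficient of `Ω₁`
freely. -/
theorem scalar_rel (r : Row) {u : ℂ} (hu : u * conj u = 1) :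
    Rel r.H r.S r.H r.S (u • (1 : Mat2)) 1 (u ^ 2) := by
  have hu0 : u ≠ 0 := by rintro rfl; simp at hu
  refine ⟨by simp [hu0], one_ne_zero, pow_ne_zero _ hu0, ?_, ?_⟩
  · rw [cbar_smul, cbar_one]
    simp [smul_smul, mul_comm (conj u), hu]
  · simp [smul_smul, pow_two]

end Row

namespace Entry

theorem eq_of_rel {t t' : Entry} (ht : t.Valid) (ht' : t'.Valid) {A : Mat2} {ρ : ℝ} {c : ℂ}
    (h : Rel t.row.H t.row.S t'.row.H t'.row.S A ρ c)
    (hΩ : A * t.Ω * A⁻¹ - (c / ρ) • t'.Ω ∈ t'.row.g) : t = t' := by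
  have hrow := Row.eq_of_rel ht.1 ht'.1 h
  obtain ⟨r, τ⟩ := t
  obtain ⟨r', τ'⟩ := t'
  obtain rfl : r = r' := hrow
  congr 1
  by_cases hT : r.HasTau
  · rw [Ω_eq, Ω_eq] at hΩ
    exact Row.tau_eq ht.1 hT h ht.2.1 ht'.2.1 hΩ
  · have h1 : τ = 0 := ht.2.2 hT
    have h2 : τ' = 0 := ht'.2.2 hT
    rw [h1, h2]

/-- Every multiple of `Ω₁` is, up to a phase, the `Ω` of an entry. -/
theorem exists_phase {r : Row} (hr : r.Valid) (t : ℂ) :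
    ∃ (E : Entry) (u : ℂ), E.Valid ∧ E.row = r ∧ u * conj u = 1 ∧
      u ^ 2 • (t • r.Ω₁) = E.Ω := by
  by_cases hT : r.HasTau
  · obtain ⟨u, hu, hut⟩ : ∃ u : ℂ, u * conj u = 1 ∧ u ^ 2 * t = ‖t‖ := by
      by_cases h0 : t = 0
      · exact ⟨1, by simp, by simp [h0]⟩
      · refine ⟨Complex.exp ((-(t.arg / 2) : ℝ) * Complex.I), ?_, ?_⟩
        · rw [← Complex.exp_conj, ← Complex.exp_add, map_mul, Complex.conj_ofReal, Complex.conj_I]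
          simp
        · rw [← Complex.exp_nat_mul]
          conv_lhs => rhs; rw [← Complex.norm_mul_exp_arg_mul_I t]
          rw [mul_left_comm, ← Complex.exp_add]
          have : ((2 : ℕ) : ℂ) * (((-(t.arg / 2) : ℝ) : ℂ) * Complex.I) + t.arg * Complex.I = 0 := by
            push_cast; ring
          rw [this, Complex.exp_zero, mul_one]
    refine ⟨⟨r, ‖t‖⟩, u, ⟨hr, norm_nonneg _, fun h => absurd hT h⟩, rfl, hu, ?_⟩
    rw [Ω_eq, smul_smul, hut]
  · refine ⟨⟨r, 0⟩, 1, ⟨hr, le_rfl, fun _ => rfl⟩, rfl, by simp, ?_⟩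
    rw [Ω_eq, Row.Ω₁_eq_zero hT]; simp

end Entry

/-! ### Normalized frames: existence and uniqueness of the entry. -/

namespace AdaptedFrame

variable {M : Hypersurface} {p : C4} (φ ψ : AdaptedFrame M p)

theorem isPair (hM : M.IsUniformly2Nondegenerate) (hp : p ∈ M.carrier) :
    IsPair (φ.H p) (φ.S02 p) :=
  ⟨φ.H_herm hM hp, isUnit_iff_ne_zero.2 (φ.det_H hM φ.p_mem hp), φ.S_ne_zero hM hp⟩

/-- The derivative of `S^{0,2}` along `e` at `p`. -/
def dS : Mat2 := applyMat (hol φ.e) φ.S02 p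

/-- The relation at `p` between the invariants of two adapted frames. -/
structure Link (B : Mat2) (ρ : ℝ) (c : ℂ) (Y : Mat2) : Prop where
  rel : Rel (ψ.H p) (ψ.S02 p) (φ.H p) (φ.S02 p) B ρ c
  Ω_eq : B * ψ.Ω p = (c / ρ) • ((φ.Ω p + Y) * B)
  dS_eq : ∃ k : ℂ, B * ψ.dS * Bᵀ =
    k • φ.S02 p + (c ^ 2 / ρ) • (φ.dS - (Y * φ.S02 p + φ.S02 p * Yᵀ))

variable {φ ψ}

/-- All transformation laws at `p` with `Y = e(U) U⁻¹`. Here `c` is the product of the factors of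
`e` and `g`, so `c/ρ` is the factor of `e`. -/
theorem Change.link (χ : Change φ ψ) (hM : M.IsUniformly2Nondegenerate) (hp : p ∈ M.carrier) :
    Link φ ψ (χ.U p) (χ.r p).re (χ.c p * χ.r p) (dm χ.U p (φ.e p, 0) * (χ.U p)⁻¹) := by
  have h := χ.eventually_at.self_of_nhds hp
  have hr : (((χ.r p).re : ℝ) : ℂ) = χ.r p := Complex.conj_eq_iff_re.1 (h.conj_r hM.analytic hp)
  have hr0 := h.r_ne hp
  have hu := isUnit_iff_ne_zero.2 (h.det_U hM hp)
  have hX : dm χ.U p (φ.e p, 0) = dm χ.U p (φ.e p, 0) * (χ.U p)⁻¹ * χ.U p := by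
    rw [Matrix.nonsing_inv_mul_cancel_right _ _ hu]
  set Y := dm χ.U p (φ.e p, 0) * (χ.U p)⁻¹
  have hS := h.S_eq hM hp
  refine ⟨⟨hu, fun h0 => hr0 (by rw [← hr, h0, Complex.ofReal_zero]),
    mul_ne_zero (h.c_ne hp) hr0, ?_, hS⟩, ?_, ?_⟩
  · rw [hr, h.H_eq hM.analytic hp]
  · rw [h.Ω_eq hM hp, hr, mul_div_cancel_right₀ _ hr0, Matrix.add_mul, ← hX]
  · obtain ⟨k, hk⟩ := (χ.derivatives hM hp).1
    refine ⟨k, ?_⟩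
    rw [hX, Matrix.transpose_mul, Matrix.mul_assoc Y, Matrix.mul_assoc Y, hS,
      ← Matrix.mul_assoc (χ.U p * ψ.S02 p), hS] at hk
    have e : (χ.c p * χ.r p) ^ 2 / χ.r p = χ.c p ^ 2 * χ.r p := by field_simp
    rw [hr, e, dS, dS]
    simp only [Matrix.mul_smul, Matrix.smul_mul] at hk
    linear_combination (norm := module) hk

theorem exists_link_of_rel (φ : AdaptedFrame M p) (hM : M.IsUniformly2Nondegenerate)
    (hp : p ∈ M.carrier) {H S B : Mat2} {ρ : ℝ} {c : ℂ} (h : Rel H S (φ.H p) (φ.S02 p) B ρ c)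
    (Y : Mat2) : ∃ ψ : AdaptedFrame M p, ψ.H p = H ∧ ψ.S02 p = S ∧ Link φ ψ B ρ c Y ∧
      (B = 1 → c = 1 → ρ = 1 → ψ.SameAt φ) := by
  have hr0 := h.r_ne'
  obtain ⟨ψ, χ, hU, hX, hc, hr, hs⟩ := φ.exists_change hM hp h.unit.ne_zero (Y * B)
    (div_ne_zero h.c_ne hr0) h.r_ne
  have hl := χ.link hM hp
  rw [hU, hX, hc, hr, Complex.ofReal_re, div_mul_cancel₀ _ hr0,
    Matrix.mul_nonsing_inv_cancel_right _ _ h.unit] at hl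
  refine ⟨ψ, ?_, ?_, hl, fun h1 h2 h3 => hs h1 (by rw [h2, h3]; simp) h3⟩
  · exact smul_right_injective _ hr0 (hl.rel.form.symm.trans h.form)
  · have e := hl.rel.symm.trans h.symm.symm
    have e2 : B⁻¹ * (B * ψ.S02 p * Bᵀ) * (Bᵀ)⁻¹ = B⁻¹ * (B * S * Bᵀ) * (Bᵀ)⁻¹ := by rw [e]
    simpa only [← Matrix.mul_assoc, Matrix.nonsing_inv_mul _ h.unit, Matrix.one_mul,
      Matrix.mul_nonsing_inv_cancel_right _ _ h.unit_transpose] using e2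

theorem exists_link (φ ψ : AdaptedFrame M p) (hM : M.IsUniformly2Nondegenerate)
    (hp : p ∈ M.carrier) : ∃ (B : Mat2) (ρ : ℝ) (c : ℂ) (Y : Mat2), Link φ ψ B ρ c Y ∧
      (φ.SameAt ψ → B = 1 ∧ ρ = 1 ∧ c = 1) := by
  obtain ⟨χ, hs⟩ := φ.nonempty_change ψ hM hp
  refine ⟨_, _, _, _, χ.link hM hp, fun h => ?_⟩
  obtain ⟨h1, h2, h3⟩ := hs h
  simp [h1, h2, h3]

/-- By `deriv_P` the condition on `e(S^{0,-2})` involves no derivative: it says that `Ω` preserves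
the line of `S^{0,-2}` infinitesimally, and `stab_iff` describes such matrices. -/
theorem isNormalizedFor_iff {r : Row} (hr : r.Valid) (hM : M.IsUniformly2Nondegenerate)
    (hp : p ∈ M.carrier) : φ.IsNormalizedFor r ↔ φ.H p = r.H ∧ φ.S02 p = r.S ∧
      (∃ t : ℂ, φ.Ω p - t • r.Ω₁ ∈ r.g) ∧ ∃ N ∈ r.N02, ∃ k : ℂ, φ.dS = N + k • r.S := by
  refine and_congr_right fun hH => and_congr_right fun hS => ?_
  have hP : φ.S0m2 p = r.P := by rw [φ.P_eq hM hp, hH, hS]; exact r.Pm_eq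
  obtain ⟨γ, hγ⟩ := φ.deriv_P hM hp
  rw [hP] at hγ
  rw [NormalizedAt, hS, hP, hγ]
  refine and_congr ?_ Iff.rfl
  rw [← Row.stab_iff hr]
  constructor
  · rintro ⟨c, hc⟩
    exact ⟨c - γ, by rw [sub_smul, ← hc]; abel⟩
  · rintro ⟨b, hb⟩
    exact ⟨b + γ, by rw [add_smul, ← hb]⟩

theorem existsUnique_row (φ : AdaptedFrame M p) (hM : M.IsUniformly2Nondegenerate)
    (hp : p ∈ M.carrier) :
    ∃! r : Row, r.Valid ∧ BigradedEquiv (φ.H p) (φ.S02 p) r.H r.S := by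
  have hφ := φ.isPair hM hp
  obtain ⟨r, hr, B, ρ, c, h⟩ := hφ.hasRow (φ.S_symm hM hp)
  refine ⟨r, ⟨hr, (bigradedEquiv_iff_rel hφ (Row.isPair hr)).2 ⟨_, _, _, h.inv⟩⟩, ?_⟩
  rintro r' ⟨hr', he⟩
  obtain ⟨A, ρ', c', h'⟩ := (bigradedEquiv_iff_rel hφ (Row.isPair hr')).1 he
  exact (Row.eq_of_rel hr hr' (h.trans h')).symm

/-- `Ω` is `t Ω₁` modulo `g'_{0,0}`, and a scalar of modulus 1 replaces `t` by `|t|`. For uniqueness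
two equivalences are composed and compared by `Entry.eq_of_rel`. -/
theorem existsUnique_modEquiv {r : Row} (hr : r.Valid) (hM : M.IsUniformly2Nondegenerate)
    (hp : p ∈ M.carrier) (hφ : φ.IsNormalizedFor r) :
    ∃! t : Entry, t.Valid ∧ ModEquiv r.H r.S (φ.Ω p) t.row.H t.row.S t.Ω := by
  obtain ⟨-, -, ⟨t, ht⟩, -⟩ := (isNormalizedFor_iff hr hM hp).1 hφ
  have hpr := Row.isPair hr
  obtain ⟨E, u, hE, rfl, hu, hut⟩ := Entry.exists_phase hr t
  have hu0 : u ≠ 0 := by rintro rfl; simp at hu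
  have hv : conj u * conj (conj u) = 1 := by rw [Complex.conj_conj, mul_comm]; exact hu
  have hrel := E.row.scalar_rel hv
  have hΩE : (conj u • (1 : Mat2)) * φ.Ω p * (conj u • (1 : Mat2))⁻¹ -
      (conj u ^ 2 / ((1 : ℝ) : ℂ)) • E.Ω ∈ g00' E.row.H E.row.S := by
    rw [Row.g00'_eq hr]
    have e : (conj u • (1 : Mat2)) * φ.Ω p * (conj u • (1 : Mat2))⁻¹ = φ.Ω p := by
      have h1 : (conj u • (1 : Mat2)) * φ.Ω p = φ.Ω p * (conj u • (1 : Mat2)) := by simp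
      rw [h1, Matrix.mul_nonsing_inv_cancel_right _ _ hrel.unit]
    rw [e, ← hut, smul_smul, Complex.ofReal_one, div_one]
    have e2 : conj u ^ 2 * u ^ 2 = 1 := by
      rw [← mul_pow, mul_comm, hu, one_pow]
    rwa [e2, one_smul]
  refine ⟨E, ⟨hE, (modEquiv_iff hpr hpr).2 ⟨_, _, _, hrel, hΩE⟩⟩, ?_⟩
  · rintro t' ⟨ht', he⟩
    have hpr' := Row.isPair ht'.1
    obtain ⟨A, ρ, c, h, hΩ⟩ := (modEquiv_iff hpr hpr').1 he
    have h2 := Rel.mod_trans h hpr hpr' (hrel.mod_inv hpr hpr hΩE) hΩ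
    rw [Row.g00'_eq ht'.1] at h2
    exact (Entry.eq_of_rel hE ht' (hrel.inv.trans h) h2).symm

/-- Between frames with the same value at `p` only `Y` matters. If both are normalized, `Y ∈ (t' -
t) Ω₁ + g'_{0,0}`, and the condition on `e(S^{0,2})` makes `(t' - t) T₁` an element of `N_{0,2} +
⟨S⟩`, so `Y ∈ g'_{0,0}`. Conversely such a `Y` changes `e(S^{0,2})` only by multiples of `S`. -/
theorem exists_sameAt_iff {r : Row} (hr : r.Valid) (hM : M.IsUniformly2Nondegenerate)
    (hp : p ∈ M.carrier) (hφ : φ.IsNormalizedFor r) (Ω' : Mat2) :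
    (∃ ψ : AdaptedFrame M p, ψ.SameAt φ ∧ ψ.IsNormalizedFor r ∧ ψ.Ω p = Ω') ↔
      Ω' - φ.Ω p ∈ r.g := by
  obtain ⟨hH, hS, ⟨t, ht⟩, N, hN, k, hk⟩ := (isNormalizedFor_iff hr hM hp).1 hφ
  constructor
  · rintro ⟨ψ, hs, hψ, rfl⟩
    obtain ⟨-, -, ⟨t', ht'⟩, N', hN', k', hk'⟩ := (isNormalizedFor_iff hr hM hp).1 hψ
    obtain ⟨B, ρ, c, Y, hl, h1⟩ := exists_link φ ψ hM hp
    obtain ⟨rfl, rfl, rfl⟩ := h1 ⟨hs.1.symm, fun a => (hs.2.1 a).symm, hs.2.2.symm⟩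
    have hY : ψ.Ω p = φ.Ω p + Y := by
      have := hl.Ω_eq
      simpa using this
    obtain ⟨l, hl2⟩ := hl.dS_eq
    simp only [Matrix.one_mul, Matrix.mul_one, Matrix.transpose_one, one_pow, Complex.ofReal_one,
      div_one, one_smul, hS, hk, hk'] at hl2
    have hZ : Y - (t' - t) • r.Ω₁ ∈ r.g := by
      have := Row.g_add ht' (Row.g_smul (-1) ht)
      rw [hY] at this
      convert this using 1
      module
    obtain ⟨a, ha⟩ := Row.g_symm hZ
    have hT : (t' - t) • r.T₁ = (N + (-1 : ℂ) • N') + (k - k' + l - a) • r.S := by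
      simp only [Matrix.sub_mul, Matrix.mul_sub, Matrix.transpose_sub, Matrix.transpose_smul,
        Matrix.smul_mul, Matrix.mul_smul] at ha
      rw [Row.T₁]
      linear_combination (norm := module) hl2 - ha
    rw [Row.T₁_eq_zero_or hr (Row.N02_add hN (Row.N02_smul _ hN')) hT, sub_zero] at hZ
    rwa [hY, add_sub_cancel_left]
  · intro hY
    have hrel := Rel.refl (φ.H p) (φ.S02 p)
    obtain ⟨ψ, hH', hS', hl, hs⟩ := φ.exists_link_of_rel hM hp hrel (Ω' - φ.Ω p)
    have hΩ : ψ.Ω p = Ω' := by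
      have := hl.Ω_eq
      simpa using this
    refine ⟨ψ, hs rfl rfl rfl, (isNormalizedFor_iff hr hM hp).2 ⟨hH'.trans hH, hS'.trans hS,
      ⟨t, ?_⟩, N, hN, ?_⟩, hΩ⟩
    · have := Row.g_add ht hY
      rw [hΩ]
      convert this using 1
      abel
    · obtain ⟨l, hl2⟩ := hl.dS_eq
      obtain ⟨a, ha⟩ := Row.g_symm hY
      simp only [Matrix.one_mul, Matrix.mul_one, Matrix.transpose_one, one_pow, Complex.ofReal_one,
        div_one, one_smul, hS, hk, ha] at hl2
      exact ⟨l + k - a, by rw [hl2]; module⟩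

end AdaptedFrame

/-- For fixed frame values the symmetric matrix `e(S) + Ω S + S Ωᵀ` does not depend on `Y` modulo
`S`. Writing it as `t T₁ + N + k S` and choosing `Y = t Ω₁ - Ω` gives a normalized frame with `Ω = t
Ω₁`; the scalar `u` turns `t` into `τ ≥ 0` in the same step. -/
theorem exists_hasModSymbol {M : Hypersurface} {p : C4} (hM : M.IsUniformly2Nondegenerate)
    (hp : p ∈ M.carrier) : ∃ t : Entry, t.Valid ∧ HasModSymbol M p t := by
  obtain ⟨φ₀⟩ := AdaptedFrame.exists_frame hM hp
  obtain ⟨r, hr, B, ρ, c, h⟩ := (φ₀.isPair hM hp).hasRow (φ₀.S_symm hM hp)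
  obtain ⟨φ, hH, hS, -⟩ := φ₀.exists_link_of_rel hM hp h 0
  have hT : (φ.dS + (φ.Ω p * r.S + r.S * (φ.Ω p)ᵀ))ᵀ =
      φ.dS + (φ.Ω p * r.S + r.S * (φ.Ω p)ᵀ) := by
    have : φ.dSᵀ = φ.dS := φ.deriv_S_symm hM hp
    simp only [Matrix.transpose_add, Matrix.transpose_mul, Matrix.transpose_transpose, this,
      Row.S_symm]
    abel
  obtain ⟨t, k, N, hN, hTe⟩ := Row.exists_T₁ hr hT
  obtain ⟨E, u, hE, rfl, hu, hut⟩ := Entry.exists_phase hr t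
  have hu0 : u ≠ 0 := by rintro rfl; simp at hu
  have hrel := E.row.scalar_rel hu
  rw [← hH, ← hS] at hrel
  obtain ⟨ψ, hH', hS', hl, -⟩ := φ.exists_link_of_rel hM hp hrel (t • E.row.Ω₁ - φ.Ω p)
  have hΩ : ψ.Ω p = E.Ω := by
    have h1 := hl.Ω_eq
    simp only [add_sub_cancel, Complex.ofReal_one, div_one, Matrix.smul_mul, Matrix.one_mul,
      Matrix.mul_smul, Matrix.mul_one] at h1
    rw [← hut]
    exact smul_right_injective _ hu0 (h1.trans (by module))
  refine ⟨E, hE, ψ, (AdaptedFrame.isNormalizedFor_iff hr hM hp).2 ⟨hH'.trans hH, hS'.trans hS,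
    ⟨E.τ, ?_⟩, u ^ 2 • N, Row.N02_smul _ hN, ?_⟩, hΩ⟩
  · rw [hΩ, Entry.Ω_eq, sub_self]
    have := (g00'Sub E.row.H E.row.S).zero_mem
    rwa [mem_g00'Sub, Row.g00'_eq hr] at this
  · obtain ⟨l, hl2⟩ := hl.dS_eq
    simp only [Complex.ofReal_one, div_one, Matrix.smul_mul, Matrix.one_mul, Matrix.mul_smul,
      Matrix.mul_one, Matrix.transpose_smul, Matrix.transpose_one, smul_smul] at hl2
    rw [hS] at hl2
    have e : φ.dS - ((t • E.row.Ω₁ - φ.Ω p) * E.row.S + E.row.S * (t • E.row.Ω₁ - φ.Ω p)ᵀ) =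
        N + k • E.row.S := by
      simp only [Matrix.sub_mul, Matrix.mul_sub, Matrix.transpose_sub, Matrix.transpose_smul,
        Matrix.smul_mul, Matrix.mul_smul]
      rw [Row.T₁] at hTe
      linear_combination (norm := module) hTe
    rw [e] at hl2
    refine ⟨l / u ^ 2 + u ^ 2 * k, ?_⟩
    have hu2 : u * u ≠ 0 := mul_ne_zero hu0 hu0
    refine smul_right_injective _ hu2 ?_
    change (u * u) • ψ.dS = (u * u) • _
    rw [hl2]
    have e3 : u * u * (l / u ^ 2) = l := by field_simp
    simp only [smul_add, add_smul, smul_smul, e3]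
    module

/-- The frames may differ at `p`, but by `residual` the transition `B` is diagonal in the rows with
`τ` and so preserves `N_{0,2}`. The argument for frames with equal values then still yields `Y ∈
g'_{0,0}`, and `tau_eq` applies. -/
theorem HasModSymbol.unique {M : Hypersurface} {p : C4} (hM : M.IsUniformly2Nondegenerate)
    (hp : p ∈ M.carrier) {t t' : Entry} (ht : t.Valid) (ht' : t'.Valid)
    (h : HasModSymbol M p t) (h' : HasModSymbol M p t') : t = t' := by
  obtain ⟨φ, hφ, hΩ⟩ := h
  obtain ⟨ψ, hψ, hΩ'⟩ := h'
  obtain ⟨hH, hS, -, N, hN, k, hk⟩ := (AdaptedFrame.isNormalizedFor_iff ht.1 hM hp).1 hφ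
  obtain ⟨hH', hS', hst, N', hN', k', hk'⟩ := (AdaptedFrame.isNormalizedFor_iff ht'.1 hM hp).1 hψ
  obtain ⟨B, ρ, c, Y, hl, -⟩ := AdaptedFrame.exists_link φ ψ hM hp
  have hrel := hl.rel
  rw [hH, hS, hH', hS'] at hrel
  have hrow := Row.eq_of_rel ht'.1 ht.1 hrel
  obtain ⟨r, τ⟩ := t
  obtain ⟨r', τ'⟩ := t'
  obtain rfl : r' = r := hrow
  congr 1
  by_cases hT : r'.HasTau
  swap
  · have h1 : τ = 0 := ht.2.2 hT
    have h2 : τ' = 0 := ht'.2.2 hT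
    rw [h1, h2]
  have hc0 := hrel.c_ne
  have hr0 := hrel.r_ne'
  have hcr : c / (ρ : ℂ) ≠ 0 := div_ne_zero hc0 hr0
  have hconj : B * ψ.Ω p * B⁻¹ = (c / ρ) • (φ.Ω p + Y) := by
    rw [hl.Ω_eq, Matrix.smul_mul, Matrix.mul_nonsing_inv_cancel_right _ _ hrel.unit]
  have hpr := Row.isPair (r := r') ht.1
  have hstY : ∃ s : ℂ, Y - s • r'.Ω₁ ∈ r'.g := by
    rw [← Row.stab_iff ht.1, ← Row.Pm_eq] at hst
    have h1 := hrel.stab_conj hpr hpr hst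
    rw [hconj, Row.Pm_eq, Row.stab_iff ht.1] at h1
    obtain ⟨s, hs⟩ := h1
    refine ⟨(c / ρ)⁻¹ * s - τ, ?_⟩
    have h2 := Row.g_smul (c / ρ : ℂ)⁻¹ hs
    have e : Y - ((c / ρ : ℂ)⁻¹ * s - τ) • r'.Ω₁ =
        (c / ρ : ℂ)⁻¹ • ((c / ρ : ℂ) • (φ.Ω p + Y) - s • r'.Ω₁) := by
      rw [smul_sub, smul_smul, inv_mul_cancel₀ hcr, one_smul, hΩ, Entry.Ω_eq]
      simp only [sub_smul, mul_smul]
      abel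
    rw [e]; exact h2
  obtain ⟨s, hs⟩ := hstY
  obtain ⟨a, ha⟩ := Row.g_symm hs
  have hYg : Y ∈ r'.g := by
    obtain ⟨-, x, y, hB, -⟩ := Row.residual ht.1 hT hrel
    have hNB : B * N' * Bᵀ ∈ r'.N02 := by rw [hB]; exact Row.N02_conj hT hN'
    obtain ⟨l, hl2⟩ := hl.dS_eq
    rw [hk, hk', hS, Matrix.mul_add, Matrix.add_mul, Matrix.mul_smul, Matrix.smul_mul,
      hrel.symm] at hl2
    have hq : c ^ 2 / (ρ : ℂ) ≠ 0 := div_ne_zero (pow_ne_zero _ hc0) hr0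
    set q := c ^ 2 / (ρ : ℂ)
    have hT1 : s • r'.T₁ = (N + (-q⁻¹) • (B * N' * Bᵀ)) +
        (k - a + q⁻¹ * (l - k' * c)) • r'.S := by
      simp only [Matrix.sub_mul, Matrix.mul_sub, Matrix.transpose_sub, Matrix.transpose_smul,
        Matrix.smul_mul, Matrix.mul_smul] at ha
      have h3 : q⁻¹ • (q • (N + k • r'.S - (Y * r'.S + r'.S * Yᵀ))) =
          q⁻¹ • (B * N' * Bᵀ + k' • c • r'.S - l • r'.S) := by
        congr 1
        linear_combination (norm := module) -hl2
      rw [smul_smul, inv_mul_cancel₀ hq, one_smul] at h3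
      rw [Row.T₁]
      linear_combination (norm := module) -ha - h3
    have := Row.T₁_eq_zero_or ht.1 (Row.N02_add hN (Row.N02_smul _ hNB)) hT1
    rwa [this, sub_zero] at hs
  refine (Row.tau_eq ht.1 hT hrel ht'.2.1 ht.2.1 ?_).symm
  have e1 : ψ.Ω p = (τ' : ℂ) • r'.Ω₁ := by rw [hΩ', Entry.Ω_eq]
  have e2 : φ.Ω p = (τ : ℂ) • r'.Ω₁ := by rw [hΩ, Entry.Ω_eq]
  rw [← e1, ← e2, hconj, smul_add, add_sub_cancel_left]
  exact Row.g_smul _ hYg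

/-! ### Derivatives of matrix exponentials -/

/-- The entries of `F` have the entries of `F'` as derivatives at `t`. -/
def HasMatDeriv {n : Type*} (F : ℂ → Matrix n n ℂ) (F' : Matrix n n ℂ) (t : ℂ) : Prop :=
  ∀ i j, HasDerivAt (fun ζ => F ζ i j) (F' i j) t

theorem HasMatDeriv.mul {n : Type*} [Fintype n] {F G : ℂ → Matrix n n ℂ} {F' G' : Matrix n n ℂ} {t : ℂ}
    (hF : HasMatDeriv F F' t) (hG : HasMatDeriv G G' t) :
    HasMatDeriv (fun ζ => F ζ * G ζ) (F' * G t + F t * G') t := fun i j => by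
  simp only [Matrix.mul_apply, Matrix.add_apply, ← Finset.sum_add_distrib]
  exact HasDerivAt.fun_sum fun k _ => (hF i k).mul (hG k j)

theorem HasMatDeriv.const {n : Type*} (A : Matrix n n ℂ) (t : ℂ) : HasMatDeriv (fun _ => A) 0 t :=
  fun _ _ => hasDerivAt_const _ _

section

variable {n : Type*} [Fintype n] [DecidableEq n]

theorem hasMatDeriv_exp (X : Matrix n n ℂ) (t : ℂ) :
    HasMatDeriv (fun ζ => NormedSpace.exp (ζ • X)) (NormedSpace.exp (t • X) * X) t := by
  let : NormedRing (Matrix n n ℂ) := Matrix.linftyOpNormedRing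
  let : NormedAlgebra ℂ (Matrix n n ℂ) := Matrix.linftyOpNormedAlgebra
  have h := hasDerivAt_exp_smul_const (𝕂 := ℂ) X t
  intro i j
  have hl := (Matrix.entryLinearMap ℂ ℂ i j).toContinuousLinearMap.hasFDerivAt.comp_hasDerivAt t h
  exact hl

theorem exp_semiconj {X Y Z : Matrix n n ℂ} (h : X * Y = Z * X) :
    X * NormedSpace.exp Y = NormedSpace.exp Z * X := by
  let : NormedRing (Matrix n n ℂ) := Matrix.linftyOpNormedRing
  let : NormedAlgebra ℂ (Matrix n n ℂ) := Matrix.linftyOpNormedAlgebra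
  let : NormedAlgebra ℚ (Matrix n n ℂ) := Matrix.linftyOpNormedAlgebra
  have : CompleteSpace (Matrix n n ℂ) := FiniteDimensional.complete ℂ _
  have h' : SemiconjBy X Y Z := h
  exact h'.exp_right

theorem exp_mul_exp_neg (X : Matrix n n ℂ) : NormedSpace.exp X * NormedSpace.exp (-X) = 1 := by
  rw [← Matrix.exp_add_of_commute _ _ (Commute.neg_right (Commute.refl X)), add_neg_cancel,
    NormedSpace.exp_zero]

theorem exp_smul_one (a : ℂ) : NormedSpace.exp (a • (1 : Matrix n n ℂ)) = Complex.exp a • 1 := by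
  have h := (Matrix.exp_diagonal (fun _ : n => a))
  have e : ∀ b : ℂ, Matrix.diagonal (fun _ : n => b) = b • (1 : Matrix n n ℂ) := fun b => by
    rw [Matrix.smul_one_eq_diagonal]
  rw [e] at h
  rw [h, ← e]
  congr 1
  ext i
  rw [Pi.coe_exp, Complex.exp_eq_exp_ℂ]

theorem exp_smul_one_add (a : ℂ) (X : Matrix n n ℂ) :
    NormedSpace.exp (a • 1 + X) = Complex.exp a • NormedSpace.exp X := by
  rw [Matrix.exp_add_of_commute _ _ ((Commute.one_left X).smul_left a), exp_smul_one,
    Matrix.smul_mul, Matrix.one_mul]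

end

theorem cbar_exp (X : Mat2) : cbar (NormedSpace.exp X) = NormedSpace.exp (cbar X) := by
  have h : ∀ A : Mat2, cbar A = (Aᴴ)ᵀ := fun A => by ext; simp [cbar]
  rw [h, h, ← Matrix.exp_conjTranspose, ← Matrix.exp_transpose]

/-! ### The groups `CU(H) ∩ G_{0,0}` -/

section

variable {H S : Mat2}

/-- `Uᵀ H Ū = (ū/u) H` and its conjugate transpose show that `ū/u` is real. The condition on
`S^{0,-2}` follows from those on `H` and `S` by `Rel.P_eq`. -/
theorem mem_CU_G00_iff (h : IsPair H S) {k : ℂˣ × GL (Fin 2) ℂ} :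
    k ∈ CU H ∩ G00 H S ↔ ∃ (μ : ℝ) (c : ℂ), Rel H S H S (k.2 : Mat2) μ c ∧
      conj (k.1 : ℂ) = μ * (k.1 : ℂ) := by
  obtain ⟨u, U⟩ := k
  have hu : (u : ℂ) ≠ 0 := u.ne_zero
  have hcu : conj (u : ℂ) ≠ 0 := (map_ne_zero _).2 hu
  have hU : IsUnit (U : Mat2).det := (Matrix.isUnit_iff_isUnit_det _).1 U.isUnit
  have hUt : IsUnit ((U : Mat2)ᵀ).det := by rwa [Matrix.det_transpose]
  have hS : ∀ z : ℂ, z • (((U⁻¹ : GL (Fin 2) ℂ) : Mat2) * S * ((U⁻¹ : GL (Fin 2) ℂ) : Mat2)ᵀ) = S ↔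
      (U : Mat2) * S * (U : Mat2)ᵀ = z • S := fun z => by
    rw [Matrix.coe_units_inv, Matrix.transpose_nonsing_inv]
    constructor
    · intro e
      conv_lhs => rw [← e]
      rw [Matrix.mul_smul, Matrix.smul_mul, Matrix.mul_assoc (U : Mat2)⁻¹,
        Matrix.mul_nonsing_inv_cancel_left _ _ hU, Matrix.nonsing_inv_mul_cancel_right _ _ hUt]
    · intro e
      rw [← Matrix.smul_mul, ← Matrix.mul_smul, ← e, Matrix.mul_assoc (U : Mat2),
        Matrix.nonsing_inv_mul_cancel_left _ _ hU, Matrix.mul_nonsing_inv_cancel_right _ _ hUt]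
  constructor
  · rintro ⟨h1, h2, -⟩
    change ((u : ℂ) * (conj (u : ℂ))⁻¹) • ((U : Mat2)ᵀ * H * cbar (U : Mat2)) = H at h1
    obtain ⟨z, hz⟩ := Submodule.span_singleton_eq_span_singleton.1 h2
    have hz' := (hS (z : ℂ)).1 hz
    have e1 : (U : Mat2)ᵀ * H * cbar (U : Mat2) = (conj (u : ℂ) / u) • H := by
      conv_rhs => rw [← h1]
      rw [smul_smul]
      have : conj (u : ℂ) / u * (u * (conj (u : ℂ))⁻¹) = 1 := by field_simp
      rw [this, one_smul]
    have e2 := congrArg (fun A => (cbar A)ᵀ) e1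
    simp only [cbar_mul, cbar_smul, cbar_cbar, cbar_transpose, h.herm, Matrix.transpose_mul,
      Matrix.transpose_smul, Matrix.transpose_transpose] at e2
    rw [← Matrix.mul_assoc, e1] at e2
    have hH0 : H ≠ 0 := by rintro rfl; simpa using h.unit
    have e3 : conj (conj (u : ℂ) / u) = conj (u : ℂ) / u :=
      (smul_left_injective ℂ hH0 e2).symm
    have e4 : (((conj (u : ℂ) / u).re : ℝ) : ℂ) = conj (u : ℂ) / u := Complex.conj_eq_iff_re.1 e3
    refine ⟨(conj (u : ℂ) / u).re, z, ⟨hU, fun h0 => ?_, z.ne_zero, by rw [e4]; exact e1, hz'⟩, ?_⟩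
    · rw [h0] at e4
      exact div_ne_zero hcu hu (by rw [← e4]; simp)
    · rw [e4]; field_simp
  · rintro ⟨μ, c, hR, hc⟩
    change conj (u : ℂ) = μ * (u : ℂ) at hc
    have hμ := hR.r_ne'
    refine ⟨?_, ?_, ?_⟩
    · change ((u : ℂ) * (conj (u : ℂ))⁻¹) • ((U : Mat2)ᵀ * H * cbar (U : Mat2)) = H
      have hf : (U : Mat2)ᵀ * H * cbar (U : Mat2) = (μ : ℂ) • H := hR.form
      rw [hf, smul_smul, hc]
      have : (u : ℂ) * (μ * (u : ℂ))⁻¹ * μ = 1 := by field_simp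
      rw [this, one_smul]
    · exact Submodule.span_singleton_eq_span_singleton.2
        ⟨Units.mk0 c hR.c_ne, (hS c).2 hR.symm⟩
    · have hd : (μ : ℂ) ^ 2 / conj c ≠ 0 :=
        div_ne_zero (pow_ne_zero _ hμ) ((map_ne_zero _).2 hR.c_ne)
      refine (Submodule.span_singleton_eq_span_singleton.2 ⟨Units.mk0 _ hd, ?_⟩).symm
      exact (hR.P_eq h h).symm

theorem isSubgroupSet_CU_G00 (h : IsPair H S) : IsSubgroupSet (CU H ∩ G00 H S) := by
  refine ⟨{ carrier := CU H ∩ G00 H S, mul_mem' := ?_, one_mem' := ?_, inv_mem' := ?_ }, rfl⟩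
  · intro k k' hk hk'
    rw [mem_CU_G00_iff h] at hk hk' ⊢
    obtain ⟨μ, c, hR, hu⟩ := hk
    obtain ⟨μ', c', hR', hu'⟩ := hk'
    refine ⟨_, _, hR'.trans hR, ?_⟩
    simp only [Prod.fst_mul, Units.val_mul, map_mul, hu, hu']
    push_cast; ring
  · rw [mem_CU_G00_iff h]
    exact ⟨1, 1, Rel.refl H S, by simp⟩
  · intro k hk
    rw [mem_CU_G00_iff h] at hk ⊢
    obtain ⟨μ, c, hR, hu⟩ := hk
    have hi := hR.inv
    refine ⟨μ⁻¹, c⁻¹, ?_, ?_⟩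
    · simp only [Prod.snd_inv, Matrix.coe_units_inv]; exact hi
    · simp only [Prod.fst_inv, Units.val_inv_eq_inv_val, map_inv₀, hu, Complex.ofReal_inv, mul_inv]

/-- Since `S ≠ 0`, the scalar in the definition is the one in `Rel`; conjugation by `U` preserves
`g'_{0,0}`, so the condition may be moved to the other side. -/
theorem mem_stabilizer_iff (h : IsPair H S) {Ω : Mat2} {k : ℂˣ × GL (Fin 2) ℂ} :
    k ∈ stabilizer H S Ω ↔ ∃ (μ : ℝ) (c : ℂ), Rel H S H S (k.2 : Mat2) μ c ∧
      conj (k.1 : ℂ) = μ * (k.1 : ℂ) ∧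
      (k.2 : Mat2) * Ω * (k.2 : Mat2)⁻¹ - c • Ω ∈ g00' H S := by
  obtain ⟨u, U⟩ := k
  have hU : IsUnit (U : Mat2).det := (Matrix.isUnit_iff_isUnit_det _).1 U.isUnit
  have hUt : IsUnit ((U : Mat2)ᵀ).det := by rwa [Matrix.det_transpose]
  have key : ∀ c : ℂ, c • (((U⁻¹ : GL (Fin 2) ℂ) : Mat2) * Ω * (U : Mat2)) - Ω =
      -((U : Mat2)⁻¹ * ((U : Mat2) * Ω * (U : Mat2)⁻¹ - c • Ω) * (U : Mat2)) := fun c => by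
    rw [Matrix.coe_units_inv, Matrix.mul_sub, Matrix.sub_mul, Matrix.mul_assoc (U : Mat2),
      Matrix.nonsing_inv_mul_cancel_left _ _ hU, Matrix.nonsing_inv_mul_cancel_right _ _ hU,
      Matrix.mul_smul, Matrix.smul_mul]
    abel
  constructor
  · rintro ⟨hk, c, hc, hcS, hcΩ⟩
    obtain ⟨μ, c', hR, hu⟩ := (mem_CU_G00_iff h).1 hk
    have hcc : c = c' := by
      change c • (((U⁻¹ : GL (Fin 2) ℂ) : Mat2) * S * ((U⁻¹ : GL (Fin 2) ℂ) : Mat2)ᵀ) = S at hcS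
      have e := hR.inv.symm
      rw [Matrix.coe_units_inv] at hcS
      change (U : Mat2)⁻¹ * S * ((U : Mat2)⁻¹)ᵀ = _ at e
      rw [e, smul_smul] at hcS
      have e2 : (c * c'⁻¹) • S = (1 : ℂ) • S := by rw [hcS, one_smul]
      have e3 := smul_left_injective ℂ h.ne e2
      exact (mul_inv_eq_one₀ hR.c_ne).1 e3
    subst hcc
    refine ⟨μ, c, hR, hu, ?_⟩
    change c • (((U⁻¹ : GL (Fin 2) ℂ) : Mat2) * Ω * (U : Mat2)) - Ω ∈ _ at hcΩ
    have h1 := hR.conj_mem h h hcΩ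
    have h2 := (g00'Sub H S).neg_mem h1
    rw [mem_g00'Sub, key] at h2
    change (U : Mat2) * Ω * (U : Mat2)⁻¹ - c • Ω ∈ _
    convert h2 using 1
    change _ = -((U : Mat2) * _ * (U : Mat2)⁻¹)
    rw [Matrix.mul_neg, Matrix.neg_mul, neg_neg, Matrix.mul_assoc (U : Mat2)⁻¹,
      Matrix.mul_nonsing_inv_cancel_left _ _ hU, Matrix.mul_nonsing_inv_cancel_right _ _ hU]
  · rintro ⟨μ, c, hR, hu, hΩ⟩
    refine ⟨(mem_CU_G00_iff h).2 ⟨μ, c, hR, hu⟩, c, hR.c_ne, ?_, ?_⟩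
    · have e := hR.inv.symm
      change c • (((U⁻¹ : GL (Fin 2) ℂ) : Mat2) * S * ((U⁻¹ : GL (Fin 2) ℂ) : Mat2)ᵀ) = S
      change (U : Mat2)⁻¹ * S * ((U : Mat2)⁻¹)ᵀ = _ at e
      rw [Matrix.coe_units_inv, e, smul_smul, mul_inv_cancel₀ hR.c_ne, one_smul]
    · change c • (((U⁻¹ : GL (Fin 2) ℂ) : Mat2) * Ω * (U : Mat2)) - Ω ∈ _
      rw [key]
      have h1 := hR.inv.conj_mem h h hΩ
      have h2 := (g00'Sub H S).neg_mem h1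
      change -((U : Mat2)⁻¹ * _ * ((U : Mat2)⁻¹)⁻¹) ∈ g00' H S at h2
      rwa [Matrix.nonsing_inv_nonsing_inv _ hU] at h2

theorem isSubgroupSet_stabilizer (h : IsPair H S) (Ω : Mat2) :
    IsSubgroupSet (stabilizer H S Ω) := by
  refine ⟨{ carrier := stabilizer H S Ω, mul_mem' := ?_, one_mem' := ?_, inv_mem' := ?_ }, rfl⟩
  · intro k k' hk hk'
    rw [mem_stabilizer_iff h] at hk hk' ⊢
    obtain ⟨μ, c, hR, hu, hΩ⟩ := hk
    obtain ⟨μ', c', hR', hu', hΩ'⟩ := hk'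
    refine ⟨_, _, hR'.trans hR, ?_, ?_⟩
    · simp only [Prod.fst_mul, Units.val_mul, map_mul, hu, hu']
      push_cast; ring
    · simp only [Prod.snd_mul, Units.val_mul]
      set U := (k.2 : Mat2)
      set U' := (k'.2 : Mat2)
      have e : U * U' * Ω * (U * U')⁻¹ - (c' * c) • Ω = U * (U' * Ω * U'⁻¹ - c' • Ω) * U⁻¹ +
          c' • (U * Ω * U⁻¹ - c • Ω) := by
        rw [Matrix.mul_inv_rev, Matrix.mul_sub, Matrix.sub_mul]
        simp only [Matrix.mul_assoc, Matrix.mul_smul, Matrix.smul_mul, smul_sub, smul_smul]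
        abel
      rw [e]
      exact (g00'Sub H S).add_mem (hR.conj_mem h h hΩ') ((g00'Sub H S).smul_mem _ hΩ)
  · rw [mem_stabilizer_iff h]
    refine ⟨1, 1, Rel.refl H S, by simp, ?_⟩
    simp only [Prod.snd_one, Units.val_one, Matrix.one_mul, inv_one, Matrix.mul_one, one_smul,
      sub_self]
    exact (g00'Sub H S).zero_mem
  · intro k hk
    rw [mem_stabilizer_iff h] at hk ⊢
    obtain ⟨μ, c, hR, hu, hΩ⟩ := hk
    have hi := hR.inv
    refine ⟨μ⁻¹, c⁻¹, ?_, ?_, ?_⟩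
    · simp only [Prod.snd_inv, Matrix.coe_units_inv]; exact hi
    · simp only [Prod.fst_inv, Units.val_inv_eq_inv_val, map_inv₀, hu, Complex.ofReal_inv, mul_inv]
    · simp only [Prod.snd_inv, Matrix.coe_units_inv]
      have h1 := (g00'Sub H S).smul_mem (-c⁻¹) (hi.conj_mem h h hΩ)
      rw [mem_g00'Sub] at h1
      convert h1 using 1
      set U := (k.2 : Mat2)
      have hU : IsUnit U.det := hR.unit
      rw [Matrix.mul_sub, Matrix.sub_mul, Matrix.nonsing_inv_nonsing_inv _ hU, Matrix.mul_assoc U,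
        Matrix.nonsing_inv_mul_cancel_left _ _ hU, Matrix.nonsing_inv_mul_cancel_right _ _ hU,
        Matrix.mul_smul, Matrix.smul_mul, smul_sub, smul_smul]
      have : -c⁻¹ * c = -1 := by rw [neg_mul, inv_mul_cancel₀ hR.c_ne]
      rw [this]
      module

end

/-! ### Lie algebras -/

theorem HasMatDeriv.eq_of_real {n : Type*} {F G : ℂ → Matrix n n ℂ} {F' G' : Matrix n n ℂ}
    (hF : HasMatDeriv F F' 0) (hG : HasMatDeriv G G' 0) (h : ∀ s : ℝ, F s = G s) : F' = G' := by
  ext i j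
  have h1 := HasDerivAt.comp_ofReal (z := 0) (by simpa using hF i j)
  have h2 := HasDerivAt.comp_ofReal (z := 0) (by simpa using hG i j)
  have e : (fun s : ℝ => F s i j) = fun s : ℝ => G s i j := funext fun s => by rw [h]
  rw [e] at h1
  exact h1.unique h2

theorem hasMatDeriv_conj (X Y S : Mat2) :
    HasMatDeriv (fun ζ => NormedSpace.exp (ζ • X) * S * NormedSpace.exp (ζ • Y))
      (X * S + S * Y) 0 := by
  have h := ((hasMatDeriv_exp X 0).mul (HasMatDeriv.const S 0)).mul (hasMatDeriv_exp Y 0)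
  simpa using h

section

variable {H S X Ω : Mat2} {a : ℂ}

/-- Skewness with respect to `H` transports the eigenvalue equation from `S` to `H S̄ Hᵀ`, with
eigenvalue `-ā`. -/
theorem mem_g00'_of_skew (h : IsPair H S) (hX : Xᵀ * H + H * cbar X = 0)
    (hS : X * S + S * Xᵀ = a • S) : X ∈ g00' H S := by
  refine (mem_g00'_iff h).2 ⟨⟨a, hS⟩, -conj a, ?_⟩
  have h1 := congrArg Matrix.transpose hX
  rw [Matrix.transpose_add, Matrix.transpose_mul, Matrix.transpose_mul,
    Matrix.transpose_transpose, Matrix.transpose_zero] at h1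
  have h2 := congrArg cbar hS
  rw [cbar_add, cbar_mul, cbar_mul, cbar_smul, cbar_transpose] at h2
  have e1 : Xᵀ * H = -(H * cbar X) := eq_neg_of_add_eq_zero_left hX
  have e2 : Hᵀ * X = -((cbar X)ᵀ * Hᵀ) := eq_neg_of_add_eq_zero_left h1
  calc Xᵀ * Pm H S + Pm H S * X = Xᵀ * H * (cbar S * Hᵀ) + H * cbar S * (Hᵀ * X) := by
        simp only [Pm, Matrix.mul_assoc]
    _ = -(H * (cbar X * cbar S + cbar S * (cbar X)ᵀ) * Hᵀ) := by
        rw [e1, e2]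
        simp only [Matrix.mul_add, Matrix.add_mul, Matrix.mul_assoc, Matrix.neg_mul,
          Matrix.mul_neg]
        abel
    _ = _ := by
        rw [h2, Matrix.mul_smul, Matrix.smul_mul, neg_smul, Pm]

/-- The infinitesimal identities are intertwining relations, `H X̄ = -Xᵀ H` and `S Xᵀ = (a - X) S`,
and these pass to exponentials. -/
theorem rel_exp (hX : Xᵀ * H + H * cbar X = 0) (hS : X * S + S * Xᵀ = a • S) (s : ℝ) :
    Rel H S H S (NormedSpace.exp ((s : ℂ) • X)) 1 (Complex.exp (s * a)) := by
  refine ⟨(Matrix.isUnit_iff_isUnit_det _).1 (Matrix.isUnit_exp _), one_ne_zero,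
    Complex.exp_ne_zero _, ?_, ?_⟩
  · have h1 : H * cbar ((s : ℂ) • X) = -((s : ℂ) • X)ᵀ * H := by
      rw [cbar_smul, Complex.conj_ofReal, Matrix.mul_smul, Matrix.transpose_smul, Matrix.neg_mul,
        Matrix.smul_mul, ← smul_neg, eq_neg_of_add_eq_zero_left hX, neg_neg]
    rw [cbar_exp, Matrix.mul_assoc, exp_semiconj h1, ← Matrix.exp_transpose, ← Matrix.mul_assoc,
      exp_mul_exp_neg, Matrix.one_mul]
    simp
  · have h1 : S * ((s : ℂ) • X)ᵀ = ((s * a) • 1 + -((s : ℂ) • X)) * S := by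
      rw [Matrix.transpose_smul, Matrix.mul_smul, Matrix.add_mul, Matrix.smul_mul, Matrix.one_mul,
        Matrix.neg_mul, Matrix.smul_mul, mul_smul, ← hS]
      module
    rw [← Matrix.exp_transpose, Matrix.mul_assoc, exp_semiconj h1, exp_smul_one_add,
      Matrix.smul_mul, Matrix.mul_smul, ← Matrix.mul_assoc, exp_mul_exp_neg, Matrix.one_mul]

theorem exp_mul_eq (hΩ : X * Ω - Ω * X = a • Ω) (s : ℝ) :
    NormedSpace.exp ((s : ℂ) • X) * Ω =
      Complex.exp (s * a) • (Ω * NormedSpace.exp ((s : ℂ) • X)) := by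
  have h1 : Ω * ((s * a) • 1 + (s : ℂ) • X) = ((s : ℂ) • X) * Ω := by
    rw [Matrix.mul_add, Matrix.mul_smul, Matrix.mul_one, Matrix.mul_smul, Matrix.smul_mul,
      mul_smul, ← hΩ]
    module
  rw [← exp_semiconj h1, exp_smul_one_add, Matrix.mul_smul]

theorem skew_of_exp (h : ∀ s : ℝ, (NormedSpace.exp ((s : ℂ) • X))ᵀ * H *
    cbar (NormedSpace.exp ((s : ℂ) • X)) = H) : Xᵀ * H + H * cbar X = 0 := by
  refine (hasMatDeriv_conj Xᵀ (cbar X) H).eq_of_real (HasMatDeriv.const H 0) fun s => ?_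
  have e := h s
  rwa [cbar_exp, ← Matrix.exp_transpose, Matrix.transpose_smul, cbar_smul,
    Complex.conj_ofReal] at e

theorem exists_entry_ne {S : Mat2} (h : S ≠ 0) : ∃ k l, S k l ≠ 0 := by
  by_contra hc
  push Not at hc
  exact h (by ext i j; exact hc i j)

/-- Nothing is known about how the factor depends on `s`. Comparison with a nonzero entry `S_{kl}`
eliminates it, and the resulting identity can be differentiated at 0. -/
theorem symm_of_exp (hS0 : S ≠ 0) (h : ∀ s : ℝ, ∃ c : ℂ, NormedSpace.exp ((s : ℂ) • X) * S *
    (NormedSpace.exp ((s : ℂ) • X))ᵀ = c • S) : ∃ a : ℂ, X * S + S * Xᵀ = a • S := by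
  obtain ⟨k, l, hkl⟩ := exists_entry_ne hS0
  have hd := hasMatDeriv_conj X Xᵀ S
  refine ⟨(X * S + S * Xᵀ) k l / S k l, ?_⟩
  have hF : HasMatDeriv (fun ζ => S k l • (NormedSpace.exp (ζ • X) * S * NormedSpace.exp (ζ • Xᵀ)))
      (S k l • (X * S + S * Xᵀ)) 0 := fun i j => (hd i j).const_mul (S k l)
  have hG : HasMatDeriv (fun ζ => (NormedSpace.exp (ζ • X) * S * NormedSpace.exp (ζ • Xᵀ)) k l • S)
      ((X * S + S * Xᵀ) k l • S) 0 := fun i j => (hd k l).mul_const (S i j)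
  have e := hF.eq_of_real hG fun s => by
    obtain ⟨c, hc⟩ := h s
    rw [← Matrix.exp_transpose, Matrix.transpose_smul] at hc
    simp only [hc, Matrix.smul_apply, smul_eq_mul, smul_smul]
    rw [mul_comm]
  rw [div_eq_inv_mul, mul_smul, ← e, smul_smul, inv_mul_cancel₀ hkl, one_smul]

theorem commutator_of_exp (hS0 : S ≠ 0) (hS : X * S + S * Xᵀ = a • S)
    (h : ∀ s : ℝ, ∃ c : ℂ, NormedSpace.exp ((s : ℂ) • X) * S *
      (NormedSpace.exp ((s : ℂ) • X))ᵀ = c • S ∧ NormedSpace.exp ((s : ℂ) • X) * Ω =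
        c • (Ω * NormedSpace.exp ((s : ℂ) • X))) : X * Ω - Ω * X = a • Ω := by
  obtain ⟨k, l, hkl⟩ := exists_entry_ne hS0
  have hd := hasMatDeriv_conj X Xᵀ S
  have hL : HasMatDeriv (fun ζ => NormedSpace.exp (ζ • X) * Ω) (X * Ω) 0 := by
    simpa using (hasMatDeriv_exp X 0).mul (HasMatDeriv.const Ω 0)
  have hR : HasMatDeriv (fun ζ => Ω * NormedSpace.exp (ζ • X)) (Ω * X) 0 := by
    simpa using (HasMatDeriv.const Ω 0).mul (hasMatDeriv_exp X 0)
  have hF : HasMatDeriv (fun ζ => S k l • (NormedSpace.exp (ζ • X) * Ω)) (S k l • (X * Ω)) 0 :=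
    fun i j => (hL i j).const_mul (S k l)
  have hG : HasMatDeriv (fun ζ => (NormedSpace.exp (ζ • X) * S * NormedSpace.exp (ζ • Xᵀ)) k l •
      (Ω * NormedSpace.exp (ζ • X))) ((X * S + S * Xᵀ) k l • Ω + S k l • (Ω * X)) 0 := fun i j => by
    have := (hd k l).fun_mul (hR i j)
    simpa using this
  have e := hF.eq_of_real hG fun s => by
    obtain ⟨c, hc, hc'⟩ := h s
    rw [← Matrix.exp_transpose, Matrix.transpose_smul] at hc
    rw [hc, hc', smul_smul, Matrix.smul_apply, smul_eq_mul, mul_comm]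
  rw [hS, Matrix.smul_apply, smul_eq_mul] at e
  refine smul_right_injective _ hkl ?_
  change S k l • (X * Ω - Ω * X) = S k l • a • Ω
  rw [smul_sub, e, smul_smul, mul_comm a]
  abel

end

/-- The values of the one-parameter group would have to stay on the real and imaginary axes; at the
`s` for which the argument is `π/4` the real part asks for `μ = 1` and the imaginary part for `μ =
-1`. -/
theorem im_eq_zero_of_exp {y : ℂ} (h : ∀ s : ℝ, ∃ μ : ℝ, conj (Complex.exp ((s : ℂ) * y)) =
    μ * Complex.exp ((s : ℂ) * y)) : y.im = 0 := by
  by_contra hb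
  obtain ⟨μ, hμ⟩ := h (Real.pi / (4 * y.im))
  set z := ((Real.pi / (4 * y.im) : ℝ) : ℂ) * y with hz
  have hzi : z.im = Real.pi / 4 := by
    rw [hz, Complex.im_ofReal_mul]; field_simp
  have h1 := congrArg Complex.re hμ
  have h2 := congrArg Complex.im hμ
  rw [Complex.conj_re, Complex.re_ofReal_mul, Complex.exp_re, hzi, Real.cos_pi_div_four] at h1
  rw [Complex.conj_im, Complex.im_ofReal_mul, Complex.exp_im, hzi, Real.sin_pi_div_four] at h2
  have hp : 0 < Real.exp z.re * (√2 / 2) := by positivity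
  nlinarith

/-- The elements of a one-parameter subgroup. -/
def expElement (y : ℂ × Mat2) (s : ℝ) : ℂˣ × GL (Fin 2) ℂ :=
  (Units.mk0 (Complex.exp ((s : ℂ) * y.1)) (Complex.exp_ne_zero _),
    Matrix.GeneralLinearGroup.mk'' (NormedSpace.exp ((s : ℂ) • y.2))
      ((Matrix.isUnit_iff_isUnit_det _).1 (Matrix.isUnit_exp _)))

theorem conj_exp_of_im {y : ℂ} (h : y.im = 0) (s : ℝ) :
    conj (Complex.exp ((s : ℂ) * y)) = Complex.exp ((s : ℂ) * y) := by
  rw [← Complex.exp_conj, map_mul, Complex.conj_ofReal, Complex.conj_eq_iff_im.2 h]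

theorem rel_one_of_im {H S : Mat2} {y : ℂ} (h : y.im = 0) {s μ : ℝ} {k : ℂˣ × GL (Fin 2) ℂ}
    (hk : (k.1 : ℂ) = Complex.exp ((s : ℂ) * y)) (hμ : conj (k.1 : ℂ) = μ * (k.1 : ℂ))
    {U : Mat2} {c : ℂ} (hR : Rel H S H S U μ c) : Uᵀ * H * cbar U = H := by
  have h1 : (μ : ℂ) = 1 := by
    rw [hk, conj_exp_of_im h] at hμ
    exact (mul_right_cancel₀ (Complex.exp_ne_zero _) (by rw [one_mul]; exact hμ.symm))
  rw [hR.form, h1, one_smul]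

namespace Row

variable {r : Row}

theorem mem_re_iff (hr : r.Valid) {X : Mat2} :
    X ∈ r.re ↔ X ∈ r.g ∧ Xᵀ * r.H + r.H * cbar X = 0 := by
  rw [re_eq hr, Set.mem_ofPred_eq, sigmaGL_eq_iff (isPair hr)]

/-- In a one-parameter subgroup the first component is real, hence `μ = 1`, and the derivatives at 0
are skewness for `H` and the eigenvalue equation for `S`. Conversely these two exponentiate by
`rel_exp`. -/
theorem lieAlg_eq (hr : r.Valid) :
    lieAlg (CU r.H ∩ G00 r.H r.S) = {y | y.1.im = 0 ∧ y.2 ∈ r.re} := by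
  have hp := isPair hr
  ext ⟨y, X⟩
  constructor
  · intro h
    have him : y.im = 0 := im_eq_zero_of_exp fun s => by
      obtain ⟨k, hk, h1, h2⟩ := h s
      obtain ⟨μ, c, -, hμ⟩ := (mem_CU_G00_iff hp).1 hk
      rw [h1] at hμ
      exact ⟨μ, hμ⟩
    have hsk : Xᵀ * r.H + r.H * cbar X = 0 := skew_of_exp fun s => by
      obtain ⟨k, hk, h1, h2⟩ := h s
      obtain ⟨μ, c, hR, hμ⟩ := (mem_CU_G00_iff hp).1 hk
      rw [h2] at hR
      exact rel_one_of_im him h1 hμ hR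
    obtain ⟨a, ha⟩ : ∃ a : ℂ, X * r.S + r.S * Xᵀ = a • r.S := symm_of_exp hp.ne fun s => by
      obtain ⟨k, hk, h1, h2⟩ := h s
      obtain ⟨μ, c, hR, hμ⟩ := (mem_CU_G00_iff hp).1 hk
      rw [h2] at hR
      exact ⟨c, hR.symm⟩
    refine ⟨him, (mem_re_iff hr).2 ⟨?_, hsk⟩⟩
    rw [← g00'_eq hr]
    exact mem_g00'_of_skew hp hsk ha
  · rintro ⟨him, hX⟩ s
    obtain ⟨hg, hsk⟩ := (mem_re_iff hr).1 hX
    obtain ⟨a, ha⟩ := g_symm hg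
    refine ⟨expElement (y, X) s, (mem_CU_G00_iff hp).2 ⟨1, _, rel_exp hsk ha s, ?_⟩, rfl, rfl⟩
    rw [Complex.ofReal_one, one_mul]
    exact conj_exp_of_im him s

/-- The weights of `X` on `Ω₁` and on `S` must agree. For `D(a,b)` in row 4 they are `b - a` and
`2a`, which gives `b = 3a`; for scalars `a` they are `0` and `2a`. -/
theorem annih_iff {X : Mat2} {τ : ℝ} (hτ : τ ≠ 0) (hT : r.HasTau) (hX : X ∈ r.g) {a : ℂ}
    (ha : X * r.S + r.S * Xᵀ = a • r.S) :
    X * ((τ : ℂ) • r.Ω₁) - ((τ : ℂ) • r.Ω₁) * X = a • ((τ : ℂ) • r.Ω₁) ↔ X ∈ r.annih := by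
  have hτ' : (τ : ℂ) ≠ 0 := by exact_mod_cast hτ
  have e : X * ((τ : ℂ) • r.Ω₁) - ((τ : ℂ) • r.Ω₁) * X = a • ((τ : ℂ) • r.Ω₁) ↔
      X * r.Ω₁ - r.Ω₁ * X = a • r.Ω₁ := by
    rw [Matrix.mul_smul, Matrix.smul_mul, ← smul_sub, smul_comm a]
    exact (smul_right_injective _ hτ').eq_iff
  rw [e]
  cases r with
  | r4 ε =>
    obtain ⟨b, d, rfl⟩ := hX
    simp only [S, transpose_of, Matrix.mul_fin_two, add_of, smul_of, of_eq_of_iff] at ha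
    simp only [Ω₁, annih, Matrix.mul_fin_two, sub_of, smul_of, of_eq_of_iff, Set.mem_ofPred_eq]
    constructor
    · rintro ⟨h1, h2, h3, h4⟩
      exact ⟨b, d, ⟨rfl, trivial, trivial, rfl⟩, by linear_combination h3 - ha.1⟩
    · rintro ⟨b', d', ⟨rfl, -, -, rfl⟩, h1⟩
      exact ⟨by ring, by ring, by linear_combination h1 + ha.1, by ring⟩
  | r3 | r5 | r7 => exact absurd hT id
  | r6 =>
    obtain ⟨b, rfl⟩ := hX
    simp only [S, transpose_of, Matrix.mul_fin_two, add_of, smul_of, of_eq_of_iff] at ha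
    simp only [Ω₁, annih, Matrix.mul_fin_two, sub_of, smul_of, of_eq_of_iff, Set.mem_ofPred_eq]
    constructor
    · rintro ⟨h1, h2, h3, h4⟩
      exact ⟨b, ⟨rfl, trivial, trivial, rfl⟩, by linear_combination (1 / 2) * ha.2.1 - (1 / 2) * h2⟩
    · rintro ⟨b', ⟨rfl, -, -, -⟩, rfl⟩
      exact ⟨by linear_combination 2 * ha.2.1, by linear_combination ha.2.1, by ring, by ring⟩
  | _ =>
    obtain ⟨b, rfl⟩ := hX
    simp only [S, transpose_of, Matrix.mul_fin_two, add_of, smul_of, of_eq_of_iff] at ha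
    simp only [Ω₁, annih, Matrix.mul_fin_two, sub_of, smul_of, of_eq_of_iff, Set.mem_ofPred_eq]
    constructor
    · rintro ⟨h1, h2, h3, h4⟩
      exact ⟨b, ⟨rfl, trivial, trivial, rfl⟩, by linear_combination (1 / 2) * ha.1 - (1 / 2) * h3⟩
    · rintro ⟨b', ⟨rfl, -, -, -⟩, rfl⟩
      have h0 : a = 0 := by linear_combination -ha.1
      subst h0
      exact ⟨by ring, by ring, by ring, by ring⟩

end Row

namespace Entry

variable {t : Entry}

/-- The stabilizer preserves `Ω` up to scale, not only modulo `g'_{0,0}`. -/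
theorem mul_Ω_eq (ht : t.Valid) {U : Mat2} {μ : ℝ} {c : ℂ}
    (hR : Rel t.row.H t.row.S t.row.H t.row.S U μ c) (hΩ : U * t.Ω * U⁻¹ - c • t.Ω ∈ t.row.g) :
    U * t.Ω = c • (t.Ω * U) := by
  by_cases hT : t.row.HasTau
  swap
  · rw [Ω_eq, Row.Ω₁_eq_zero hT]; simp
  obtain ⟨hc, x, y, rfl, hx, hxy, h6⟩ := Row.residual ht.1 hT hR
  set G := !![x, 0; 0, y] * t.Ω * (!![x, 0; 0, y])⁻¹ - c • t.Ω with hG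
  have hy : y ≠ 0 := norm_ne_zero_iff.1 (hxy ▸ norm_ne_zero_iff.2 hx)
  -- `G` is diagonal. Diagonal positions where `Ω₁` has entry zero determine it, so the congruence
  -- modulo `g'_{0,0}` becomes an equality.
  have e : !![x, 0; 0, y] * t.Ω = c • (t.Ω * !![x, 0; 0, y]) + G * !![x, 0; 0, y] := by
    rw [hG, Matrix.sub_mul, Matrix.nonsing_inv_mul_cancel_right _ _ hR.unit, Matrix.smul_mul]
    abel
  clear_value G
  suffices h0 : G = 0 by rw [e, h0, Matrix.zero_mul, add_zero]
  obtain ⟨r, τ⟩ := t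
  rw [Ω_eq] at e
  change r.HasTau at hT
  change G ∈ r.g at hΩ
  cases r with
  | r1 ε lam =>
    obtain ⟨a, rfl⟩ := hΩ
    simp only [Row.Ω₁, Matrix.mul_fin_two, smul_of, add_of, of_eq_of_iff] at e
    obtain rfl : a = 0 := (mul_eq_zero.1 (by linear_combination -e.1 : a * x = 0)).resolve_right hx
    simp [of_eq_zero_iff]
  | r2 θ =>
    obtain ⟨a, rfl⟩ := hΩ
    simp only [Row.Ω₁, Matrix.mul_fin_two, smul_of, add_of, of_eq_of_iff] at e
    obtain rfl : a = 0 := (mul_eq_zero.1 (by linear_combination -e.1 : a * x = 0)).resolve_right hx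
    simp [of_eq_zero_iff]
  | r4 ε =>
    obtain ⟨a, b, rfl⟩ := hΩ
    simp only [Row.Ω₁, Matrix.mul_fin_two, smul_of, add_of, of_eq_of_iff] at e
    obtain rfl : a = 0 := (mul_eq_zero.1 (by linear_combination -e.1 : a * x = 0)).resolve_right hx
    obtain rfl : b = 0 := (mul_eq_zero.1 (by linear_combination -e.2.2.2 :
      b * y = 0)).resolve_right hy
    simp [of_eq_zero_iff]
  | r6 =>
    obtain ⟨a, rfl⟩ := hΩ
    simp only [Row.Ω₁, Matrix.mul_fin_two, smul_of, add_of, of_eq_of_iff] at e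
    obtain rfl : a = 0 := (mul_eq_zero.1 (by linear_combination -e.2.2.2 :
      a * y = 0)).resolve_right hy
    simp [of_eq_zero_iff]
  | _ => exact absurd hT id

theorem exists_of_mem_stabilizer (ht : t.Valid) {k : ℂˣ × GL (Fin 2) ℂ}
    (hk : k ∈ stabilizer t.row.H t.row.S t.Ω) :
    ∃ (μ : ℝ) (c : ℂ), Rel t.row.H t.row.S t.row.H t.row.S (k.2 : Mat2) μ c ∧
      conj (k.1 : ℂ) = μ * (k.1 : ℂ) ∧ (k.2 : Mat2) * t.Ω = c • (t.Ω * (k.2 : Mat2)) := by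
  obtain ⟨μ, c, hR, hu, hΩ⟩ := (mem_stabilizer_iff (Row.isPair ht.1)).1 hk
  rw [Row.g00'_eq ht.1] at hΩ
  exact ⟨μ, c, hR, hu, mul_Ω_eq ht hR hΩ⟩

theorem lieAlg_stabilizer (ht : t.Valid) :
    lieAlg (stabilizer t.row.H t.row.S t.Ω) = {y | y.1.im = 0 ∧ y.2 ∈ t.stabAlg} := by
  have hp := Row.isPair ht.1
  ext ⟨y, X⟩
  constructor
  · intro h
    have h' : (y, X) ∈ lieAlg (CU t.row.H ∩ G00 t.row.H t.row.S) := fun s => by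
      obtain ⟨k, hk, h1⟩ := h s
      exact ⟨k, hk.1, h1⟩
    rw [Row.lieAlg_eq ht.1] at h'
    obtain ⟨him, hX⟩ := h'
    refine ⟨him, hX, fun hτ => ?_⟩
    have hg := ((Row.mem_re_iff ht.1).1 hX).1
    obtain ⟨a, ha⟩ := Row.g_symm hg
    have hT : t.row.HasTau := by
      by_contra hT; exact hτ (ht.2.2 hT)
    rw [← Row.annih_iff hτ hT hg ha, ← Ω_eq]
    refine commutator_of_exp hp.ne ha fun s => ?_
    obtain ⟨k, hk, h1, h2⟩ := h s
    obtain ⟨μ, c, hR, -, hΩ⟩ := exists_of_mem_stabilizer ht hk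
    rw [h2] at hR hΩ
    exact ⟨c, hR.symm, hΩ⟩
  · rintro ⟨him, hX, hann⟩ s
    obtain ⟨hg, hsk⟩ := (Row.mem_re_iff ht.1).1 hX
    obtain ⟨a, ha⟩ := Row.g_symm hg
    have hΩ : X * t.Ω - t.Ω * X = a • t.Ω := by
      by_cases hτ : t.τ = 0
      · rw [Ω_eq, hτ]; simp
      · have hT : t.row.HasTau := by
          by_contra hT; exact hτ (ht.2.2 hT)
        rw [Ω_eq]
        exact (Row.annih_iff hτ hT hg ha).2 (hann hτ)
    have hR := rel_exp hsk ha s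
    refine ⟨expElement (y, X) s, (mem_stabilizer_iff hp).2 ⟨1, _, hR, ?_, ?_⟩, rfl, rfl⟩
    · rw [Complex.ofReal_one, one_mul]
      exact conj_exp_of_im him s
    · change NormedSpace.exp ((s : ℂ) • X) * t.Ω * (NormedSpace.exp ((s : ℂ) • X))⁻¹ - _ ∈ _
      rw [exp_mul_eq hΩ, Matrix.smul_mul, Matrix.mul_nonsing_inv_cancel_right _ _ hR.unit, sub_self]
      exact (g00'Sub _ _).zero_mem

end Entry

/-! ### The function `S(ζ)` of the distinguished models -/

theorem HasMatDeriv.unique {n : Type*} {F G F' : ℂ → Matrix n n ℂ}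
    (hF : ∀ t, HasMatDeriv F (F' t) t) (hG : ∀ t, HasMatDeriv G (F' t) t) (h0 : F 0 = G 0) (t : ℂ) :
    F t = G t := by
  ext i j
  have h : ∀ t, HasDerivAt (fun ζ => F ζ i j - G ζ i j) 0 t := fun t => by
    simpa using (hF t i j).fun_sub (hG t i j)
  have := is_const_of_deriv_eq_zero (fun t => (h t).differentiableAt) (fun t => (h t).deriv) t 0
  simpa [h0, sub_eq_zero] using this

theorem exp_fromBlocks_diag (A D : Mat2) : NormedSpace.exp (Matrix.fromBlocks A 0 0 D) =
    Matrix.fromBlocks (NormedSpace.exp A) 0 0 (NormedSpace.exp D) := by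
  let : NormedRing Mat2 := Matrix.linftyOpNormedRing
  let : NormedAlgebra ℂ Mat2 := Matrix.linftyOpNormedAlgebra
  let : NormedAlgebra ℚ Mat2 := Matrix.linftyOpNormedAlgebra
  have : CompleteSpace Mat2 := FiniteDimensional.complete ℂ _
  let : NormedRing Mat22 := Matrix.linftyOpNormedRing
  let : NormedAlgebra ℂ Mat22 := Matrix.linftyOpNormedAlgebra
  let : NormedAlgebra ℚ Mat22 := Matrix.linftyOpNormedAlgebra
  have : CompleteSpace Mat22 := FiniteDimensional.complete ℂ _
  let f : Mat2 × Mat2 →ₐ[ℂ] Mat22 :=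
    { toFun := fun p => Matrix.fromBlocks p.1 0 0 p.2
      map_one' := Matrix.fromBlocks_one
      map_mul' := fun p q => by simp [Matrix.fromBlocks_multiply]
      map_zero' := Matrix.fromBlocks_zero
      map_add' := fun p q => by simp [Matrix.fromBlocks_add]
      commutes' := fun r => by
        simp [Algebra.algebraMap_eq_smul_one, ← Matrix.fromBlocks_one, Matrix.fromBlocks_smul] }
  have hf : Continuous f := f.toLinearMap.continuous_of_finiteDimensional
  have h := NormedSpace.map_exp f hf (A, D)
  have h2 : NormedSpace.exp ((A, D) : Mat2 × Mat2) = (NormedSpace.exp A, NormedSpace.exp D) := by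
    ext1
    · exact Prod.fst_exp _
    · exact Prod.snd_exp _
  exact h.symm.trans (congrArg f h2)

theorem exp_of_mul_self {N : Mat22} (h : N * N = 0) : NormedSpace.exp N = 1 + N := by
  rw [NormedSpace.exp_eq_tsum ℂ]
  change ∑' n : ℕ, ((n.factorial : ℂ)⁻¹) • N ^ n = 1 + N
  rw [tsum_eq_sum (s := Finset.range 2)]
  · simp [Finset.sum_range_succ]
  · intro n hn
    have h2 : 2 ≤ n := by simpa [Nat.lt_iff_add_one_le] using hn
    obtain ⟨k, rfl⟩ := Nat.exists_eq_add_of_le h2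
    rw [pow_add, pow_two, h, zero_mul, smul_zero]

theorem ofS_mul_ofS (H S T : Mat2) : ofS H S * ofS H T = 0 := by
  simp [ofS, Matrix.fromBlocks_multiply]

section

variable {H S Ω : Mat2}

/-- `ι(e)` is block triangular with the diagonal blocks of `ofGL H Ω`. Multiplying by the projection
onto `f₁, f₂` makes this an intertwining relation, which exponentiates. -/
theorem exp_smul_iotaMod_mul_fst (ζ : ℂ) :
    NormedSpace.exp (ζ • iotaMod H S Ω) * Matrix.fromBlocks 1 0 0 0 =
      Matrix.fromBlocks 1 0 0 0 * NormedSpace.exp (ζ • ofGL H Ω) := by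
  refine (exp_semiconj ?_).symm
  simp [iotaMod, ofS, ofGL, Matrix.fromBlocks_smul, Matrix.fromBlocks_multiply,
    Matrix.fromBlocks_add]

theorem snd_mul_exp_smul_iotaMod (ζ : ℂ) :
    Matrix.fromBlocks 0 0 0 1 * NormedSpace.exp (ζ • iotaMod H S Ω) =
      NormedSpace.exp (ζ • ofGL H Ω) * Matrix.fromBlocks 0 0 0 1 := by
  refine exp_semiconj ?_
  simp [iotaMod, ofS, ofGL, Matrix.fromBlocks_smul, Matrix.fromBlocks_multiply,
    Matrix.fromBlocks_add]

theorem exp_neg_smul_ofGL_comm (ζ : ℂ) {X : Mat22} (hX : X * ofGL H Ω = ofGL H Ω * X) :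
    X * NormedSpace.exp (-(ζ • ofGL H Ω)) = NormedSpace.exp (-(ζ • ofGL H Ω)) * X := by
  refine exp_semiconj ?_
  rw [Matrix.mul_neg, Matrix.neg_mul, Matrix.mul_smul, Matrix.smul_mul, hX]

/-- The logarithm in the definition of `S(ζ)` lies in `csp(g₋₁)_{0,2}`. -/
theorem exp_iotaMod_mul (hH : IsUnit H.det) (ζ : ℂ) :
    NormedSpace.exp (ζ • iotaMod H S Ω) * NormedSpace.exp (-(ζ • ofGL H Ω)) =
      1 + ofS H (distinguishedS H S Ω ζ) := by
  set E := NormedSpace.exp (ζ • iotaMod H S Ω) * NormedSpace.exp (-(ζ • ofGL H Ω)) with hE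
  have h1 : E * Matrix.fromBlocks 1 0 0 0 = Matrix.fromBlocks 1 0 0 0 := by
    rw [hE, Matrix.mul_assoc, ← exp_neg_smul_ofGL_comm ζ (by simp [ofGL, Matrix.fromBlocks_multiply]),
      ← Matrix.mul_assoc, exp_smul_iotaMod_mul_fst, Matrix.mul_assoc, exp_mul_exp_neg,
      Matrix.mul_one]
  have h2 : Matrix.fromBlocks 0 0 0 1 * E = Matrix.fromBlocks 0 0 0 1 := by
    rw [hE, ← Matrix.mul_assoc, snd_mul_exp_smul_iotaMod, Matrix.mul_assoc,
      exp_neg_smul_ofGL_comm ζ (by simp [ofGL, Matrix.fromBlocks_multiply]), ← Matrix.mul_assoc,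
      exp_mul_exp_neg, Matrix.one_mul]
  have h3 : distinguishedS H S Ω ζ * H = E.toBlocks₁₂ := by
    rw [distinguishedS, Matrix.mul_assoc, Matrix.nonsing_inv_mul _ hH, Matrix.mul_one]
  rw [ofS, h3]
  rw [← Matrix.fromBlocks_toBlocks E] at h1 h2
  simp only [Matrix.fromBlocks_multiply, Matrix.mul_zero, Matrix.mul_one, Matrix.one_mul,
    Matrix.zero_mul, add_zero, zero_add, Matrix.fromBlocks_inj] at h1 h2
  conv_lhs => rw [← Matrix.fromBlocks_toBlocks E]
  rw [h1.1, h2.2.2.1, h2.2.2.2, ← Matrix.fromBlocks_one, Matrix.fromBlocks_add]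
  simp

theorem exp_ofS_distinguishedS (hH : IsUnit H.det) (ζ : ℂ) :
    NormedSpace.exp (ofS H (distinguishedS H S Ω ζ)) =
      NormedSpace.exp (ζ • iotaMod H S Ω) * NormedSpace.exp (-(ζ • ofGL H Ω)) := by
  rw [exp_iotaMod_mul hH, exp_of_mul_self (ofS_mul_ofS _ _ _)]

theorem distinguishedS_zero : distinguishedS H S Ω 0 = 0 := by
  rw [distinguishedS, zero_smul, zero_smul, neg_zero, NormedSpace.exp_zero, Matrix.mul_one]
  have : (1 : Mat22).toBlocks₁₂ = 0 := by
    rw [← Matrix.fromBlocks_one, Matrix.toBlocks_fromBlocks₁₂]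
  rw [this, Matrix.zero_mul]

/-- The derivative of `S(ζ)`. -/
def derivS (S Ω : Mat2) (ζ : ℂ) : Mat2 :=
  NormedSpace.exp (ζ • Ω) * S * NormedSpace.exp (ζ • Ωᵀ)

/-- The derivative of the product of exponentials is `exp(ζι) S exp(-ζΩ)`. As `S` takes values in
the span of `f₁, f₂`, where `ι` acts as `Ω`, the first factor may be replaced by `exp(ζΩ)`, and a
conjugate of `S` remains. -/
theorem hasMatDeriv_distinguishedS (hH : IsUnit H.det) (ζ : ℂ) :
    HasMatDeriv (distinguishedS H S Ω) (derivS S Ω ζ) ζ := by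
  have h1 : HasMatDeriv (fun ζ => NormedSpace.exp (-(ζ • ofGL H Ω)))
      (-(ofGL H Ω * NormedSpace.exp (-(ζ • ofGL H Ω)))) ζ := by
    have := hasMatDeriv_exp (-ofGL H Ω) ζ
    simp only [smul_neg] at this
    rw [exp_neg_smul_ofGL_comm ζ rfl, ← Matrix.mul_neg]
    exact this
  have h2 := (hasMatDeriv_exp (iotaMod H S Ω) ζ).mul h1
  have e1 : NormedSpace.exp (ζ • iotaMod H S Ω) * iotaMod H S Ω *
        NormedSpace.exp (-(ζ • ofGL H Ω)) + NormedSpace.exp (ζ • iotaMod H S Ω) *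
        -(ofGL H Ω * NormedSpace.exp (-(ζ • ofGL H Ω))) =
      NormedSpace.exp (ζ • ofGL H Ω) * ofS H S * NormedSpace.exp (-(ζ • ofGL H Ω)) := by
    have e2 : ofS H S = Matrix.fromBlocks 1 0 0 0 * ofS H S := by
      simp [ofS, Matrix.fromBlocks_multiply]
    have e3 : NormedSpace.exp (ζ • iotaMod H S Ω) * ofS H S =
        NormedSpace.exp (ζ • ofGL H Ω) * ofS H S := by
      conv_lhs => rw [e2]
      rw [← Matrix.mul_assoc, exp_smul_iotaMod_mul_fst,
        exp_semiconj (Z := ζ • ofGL H Ω), Matrix.mul_assoc, ← e2]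
      simp [ofGL, Matrix.fromBlocks_multiply, Matrix.fromBlocks_smul]
    rw [← e3, iotaMod]
    noncomm_ring
  rw [e1] at h2
  have e4 : NormedSpace.exp (ζ • ofGL H Ω) * ofS H S * NormedSpace.exp (-(ζ • ofGL H Ω)) =
      ofS H (derivS S Ω ζ) := by
    have e5 : NormedSpace.exp (ζ • (H⁻¹ * Ωᵀ * H)) = H⁻¹ * NormedSpace.exp (ζ • Ωᵀ) * H := by
      have : H * NormedSpace.exp (ζ • (H⁻¹ * Ωᵀ * H)) = NormedSpace.exp (ζ • Ωᵀ) * H := by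
        refine exp_semiconj ?_
        rw [Matrix.mul_smul, Matrix.smul_mul, Matrix.mul_assoc,
          Matrix.mul_nonsing_inv_cancel_left _ _ hH]
      rw [Matrix.mul_assoc H⁻¹ (NormedSpace.exp _), ← this, Matrix.nonsing_inv_mul_cancel_left _ _ hH]
    rw [ofGL, Matrix.fromBlocks_smul, Matrix.fromBlocks_neg, smul_zero, neg_zero, smul_neg, neg_neg,
      exp_fromBlocks_diag, exp_fromBlocks_diag, e5, ofS, ofS, derivS, Matrix.fromBlocks_multiply,
      Matrix.fromBlocks_multiply]
    simp [Matrix.mul_assoc, Matrix.mul_nonsing_inv_cancel_left _ _ hH]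
  rw [e4] at h2
  have h3 : HasMatDeriv (fun ζ => (NormedSpace.exp (ζ • iotaMod H S Ω) *
      NormedSpace.exp (-(ζ • ofGL H Ω))).toBlocks₁₂) (derivS S Ω ζ * H) ζ := fun i j => by
    simpa [ofS, Matrix.toBlocks₁₂] using h2 (Sum.inl i) (Sum.inr j)
  have h4 := h3.mul (HasMatDeriv.const H⁻¹ ζ)
  rw [Matrix.mul_zero, add_zero, Matrix.mul_assoc, Matrix.mul_nonsing_inv _ hH, Matrix.mul_one] at h4
  exact h4

theorem derivS_zero : derivS S Ω 0 = S := by simp [derivS]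

theorem derivS_transpose (hS : Sᵀ = S) (ζ : ℂ) : (derivS S Ω ζ)ᵀ = derivS S Ω ζ := by
  simp only [derivS, Matrix.transpose_mul, ← Matrix.exp_transpose, Matrix.transpose_smul,
    Matrix.transpose_transpose, hS, Matrix.mul_assoc]

theorem derivS_ne_zero (hS : S ≠ 0) (ζ : ℂ) : derivS S Ω ζ ≠ 0 := by
  intro h
  apply hS
  have h1 : NormedSpace.exp (-(ζ • Ω)) * NormedSpace.exp (ζ • Ω) = 1 := by
    simpa using exp_mul_exp_neg (-(ζ • Ω))
  have h2 : NormedSpace.exp (-(ζ • Ω)) * derivS S Ω ζ * NormedSpace.exp (-(ζ • Ωᵀ)) = S := by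
    rw [derivS, Matrix.mul_assoc, Matrix.mul_assoc, exp_mul_exp_neg, Matrix.mul_one, ← Matrix.mul_assoc,
      h1, Matrix.one_mul]
  rw [← h2, h, Matrix.mul_zero, Matrix.zero_mul]

theorem hasMatDeriv_derivS (ζ : ℂ) :
    HasMatDeriv (derivS S Ω) (Ω * derivS S Ω ζ + derivS S Ω ζ * Ωᵀ) ζ := by
  have h := ((hasMatDeriv_exp Ω ζ).mul (HasMatDeriv.const S ζ)).mul (hasMatDeriv_exp Ωᵀ ζ)
  have e : NormedSpace.exp (ζ • Ω) * Ω = Ω * NormedSpace.exp (ζ • Ω) :=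
    (exp_semiconj (by rw [Matrix.mul_smul, Matrix.smul_mul])).symm
  rw [Matrix.mul_zero, add_zero, e] at h
  simp only [derivS, ← Matrix.mul_assoc] at h ⊢
  exact h

theorem distinguishedS_transpose (hH : IsUnit H.det) (hS : Sᵀ = S) (ζ : ℂ) :
    (distinguishedS H S Ω ζ)ᵀ = distinguishedS H S Ω ζ := by
  refine HasMatDeriv.unique (F := fun ζ => (distinguishedS H S Ω ζ)ᵀ) (F' := derivS S Ω)
    (fun t i j => ?_) (hasMatDeriv_distinguishedS hH) ?_ ζ
  · have := hasMatDeriv_distinguishedS (S := S) (Ω := Ω) hH t j i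
    rw [← derivS_transpose hS]
    exact this
  · simp [distinguishedS_zero]

/-- Both sides vanish at 0 and have the same derivative, because `U Ω = c Ω U` gives `U exp(ζΩ) =
exp(cζΩ) U`. -/
theorem distinguishedS_mul (hH : IsUnit H.det) {U : Mat2} {c : ℂ} (hS : U * S * Uᵀ = c • S)
    (hΩ : U * Ω = c • (Ω * U)) (ζ : ℂ) :
    distinguishedS H S Ω (c * ζ) = U * distinguishedS H S Ω ζ * Uᵀ := by
  refine HasMatDeriv.unique (F := fun ζ => distinguishedS H S Ω (c * ζ))
    (G := fun ζ => U * distinguishedS H S Ω ζ * Uᵀ) (F' := fun ζ => c • derivS S Ω (c * ζ))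
    (fun t i j => ?_) (fun t => ?_) ?_ ζ
  · have h1 := (hasMatDeriv_distinguishedS (S := S) (Ω := Ω) hH (c * t) i j).comp t
      ((hasDerivAt_id t).const_mul c)
    rw [mul_one, mul_comm] at h1
    exact h1
  · have h1 := ((HasMatDeriv.const U t).mul (hasMatDeriv_distinguishedS (S := S) (Ω := Ω) hH t)).mul
      (HasMatDeriv.const Uᵀ t)
    have e1 : U * NormedSpace.exp (t • Ω) = NormedSpace.exp ((c * t) • Ω) * U := by
      refine exp_semiconj ?_
      rw [Matrix.mul_smul, hΩ, Matrix.smul_mul, smul_smul, mul_comm]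
    have e2 : NormedSpace.exp (t • Ωᵀ) * Uᵀ = Uᵀ * NormedSpace.exp ((c * t) • Ωᵀ) := by
      have := congrArg Matrix.transpose e1
      simpa only [Matrix.transpose_mul, ← Matrix.exp_transpose, Matrix.transpose_smul] using this
    have e3 : U * derivS S Ω t * Uᵀ = c • derivS S Ω (c * t) := by
      have e4 : U * derivS S Ω t * Uᵀ =
          (U * NormedSpace.exp (t • Ω)) * S * (NormedSpace.exp (t • Ωᵀ) * Uᵀ) := by
        simp only [derivS, Matrix.mul_assoc]
      rw [e4, e1, e2, derivS, ← Matrix.smul_mul, ← Matrix.mul_smul, ← hS]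
      simp only [Matrix.mul_assoc]
    simpa only [Matrix.zero_mul, Matrix.mul_zero, zero_add, add_zero, e3] using h1
  · simp [distinguishedS_zero]

end

/-! ### The matrix functions of a model -/

section

variable {H s : Mat2}

/-- The solution `y` of `y = H (z̄ + s̄ ȳ)`. -/
def modelY (H s : Mat2) (z : Fin 2 → ℂ) : Fin 2 → ℂ :=
  modelH H s *ᵥ (star z + cbar s *ᵥ (Hᵀ *ᵥ z))

theorem star_mulVec (A : Mat2) (v : Fin 2 → ℂ) : star (A *ᵥ v) = cbar A *ᵥ star v := by
  ext i
  fin_cases i <;> simp [Matrix.mulVec, dotProduct, cbar]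

theorem cbar_sub (A B : Mat2) : cbar (A - B) = cbar A - cbar B := by
  ext i j; simp [cbar]

/-- The condition under which the functions of the model are defined at `s`. -/
structure IsRegular (H s : Mat2) : Prop where
  herm : cbar H = Hᵀ
  unit : IsUnit H.det
  symm : sᵀ = s
  unit' : IsUnit (1 - cbar s * Hᵀ * s * H).det

namespace IsRegular

theorem unit_left (h : IsRegular H s) : IsUnit (1 - H * cbar s * Hᵀ * s).det := by
  have e : (1 - H * cbar s * Hᵀ * s).det = (1 - cbar s * Hᵀ * s * H).det := by
    have := Matrix.det_one_sub_mul_comm H (cbar s * Hᵀ * s)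
    simpa only [Matrix.mul_assoc] using this
  rw [e]; exact h.unit'

theorem unit_conj (h : IsRegular H s) : IsUnit (1 - s * H * cbar s * Hᵀ).det := by
  have e : 1 - s * H * cbar s * Hᵀ = cbar (1 - cbar s * Hᵀ * s * H) := by
    rw [cbar_sub, cbar_mul, cbar_mul, cbar_mul, cbar_cbar, cbar_transpose, h.herm, cbar_one,
      Matrix.transpose_transpose]
  rw [e, det_cbar]
  exact h.unit'.map _

/-- The push-through identity for inverses. The two summands in `H(ζ, ζ̄)` coincide, so the average
is either of them. -/
theorem inv_mul_eq (h : IsRegular H s) :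
    (1 - H * cbar s * Hᵀ * s)⁻¹ * H = H * (1 - cbar s * Hᵀ * s * H)⁻¹ := by
  have e : H * (1 - cbar s * Hᵀ * s * H) = (1 - H * cbar s * Hᵀ * s) * H := by noncomm_ring
  have := congrArg (fun A => (1 - H * cbar s * Hᵀ * s)⁻¹ * A * (1 - cbar s * Hᵀ * s * H)⁻¹) e
  rwa [Matrix.nonsing_inv_mul_cancel_left _ _ h.unit_left, ← Matrix.mul_assoc,
    Matrix.mul_nonsing_inv_cancel_right _ _ h.unit'] at this

theorem modelH_eq (h : IsRegular H s) : modelH H s = H * (1 - cbar s * Hᵀ * s * H)⁻¹ := by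
  rw [modelH, h.inv_mul_eq]
  module

theorem modelH_eq' (h : IsRegular H s) : modelH H s = (1 - H * cbar s * Hᵀ * s)⁻¹ * H := by
  rw [h.modelH_eq, h.inv_mul_eq]

theorem unit_modelH (h : IsRegular H s) : IsUnit (modelH H s).det := by
  rw [h.modelH_eq, Matrix.det_mul]
  exact h.unit.mul (Matrix.isUnit_nonsing_inv_det _ h.unit')

theorem modelH_mul (h : IsRegular H s) (v : Fin 2 → ℂ) :
    (1 - H * cbar s * Hᵀ * s) *ᵥ (modelH H s *ᵥ v) = H *ᵥ v := by
  rw [h.modelH_eq', Matrix.mulVec_mulVec, Matrix.mul_nonsing_inv_cancel_left _ _ h.unit_left]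

theorem eq_modelH_mul (h : IsRegular H s) {v w : Fin 2 → ℂ} (e : (1 - H * cbar s * Hᵀ * s) *ᵥ v = H *ᵥ w) :
    v = modelH H s *ᵥ w := by
  rw [h.modelH_eq', ← Matrix.mulVec_mulVec, ← e, Matrix.mulVec_mulVec,
    Matrix.nonsing_inv_mul _ h.unit_left, Matrix.one_mulVec]

/-- Substituting the conjugate of the equation into itself removes `ȳ` and leaves a complex linear
system with invertible matrix. -/
theorem eq_modelY (h : IsRegular H s) {y z : Fin 2 → ℂ} (e : y = H *ᵥ (star z + cbar s *ᵥ star y)) :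
    y = modelY H s z := by
  have e' : star y = Hᵀ *ᵥ (z + s *ᵥ y) := by
    conv_lhs => rw [e]
    rw [star_mulVec, h.herm, star_add, star_star, star_mulVec, cbar_cbar, star_star]
  refine h.eq_modelH_mul ?_
  rw [e', Matrix.mulVec_add, Matrix.mulVec_add] at e
  rw [Matrix.mulVec_add, Matrix.sub_mulVec, Matrix.one_mulVec, sub_eq_iff_eq_add]
  conv_lhs => rw [e]
  simp only [Matrix.mulVec_add, Matrix.mulVec_mulVec, Matrix.mul_assoc]
  abel

/-- By definition `y` solves only the equation substituted into its own conjugate. To return to the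
original equation, `a = z + s y` and `b̄`, where `y = H b`, are shown to solve the same invertible
system; hence `ȳ = Hᵀ a`. -/
theorem modelY_eq (h : IsRegular H s) (z : Fin 2 → ℂ) :
    modelY H s z = H *ᵥ (star z + cbar s *ᵥ star (modelY H s z)) := by
  set y := modelY H s z with hy
  set a := z + s *ᵥ y with ha
  have e1 : y = H *ᵥ (star z + cbar s *ᵥ (Hᵀ *ᵥ a)) := by
    have := h.modelH_mul (star z + cbar s *ᵥ (Hᵀ *ᵥ z))
    change _ *ᵥ y = _ at this
    rw [Matrix.sub_mulVec, Matrix.one_mulVec, sub_eq_iff_eq_add] at this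
    conv_lhs => rw [this]
    simp only [ha, Matrix.mulVec_add, Matrix.mulVec_mulVec, Matrix.mul_assoc]
    abel
  have e2 : (1 - s * H * cbar s * Hᵀ) *ᵥ a = z + s *ᵥ (H *ᵥ star z) := by
    rw [Matrix.sub_mulVec, Matrix.one_mulVec, sub_eq_iff_eq_add]
    conv_lhs => rw [ha, e1]
    simp only [Matrix.mulVec_add, Matrix.mulVec_mulVec, Matrix.mul_assoc]
    abel
  set b := star z + cbar s *ᵥ (Hᵀ *ᵥ a) with hb
  have e3 : (1 - s * H * cbar s * Hᵀ) *ᵥ star b = z + s *ᵥ (H *ᵥ star z) := by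
    have hyb : y = H *ᵥ b := e1
    have e4 : star b = z + s *ᵥ (H *ᵥ star a) := by
      rw [hb, star_add, star_star, star_mulVec, star_mulVec, cbar_cbar, cbar_transpose, h.herm,
        Matrix.transpose_transpose]
    have e5 : star a = star z + cbar s *ᵥ (Hᵀ *ᵥ star b) := by
      rw [ha, star_add, star_mulVec, hyb, star_mulVec, h.herm]
    rw [e5] at e4
    rw [Matrix.sub_mulVec, Matrix.one_mulVec, sub_eq_iff_eq_add]
    conv_lhs => rw [e4]
    simp only [Matrix.mulVec_add, Matrix.mulVec_mulVec, Matrix.mul_assoc]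
    abel
  have e6 : a = star b := by
    have := congrArg ((1 - s * H * cbar s * Hᵀ)⁻¹ *ᵥ ·) (e2.trans e3.symm)
    simpa only [Matrix.mulVec_mulVec, Matrix.nonsing_inv_mul _ h.unit_conj, Matrix.one_mulVec]
      using this
  conv_lhs => rw [e1]
  have e7 : star y = Hᵀ *ᵥ a := by
    rw [e6, e1, star_mulVec, h.herm]
  rw [e7]

theorem star_modelY_eq (h : IsRegular H s) (z : Fin 2 → ℂ) :
    star (modelY H s z) = Hᵀ *ᵥ (z + s *ᵥ modelY H s z) := by
  conv_lhs => rw [h.modelY_eq]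
  rw [star_mulVec, h.herm, star_add, star_star, star_mulVec, cbar_cbar, star_star]

/-- The conjugate of `S(ζ, ζ̄)` is `H(ζ, ζ̄) s̄ Hᵀ`, so inside the real part both terms combine to
`zᵀ y`. -/
theorem modelRHS_eq {Sz : ℂ → Mat2} {x : C4} (h : IsRegular H (Sz (x 3))) :
    modelRHS H Sz x = (zPart x ⬝ᵥ modelY H (Sz (x 3)) (zPart x)).re := by
  set s := Sz (x 3)
  set z := zPart x
  have e1 : cbar (modelS H s) = modelH H s * cbar s * Hᵀ := by
    rw [h.modelH_eq, modelS, cbar_mul, cbar_mul, cbar_mul, cbar_inv, cbar_sub, cbar_mul, cbar_mul,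
      cbar_mul, cbar_cbar, cbar_transpose, h.herm, cbar_one, Matrix.transpose_transpose]
  have e2 : (star z ⬝ᵥ (modelS H s *ᵥ star z)).re = (z ⬝ᵥ (modelH H s * cbar s * Hᵀ) *ᵥ z).re := by
    rw [← e1, ← Complex.conj_re]
    congr 1
    simp [dotProduct, Matrix.mulVec, cbar, Fin.sum_univ_two]
  rw [modelRHS, Complex.add_re, Complex.ofReal_re, modelY, Matrix.mulVec_add, dotProduct_add,
    Complex.add_re, Matrix.mulVec_mulVec, Matrix.mulVec_mulVec, ← e2]

end IsRegular

end

/-! ### Analyticity of the models -/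

/-- The entries of `F` are real analytic at `x`. -/
def Anm (F : C4 → Mat2) (x : C4) : Prop := ∀ i j, AnalyticAt ℝ (fun y => F y i j) x

theorem analyticAt_conj {f : C4 → ℂ} {x : C4} (hf : AnalyticAt ℝ f x) :
    AnalyticAt ℝ (fun y => conj (f y)) x :=
  (Complex.conjCLE.toContinuousLinearMap.analyticAt (f x)).comp hf

theorem analyticAt_coord (i : Fin 4) (x : C4) : AnalyticAt ℝ (fun y : C4 => y i) x :=
  (ContinuousLinearMap.proj (R := ℝ) (φ := fun _ : Fin 4 => ℂ) i).analyticAt x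

namespace Anm

variable {F G : C4 → Mat2} {x : C4}

theorem const (A : Mat2) (x : C4) : Anm (fun _ => A) x := fun _ _ => analyticAt_const

theorem mul (hF : Anm F x) (hG : Anm G x) : Anm (fun y => F y * G y) x := fun i j => by
  simp only [Matrix.mul_apply, Fin.sum_univ_two]
  exact ((hF i 0).mul (hG 0 j)).add ((hF i 1).mul (hG 1 j))

theorem sub (hF : Anm F x) (hG : Anm G x) : Anm (fun y => F y - G y) x := fun i j =>
  (hF i j).sub (hG i j)

theorem cbar (hF : Anm F x) : Anm (fun y => cbar (F y)) x := fun i j =>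
  analyticAt_conj (hF i j)

theorem inv (hF : Anm F x) (h0 : (F x).det ≠ 0) : Anm (fun y => (F y)⁻¹) x := by
  have hd : AnalyticAt ℝ (fun y => (F y).det) x := by
    simp only [Matrix.det_fin_two]
    exact ((hF 0 0).mul (hF 1 1)).sub ((hF 0 1).mul (hF 1 0))
  have ha : Anm (fun y => (F y).adjugate) x := fun i j => by
    simp only [Matrix.adjugate_fin_two]
    fin_cases i <;> fin_cases j
    · exact hF 1 1
    · exact (hF 0 1).neg
    · exact (hF 1 0).neg
    · exact hF 0 0
  intro i j
  simp only [Matrix.inv_def, Ring.inverse_eq_inv', Matrix.smul_apply, smul_eq_mul]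
  exact (hd.inv h0).mul (ha i j)

theorem smm (hF : Anm F x) : Smm F x := fun i j => (hF i j).contDiffAt

theorem mulVec (hF : Anm F x) {v : C4 → Fin 2 → ℂ} (hv : ∀ i, AnalyticAt ℝ (fun y => v y i) x)
    (i : Fin 2) : AnalyticAt ℝ (fun y => (F y *ᵥ v y) i) x := by
  simp only [Matrix.mulVec, dotProduct, Fin.sum_univ_two]
  exact ((hF i 0).mul (hv 0)).add ((hF i 1).mul (hv 1))

theorem of_hasMatDeriv {s s' : ℂ → Mat2} (h : ∀ ζ, HasMatDeriv s (s' ζ) ζ) (x : C4) :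
    Anm (fun y => s (y 3)) x := fun i j => by
  have h1 : AnalyticAt ℂ (fun ζ => s ζ i j) (x 3) :=
    Differentiable.analyticAt (fun ζ => (h ζ i j).differentiableAt) _
  exact AnalyticAt.fun_comp (f := fun y : C4 => y 3) (h1.restrictScalars (𝕜 := ℝ))
    (analyticAt_coord 3 x)

end Anm

theorem zPart_star (v : C4) : zPart (star v) = star (zPart v) := by
  ext i; fin_cases i <;> rfl

theorem zPart_zero : zPart (0 : C4) = 0 := by
  ext i; fin_cases i <;> rfl

theorem dotProduct_mulVec_comm (A : Mat2) (u v : Fin 2 → ℂ) : u ⬝ᵥ A *ᵥ v = (Aᵀ *ᵥ u) ⬝ᵥ v := by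
  rw [Matrix.dotProduct_mulVec, Matrix.mulVec_transpose]

theorem analyticAt_zPart (x : C4) (i : Fin 2) : AnalyticAt ℝ (fun y => zPart y i) x := by
  fin_cases i
  · exact analyticAt_coord 1 x
  · exact analyticAt_coord 2 x

/-- The data of a 2-nondegenerate model over the disc of radius `δ`. -/
structure IsModel (H : Mat2) (s s' s'' : ℂ → Mat2) (δ : ℝ) : Prop where
  reg : ∀ ζ, ‖ζ‖ < δ → IsRegular H (s ζ)
  deriv : ∀ ζ, HasMatDeriv s (s' ζ) ζ
  deriv' : ∀ ζ, HasMatDeriv s' (s'' ζ) ζ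
  symm : ∀ ζ, (s' ζ)ᵀ = s' ζ
  ne : ∀ ζ, s' ζ ≠ 0

/-- The vector `y` as a function on the domain of the model. -/
def Yv (H : Mat2) (s : ℂ → Mat2) (x : C4) : Fin 2 → ℂ := modelY H (s (x 3)) (zPart x)

namespace IsModel

variable {H : Mat2} {s s' s'' : ℂ → Mat2} {δ : ℝ} {x : C4}

theorem isOpen_dom (H : Mat2) (s : ℂ → Mat2) (δ : ℝ) : IsOpen (model H s δ).dom :=
  isOpen_lt (continuous_norm.comp (continuous_apply 3)) continuous_const

theorem analyticAt_Y (h : IsModel H s s' s'' δ) (hx : ‖x 3‖ < δ) (i : Fin 2) :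
    AnalyticAt ℝ (fun y => Yv H s y i) x := by
  have hr := h.reg _ hx
  have hs := Anm.of_hasMatDeriv h.deriv x
  have hK : Anm (fun y => modelH H (s (y 3))) x := by
    have h1 : Anm (fun y => H * (1 - cbar (s (y 3)) * Hᵀ * s (y 3) * H)⁻¹) x :=
      (Anm.const H x).mul (((Anm.const 1 x).sub (((hs.cbar.mul (Anm.const Hᵀ x)).mul hs).mul
        (Anm.const H x))).inv hr.unit'.ne_zero)
    intro i j
    refine (h1 i j).congr ?_
    filter_upwards [(isOpen_dom H s δ).mem_nhds hx] with y hy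
    rw [(h.reg _ hy).modelH_eq]
  refine hK.mulVec (fun i => ?_) i
  refine (analyticAt_conj (analyticAt_zPart x i)).add (hs.cbar.mulVec (fun i => ?_) i)
  exact (Anm.const Hᵀ x).mulVec (analyticAt_zPart x) i

theorem ρ_eq (h : IsModel H s s' s'' δ) (hx : ‖x 3‖ < δ) :
    (model H s δ).ρ x = (x 0 - zPart x ⬝ᵥ Yv H s x).re := by
  rw [Complex.sub_re]
  change (x 0).re - modelRHS H s x = _
  rw [IsRegular.modelRHS_eq (h.reg _ hx)]
  rfl

theorem analyticOnNhd (h : IsModel H s s' s'' δ) :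
    AnalyticOnNhd ℝ (model H s δ).ρ (model H s δ).dom := by
  intro x hx
  have h1 : AnalyticAt ℝ (fun y : C4 => y 0 - zPart y ⬝ᵥ Yv H s y) x := by
    simp only [dotProduct, Fin.sum_univ_two]
    exact (analyticAt_coord 0 x).sub (((analyticAt_zPart x 0).mul (h.analyticAt_Y hx 0)).add
      ((analyticAt_zPart x 1).mul (h.analyticAt_Y hx 1)))
  refine ((Complex.reCLM.analyticAt _).comp h1).congr ?_
  filter_upwards [(isOpen_dom H s δ).mem_nhds hx] with y hy
  exact (h.ρ_eq hy).symm

end IsModel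

/-! ### Derivatives of the functions of a model -/

/-- The derivative of a vector function. -/
def dv (u : C4 → Fin 2 → ℂ) (x : C4) (V : C4 × C4) : Fin 2 → ℂ := fun i => dd (fun y => u y i) x V

section

variable {x : C4} {V : C4 × C4} {u v : C4 → Fin 2 → ℂ} {F : C4 → Mat2}

theorem dv_add (hu : ∀ i, Sm (fun y => u y i) x) (hv : ∀ i, Sm (fun y => v y i) x) :
    dv (fun y => u y + v y) x V = dv u x V + dv v x V :=
  funext fun i => dd_add (hu i) (hv i) V

theorem dv_congr (h : u =ᶠ[𝓝 x] v) : dv u x V = dv v x V := funext fun i => by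
  have : (fun y => u y i) =ᶠ[𝓝 x] fun y => v y i := h.mono fun y hy => congrFun hy i
  rw [dv, dd_congr this]; rfl

theorem sm_mulVec (hF : Smm F x) (hu : ∀ i, Sm (fun y => u y i) x) (i : Fin 2) :
    Sm (fun y => (F y *ᵥ u y) i) x := by
  simp only [Matrix.mulVec, dotProduct, Fin.sum_univ_two]
  exact ((hF i 0).mul (hu 0)).add ((hF i 1).mul (hu 1))

theorem dv_mulVec (hF : Smm F x) (hu : ∀ i, Sm (fun y => u y i) x) :
    dv (fun y => F y *ᵥ u y) x V = dm F x V *ᵥ u x + F x *ᵥ dv u x V := by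
  ext i
  simp only [dv, dm, Matrix.mulVec, dotProduct, Fin.sum_univ_two, Pi.add_apply, Matrix.of_apply]
  rw [dd_add ((hF i 0).mul (hu 0)) ((hF i 1).mul (hu 1)), dd_mul (hF i 0) (hu 0),
    dd_mul (hF i 1) (hu 1)]
  ring

theorem dm_const (A : Mat2) : dm (fun _ => A) x V = 0 := by
  ext i j; exact dd_const _ _ _

theorem dv_const_mulVec (A : Mat2) (hu : ∀ i, Sm (fun y => u y i) x) :
    dv (fun y => A *ᵥ u y) x V = A *ᵥ dv u x V := by
  rw [dv_mulVec (F := fun _ => A) (fun _ _ => contDiffAt_const) hu, dm_const, Matrix.zero_mulVec, zero_add]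

theorem dd_dotProduct (hu : ∀ i, Sm (fun y => u y i) x) (hv : ∀ i, Sm (fun y => v y i) x) :
    dd (fun y => u y ⬝ᵥ v y) x V = dv u x V ⬝ᵥ v x + u x ⬝ᵥ dv v x V := by
  simp only [dv, dotProduct, Fin.sum_univ_two]
  rw [dd_add ((hu 0).mul (hv 0)) ((hu 1).mul (hv 1)), dd_mul (hu 0) (hv 0), dd_mul (hu 1) (hv 1)]
  ring

theorem sm_dotProduct (hu : ∀ i, Sm (fun y => u y i) x) (hv : ∀ i, Sm (fun y => v y i) x) :
    Sm (fun y => u y ⬝ᵥ v y) x := by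
  simp only [dotProduct, Fin.sum_univ_two]
  exact ((hu 0).mul (hv 0)).add ((hu 1).mul (hv 1))

theorem dd_conj_coord (i : Fin 4) (x : C4) (V : C4 × C4) :
    dd (fun y : C4 => conj (y i)) x V = V.2 i := by
  have := dd_conj (h := fun y : C4 => y i) (x := x) (cc V)
  rw [AdaptedFrame.dd_coord] at this
  simpa [cc] using this.symm

theorem dv_zPart : dv zPart x V = zPart V.1 := by
  ext i; fin_cases i <;> exact AdaptedFrame.dd_coord _ _ _

theorem dv_star_zPart : dv (fun y => star (zPart y)) x V = zPart V.2 := by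
  ext i; fin_cases i <;> exact dd_conj_coord _ _ _

theorem sm_zPart (i : Fin 2) : Sm (fun y => zPart y i) x := (analyticAt_zPart x i).contDiffAt

theorem sm_star_zPart (i : Fin 2) : Sm (fun y => (star (zPart y)) i) x := (sm_zPart i).conj

theorem dd_comp_coord {f : ℂ → ℂ} {f' : ℂ} {i : Fin 4} (hf : HasDerivAt f f' (x i)) :
    dd (fun y : C4 => f (y i)) x V = f' * V.1 i := by
  have h1 : ∀ v, fderiv ℝ (fun y : C4 => f (y i)) x v = f' * v i := by
    intro v
    have h2 : HasFDerivAt (𝕜 := ℝ) f _ (x i) := hf.hasFDerivAt.restrictScalars ℝ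
    have h3 := h2.comp x (ContinuousLinearMap.proj (R := ℝ) (φ := fun _ : Fin 4 => ℂ) i).hasFDerivAt
    have h4 := congrArg (fun T => T v) h3.fderiv
    refine h4.trans ?_
    simp [mul_comm]
  have hI := Complex.I_sq
  simp only [dd_def, h1, Pi.smul_apply, smul_eq_mul]
  linear_combination (1 / 2 * f' * (star V.2 i - V.1 i)) * hI

theorem dm_comp {s : ℂ → Mat2} {S' : Mat2} (hs : HasMatDeriv s S' (x 3)) :
    dm (fun y => s (y 3)) x V = V.1 3 • S' := by
  ext i j
  refine (dd_comp_coord (hs i j)).trans ?_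
  rw [mul_comm]; rfl

theorem dm_comp_cbar {s : ℂ → Mat2} {S' : Mat2} (hs : HasMatDeriv s S' (x 3)) :
    dm (fun y => cbar (s (y 3))) x V = V.2 3 • cbar S' := by
  ext i j
  have h1 := dd_conj (h := fun y : C4 => s (y 3) i j) (x := x) (cc V)
  rw [dd_comp_coord (hs i j)] at h1
  have h2 : cc (cc V) = V := by simp [cc]
  rw [h2] at h1
  refine h1.symm.trans ?_
  simp [cc, cbar, mul_comm]

end

/-! ### The Levi form of a model -/

namespace IsModel

variable {H : Mat2} {s s' s'' : ℂ → Mat2} {δ : ℝ} {x : C4}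

theorem sm_Y (h : IsModel H s s' s'' δ) (hx : ‖x 3‖ < δ) (i : Fin 2) :
    Sm (fun y => Yv H s y i) x := (h.analyticAt_Y hx i).contDiffAt

theorem sm_star_Y (h : IsModel H s s' s'' δ) (hx : ‖x 3‖ < δ) (i : Fin 2) :
    Sm (fun y => star (Yv H s y) i) x := (h.sm_Y hx i).conj

theorem smm_s (h : IsModel H s s' s'' δ) (x : C4) : Smm (fun y => s (y 3)) x :=
  (Anm.of_hasMatDeriv h.deriv x).smm

theorem smm_s' (h : IsModel H s s' s'' δ) (x : C4) : Smm (fun y => s' (y 3)) x :=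
  (Anm.of_hasMatDeriv h.deriv' x).smm

theorem Y_eq (h : IsModel H s s' s'' δ) (hx : ‖x 3‖ < δ) :
    Yv H s x = H *ᵥ (star (zPart x) + cbar (s (x 3)) *ᵥ star (Yv H s x)) :=
  (h.reg _ hx).modelY_eq _

theorem star_Y_eq (h : IsModel H s s' s'' δ) (hx : ‖x 3‖ < δ) :
    star (Yv H s x) = Hᵀ *ᵥ (zPart x + s (x 3) *ᵥ Yv H s x) :=
  (h.reg _ hx).star_modelY_eq _

/-- Differentiating the implicit equation instead of the explicit formula avoids derivatives of
matrix inverses. -/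
theorem dv_Y (h : IsModel H s s' s'' δ) (hx : ‖x 3‖ < δ) (V : C4 × C4) :
    dv (Yv H s) x V = H *ᵥ (zPart V.2 + ((V.2 3 • cbar (s' (x 3))) *ᵥ star (Yv H s x) +
      cbar (s (x 3)) *ᵥ dv (fun y => star (Yv H s y)) x V)) := by
  have h1 : Yv H s =ᶠ[𝓝 x] fun y =>
      H *ᵥ (star (zPart y) + cbar (s (y 3)) *ᵥ star (Yv H s y)) := by
    filter_upwards [(isOpen_dom H s δ).mem_nhds hx] with y hy using h.Y_eq hy
  have h2 := sm_mulVec (h.smm_s x).cbar (h.sm_star_Y hx)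
  have h3 : ∀ i, Sm (fun y => (star (zPart y) + cbar (s (y 3)) *ᵥ star (Yv H s y)) i) x :=
    fun i => (sm_star_zPart i).add (h2 i)
  rw [dv_congr h1, dv_const_mulVec _ h3,
    dv_add sm_star_zPart h2, dv_star_zPart, dv_mulVec (h.smm_s x).cbar (h.sm_star_Y hx),
    dm_comp_cbar (h.deriv _)]

theorem dv_star_Y (h : IsModel H s s' s'' δ) (hx : ‖x 3‖ < δ) (V : C4 × C4) :
    dv (fun y => star (Yv H s y)) x V = Hᵀ *ᵥ (zPart V.1 + ((V.1 3 • s' (x 3)) *ᵥ Yv H s x +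
      s (x 3) *ᵥ dv (Yv H s) x V)) := by
  have h1 : (fun y => star (Yv H s y)) =ᶠ[𝓝 x] fun y =>
      Hᵀ *ᵥ (zPart y + s (y 3) *ᵥ Yv H s y) := by
    filter_upwards [(isOpen_dom H s δ).mem_nhds hx] with y hy using h.star_Y_eq hy
  have h2 := sm_mulVec (h.smm_s x) (h.sm_Y hx)
  have h3 : ∀ i, Sm (fun y => (zPart y + s (y 3) *ᵥ Yv H s y) i) x :=
    fun i => (sm_zPart i).add (h2 i)
  rw [dv_congr h1, dv_const_mulVec _ h3,
    dv_add sm_zPart h2, dv_zPart, dv_mulVec (h.smm_s x) (h.sm_Y hx), dm_comp (h.deriv _)]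

/-- A cancellation as for Legendre transforms: by the implicit equations `z · dy` and `z̄ · dȳ` are
rewritten through `ȳ` and `y`, and the terms with `s dy` and `s̄ dȳ` cancel because `s` is
symmetric. No derivative of `y` survives. -/
theorem dd_Q (h : IsModel H s s' s'' δ) (hx : ‖x 3‖ < δ) (V : C4 × C4) :
    dd (fun y => zPart y ⬝ᵥ Yv H s y + star (zPart y) ⬝ᵥ star (Yv H s y)) x V =
      2 * (zPart V.1 ⬝ᵥ Yv H s x) + 2 * (zPart V.2 ⬝ᵥ star (Yv H s x)) +
      V.1 3 * (Yv H s x ⬝ᵥ s' (x 3) *ᵥ Yv H s x) +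
      V.2 3 * (star (Yv H s x) ⬝ᵥ cbar (s' (x 3)) *ᵥ star (Yv H s x)) := by
  rw [dd_add (sm_dotProduct sm_zPart (h.sm_Y hx)) (sm_dotProduct sm_star_zPart (h.sm_star_Y hx)),
    dd_dotProduct sm_zPart (h.sm_Y hx), dd_dotProduct sm_star_zPart (h.sm_star_Y hx), dv_zPart,
    dv_star_zPart]
  have e1 := h.dv_Y hx V
  have e2 := h.dv_star_Y hx V
  have e3 := h.Y_eq hx
  have e4 := h.star_Y_eq hx
  have hs := (h.reg _ hx).symm
  have hs' : (cbar (s (x 3)))ᵀ = cbar (s (x 3)) := by rw [← cbar_transpose, hs]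
  set Y := Yv H s x
  set D := dv (Yv H s) x V
  set D' := dv (fun y => star (Yv H s y)) x V
  set z := zPart x
  set a := zPart V.2 + ((V.2 3 • cbar (s' (x 3))) *ᵥ star Y + cbar (s (x 3)) *ᵥ D') with ha
  set b := zPart V.1 + ((V.1 3 • s' (x 3)) *ᵥ Y + s (x 3) *ᵥ D) with hb
  have f1 : z ⬝ᵥ D = star Y ⬝ᵥ a - Y ⬝ᵥ s (x 3) *ᵥ D := by
    have : Hᵀ *ᵥ z = star Y - Hᵀ *ᵥ (s (x 3) *ᵥ Y) := by
      rw [e4, Matrix.mulVec_add, add_sub_cancel_right]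
    conv_lhs => rw [e1, dotProduct_mulVec_comm, this, sub_dotProduct,
      ← dotProduct_mulVec_comm, ← e1]
    rw [dotProduct_mulVec_comm, hs]
  have f2 : star z ⬝ᵥ D' = Y ⬝ᵥ b - star Y ⬝ᵥ cbar (s (x 3)) *ᵥ D' := by
    have : (Hᵀ)ᵀ *ᵥ star z = Y - (Hᵀ)ᵀ *ᵥ (cbar (s (x 3)) *ᵥ star Y) := by
      rw [Matrix.mulVec_add] at e3
      rw [Matrix.transpose_transpose]
      exact eq_sub_of_add_eq e3.symm
    conv_lhs => rw [e2, dotProduct_mulVec_comm, this, sub_dotProduct,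
      ← dotProduct_mulVec_comm, ← e2]
    rw [dotProduct_mulVec_comm, hs']
  rw [f1, f2, ha, hb]
  simp only [dotProduct_add, Matrix.smul_mulVec, dotProduct_smul, smul_eq_mul]
  rw [dotProduct_comm Y (zPart V.1), dotProduct_comm (star Y) (zPart V.2)]
  ring

theorem ρc_eq (h : IsModel H s s' s'' δ) (hx : ‖x 3‖ < δ) :
    (model H s δ).ρc x = (1 / 2) * ((x 0 + conj (x 0)) -
      (zPart x ⬝ᵥ Yv H s x + star (zPart x) ⬝ᵥ star (Yv H s x))) := by
  have e : star (zPart x) ⬝ᵥ star (Yv H s x) = conj (zPart x ⬝ᵥ Yv H s x) := by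
    simp [dotProduct, Fin.sum_univ_two]
  rw [Hypersurface.ρc, h.ρ_eq hx, Complex.re_eq_add_conj, e, map_sub]
  ring

theorem dr_eq (h : IsModel H s s' s'' δ) (hx : ‖x 3‖ < δ) (v : C4) :
    (model H s δ).dr x v =
      (1 / 2) * (v 0 - 2 * (zPart v ⬝ᵥ Yv H s x) - v 3 * (Yv H s x ⬝ᵥ s' (x 3) *ᵥ Yv H s x)) := by
  have h1 : (model H s δ).ρc =ᶠ[𝓝 x] fun y => (1 / 2) * ((y 0 + conj (y 0)) -
      (zPart y ⬝ᵥ Yv H s y + star (zPart y) ⬝ᵥ star (Yv H s y))) := by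
    filter_upwards [(isOpen_dom H s δ).mem_nhds hx] with y hy using h.ρc_eq hy
  have c0 : Sm (fun y : C4 => y 0) x := (analyticAt_coord 0 x).contDiffAt
  have hQ := (sm_dotProduct sm_zPart (h.sm_Y hx)).add
    (sm_dotProduct sm_star_zPart (h.sm_star_Y hx))
  rw [dr, dd_congr h1, dd_const_mul _ ((c0.add c0.conj).sub hQ), dd_sub (c0.add c0.conj) hQ,
    h.dd_Q hx, dd_add c0 c0.conj, AdaptedFrame.dd_coord, dd_conj_coord, zPart_zero]
  simp
  ring

theorem dr_bv_zero (h : IsModel H s s' s'' δ) (hx : ‖x 3‖ < δ) :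
    (model H s δ).dr x (bv 0) = 1 / 2 := by
  rw [h.dr_eq hx]
  simp [zPart, bv]

theorem dr_bv_zero_ne (h : IsModel H s s' s'' δ) (hx : ‖x 3‖ < δ) :
    (model H s δ).dr x (bv 0) ≠ 0 := by
  rw [h.dr_bv_zero hx]; norm_num

theorem isRealAnalytic (h : IsModel H s s' s'' δ) : (model H s δ).IsRealAnalytic where
  isOpen_dom := isOpen_dom H s δ
  analytic := h.analyticOnNhd
  regular x hx h0 := by
    apply h.dr_bv_zero_ne hx.1
    have hd : DifferentiableAt ℝ (model H s δ).ρ x := (h.analyticOnNhd x hx.1).differentiableAt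
    have h1 : ∀ v, fderiv ℝ (model H s δ).ρc x v = 0 := fun v => by
      have := fderiv_ofReal_comp hd v
      rw [h0] at this
      exact this.trans (by simp)
    simp [dr, dd_def, h1]

theorem R_eq (h : IsModel H s s' s'' δ) (hx : ‖x 3‖ < δ) (v : C4) :
    (model H s δ).R 0 v x =
      v 0 - 2 * (zPart v ⬝ᵥ Yv H s x) - v 3 * (Yv H s x ⬝ᵥ s' (x 3) *ᵥ Yv H s x) := by
  rw [R, h.dr_bv_zero hx, h.dr_eq hx]
  ring

theorem ext_apply (v : C4) {i : Fin 4} (hi : i ≠ 0) : (model H s δ).ext 0 v x i = v i := by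
  simp [Hypersurface.ext, bv, hi]

theorem zPart_ext (v : C4) : zPart ((model H s δ).ext 0 v x) = zPart v := by
  ext i; fin_cases i <;> exact ext_apply v (by decide)

theorem dv_Y_bar (h : IsModel H s s' s'' δ) (hx : ‖x 3‖ < δ) (w : C4) :
    dv (Yv H s) x (0, star w) =
      modelH H (s (x 3)) *ᵥ star (zPart w + w 3 • (s' (x 3) *ᵥ Yv H s x)) := by
  refine (h.reg _ hx).eq_modelH_mul ?_
  have e1 := h.dv_Y hx (0, star w)
  rw [h.dv_star_Y hx] at e1
  simp only [zPart_zero, Pi.zero_apply, zero_smul, Matrix.zero_mulVec, zero_add] at e1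
  rw [Matrix.sub_mulVec, Matrix.one_mulVec, sub_eq_iff_eq_add]
  conv_lhs => rw [e1]
  rw [zPart_star, star_add, star_smul, star_mulVec, Matrix.smul_mulVec]
  simp only [Matrix.mulVec_add, Matrix.mulVec_mulVec, Matrix.mul_assoc, ← add_assoc]
  rfl

/-- In `(1,0)` directions `dy` is `H s̄ dȳ`, which vanishes where `s` does. This makes `Ω` zero at
such points. -/
theorem dv_Y_fst (h : IsModel H s s' s'' δ) (hx : ‖x 3‖ < δ) (h0 : s (x 3) = 0) (v : C4) :
    dv (Yv H s) x (v, 0) = 0 := by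
  rw [h.dv_Y hx, h0, cbar_zero, zPart_zero]
  simp

/-- The Levi form of the model. -/
theorem B_eq (h : IsModel H s s' s'' δ) (hx : ‖x 3‖ < δ) (v w : C4) :
    (model H s δ).B 0 v w x = -2 * ((zPart v + v 3 • (s' (x 3) *ᵥ Yv H s x)) ⬝ᵥ
      modelH H (s (x 3)) *ᵥ star (zPart w + w 3 • (s' (x 3) *ᵥ Yv H s x))) := by
  have h1 : (model H s δ).R 0 v =ᶠ[𝓝 x] fun y => v 0 - 2 * (zPart v ⬝ᵥ Yv H s y) -
      v 3 * (Yv H s y ⬝ᵥ s' (y 3) *ᵥ Yv H s y) := by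
    filter_upwards [(isOpen_dom H s δ).mem_nhds hx] with y hy using h.R_eq hy v
  have c1 : Sm (fun y => zPart v ⬝ᵥ Yv H s y) x :=
    sm_dotProduct (u := fun _ => zPart v) (fun _ => contDiffAt_const) (h.sm_Y hx)
  have c2 := sm_mulVec (h.smm_s' x) (h.sm_Y hx)
  have c3 := sm_dotProduct (h.sm_Y hx) c2
  have c4 : dv (fun _ => zPart v) x (0, star ((model H s δ).ext 0 w x)) = 0 :=
    funext fun i => dd_const _ _ _
  rw [B, Gd, dd_congr h1, dd_sub (contDiffAt_const.sub (contDiffAt_const.mul c1))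
    (contDiffAt_const.mul c3), dd_sub contDiffAt_const (contDiffAt_const.mul c1), dd_const,
    dd_const_mul _ c1, dd_const_mul _ c3,
    dd_dotProduct (u := fun _ => zPart v) (fun _ => contDiffAt_const) (h.sm_Y hx),
    dd_dotProduct (h.sm_Y hx) c2, dv_mulVec (h.smm_s' x) (h.sm_Y hx), dm_comp (h.deriv' _), c4,
    h.dv_Y_bar hx, zPart_ext, ext_apply w (by decide)]
  set D := modelH H (s (x 3)) *ᵥ star (zPart w + w 3 • (s' (x 3) *ᵥ Yv H s x))
  have e1 : Yv H s x ⬝ᵥ s' (x 3) *ᵥ D = (s' (x 3) *ᵥ Yv H s x) ⬝ᵥ D := by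
    rw [dotProduct_mulVec_comm, h.symm]
  simp only [Pi.zero_apply, zero_smul, Matrix.zero_mulVec, zero_add, e1, add_dotProduct,
    smul_dotProduct, smul_eq_mul, zero_dotProduct, dotProduct_comm D]
  ring

/-- The Levi kernel in the coordinates `z₁, z₂, ζ`. -/
def kernelCoeff (H : Mat2) (s s' : ℂ → Mat2) (a : Fin 3) (y : C4) : ℂ :=
  ![-(s' (y 3) *ᵥ Yv H s y) 0, -(s' (y 3) *ᵥ Yv H s y) 1, 1] a

/-- The chart of the model. -/
def chart (h : IsModel H s s' s'' δ) {p : C4} (hp : ‖p 3‖ < δ) : KernelChart (model H s δ) p where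
  j := 0
  τ := Fin.succ
  τ_ne := Fin.succ_ne_zero
  τ_inj := Fin.succ_injective 3
  τ_surj i hi := Fin.exists_succ_eq.2 hi
  W := (model H s δ).dom
  isOpen_W := isOpen_dom H s δ
  W_subset := subset_rfl
  p_mem := hp
  dr_ne x hx := h.dr_bv_zero_ne hx
  c := kernelCoeff H s s'
  sm_c a x hx := by
    have c2 := sm_mulVec (h.smm_s' x) (h.sm_Y hx)
    fin_cases a
    · exact (c2 0).neg
    · exact (c2 1).neg
    · exact contDiffAt_const
  c_two x := rfl
  -- The Levi form depends on its first argument through `v + v₃ s' y` only, and the coefficients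
  -- `-s' y, 1` make this zero.
  ker x hx hxM b := by
    simp only [h.B_eq hx, Fin.sum_univ_three]
    set K := modelH H (s (x 3)) *ᵥ _
    set Y := s' (x 3) *ᵥ Yv H s x with hY
    simp [kernelCoeff, ← hY, zPart, bv, dotProduct, Fin.sum_univ_two]
    ring
  det_ne x hx hxM := by
    have hd := (h.reg _ hx).unit_modelH.ne_zero
    rw [Matrix.det_fin_two] at hd
    simp only [h.B_eq hx]
    simp [zPart, bv, dotProduct, Fin.sum_univ_two, Matrix.mulVec]
    intro h0
    apply hd
    linear_combination (1 / 4) * h0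

end IsModel

/-! ### Uniform 2-nondegeneracy and the invariants of a model -/

theorem zPart_bv (k : Fin 2) : zPart (bv k.castSucc.succ) = Pi.single k 1 := by
  ext i; fin_cases k <;> fin_cases i <;> simp [zPart, bv]

theorem bv_three (k : Fin 2) : bv k.castSucc.succ 3 = 0 := by
  fin_cases k <;> simp [bv]

namespace IsModel

variable {H : Mat2} {s s' s'' : ℂ → Mat2} {δ : ℝ} {p x : C4}

theorem chart_c (h : IsModel H s s' s'' δ) (hp : ‖p 3‖ < δ) (l : Fin 2) :
    (h.chart hp).c l.castSucc = fun y => -(s' (y 3) *ᵥ Yv H s y) l := by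
  fin_cases l <;> rfl

theorem dd_chart_c (h : IsModel H s s' s'' δ) (hp : ‖p 3‖ < δ) (hx : ‖x 3‖ < δ) (l : Fin 2)
    (V : C4 × C4) : dd ((h.chart hp).c l.castSucc) x V =
      -((V.1 3 • s'' (x 3)) *ᵥ Yv H s x + s' (x 3) *ᵥ dv (Yv H s) x V) l := by
  rw [h.chart_c hp, dd_neg, ← dm_comp (h.deriv' _), ← dv_mulVec (h.smm_s' x) (h.sm_Y hx)]
  rfl

theorem Db_c (h : IsModel H s s' s'' δ) (hp : ‖p 3‖ < δ) (hx : ‖x 3‖ < δ) (k l : Fin 2) :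
    (h.chart hp).Db k.castSucc ((h.chart hp).c l.castSucc) x =
      -(s' (x 3) * modelH H (s (x 3))) l k := by
  have e := h.dd_chart_c hp hx l (0, star ((model H s δ).ext 0 (bv k.castSucc.succ) x))
  refine e.trans ?_
  rw [h.dv_Y_bar hx, zPart_ext, ext_apply _ (by decide), zPart_bv, bv_three]
  have e1 : star (Pi.single k 1 : Fin 2 → ℂ) = Pi.single k 1 := by
    ext i; fin_cases k <;> fin_cases i <;> simp
  change -(((0 : ℂ) • s'' (x 3)) *ᵥ _ + _) l = _
  rw [zero_smul, zero_smul, add_zero, e1, Matrix.zero_mulVec, zero_add,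
    Matrix.mulVec_mulVec, Matrix.mulVec_single_one]
  rfl

theorem D_c (h : IsModel H s s' s'' δ) (hp : ‖p 3‖ < δ) (hx : ‖x 3‖ < δ) (h0 : s (x 3) = 0)
    (k l : Fin 2) : (h.chart hp).D k.castSucc ((h.chart hp).c l.castSucc) x = 0 := by
  have e := h.dd_chart_c hp hx l ((model H s δ).ext 0 (bv k.castSucc.succ) x, 0)
  refine e.trans ?_
  have e1 : (model H s δ).ext 0 (bv k.castSucc.succ) x 3 = 0 := by
    rw [ext_apply _ (by decide), bv_three]
  rw [h.dv_Y_fst hx h0]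
  simp [e1]

theorem B_chart (h : IsModel H s s' s'' δ) (hp : ‖p 3‖ < δ) (hx : ‖x 3‖ < δ) (k l : Fin 2) :
    (h.chart hp).Bm k.castSucc l.castSucc x = -2 * modelH H (s (x 3)) k l := by
  refine (h.B_eq hx _ _).trans ?_
  change -2 * ((zPart (bv k.castSucc.succ) + bv k.castSucc.succ 3 • _) ⬝ᵥ _ *ᵥ
    star (zPart (bv l.castSucc.succ) + bv l.castSucc.succ 3 • _)) = _
  rw [zPart_bv, zPart_bv, bv_three, bv_three]
  have e1 : star (Pi.single l 1 : Fin 2 → ℂ) = Pi.single l 1 := by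
    ext i; fin_cases l <;> fin_cases i <;> simp
  simp [e1]

theorem exists_ne (h : IsModel H s s' s'' δ) (hx : ‖x 3‖ < δ) :
    ∃ l k, (s' (x 3) * modelH H (s (x 3))) l k ≠ 0 := by
  refine exists_entry_ne fun h0 => h.ne (x 3) ?_
  rw [← Matrix.mul_nonsing_inv_cancel_right _ (s' (x 3)) (h.reg _ hx).unit_modelH, h0,
    Matrix.zero_mul]

/-- On `M` the section is a function times the kernel field of the chart. Its brackets with `F̄_k`
have, modulo `𝒦 ⊕ ℋ̄`, that function times the entries of `s' H(ζ, ζ̄)` as coefficients up to sign;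
one entry is nonzero, so otherwise the function would vanish at `x`. -/
theorem twoNondegenerateAt (h : IsModel H s s' s'' δ) (hx : x ∈ (model H s δ).carrier) :
    (model H s δ).TwoNondegenerateAt x := by
  have hA := h.isRealAnalytic
  intro W X hW hWd hxW hX hXK hX0
  obtain ⟨l, k, hlk⟩ := h.exists_ne hx.1
  set κ := h.chart hx.1 with hκ
  have hsec : (model H s δ).IsSection W (κ.F k.castSucc) :=
    ⟨fun y hy => (κ.smF hA (hWd hy) _).contDiffWithinAt, fun y hy _ => κ.F_mem (hWd hy) _⟩
  refine ⟨κ.F k.castSucc, hsec, fun hmem => ?_⟩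
  have hXs := (hX.secAt hW hxW).sm
  have hc : Sm (fun y => X y (κ.τ 2)) x := hXs.comp_apply _
  have heq : ∀ᶠ y in 𝓝 x, y ∈ (model H s δ).carrier → X y = X y (κ.τ 2) • κ.e y := by
    filter_upwards [hW.mem_nhds hxW] with y h1 h2
    exact κ.KFib_eq hA (hWd h1) h2 (hXK y h1 h2)
  have h1 := dd_congr_tan' hA hx hXs (hc.smul (κ.sme hA κ.p_mem)) heq
    (tan_snd (κ.F_mem κ.p_mem k.castSucc))
  have h3 : dd (fun y => X y (κ.τ 2) • κ.e y) x (0, star (κ.F k.castSucc x)) =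
      X x (κ.τ 2) • dd κ.e x (0, star (κ.F k.castSucc x))
        + dd (fun y => X y (κ.τ 2)) x (0, star (κ.F k.castSucc x)) • κ.e x :=
    dd_smul hc (κ.sme hA κ.p_mem) _
  have hm := hmem.1
  rw [lieBr_hol_antihol] at hm
  have h4 := κ.KFib_eq hA κ.p_mem hx hm
  change - dd X x (0, star (κ.F k.castSucc x)) = _ • _ at h4
  have h5 : dd X x (0, star (κ.F k.castSucc x)) = X x (κ.τ 2) • ∑ a, κ.Db k.castSucc (κ.c a) x • κ.F a x
      + dd (fun y => X y (κ.τ 2)) x (0, star (κ.F k.castSucc x)) • κ.e x := by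
    rw [← κ.dd_e_F_bar hA κ.p_mem hx]
    exact h1.trans h3
  set μ := dd (fun y => X y (κ.τ 2)) x (0, star (κ.F k.castSucc x))
  have hv : ∀ a, dd X x (0, star (κ.F k.castSucc x)) (κ.τ a) =
      X x (κ.τ 2) * κ.Db k.castSucc (κ.c a) x + μ * κ.c a x := fun a => by
    rw [h5]
    simp [Finset.sum_apply, Chart.F_apply, KernelChart.e_apply]
  have h6 := congrFun h4 (κ.τ l.castSucc)
  rw [Pi.neg_apply, hv, Pi.smul_apply, κ.e_apply] at h6
  change _ = (- dd X x (0, star (κ.F k.castSucc x))) (κ.τ 2) * _ at h6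
  rw [Pi.neg_apply, hv, κ.Db_c_two, κ.c_two, h.Db_c hx.1 hx.1] at h6
  have h7 : X x (κ.τ 2) * (s' (x 3) * modelH H (s (x 3))) l k = 0 := by linear_combination h6
  have h8 := (mul_eq_zero.1 h7).resolve_right hlk
  apply hX0
  rw [heq.self_of_nhds hx, h8, zero_smul]

theorem isUniformly2Nondegenerate (h : IsModel H s s' s'' δ) :
    (model H s δ).IsUniformly2Nondegenerate where
  analytic := h.isRealAnalytic
  leviRank _ hx := (h.chart hx.1).leviRankTwo h.isRealAnalytic (h.chart hx.1).p_mem hx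
  nondeg _ hx := h.twoNondegenerateAt hx

/-- In the frame of the chart `H = H(ζ, ζ̄)` and `S^{0,2} = s'(ζ)` along `M`, as `∂ρ(∂/∂w) = 1/2`.
The kernel field has `ζ`-component 1, so its derivative of `S^{0,2}` is `s''`. -/
theorem exists_frame (h : IsModel H s s' s'' δ) (hp : p ∈ (model H s δ).carrier)
    (h0 : s (p 3) = 0) : ∃ φ : AdaptedFrame (model H s δ) p, φ.H p = H ∧ φ.S02 p = s' (p 3) ∧
      φ.Ω p = 0 ∧ φ.dS = s'' (p 3) := by
  have hM := h.isUniformly2Nondegenerate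
  have hA := hM.analytic
  obtain ⟨φ, hφ⟩ := (h.chart hp.1).exists_isFrame hM hp
  have hH : ∀ x ∈ φ.W, x ∈ (model H s δ).carrier → φ.H x = modelH H (s (x 3)) := by
    intro x hx hxM
    ext a b
    rw [hφ.H_eq hA hx hxM, h.B_chart hp.1 hxM.1]
    change -((model H s δ).dr x (bv 0) * _) = _
    rw [h.dr_bv_zero hxM.1]
    ring
  have hS : ∀ x ∈ φ.W, x ∈ (model H s δ).carrier → φ.S02 x = s' (x 3) := by
    intro x hx hxM
    have e : φ.Ξ x = s' (x 3) * modelH H (s (x 3)) := by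
      ext l k
      rw [hφ.Ξ_eq hM hx hxM, h.Db_c hp.1 hxM.1, neg_neg]
    rw [AdaptedFrame.S02, e, hH x hx hxM,
      Matrix.mul_nonsing_inv_cancel_right _ _ (h.reg _ hxM.1).unit_modelH]
  refine ⟨φ, ?_, hS p φ.p_mem hp, ?_, ?_⟩
  · rw [hH p φ.p_mem hp, (h.reg _ hp.1).modelH_eq, h0]
    simp
  · ext l k
    rw [hφ.Ω_eq hM φ.p_mem hp, h.D_c hp.1 hp.1 h0]
    simp
  · have he : φ.e p ∈ (model H s δ).HFib p := φ.e_mem φ.p_mem hp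
    have e1 : dm φ.S02 p (φ.e p, 0) = dm (fun y => s' (y 3)) p (φ.e p, 0) := by
      refine dm_congr_tan hA hp (φ.smmS hM φ.p_mem hp) (h.smm_s' p) ?_ (tan_fst he)
      filter_upwards [φ.isOpen_W.mem_nhds φ.p_mem] with y h1 h2 using hS y h1 h2
    have e2 : φ.e p 3 = 1 := by
      rw [hφ.e]
      exact (h.chart hp.1).e_apply 2 p
    rw [AdaptedFrame.dS, applyMat_eq]
    refine e1.trans ?_
    rw [dm_comp (h.deriv' _)]
    change φ.e p 3 • _ = _
    rw [e2, one_smul]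

end IsModel

/-! ### The distinguished models -/

theorem exists_regular_radius {H : Mat2} {s s' : ℂ → Mat2} (hs : ∀ ζ, HasMatDeriv s (s' ζ) ζ)
    (h0 : s 0 = 0) : ∃ δ₀ : ℝ, 0 < δ₀ ∧ ∀ ζ, ‖ζ‖ < δ₀ →
      IsUnit (1 - cbar (s ζ) * Hᵀ * s ζ * H).det := by
  have hc : Continuous s := continuous_pi fun i => continuous_pi fun j =>
    Differentiable.continuous fun ζ => (hs ζ i j).differentiableAt
  have hcb : Continuous fun ζ => cbar (s ζ) := hc.matrix_map Complex.continuous_conj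
  have hd : Continuous fun ζ => (1 - cbar (s ζ) * Hᵀ * s ζ * H).det := by
    refine Continuous.matrix_det (continuous_const.sub ?_)
    exact ((hcb.matrix_mul continuous_const).matrix_mul hc).matrix_mul continuous_const
  have h1 : ∀ᶠ ζ in 𝓝 (0 : ℂ), (1 - cbar (s ζ) * Hᵀ * s ζ * H).det ≠ 0 := by
    refine hd.continuousAt.eventually_ne ?_
    simp [h0]
  obtain ⟨δ₀, hδ, h2⟩ := Metric.eventually_nhds_iff.1 h1
  exact ⟨δ₀, hδ, fun ζ hζ => isUnit_iff_ne_zero.2 (h2 (by simpa using hζ))⟩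

namespace Entry

variable {t : Entry} {δ : ℝ}

theorem exists_isModel (ht : t.Valid) : ∃ δ₀ : ℝ, 0 < δ₀ ∧ ∀ δ, δ ≤ δ₀ →
    IsModel t.row.H (distinguishedS t.row.H t.row.S t.Ω) (derivS t.row.S t.Ω)
      (fun ζ => t.Ω * derivS t.row.S t.Ω ζ + derivS t.row.S t.Ω ζ * t.Ωᵀ) δ := by
  have hp := Row.isPair ht.1
  obtain ⟨δ₀, hδ, h⟩ := exists_regular_radius (H := t.row.H)
    (hasMatDeriv_distinguishedS (S := t.row.S) (Ω := t.Ω) hp.unit) distinguishedS_zero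
  exact ⟨δ₀, hδ, fun δ hδ' => ⟨fun ζ hζ => ⟨hp.herm, hp.unit,
    distinguishedS_transpose hp.unit t.row.S_symm ζ, h ζ (hζ.trans_le hδ')⟩,
    hasMatDeriv_distinguishedS hp.unit, hasMatDeriv_derivS, derivS_transpose t.row.S_symm,
    derivS_ne_zero hp.ne⟩⟩

theorem zero_mem_model (t : Entry) (hδ : 0 < δ) : (0 : C4) ∈ (t.model δ).carrier := by
  refine ⟨by simpa [model, CRSymbol.model] using hδ, ?_⟩
  simp [model, CRSymbol.model, modelRHS, zPart_zero]

/-- The frame of the chart has `Ω = 0` and `e(S) = Ω S + S Ωᵀ` with the `Ω` of the entry. A change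
with `U(0) = 1` and `e(U)(0) = Ω` trades one for the other: the new frame has the required `Ω`, and
`e(S)` becomes a multiple of `S`. -/
theorem hasModSymbol_model (ht : t.Valid) (hδ : 0 < δ)
    (h : IsModel t.row.H (distinguishedS t.row.H t.row.S t.Ω) (derivS t.row.S t.Ω)
      (fun ζ => t.Ω * derivS t.row.S t.Ω ζ + derivS t.row.S t.Ω ζ * t.Ωᵀ) δ) :
    HasModSymbol (t.model δ) 0 t := by
  have hM : (t.model δ).IsUniformly2Nondegenerate := h.isUniformly2Nondegenerate
  have h0 := t.zero_mem_model hδ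
  obtain ⟨φ, hH, hS, hΩ, hdS⟩ := h.exists_frame h0 distinguishedS_zero
  change φ.S02 0 = derivS t.row.S t.Ω 0 at hS
  rw [derivS_zero] at hS
  have hrel : Rel t.row.H t.row.S (φ.H 0) (φ.S02 0) 1 1 1 := by
    rw [hH, hS]; exact Rel.refl _ _
  obtain ⟨ψ, hH', hS', hl, -⟩ := φ.exists_link_of_rel hM h0 hrel t.Ω
  have hψ : ψ.Ω 0 = t.Ω := by
    have := hl.Ω_eq
    simpa [hΩ] using this
  refine ⟨ψ, (AdaptedFrame.isNormalizedFor_iff ht.1 hM h0).2 ⟨hH', hS', ⟨t.τ, ?_⟩, 0,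
    t.row.zero_mem_N02, ?_⟩, hψ⟩
  · rw [hψ, Entry.Ω_eq, sub_self]
    have := (g00'Sub t.row.H t.row.S).zero_mem
    rwa [mem_g00'Sub, Row.g00'_eq ht.1] at this
  · obtain ⟨k, hk⟩ := hl.dS_eq
    refine ⟨k, ?_⟩
    have e : φ.dS = t.Ω * t.row.S + t.row.S * t.Ωᵀ := by
      rw [hdS]
      change t.Ω * derivS t.row.S t.Ω 0 + derivS t.row.S t.Ω 0 * t.Ωᵀ = _
      rw [derivS_zero]
    rw [e, hS] at hk
    simp only [sub_self, smul_zero, add_zero, Matrix.one_mul, Matrix.transpose_one,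
      Matrix.mul_one] at hk
    exact hk.trans (zero_add _).symm

end Entry

/-! ### Symmetries of the distinguished models -/

/-- The factor `c` with `U S Uᵀ = c S`. -/
def scaleFactor (S U : Mat2) : ℂ :=
  open Classical in if h : ∃ c : ℂ, U * S * Uᵀ = c • S then h.choose else 1

theorem scaleFactor_eq {S U : Mat2} (hS : S ≠ 0) {c : ℂ} (h : U * S * Uᵀ = c • S) :
    scaleFactor S U = c := by
  have h1 : ∃ c : ℂ, U * S * Uᵀ = c • S := ⟨c, h⟩
  rw [scaleFactor, dif_pos h1]
  exact smul_left_injective ℂ hS (h1.choose_spec.symm.trans h)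

theorem zPart_coordChange (k : ℂˣ × GL (Fin 2) ℂ) (h : ℂ → ℂ) (x : C4) :
    zPart (coordChange k h x) = (k.1 : ℂ)⁻¹ • ((k.2 : Mat2) *ᵥ zPart x) := by
  ext i; fin_cases i <;> rfl

section

variable {H : Mat2} {s s' s'' : ℂ → Mat2} {δ : ℝ} {x : C4} {k : ℂˣ × GL (Fin 2) ℂ} {μ : ℝ} {c : ℂ}

/-- The right hand side solves the implicit equation at the image point, where the solution is
unique. The factor `μ` from `H` is balanced by `ū = μ u`. -/
theorem IsModel.Y_coordChange (h : IsModel H s s' s'' δ) (hx : ‖x 3‖ < δ) (hcx : ‖c * x 3‖ < δ)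
    (hU : (k.2 : Mat2)ᵀ * H * cbar (k.2 : Mat2) = (μ : ℂ) • H)
    (hu : conj (k.1 : ℂ) = μ * (k.1 : ℂ))
    (hs : s (c * x 3) = (k.2 : Mat2) * s (x 3) * (k.2 : Mat2)ᵀ) :
    Yv H s (coordChange k (fun ζ => c * ζ) x) =
      (k.1 : ℂ)⁻¹ • (((k.2 : Mat2)ᵀ)⁻¹ *ᵥ Yv H s x) := by
  obtain ⟨u, U⟩ := k
  simp only at hU hu hs ⊢
  have hu0 : (u : ℂ) ≠ 0 := u.ne_zero
  have hμ : (μ : ℂ) ≠ 0 := fun h0 => by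
    rw [h0, zero_mul, map_eq_zero] at hu
    exact hu0 hu
  have hUt : IsUnit ((U : Mat2)ᵀ).det := by
    rw [Matrix.det_transpose]; exact (Matrix.isUnit_iff_isUnit_det _).1 U.isUnit
  have e1 : H * cbar (U : Mat2) = (μ : ℂ) • (((U : Mat2)ᵀ)⁻¹ * H) := by
    rw [← Matrix.mul_smul, ← hU, Matrix.mul_assoc, Matrix.nonsing_inv_mul_cancel_left _ _ hUt]
  have e2 : cbar (s (c * x 3)) * cbar ((U : Mat2)ᵀ)⁻¹ = cbar (U : Mat2) * cbar (s (x 3)) := by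
    rw [← cbar_mul, hs, Matrix.mul_nonsing_inv_cancel_right _ _ hUt, cbar_mul]
  have e3 : conj ((u : ℂ)⁻¹) * μ = (u : ℂ)⁻¹ := by
    rw [map_inv₀, hu]; field_simp
  refine ((h.reg (c * x 3) hcx).eq_modelY ?_).symm
  rw [zPart_coordChange]
  change _ = H *ᵥ (star ((u : ℂ)⁻¹ • ((U : Mat2) *ᵥ zPart x)) + _)
  rw [star_smul, star_smul, star_mulVec, star_mulVec, Matrix.mulVec_smul, ← smul_add,
    Matrix.mulVec_smul, Matrix.mulVec_mulVec, e2, ← Matrix.mulVec_mulVec, ← Matrix.mulVec_add,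
    Matrix.mulVec_mulVec, e1, Matrix.smul_mulVec, smul_smul, ← Matrix.mulVec_mulVec, ← h.Y_eq hx]
  congr 1
  exact e3.symm

/-- `zᵀ y` acquires the factor `u⁻²`, just as `w` does. This factor is real because `μ² = 1`, so `ρ`
is multiplied by a nonzero real number. -/
theorem IsModel.mem_carrier_iff (h : IsModel H s s' s'' δ) (hx : ‖x 3‖ < δ) (hcx : ‖c * x 3‖ < δ)
    (hU : (k.2 : Mat2)ᵀ * H * cbar (k.2 : Mat2) = (μ : ℂ) • H)
    (hu : conj (k.1 : ℂ) = μ * (k.1 : ℂ))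
    (hs : s (c * x 3) = (k.2 : Mat2) * s (x 3) * (k.2 : Mat2)ᵀ) :
    x ∈ (model H s δ).carrier ↔ coordChange k (fun ζ => c * ζ) x ∈ (model H s δ).carrier := by
  have hY := h.Y_coordChange hx hcx hU hu hs
  have hUt : IsUnit ((k.2 : Mat2)ᵀ).det := by
    rw [Matrix.det_transpose]; exact (Matrix.isUnit_iff_isUnit_det _).1 k.2.isUnit
  have hu0 : (k.1 : ℂ) ≠ 0 := k.1.ne_zero
  have e1 : zPart (coordChange k (fun ζ => c * ζ) x) ⬝ᵥ Yv H s (coordChange k (fun ζ => c * ζ) x) =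
      ((k.1 : ℂ) ^ 2)⁻¹ * (zPart x ⬝ᵥ Yv H s x) := by
    rw [hY, zPart_coordChange, smul_dotProduct, dotProduct_smul, dotProduct_comm,
      dotProduct_mulVec_comm, Matrix.mulVec_mulVec, Matrix.mul_nonsing_inv _ hUt, Matrix.one_mulVec,
      dotProduct_comm, smul_eq_mul, smul_eq_mul]
    ring
  have hr : (((k.1 : ℂ) ^ 2)⁻¹).im = 0 := by
    rw [← Complex.conj_eq_iff_im, map_inv₀, map_pow]
    have h1 : (μ : ℂ) ^ 2 = 1 := by
      have h2 := congrArg (starRingEnd ℂ) hu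
      rw [Complex.conj_conj, map_mul, Complex.conj_ofReal, hu] at h2
      refine mul_right_cancel₀ hu0 ?_
      linear_combination -h2
    rw [hu, mul_pow, h1, one_mul]
  have e2 : (model H s δ).ρ (coordChange k (fun ζ => c * ζ) x) =
      (((k.1 : ℂ) ^ 2)⁻¹).re * (model H s δ).ρ x := by
    rw [h.ρ_eq hx, h.ρ_eq (x := coordChange k (fun ζ => c * ζ) x) hcx, e1]
    change (((k.1 : ℂ) ^ 2)⁻¹ * x 0 - _).re = _
    rw [← mul_sub, Complex.mul_re, hr, zero_mul, sub_zero]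
  have hne : (((k.1 : ℂ) ^ 2)⁻¹).re ≠ 0 := fun h0 =>
    inv_ne_zero (pow_ne_zero 2 hu0) (Complex.ext h0 hr)
  change ‖x 3‖ < δ ∧ _ ↔ ‖c * x 3‖ < δ ∧ _
  rw [e2, mul_eq_zero, or_iff_right hne]
  exact and_congr_left fun _ => ⟨fun _ => hcx, fun _ => hx⟩

end

namespace Entry

variable {t : Entry} {δ : ℝ}

theorem exists_symmetries (ht : t.Valid) (hδ : 0 < δ)
    (h : IsModel t.row.H (distinguishedS t.row.H t.row.S t.Ω) (derivS t.row.S t.Ω)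
      (fun ζ => t.Ω * derivS t.row.S t.Ω ζ + derivS t.row.S t.Ω ζ * t.Ωᵀ) δ) :
    ∃ h : ℂˣ × GL (Fin 2) ℂ → ℂ → ℂ,
      (∀ k ∈ stabilizer t.row.H t.row.S t.Ω,
        AnalyticAt ℂ (h k) 0 ∧ h k 0 = 0 ∧ deriv (h k) 0 ≠ 0 ∧
        ∀ᶠ x in 𝓝 (0 : C4), x ∈ (t.model δ).carrier ↔ coordChange k (h k) x ∈ (t.model δ).carrier) ∧
      (∀ᶠ ζ in 𝓝 (0 : ℂ), h 1 ζ = ζ) ∧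
      ∀ k ∈ stabilizer t.row.H t.row.S t.Ω, ∀ k' ∈ stabilizer t.row.H t.row.S t.Ω,
        ∀ᶠ ζ in 𝓝 (0 : ℂ), h (k * k') ζ = h k (h k' ζ) := by
  have hp := Row.isPair ht.1
  -- The map of the disc is multiplication by the `c` with `U S Uᵀ = c S`; it depends on `U` alone
  -- and is multiplicative.
  refine ⟨fun k ζ => scaleFactor t.row.S (k.2 : Mat2) * ζ, fun k hk => ?_, ?_,
    fun k hk k' hk' => ?_⟩
  · obtain ⟨μ, c, hR, hu, hΩ⟩ := exists_of_mem_stabilizer ht hk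
    have hc := scaleFactor_eq hp.ne hR.symm
    simp only [hc]
    refine ⟨by fun_prop, mul_zero _, ?_, ?_⟩
    · rw [deriv_const_mul_id]
      exact hR.c_ne
    · have c3 : Continuous fun x : C4 => x 3 := continuous_apply 3
      have h1 : ∀ᶠ x : C4 in 𝓝 0, ‖x 3‖ < δ :=
        c3.norm.continuousAt.eventually_lt continuousAt_const (by simpa using hδ)
      have h2 : ∀ᶠ x : C4 in 𝓝 0, ‖c * x 3‖ < δ :=
        (continuous_const.mul c3).norm.continuousAt.eventually_lt continuousAt_const
          (by simpa using hδ)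
      filter_upwards [h1, h2] with x hx hcx
      exact h.mem_carrier_iff hx hcx hR.form hu (distinguishedS_mul hp.unit hR.symm hΩ _)
  · refine Filter.Eventually.of_forall fun ζ => ?_
    change scaleFactor t.row.S (1 : Mat2) * ζ = ζ
    rw [scaleFactor_eq hp.ne (c := 1) (by simp), one_mul]
  · refine Filter.Eventually.of_forall fun ζ => ?_
    obtain ⟨μ, c, hR, -, -⟩ := exists_of_mem_stabilizer ht hk
    obtain ⟨μ', c', hR', -, -⟩ := exists_of_mem_stabilizer ht hk'
    have hm : ((k * k').2 : Mat2) * t.row.S * ((k * k').2 : Mat2)ᵀ = (c * c') • t.row.S := by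
      have e : ((k * k').2 : Mat2) = (k.2 : Mat2) * (k'.2 : Mat2) := rfl
      have e' : (k.2 : Mat2) * (k'.2 : Mat2) * t.row.S * ((k.2 : Mat2) * (k'.2 : Mat2))ᵀ =
          (k.2 : Mat2) * ((k'.2 : Mat2) * t.row.S * (k'.2 : Mat2)ᵀ) * (k.2 : Mat2)ᵀ := by
        simp only [Matrix.transpose_mul, Matrix.mul_assoc]
      rw [e, e', hR'.symm, Matrix.mul_smul, Matrix.smul_mul, hR.symm, smul_smul, mul_comm]
    change scaleFactor t.row.S ((k * k').2 : Mat2) * ζ =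
      scaleFactor t.row.S (k.2 : Mat2) * (scaleFactor t.row.S (k'.2 : Mat2) * ζ)
    rw [scaleFactor_eq hp.ne hm, scaleFactor_eq hp.ne hR.symm, scaleFactor_eq hp.ne hR'.symm,
      mul_assoc]

end Entry

end CRSymbol

end

/-! ### The proposition. -/

theorem proposition2p4 :
    -- every bigraded symbol is equivalent to exactly one `(H, S)` of the table
    (∀ (M : Hypersurface) (p : C4), M.IsUniformly2Nondegenerate → p ∈ M.carrier →
      ∀ φ : AdaptedFrame M p, ∃! r : Row, r.Valid ∧ BigradedEquiv (φ.H p) (φ.S02 p) r.H r.S) ∧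
    -- at every point exactly one entry of the table represents the modified symbol
    (∀ (M : Hypersurface) (p : C4), M.IsUniformly2Nondegenerate → p ∈ M.carrier →
      ∃! t : Entry, t.Valid ∧ HasModSymbol M p t) ∧
    -- every normalized modified symbol is equivalent to exactly one entry of the table
    (∀ (M : Hypersurface) (p : C4), M.IsUniformly2Nondegenerate → p ∈ M.carrier →
      ∀ (r : Row) (φ : AdaptedFrame M p), r.Valid → φ.IsNormalizedFor r →
        ∃! t : Entry, t.Valid ∧ ModEquiv r.H r.S (φ.Ω p) t.row.H t.row.S t.Ω) ∧
    -- for a given value of the frame at `p`, `Ω` is unique exactly up to `g'_{0,0}`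
    (∀ (M : Hypersurface) (p : C4), M.IsUniformly2Nondegenerate → p ∈ M.carrier →
      ∀ (r : Row) (φ : AdaptedFrame M p), r.Valid → φ.IsNormalizedFor r →
        ∀ Ω' : Mat2, (∃ ψ : AdaptedFrame M p, ψ.SameAt φ ∧ ψ.IsNormalizedFor r ∧ ψ.Ω p = Ω') ↔
          Ω' - φ.Ω p ∈ r.g) ∧
    (∀ r : Row, r.Valid →
      -- the column `g'_{0,0}`, and its relation to `g_{0,0}` and the grading element
      g00' r.H r.S = r.g ∧
      (∀ D : Mat22, D ∈ g00 r.H r.S ↔ ∃ c : ℂ, ∃ L ∈ r.g, D = c • gradingElement + ofGL r.H L) ∧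
      (∀ Ω Ω' : Mat2, modSymbol r.H r.S Ω' = modSymbol r.H r.S Ω ↔ Ω' - Ω ∈ r.g) ∧
      -- the real forms, and the Lie algebra of `CU(H) ∩ G_{0,0}`
      r.re = {L | L ∈ r.g ∧ sigmaGL r.H L = L} ∧
      IsSubgroupSet (CU r.H ∩ G00 r.H r.S) ∧
      lieAlg (CU r.H ∩ G00 r.H r.S) = {y | y.1.im = 0 ∧ y.2 ∈ r.re}) ∧
    (∀ t : Entry, t.Valid →
      -- the Lie algebra of the stabilizer of `Ω`
      IsSubgroupSet (stabilizer t.row.H t.row.S t.Ω) ∧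
      lieAlg (stabilizer t.row.H t.row.S t.Ω) = {y | y.1.im = 0 ∧ y.2 ∈ t.stabAlg} ∧
      -- the distinguished model realizes the modified symbol
      (∀ ζ : ℂ, NormedSpace.exp (ofS t.row.H (distinguishedS t.row.H t.row.S t.Ω ζ)) =
        NormedSpace.exp (ζ • iotaMod t.row.H t.row.S t.Ω) *
          NormedSpace.exp (-(ζ • ofGL t.row.H t.Ω))) ∧
      (∃ δ₀ : ℝ, 0 < δ₀ ∧ ∀ δ : ℝ, 0 < δ → δ ≤ δ₀ →
        (t.model δ).IsUniformly2Nondegenerate ∧ (0 : C4) ∈ (t.model δ).carrier ∧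
        HasModSymbol (t.model δ) 0 t ∧
        -- the stabilizer acts on its germ at `0` by symmetries
        ∃ h : ℂˣ × GL (Fin 2) ℂ → ℂ → ℂ,
          (∀ k ∈ stabilizer t.row.H t.row.S t.Ω,
            AnalyticAt ℂ (h k) 0 ∧ h k 0 = 0 ∧ deriv (h k) 0 ≠ 0 ∧
            ∀ᶠ x in 𝓝 (0 : C4),
              x ∈ (t.model δ).carrier ↔ coordChange k (h k) x ∈ (t.model δ).carrier) ∧
          (∀ᶠ ζ in 𝓝 (0 : ℂ), h 1 ζ = ζ) ∧
          ∀ k ∈ stabilizer t.row.H t.row.S t.Ω, ∀ k' ∈ stabilizer t.row.H t.row.S t.Ω,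
            ∀ᶠ ζ in 𝓝 (0 : ℂ), h (k * k') ζ = h k (h k' ζ))) := by
  refine ⟨fun M p hM hp φ => φ.existsUnique_row hM hp, fun M p hM hp => ?_,
    fun M p hM hp r φ hr hφ => AdaptedFrame.existsUnique_modEquiv hr hM hp hφ,
    fun M p hM hp r φ hr hφ => AdaptedFrame.exists_sameAt_iff hr hM hp hφ,
    fun r hr => ⟨Row.g00'_eq hr, Row.mem_g00_iff hr, Row.modSymbol_eq_iff hr, Row.re_eq hr,
      isSubgroupSet_CU_G00 (Row.isPair hr), Row.lieAlg_eq hr⟩,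
    fun t ht => ⟨isSubgroupSet_stabilizer (Row.isPair ht.1) t.Ω, Entry.lieAlg_stabilizer ht,
      exp_ofS_distinguishedS (Row.isPair ht.1).unit, ?_⟩⟩
  · obtain ⟨t, ht, h⟩ := exists_hasModSymbol hM hp
    exact ⟨t, ⟨ht, h⟩, fun t' h' => HasModSymbol.unique hM hp h'.1 ht h'.2 h⟩
  · obtain ⟨δ₀, hδ₀, h⟩ := Entry.exists_isModel ht
    exact ⟨δ₀, hδ₀, fun δ hδ hle => ⟨(h δ hle).isUniformly2Nondegenerate, t.zero_mem_model hδ,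
      Entry.hasModSymbol_model ht hδ (h δ hle), Entry.exists_symmetries ht hδ (h δ hle)⟩⟩
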